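/- **Setting.** Let $\Sigma$ be a closed connected orientable surface of genus $\ell\ge 1$ with base point $Q$, and let $F$ be the free group on $x_1,y_1,\dots,x_\ell,y_\ell$, $r=[x_1,y_1]\cdots[x_\ell,y_\ell]$, $N$ the normal closure of $r$ in $F$, and $\Gamma=F/[F,N]$. Let $\Gamma_{\mathbb R}=(\mathbb R\times\Gamma)/\langle(-2\pi,[r])\rangle$, the one-dimensional Lie group obtained from $\Gamma$ by extending the central subgroup $\mathbb Z\langle[r]\rangle$ to $\mathbb R$ along $[r]\mapsto 2\pi$; for $t\in\mathbb R$, write $t[r]$ for the image of $2\pi t\in\mathbb R$ in $\Gamma_{\mathbb R}$. Let $\xi_M\colon M\to\Sigma$ be a principal $\mathrm U(1)$-bundle of Chern class $1$ with a smooth connection form $\omega_M$ whose curvature form is $-2\pi i\,\mathrm{vol}_\Sigma$ for a nowhere vanishing $2$-form $\mathrm{vol}_\Sigma$ on $\Sigma$; orient $\Sigma$ by $\mathrm{vol}_\Sigma$ (so that $\int_\Sigma\mathrm{vol}_\Sigma=1$). Let $u_1,v_1,\dots,u_\ell,v_\ell$ be a canonical system of smooth simple closed curves based at $Q$ and meeting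 only there: cutting $\Sigma$ along them yields a disk $e^2$ whose boundary path, for the orientation given by $\mathrm{vol}_\Sigma$, is $[u_1,v_1]\cdots[u_\ell,v_\ell]$. Here products of paths are read so that parallel transport is multiplicative, i.e. the right-most factor is traversed first. Fix $Q_M\in M$ over $Q$, and suppose $\omega_M$ chosen such that its holonomies along all $u_j,v_j$ with respect to $Q_M$ are trivial. Let $q\colon\widetilde M\to M$ be the universal covering, with $Q_{\widetilde M}$ over $Q_M$. It carries the structure of a principal $\Gamma_{\mathbb R}$-bundle $\xi_{\widetilde M}=\xi_M\circ q\colon\widetilde M\to\Sigma$, in which $\mathbb R$ lifts the $\mathrm U(1)$-action along $t\mapsto e^{it}$, and $\Gamma\cong\pi_1(M,Q_M)$ acts by deck transformations, where $x_j,y_j$ are the classes of the closed $\omega_M$-horizontal lifts of $u_j,v_j$ starting at $Q_M$ (so that the lifts of these to $\widetilde M$ starting at $Q_{\widetilde M}$ end at $Q_{\widetilde M}x_j$ and $Q_{\widetilde M}y_j$). Let $\omega_{\widetilde M}$ be the $\Gamma_{\mathbb R}$-connection form lifted from $\omega_M$, that is, $q^*\omega_M=i\,\omega_{\widetilde M}$.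 Let $G$ be a compact connected Lie group with Lie algebra $\mathfrak g$, $\mathfrak h$ the center of $\mathfrak g$, $H$ the identity component of the center of $G$, and $S=[G,G]$. Let $\xi\colon P\to\Sigma$ be a smooth principal $G$-bundle and $Q_P\in P$ a point over $Q$. Its characteristic class $X_\xi\in\mathfrak h\cong\mathrm{Lie}(G/S)$ is determined by the following property: there is a homomorphism $\varphi\colon\mathrm U(1)\to G/S$ with $\varphi(e^{2\pi i t})=\exp(tX_\xi)S$ for all $t\in\mathbb R$, such that the principal $G/S$-bundles $P/S$ and $M\times_\varphi (G/S)$ on $\Sigma$ are isomorphic. A disk $\Delta$ in $\Sigma$ is a smoothly embedded closed disk, oriented by its parametrization; $a_\Delta=\int_\Delta\mathrm{vol}_\Sigma$ is its (signed) area. For a smooth loop $w\colon[0,1]\to\Sigma$ and $q_P\in P$ over $w(0)$, the horizontal lift of $w$ with respect to a connection $A$ on $\xi$ starting at $q_P$ ends at $q_P\,\mathrm{Hol}_{w,q_P}(A)$. The homomorphism $\rho(A)\colon F\to G$ sends $x_j,y_j$ to $\mathrm{Hol}_{u_j,Q_P}(A),\mathrm{Hol}_{v_j,Q_P}(A)$.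 The *pre-reduction map* $\lambda_A\colon\widetilde M\to P$ of $A$ sends $T$ to the end point of the $A$-horizontal lift, starting at $Q_P$, of the projection to $\Sigma$ of any smooth $\omega_{\widetilde M}$-horizontal path from $Q_{\widetilde M}$ to $T$ (it is part of condition (iv) below that the result does not depend on the choice of that path). **Lemma.** For a smooth connection $A$ on $\xi$ with curvature form $\mathrm{curv}_A=d\omega_A+\tfrac12[\omega_A,\omega_A]$, the following are equivalent. 1. (i) The values of $\mathrm{curv}_A$ lie in $\mathfrak h$, and $\mathrm{curv}_A=-X_\xi\cdot\mathrm{vol}_\Sigma$. 2. (ii) The values of $\mathrm{curv}_A$ lie in $\mathfrak h$ and, with $\mathrm{curv}_A$ viewed as an ordinary $\mathfrak h$-valued $2$-form on $\Sigma$, $\int_\Delta\mathrm{curv}_A=-a_\Delta X_\xi$ for every disk $\Delta$ in $\Sigma$. 3. (iii) For every disk $\Delta$ in $\Sigma$, every smooth loop $w$ in $\Sigma$ that traverses the boundary of $\Delta$ once in the positive direction, and every $q_P\in P$ over $w(0)$, $\mathrm{Hol}_{w,q_P}(A)=\exp(a_\Delta X_\xi)\in H$. 4. (iv) The pre-reduction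 map $\lambda_A$ of $A$ is well defined and, together with a homomorphism $\chi_A\colon\Gamma_{\mathbb R}\to G$ of Lie groups, yields a morphism of principal bundles with connection over the identity of $\Sigma$ from $(\xi_{\widetilde M},\omega_{\widetilde M})$ to $(\xi,A)$, in such a way that (a) $\rho(A)$ is the composite $F\to\Gamma\to\Gamma_{\mathbb R}\xrightarrow{\chi_A}G$, and (b) $\chi_A(t[r])=\exp(tX_\xi)$ for all $t\in\mathbb R$. -/

import Mathlib

open scoped Manifold ContDiff RightActions
open Set


namespace CentralYM

noncomputable section

section Groups

open scoped commutatorElement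

/-! ### The groups `F`, `Γ` and `Γ_ℝ` -/

/-- The free group on `x_1, y_1, …, x_ℓ, y_ℓ`; the letter `Sum.inl j` is `x_j` and
`Sum.inr j` is `y_j`. -/
abbrev FreeSurfaceGroup (ℓ : ℕ) : Type := FreeGroup (Fin ℓ ⊕ Fin ℓ)

/-- The relator `r = [x_1, y_1] ⋯ [x_ℓ, y_ℓ]`. -/
def relator (ℓ : ℕ) : FreeSurfaceGroup ℓ :=
  (List.ofFn fun j : Fin ℓ => ⁅(FreeGroup.of (Sum.inl j) : FreeSurfaceGroup ℓ),
    (FreeGroup.of (Sum.inr j) : FreeSurfaceGroup ℓ)⁆).prod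

/-- The normal closure `N` of the relator in `F`. -/
def relatorClosure (ℓ : ℕ) : Subgroup (FreeSurfaceGroup ℓ) :=
  Subgroup.normalClosure {relator ℓ}

instance (ℓ : ℕ) : (relatorClosure ℓ).Normal := Subgroup.normalClosure_normal

/-- The group `Γ = F / [F, N]`. -/
abbrev Gam (ℓ : ℕ) : Type :=
  FreeSurfaceGroup ℓ ⧸ ⁅(⊤ : Subgroup (FreeSurfaceGroup ℓ)), relatorClosure ℓ⁆

/-- The class `[r] ∈ Γ` of the relator. -/
def relClass (ℓ : ℕ) : Gam ℓ := QuotientGroup.mk (relator ℓ)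

theorem relClass_comm (ℓ : ℕ) (g : Gam ℓ) : g * relClass ℓ = relClass ℓ * g := by
  obtain ⟨f, rfl⟩ := QuotientGroup.mk_surjective g
  have h : ⁅f, relator ℓ⁆ ∈ ⁅(⊤ : Subgroup (FreeSurfaceGroup ℓ)), relatorClosure ℓ⁆ :=
    Subgroup.commutator_mem_commutator (Subgroup.mem_top f)
      (Subgroup.subset_normalClosure rfl)
  have h' := (QuotientGroup.eq_one_iff _).2 h
  rw [← commutatorElement_eq_one_iff_mul_comm]
  exact h'

/-- The subgroup of `ℝ × Γ` generated by `(-2π, [r])`: dividing by it identifies `[r]` with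
`2π ∈ ℝ`. -/
def gluing (ℓ : ℕ) : Subgroup (Multiplicative ℝ × Gam ℓ) :=
  Subgroup.zpowers (Multiplicative.ofAdd (-(2 * Real.pi)), relClass ℓ)

instance (ℓ : ℕ) : (gluing ℓ).Normal := by
  refine ⟨fun n hn g => ?_⟩
  obtain ⟨k, rfl⟩ := Subgroup.mem_zpowers_iff.1 hn
  have hc : Commute g (Multiplicative.ofAdd (-(2 * Real.pi)), relClass ℓ) :=
    Prod.ext (mul_comm _ _) (relClass_comm ℓ g.2)
  rw [(hc.zpow_right k).eq, mul_assoc, mul_inv_cancel, mul_one]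
  exact hn

/-- The group `Γ_ℝ`, the push-out of `Γ` along the embedding `ℤ⟨[r]⟩ → ℝ` that sends `[r]`
to `2π`. -/
def GammaR (ℓ : ℕ) : Type := (Multiplicative ℝ × Gam ℓ) ⧸ gluing ℓ

instance (ℓ : ℕ) : Group (GammaR ℓ) :=
  inferInstanceAs (Group ((Multiplicative ℝ × Gam ℓ) ⧸ gluing ℓ))

/-- The quotient homomorphism `ℝ × Γ → Γ_ℝ`. -/
def GammaR.mk (ℓ : ℕ) : Multiplicative ℝ × Gam ℓ →* GammaR ℓ := QuotientGroup.mk' (gluing ℓ)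

/-- The central homomorphism `ℝ → Γ_ℝ`. -/
def GammaR.ofReal {ℓ : ℕ} (t : ℝ) : GammaR ℓ := GammaR.mk ℓ (Multiplicative.ofAdd t, 1)

/-- The composite `F → Γ → Γ_ℝ`. -/
def freeToGammaR (ℓ : ℕ) : FreeSurfaceGroup ℓ →* GammaR ℓ :=
  ((GammaR.mk ℓ).comp (MonoidHom.inr (Multiplicative ℝ) (Gam ℓ))).comp
    (QuotientGroup.mk' ⁅(⊤ : Subgroup (FreeSurfaceGroup ℓ)), relatorClosure ℓ⁆)

/-- The surjection `Γ_ℝ → U(1)` that is `t ↦ e^{it}` on `ℝ` and trivial on `Γ`. -/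
def GammaR.toCircle (ℓ : ℕ) : GammaR ℓ →* Circle :=
  QuotientGroup.lift (gluing ℓ)
    ((AddMonoidHom.toMultiplicativeLeft Circle.expHom).comp
      (MonoidHom.fst (Multiplicative ℝ) (Gam ℓ)))
    (by
      intro a ha
      obtain ⟨k, rfl⟩ := Subgroup.mem_zpowers_iff.1 ha
      simp [AddMonoidHom.toMultiplicativeLeft])

theorem GammaR.ofReal_add {ℓ : ℕ} (s t : ℝ) :
    (GammaR.ofReal (s + t) : GammaR ℓ) = GammaR.ofReal s * GammaR.ofReal t := by
  rw [GammaR.ofReal, GammaR.ofReal, GammaR.ofReal, ← map_mul]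
  rfl

theorem GammaR.ofReal_zero {ℓ : ℕ} : (GammaR.ofReal 0 : GammaR ℓ) = 1 :=
  map_one (GammaR.mk ℓ)

theorem GammaR.ofReal_neg {ℓ : ℕ} (t : ℝ) :
    (GammaR.ofReal (-t) : GammaR ℓ) = (GammaR.ofReal t)⁻¹ := by
  rw [eq_inv_iff_mul_eq_one, ← GammaR.ofReal_add, neg_add_cancel, GammaR.ofReal_zero]

theorem GammaR.ofReal_comm {ℓ : ℕ} (t : ℝ) (g : GammaR ℓ) :
    g * GammaR.ofReal t = GammaR.ofReal t * g := by
  obtain ⟨⟨s, γ⟩, rfl⟩ := QuotientGroup.mk'_surjective (gluing ℓ) g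
  change GammaR.mk ℓ _ * GammaR.mk ℓ _ = GammaR.mk ℓ _ * GammaR.mk ℓ _
  rw [← map_mul, ← map_mul]
  congr 1
  exact Prod.ext (mul_comm _ _) (by simp)

/-- In `Γ_ℝ`, the class `[r]` is the image of `2π ∈ ℝ`. -/
theorem freeToGammaR_relator (ℓ : ℕ) :
    freeToGammaR ℓ (relator ℓ) = GammaR.ofReal (2 * Real.pi) := by
  refine QuotientGroup.eq.2 (Subgroup.mem_zpowers_iff.2 ⟨-1, ?_⟩)
  refine Prod.ext ?_ ?_
  · change _ = (1 : Multiplicative ℝ)⁻¹ * _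
    simp [← ofAdd_neg]
  · change _ = (relClass ℓ)⁻¹ * 1
    simp

/-- Permutations `(a, b) ↦ (a + 1, b)` and `(a, b) ↦ (a, b + a)` of `ℤ × ℤ`; they generate a
Heisenberg group, which detects that `[r]` has infinite order. -/
def heisX : Equiv.Perm (ℤ × ℤ) :=
  ⟨fun p => (p.1 + 1, p.2), fun p => (p.1 - 1, p.2), fun p => by simp, fun p => by simp⟩

/-- See `heisX`. -/
def heisY : Equiv.Perm (ℤ × ℤ) :=
  ⟨fun p => (p.1, p.2 + p.1), fun p => (p.1, p.2 - p.1), fun p => by simp, fun p => by simp⟩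

/-- See `heisX`. -/
def heisZ : Equiv.Perm (ℤ × ℤ) :=
  ⟨fun p => (p.1, p.2 - 1), fun p => (p.1, p.2 + 1), fun p => by simp, fun p => by simp⟩

theorem heis_comm : ⁅heisX, heisY⁆ = heisZ := by
  ext p <;> simp [commutatorElement_def, heisX, heisY, heisZ, Equiv.Perm.inv_def]

theorem heisZ_zpow (k : ℤ) : (heisZ ^ k) (0, 0) = (0, -k) := by
  have hn : ∀ n : ℕ, ∀ p : ℤ × ℤ, (heisZ ^ n) p = (p.1, p.2 - n) := by
    intro n
    induction n with
    | zero => intro p; simp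
    | succ n ih =>
      intro p
      rw [pow_succ, Equiv.Perm.mul_apply, ih]
      simp [heisZ]
      ring
  obtain ⟨n, rfl | rfl⟩ := k.eq_nat_or_neg
  · simpa using hn n (0, 0)
  · rw [zpow_neg, zpow_natCast, Equiv.Perm.inv_eq_iff_eq, hn]
    simp

/-- The homomorphism from `F` to the Heisenberg group that only sees `x_1` and `y_1`. -/
def heisHom (ℓ : ℕ) : FreeSurfaceGroup ℓ →* Equiv.Perm (ℤ × ℤ) :=
  FreeGroup.lift (Sum.elim (fun j => if (j : ℕ) = 0 then heisX else 1)
    (fun j => if (j : ℕ) = 0 then heisY else 1))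

theorem heisHom_relator (ℓ : ℕ) [NeZero ℓ] : heisHom ℓ (relator ℓ) = heisZ := by
  obtain ⟨n, rfl⟩ := Nat.exists_eq_succ_of_ne_zero (NeZero.ne ℓ)
  rw [relator, map_list_prod, List.map_ofFn, List.ofFn_succ, List.prod_cons]
  have h1 : (List.ofFn fun i : Fin n => (heisHom (n + 1) ∘ fun j : Fin (n + 1) =>
      ⁅(FreeGroup.of (Sum.inl j) : FreeSurfaceGroup (n + 1)),
        (FreeGroup.of (Sum.inr j) : FreeSurfaceGroup (n + 1))⁆) i.succ).prod = 1 := by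
    apply List.prod_eq_one
    intro x hx
    obtain ⟨i, rfl⟩ := (List.mem_ofFn' _ _).1 hx
    simp [heisHom, map_commutatorElement]
  rw [h1]
  simp [heisHom, map_commutatorElement, heis_comm]

theorem heisZ_commute (ℓ : ℕ) (f : FreeSurfaceGroup ℓ) : Commute heisZ (heisHom ℓ f) := by
  have hX : Commute heisZ heisX := by
    ext p <;> simp [heisX, heisZ]
  have hY : Commute heisZ heisY := by
    ext p <;> simp [heisY, heisZ]
    ring
  induction f using FreeGroup.induction_on with
  | C1 => simp
  | of a =>
    rcases a with j | j
    · by_cases hj : (j : ℕ) = 0 <;> simp [heisHom, hj, hX]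
    · by_cases hj : (j : ℕ) = 0 <;> simp [heisHom, hj, hY]
  | inv_of a ih => rw [map_inv]; exact ih.inv_right
  | mul a b iha ihb => rw [map_mul]; exact iha.mul_right ihb

theorem heisHom_commutator (ℓ : ℕ) [NeZero ℓ] (g : FreeSurfaceGroup ℓ)
    (hg : g ∈ ⁅(⊤ : Subgroup (FreeSurfaceGroup ℓ)), relatorClosure ℓ⁆) :
    heisHom ℓ g = 1 := by
  have hN : relatorClosure ℓ ≤ (Subgroup.zpowers heisZ).comap (heisHom ℓ) ⊓
      (relatorClosure ℓ) := by
    refine le_inf ?_ le_rfl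
    have : ((Subgroup.zpowers heisZ).comap (heisHom ℓ)).Normal := by
      refine ⟨fun n hn g => ?_⟩
      obtain ⟨k, hk⟩ := Subgroup.mem_zpowers_iff.1 (Subgroup.mem_comap.1 hn)
      refine Subgroup.mem_comap.2 (Subgroup.mem_zpowers_iff.2 ⟨k, ?_⟩)
      rw [map_mul, map_mul, map_inv, ← hk, ← ((heisZ_commute ℓ g).zpow_left k).eq, mul_assoc,
        mul_inv_cancel, mul_one]
    refine Subgroup.normalClosure_le_normal ?_
    rintro _ rfl
    exact Subgroup.mem_comap.2 (by rw [heisHom_relator]; exact Subgroup.mem_zpowers _)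
  have hle : ⁅(⊤ : Subgroup (FreeSurfaceGroup ℓ)), relatorClosure ℓ⁆ ≤ (heisHom ℓ).ker := by
    refine Subgroup.commutator_le.2 fun a _ b hb => ?_
    obtain ⟨k, hk⟩ := Subgroup.mem_zpowers_iff.1 (Subgroup.mem_comap.1 (hN hb).1)
    rw [MonoidHom.mem_ker, map_commutatorElement, commutatorElement_eq_one_iff_mul_comm, ← hk]
    exact ((heisZ_commute ℓ a).zpow_left k).eq.symm
  exact hle hg

theorem relClass_zpow_eq_one {ℓ : ℕ} [NeZero ℓ] {k : ℤ} (h : relClass ℓ ^ k = 1) : k = 0 := by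
  have h' : heisHom ℓ (relator ℓ ^ k) = 1 := by
    apply heisHom_commutator
    exact (QuotientGroup.eq_one_iff _).1 h
  rw [map_zpow, heisHom_relator] at h'
  have := heisZ_zpow k
  rw [h'] at this
  simpa using this.symm

theorem GammaR.ofReal_injective {ℓ : ℕ} [NeZero ℓ] :
    Function.Injective (GammaR.ofReal : ℝ → GammaR ℓ) := by
  have key : ∀ t : ℝ, (GammaR.ofReal t : GammaR ℓ) = 1 → t = 0 := by
    intro t ht
    have h := (QuotientGroup.eq_one_iff (N := gluing ℓ) _).1 ht
    obtain ⟨k, hk⟩ := Subgroup.mem_zpowers_iff.1 h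
    have h2 : relClass ℓ ^ k = 1 := congrArg Prod.snd hk
    have h0 := relClass_zpow_eq_one h2
    subst h0
    exact (Multiplicative.ofAdd.injective (congrArg Prod.fst hk)).symm
  intro s t hst
  have := key (s - t) (by
    rw [sub_eq_add_neg, GammaR.ofReal_add, GammaR.ofReal_neg, hst, mul_inv_cancel])
  linarith

/-! ### `Γ_ℝ` as a one-dimensional Lie group -/

/-- The topology of `Γ_ℝ` in which all cosets `g ℝ` are open copies of the real line. -/
instance (ℓ : ℕ) : TopologicalSpace (GammaR ℓ) :=
  ⨆ g : GammaR ℓ, TopologicalSpace.coinduced (fun t : ℝ => g * GammaR.ofReal t) inferInstance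

theorem GammaR.isOpen_iff {ℓ : ℕ} {U : Set (GammaR ℓ)} :
    IsOpen U ↔ ∀ g : GammaR ℓ, IsOpen ((fun t : ℝ => g * GammaR.ofReal t) ⁻¹' U) := by
  rw [isOpen_iSup_iff]
  rfl

theorem GammaR.isOpenEmbedding {ℓ : ℕ} [NeZero ℓ] (g : GammaR ℓ) :
    Topology.IsOpenEmbedding (fun t : ℝ => g * GammaR.ofReal t) := by
  refine Topology.IsOpenEmbedding.of_continuous_injective_isOpenMap ?_ ?_ ?_
  · exact continuous_def.2 fun U hU => GammaR.isOpen_iff.1 hU g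
  · intro s t h
    exact GammaR.ofReal_injective (mul_left_cancel h)
  · intro V hV
    refine GammaR.isOpen_iff.2 fun g' => ?_
    by_cases h : ∃ c : ℝ, g' = g * GammaR.ofReal c
    · obtain ⟨c, rfl⟩ := h
      have : (fun t : ℝ => g * GammaR.ofReal c * GammaR.ofReal t) ⁻¹'
          ((fun t : ℝ => g * GammaR.ofReal t) '' V) = (fun t => c + t) ⁻¹' V := by
        ext t
        simp only [mem_preimage, mem_image, mul_assoc, ← GammaR.ofReal_add]
        constructor
        · rintro ⟨s, hs, h⟩
          rwa [← GammaR.ofReal_injective (mul_left_cancel h)]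
        · intro h
          exact ⟨_, h, rfl⟩
      rw [this]
      exact hV.preimage (by fun_prop)
    · convert isOpen_empty
      rw [eq_empty_iff_forall_notMem]
      rintro t ⟨s, _, hs⟩
      refine h ⟨s - t, ?_⟩
      have hs' : g * GammaR.ofReal s = g' * GammaR.ofReal t := hs
      rw [sub_eq_add_neg, GammaR.ofReal_add, ← mul_assoc, hs', GammaR.ofReal_neg, mul_assoc,
        mul_inv_cancel, mul_one]

/-- The chart of `Γ_ℝ` with source the coset `g ℝ` and inverse `t ↦ g t`. -/
def GammaR.chart {ℓ : ℕ} [NeZero ℓ] (g : GammaR ℓ) : OpenPartialHomeomorph (GammaR ℓ) ℝ :=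
  ((GammaR.isOpenEmbedding g).toOpenPartialHomeomorph _).symm

theorem GammaR.chart_apply {ℓ : ℕ} [NeZero ℓ] (g : GammaR ℓ) (t : ℝ) :
    GammaR.chart g (g * GammaR.ofReal t) = t :=
  (GammaR.isOpenEmbedding g).toOpenPartialHomeomorph_left_inv

theorem GammaR.chart_symm_apply {ℓ : ℕ} [NeZero ℓ] (g : GammaR ℓ) (t : ℝ) :
    (GammaR.chart g).symm t = g * GammaR.ofReal t := rfl

theorem GammaR.chart_source {ℓ : ℕ} [NeZero ℓ] (g : GammaR ℓ) :
    (GammaR.chart g).source = range (fun t : ℝ => g * GammaR.ofReal t) := by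
  simp [GammaR.chart]

instance (ℓ : ℕ) [NeZero ℓ] : ChartedSpace ℝ (GammaR ℓ) where
  atlas := range GammaR.chart
  chartAt g := GammaR.chart g
  mem_chart_source g := by
    rw [GammaR.chart_source]
    exact ⟨0, by simp [GammaR.ofReal_zero]⟩
  chart_mem_atlas g := mem_range_self g

instance (ℓ : ℕ) [NeZero ℓ] : IsManifold 𝓘(ℝ, ℝ) ∞ (GammaR ℓ) := by
  refine isManifold_of_contDiffOn _ _ _ ?_
  rintro _ _ ⟨g, rfl⟩ ⟨g', rfl⟩
  simp only [modelWithCornersSelf_coe, modelWithCornersSelf_coe_symm, Function.id_comp,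
    Function.comp_id, preimage_id_eq, id_eq, range_id, inter_univ]
  by_cases h : ∃ c : ℝ, g = g' * GammaR.ofReal c
  · obtain ⟨c, rfl⟩ := h
    refine ContDiffOn.congr (f := fun t => c + t) (by fun_prop) fun t _ => ?_
    simp only [OpenPartialHomeomorph.coe_trans, Function.comp_apply, GammaR.chart_symm_apply,
      mul_assoc, ← GammaR.ofReal_add, GammaR.chart_apply]
  · convert contDiffOn_empty
    rw [eq_empty_iff_forall_notMem]
    intro t ht
    rw [OpenPartialHomeomorph.trans_source] at ht
    have h2 : (GammaR.chart g).symm t ∈ (GammaR.chart g').source := ht.2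
    rw [GammaR.chart_source, GammaR.chart_symm_apply] at h2
    obtain ⟨s, hs⟩ := h2
    refine h ⟨s - t, ?_⟩
    have hs' : g' * GammaR.ofReal s = g * GammaR.ofReal t := hs
    rw [sub_eq_add_neg, GammaR.ofReal_add, ← mul_assoc, hs', GammaR.ofReal_neg, mul_assoc,
      mul_inv_cancel, mul_one]

theorem GammaR.contMDiff_line {ℓ : ℕ} [NeZero ℓ] (g : GammaR ℓ) :
    ContMDiff 𝓘(ℝ, ℝ) 𝓘(ℝ, ℝ) ∞ (fun t : ℝ => g * GammaR.ofReal t) := by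
  have h := contMDiffOn_chart_symm (I := 𝓘(ℝ, ℝ)) (n := ∞) (x := g)
  have ht : (chartAt ℝ g).target = univ := by
    change (GammaR.chart g).target = univ
    simp [GammaR.chart]
  rw [ht] at h
  exact contMDiffOn_univ.1 h

theorem GammaR.contMDiffOn_chart' {ℓ : ℕ} [NeZero ℓ] (g : GammaR ℓ) :
    ContMDiffOn 𝓘(ℝ, ℝ) 𝓘(ℝ, ℝ) ∞ (GammaR.chart g) (GammaR.chart g).source :=
  contMDiffOn_chart (I := 𝓘(ℝ, ℝ)) (n := ∞) (x := g)

instance (ℓ : ℕ) [NeZero ℓ] : LieGroup 𝓘(ℝ, ℝ) ∞ (GammaR ℓ) where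
  contMDiff_mul := by
    rintro ⟨a, b⟩
    have h : ContMDiffOn (𝓘(ℝ, ℝ).prod 𝓘(ℝ, ℝ)) 𝓘(ℝ, ℝ) ∞
        (fun p : GammaR ℓ × GammaR ℓ =>
          (a * b) * GammaR.ofReal (GammaR.chart a p.1 + GammaR.chart b p.2))
        ((GammaR.chart a).source ×ˢ (GammaR.chart b).source) := by
      refine (GammaR.contMDiff_line (a * b)).comp_contMDiffOn ?_
      refine ContMDiffOn.add ?_ ?_
      · exact (GammaR.contMDiffOn_chart' a).comp contMDiffOn_fst fun p hp => hp.1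
      · exact (GammaR.contMDiffOn_chart' b).comp contMDiffOn_snd fun p hp => hp.2
    have h' := h.congr (f₁ := fun p : GammaR ℓ × GammaR ℓ => p.1 * p.2) (by
      rintro ⟨p, q⟩ ⟨hp, hq⟩
      rw [GammaR.chart_source] at hp hq
      obtain ⟨s, rfl⟩ := hp
      obtain ⟨t, rfl⟩ := hq
      simp only [GammaR.chart_apply, GammaR.ofReal_add]
      rw [mul_assoc, mul_assoc, ← mul_assoc (GammaR.ofReal s), ← GammaR.ofReal_comm s b]
      simp only [mul_assoc])
    refine h'.contMDiffAt (prod_mem_nhds ?_ ?_)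
    · exact (GammaR.chart a).open_source.mem_nhds (mem_chart_source ℝ a)
    · exact (GammaR.chart b).open_source.mem_nhds (mem_chart_source ℝ b)
  contMDiff_inv := by
    intro a
    have h : ContMDiffOn 𝓘(ℝ, ℝ) 𝓘(ℝ, ℝ) ∞
        (fun p : GammaR ℓ => a⁻¹ * GammaR.ofReal (-(GammaR.chart a p)))
        (GammaR.chart a).source :=
      (GammaR.contMDiff_line a⁻¹).comp_contMDiffOn (GammaR.contMDiffOn_chart' a).neg
    have h' := h.congr (f₁ := fun p : GammaR ℓ => p⁻¹) (by
      intro p hp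
      rw [GammaR.chart_source] at hp
      obtain ⟨s, rfl⟩ := hp
      simp only [GammaR.chart_apply, GammaR.ofReal_neg, mul_inv_rev]
      rw [← GammaR.ofReal_neg, GammaR.ofReal_comm])
    exact h'.contMDiffAt ((GammaR.chart a).open_source.mem_nhds (mem_chart_source ℝ a))

end Groups

/-! ### Lie groups -/

section LieGroups

variable {E₁ : Type*} [NormedAddCommGroup E₁] [NormedSpace ℝ E₁]
  {G : Type*} [Group G] [TopologicalSpace G] [ChartedSpace E₁ G]
  {E₂ : Type*} [NormedAddCommGroup E₂] [NormedSpace ℝ E₂]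
  {G' : Type*} [Group G'] [TopologicalSpace G'] [ChartedSpace E₂ G']

/-- The identification of the Lie algebra of `G` with the normed space on which `G` is modelled,
through the preferred chart at the identity (in Mathlib, this is the identity map). -/
def lieCoord : GroupLieAlgebra 𝓘(ℝ, E₁) G ≃L[ℝ] E₁ := ContinuousLinearEquiv.refl ℝ E₁

/-- The exponential map of a Lie group: the value at time `1` of the integral curve through the
identity of the left-invariant vector field with value `X` at the identity. -/
def lieExp (X : GroupLieAlgebra 𝓘(ℝ, E₁) G) : G :=
  Classical.epsilon fun g => ∃ γ : ℝ → G,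
    γ 0 = 1 ∧ IsMIntegralCurve γ (mulInvariantVectorField X) ∧ γ 1 = g

/-- The adjoint representation: `Ad g` is the derivative at the identity of `h ↦ g h g⁻¹`. -/
def Ad (g : G) : GroupLieAlgebra 𝓘(ℝ, E₁) G →L[ℝ] GroupLieAlgebra 𝓘(ℝ, E₁) G :=
  mfderiv 𝓘(ℝ, E₁) 𝓘(ℝ, E₁) (fun h : G => g * h * g⁻¹) 1

/-- The homomorphism of Lie algebras induced by a homomorphism of Lie groups: the derivative at
the identity. -/
def lieMap (χ : G →* G') : GroupLieAlgebra 𝓘(ℝ, E₁) G →L[ℝ] GroupLieAlgebra 𝓘(ℝ, E₂) G' :=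
  mfderiv 𝓘(ℝ, E₁) 𝓘(ℝ, E₂) χ 1

/-- `X` lies in the center of the Lie algebra. -/
def IsCentral (X : GroupLieAlgebra 𝓘(ℝ, E₁) G) : Prop :=
  ∀ Y : GroupLieAlgebra 𝓘(ℝ, E₁) G, ⁅X, Y⁆ = 0

end LieGroups

/-- The element `i` of the Lie algebra `iℝ` of `U(1)`: the derivative of `t ↦ e^{it}` at `0`. -/
def circleI : GroupLieAlgebra (𝓡 1) Circle :=
  mfderiv 𝓘(ℝ, ℝ) (𝓡 1) Circle.exp 0 (1 : ℝ)

/-! ### Differential forms -/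

section Forms

variable {E : Type*} [NormedAddCommGroup E] [NormedSpace ℝ E]
  {P : Type*} [TopologicalSpace P] [ChartedSpace E P]
  {V : Type*} [NormedAddCommGroup V] [NormedSpace ℝ V]

/-- The exterior derivative `dη(u, v)` at `p` of a `V`-valued `1`-form, computed in the preferred
chart at `p` (in Mathlib a tangent vector at `p` is given by its coordinates in that chart). -/
def extDerivOne (η : ∀ p : P, TangentSpace 𝓘(ℝ, E) p →L[ℝ] V) (p : P)
    (u v : TangentSpace 𝓘(ℝ, E) p) : V :=
  let ηloc : E → E →L[ℝ] V := fun x =>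
    (η ((extChartAt 𝓘(ℝ, E) p).symm x)).comp
      (mfderiv 𝓘(ℝ, E) 𝓘(ℝ, E) (extChartAt 𝓘(ℝ, E) p).symm x)
  let x₀ : E := extChartAt 𝓘(ℝ, E) p p
  fderiv ℝ ηloc x₀ u v - fderiv ℝ ηloc x₀ v u

/-- The integral of a `V`-valued `2`-form on `P` over the (interior of the) unit disk, pulled back
along `φ : ℂ → P`; the unit disk carries the standard orientation of `ℂ`. -/
def diskIntegral (φ : ℂ → P) (β : ∀ x : P, TangentSpace 𝓘(ℝ, E) x [⋀^Fin 2]→L[ℝ] V) : V :=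
  ∫ z in Metric.ball (0 : ℂ) 1,
    β (φ z) ![mfderiv 𝓘(ℝ, ℂ) 𝓘(ℝ, E) φ z (1 : ℂ), mfderiv 𝓘(ℝ, ℂ) 𝓘(ℝ, E) φ z Complex.I]

/-- A disk in a surface `P`: a smooth embedding of the closed unit disk (the values outside of the
closed unit disk, where the map need only be smooth near it, are irrelevant). -/
structure EmbeddedDisk (E : Type*) [NormedAddCommGroup E] [NormedSpace ℝ E]
    (P : Type*) [TopologicalSpace P] [ChartedSpace E P] where
  toFun : ℂ → P
  smooth : ∃ U : Set ℂ, IsOpen U ∧ Metric.closedBall 0 1 ⊆ U ∧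
    ContMDiffOn 𝓘(ℝ, ℂ) 𝓘(ℝ, E) ∞ toFun U
  injOn : Set.InjOn toFun (Metric.closedBall 0 1)
  immersion : ∀ z ∈ Metric.closedBall (0 : ℂ) 1,
    Function.Injective (mfderiv 𝓘(ℝ, ℂ) 𝓘(ℝ, E) toFun z)

/-- The smooth loop `w : [0, 1] → P` traverses the boundary of the disk `Δ` once, in the direction
prescribed by the parametrization of `Δ`, from an arbitrary starting point and with an arbitrary
parametrization. -/
def IsBoundaryLoop (Δ : EmbeddedDisk E P) (w : ℝ → P) : Prop :=
  ContMDiffOn 𝓘(ℝ, ℝ) 𝓘(ℝ, E) ∞ w (Icc 0 1) ∧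
  ∃ θ : ℝ → ℝ, ContinuousOn θ (Icc 0 1) ∧ θ 1 = θ 0 + 1 ∧
    ∀ t ∈ Icc (0 : ℝ) 1, w t = Δ.toFun (Complex.exp (2 * Real.pi * θ t * Complex.I))

end Forms

/-! ### Principal bundles, connections, holonomy -/

section Bundles

variable {EB : Type*} [NormedAddCommGroup EB] [NormedSpace ℝ EB]
  {B : Type*} [TopologicalSpace B] [ChartedSpace EB B]
  {E : Type*} [NormedAddCommGroup E] [NormedSpace ℝ E]
  {P : Type*} [TopologicalSpace P] [ChartedSpace E P]
  {EG : Type*} [NormedAddCommGroup EG] [NormedSpace ℝ EG]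
  {G : Type*} [Group G] [TopologicalSpace G] [ChartedSpace EG G] [MulAction Gᵐᵒᵖ P]
  {E' : Type*} [NormedAddCommGroup E'] [NormedSpace ℝ E']
  {P' : Type*} [TopologicalSpace P'] [ChartedSpace E' P']
  {EG' : Type*} [NormedAddCommGroup EG'] [NormedSpace ℝ EG']
  {G' : Type*} [Group G'] [TopologicalSpace G'] [ChartedSpace EG' G'] [MulAction G'ᵐᵒᵖ P']

variable (EB E EG G) in
/-- `π : P → B` is a smooth principal `G`-bundle for the given right action of `G` on `P`: the
action is smooth and free and preserves the fibers, and near every point of the base there are a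
smooth section `s` and a smooth `τ` such that `p = s(π(p)) τ(p)`, that is, `(x, g) ↦ s(x) g` is a
local trivialization with smooth inverse `p ↦ (π(p), τ(p))`. -/
structure IsPrincipalBundle (π : P → B) : Prop where
  smooth_proj : ContMDiff 𝓘(ℝ, E) 𝓘(ℝ, EB) ∞ π
  smooth_act : ContMDiff (𝓘(ℝ, E).prod 𝓘(ℝ, EG)) 𝓘(ℝ, E) ∞ (fun z : P × G => z.1 <• z.2)
  free : ∀ (p : P) (g : G), p <• g = p → g = 1
  proj_act : ∀ (p : P) (g : G), π (p <• g) = π p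
  locally_trivial : ∀ x : B, ∃ (U : Set B) (s : B → P) (τ : P → G), IsOpen U ∧ x ∈ U ∧
    ContMDiffOn 𝓘(ℝ, EB) 𝓘(ℝ, E) ∞ s U ∧ (∀ y ∈ U, π (s y) = y) ∧
    ContMDiffOn 𝓘(ℝ, E) 𝓘(ℝ, EG) ∞ τ (π ⁻¹' U) ∧ ∀ p ∈ π ⁻¹' U, s (π p) <• τ p = p

variable [IsManifold 𝓘(ℝ, E) ∞ P] [IsManifold 𝓘(ℝ, E') ∞ P']

variable (E P EG G) in
/-- A smooth principal `G`-connection on `P`, given by its connection form. -/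
structure Connection where
  form : ∀ p : P, TangentSpace 𝓘(ℝ, E) p →L[ℝ] GroupLieAlgebra 𝓘(ℝ, EG) G
  smooth : ContMDiff 𝓘(ℝ, E).tangent 𝓘(ℝ, EG) ∞
    (fun z : TangentBundle 𝓘(ℝ, E) P => lieCoord (form z.1 z.2))
  vertical : ∀ (p : P) (X : GroupLieAlgebra 𝓘(ℝ, EG) G),
    form (p <• (1 : G)) (mfderiv 𝓘(ℝ, EG) 𝓘(ℝ, E) (fun g : G => p <• g) 1 X) = X
  equivariant : ∀ (g : G) (p : P) (v : TangentSpace 𝓘(ℝ, E) p),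
    form (p <• g) (mfderiv 𝓘(ℝ, E) 𝓘(ℝ, E) (fun p : P => p <• g) p v) = Ad g⁻¹ (form p v)

/-- The curvature form `curv_A = dω + ½[ω, ω]`, as a `2`-form on the total space with values in the
Lie algebra. -/
def Connection.curv (A : Connection E P EG G) (p : P) (u v : TangentSpace 𝓘(ℝ, E) p) :
    GroupLieAlgebra 𝓘(ℝ, EG) G :=
  lieCoord.symm (extDerivOne
      (fun x => (lieCoord (E₁ := EG) (G := G)).toContinuousLinearMap.comp (A.form x)) p u v) +
    ⁅A.form p u, A.form p v⁆

/-- `wP : [0, 1] → P` is a smooth lift of the path `w : [0, 1] → B` that is horizontal for `A`. -/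
structure IsHorizontalLift (π : P → B) (A : Connection E P EG G) (w : ℝ → B) (wP : ℝ → P) :
    Prop where
  smooth : ContMDiffOn 𝓘(ℝ, ℝ) 𝓘(ℝ, E) ∞ wP (Icc 0 1)
  lift : ∀ t ∈ Icc (0 : ℝ) 1, π (wP t) = w t
  horizontal : ∀ t ∈ Icc (0 : ℝ) 1,
    A.form (wP t) (mfderivWithin 𝓘(ℝ, ℝ) 𝓘(ℝ, E) wP (Icc 0 1) t (1 : ℝ)) = 0

/-- The holonomy `Hol_{w,q}(A)` of `A` along the loop `w` with respect to the point `q` over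
`w(0)`: the horizontal lift of `w` that starts at `q` ends at `q Hol_{w,q}(A)`. -/
def holonomy (π : P → B) (A : Connection E P EG G) (w : ℝ → B) (q : P) : G :=
  Classical.epsilon fun g => ∃ wP : ℝ → P,
    IsHorizontalLift π A w wP ∧ wP 0 = q ∧ wP 1 = q <• g

/-- `f : P → P'` together with the homomorphism `χ : G → G'` of structure groups is a morphism of
principal bundles with connection over the identity of `B`. -/
structure IsConnectionMorphism (π : P → B) (A : Connection E P EG G)
    (π' : P' → B) (A' : Connection E' P' EG' G') (χ : G →* G') (f : P → P') : Prop where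
  smooth_hom : ContMDiff 𝓘(ℝ, EG) 𝓘(ℝ, EG') ∞ χ
  smooth_map : ContMDiff 𝓘(ℝ, E) 𝓘(ℝ, E') ∞ f
  proj_map : ∀ p, π' (f p) = π p
  map_act : ∀ (p : P) (g : G), f (p <• g) = f p <• χ g
  map_form : ∀ (p : P) (v : TangentSpace 𝓘(ℝ, E) p),
    A'.form (f p) (mfderiv 𝓘(ℝ, E) 𝓘(ℝ, E') f p v) = lieMap χ (A.form p v)

/-- `lam : P → P'` is the pre-reduction map of the connection `A'` relative to the points `q` and
`q'` and to the reference connection `A`: for every `T`, the value `lam T` is the end point of the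
`A'`-horizontal lift `w'`, starting at `q'`, of the projection to `B` of an `A`-horizontal path
`wt` that joins `q` to `T`. Such paths exist for every `T`, and all of them give the same value. -/
def IsPreReductionMap (π : P → B) (A : Connection E P EG G)
    (π' : P' → B) (A' : Connection E' P' EG' G') (q : P) (q' : P') (lam : P → P') : Prop :=
  ∀ (T : P) (T' : P'), lam T = T' ↔
    ∃ (wt : ℝ → P) (w' : ℝ → P'), IsHorizontalLift π A (fun t => π (wt t)) wt ∧
      wt 0 = q ∧ wt 1 = T ∧
      IsHorizontalLift π' A' (fun t => π (wt t)) w' ∧ w' 0 = q' ∧ w' 1 = T'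

end Bundles

/-! ### The characteristic class -/

section CharacteristicClass

variable {B : Type*}
  {EM : Type*} [NormedAddCommGroup EM] [NormedSpace ℝ EM]
  {M : Type*} [TopologicalSpace M] [MulAction Circleᵐᵒᵖ M]
  {P : Type*} [TopologicalSpace P]
  {EG : Type*} [NormedAddCommGroup EG] [NormedSpace ℝ EG]
  {G : Type*} [Group G] [TopologicalSpace G] [ChartedSpace EG G] [MulAction Gᵐᵒᵖ P]

variable (G P) in
/-- The equivalence relation on `P` whose classes are the orbits of `S = [G, G]`. -/
def orbitSetoid : Setoid P where
  r p p' := ∃ s ∈ commutator G, p' = p <• s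
  iseqv := by
    refine ⟨fun p => ⟨1, one_mem _, by simp⟩, ?_, ?_⟩
    · rintro p _ ⟨s, hs, rfl⟩
      exact ⟨s⁻¹, inv_mem hs, by simp⟩
    · rintro p _ _ ⟨s, hs, rfl⟩ ⟨s', hs', rfl⟩
      exact ⟨s * s', mul_mem hs hs', by simp [mul_smul]⟩

variable (G P) in
/-- The orbit space `P/S`, with the quotient topology. -/
abbrev OrbitSpace : Type _ := Quotient (orbitSetoid P G)

variable (M) in
/-- The equivalence relation `(m z, a) ∼ (m, φ(z) a)` on `M × (G/S)`. -/
def assocSetoid (φ : Circle →* G ⧸ commutator G) : Setoid (M × (G ⧸ commutator G)) where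
  r x y := ∃ z : Circle, y = (x.1 <• z, (φ z)⁻¹ * x.2)
  iseqv := by
    refine ⟨fun x => ⟨1, by simp⟩, ?_, ?_⟩
    · rintro x _ ⟨z, rfl⟩
      exact ⟨z⁻¹, by simp⟩
    · rintro x _ _ ⟨z, rfl⟩ ⟨z', rfl⟩
      exact ⟨z * z', by simp [mul_smul, mul_assoc]⟩

variable (M) in
/-- The total space `M ×_φ (G/S)` of the principal `G/S`-bundle associated with the principal
`U(1)`-bundle `M`, with the quotient topology. -/
abbrev AssocSpace (φ : Circle →* G ⧸ commutator G) : Type _ := Quotient (assocSetoid M φ)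

/-- `X` is the characteristic class of the principal `G`-bundle `π : P → B`, relative to the
reference `U(1)`-bundle `πM : M → B`: it lies in the center of the Lie algebra of `G` (which maps
isomorphically to the Lie algebra of `G/S`), and it corresponds to a homomorphism
`φ : U(1) → G/S`, by `φ(e^{2πit}) = exp(tX)` in `G/S`, such that the principal `G/S`-bundles
`P/S` and `M ×_φ (G/S)` on `B` are isomorphic. -/
def IsCharacteristicClass (πM : M → B) (π : P → B) (X : GroupLieAlgebra 𝓘(ℝ, EG) G) : Prop :=
  IsCentral X ∧ ∃ φ : Circle →* G ⧸ commutator G, Continuous φ ∧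
    (∀ t : ℝ, φ (Circle.exp (2 * Real.pi * t)) = QuotientGroup.mk (lieExp (t • X))) ∧
    ∃ f : OrbitSpace P G ≃ₜ AssocSpace M φ,
      ∀ (p : P) (m : M) (a : G ⧸ commutator G), f ⟦p⟧ = ⟦(m, a)⟧ →
        πM m = π p ∧ ∀ g : G, f ⟦p <• g⟧ = ⟦(m, a * QuotientGroup.mk g)⟧

end CharacteristicClass

/-! ### The surface and the reference bundles -/

section Reference

variable {B : Type*} [TopologicalSpace B] [ChartedSpace (EuclideanSpace ℝ (Fin 2)) B]

/-- A point on the `k`-th of the `4ℓ` consecutive arcs of the unit circle, `s ∈ [0, 1]`. -/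
def polygonPoint (ℓ k : ℕ) (s : ℝ) : ℂ :=
  Complex.exp (2 * Real.pi * ((k + s) / (4 * ℓ)) * Complex.I)

/-- A canonical system of smooth closed curves `u_1, v_1, …, u_ℓ, v_ℓ` on the surface `B`, starting
at `Q`; `curve (Sum.inl j)` is `u_j` and `curve (Sum.inr j)` is `v_j`. The curves are simple and
meet only at `Q`, and cutting `B` along them yields a disk `e²`, described by its characteristic map
`cell`, which is orientation preserving for the area form `vol` and whose boundary path is
`[u_1, v_1] ⋯ [u_ℓ, v_ℓ]`. Products of paths are read as compositions of parallel transports,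
so the right-most factor is traversed first: counterclockwise the boundary of `e²` is
`v_ℓ⁻¹, u_ℓ⁻¹, v_ℓ, u_ℓ, …, v_1⁻¹, u_1⁻¹, v_1, u_1`. -/
structure CanonicalSystem (ℓ : ℕ)
    (vol : ∀ x : B, TangentSpace (𝓡 2) x [⋀^Fin 2]→L[ℝ] ℝ) (Q : B) where
  curve : Fin ℓ ⊕ Fin ℓ → ℝ → B
  smooth_curve : ∀ a, ContMDiffOn 𝓘(ℝ, ℝ) (𝓡 2) ∞ (curve a) (Icc 0 1)
  curve_zero : ∀ a, curve a 0 = Q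
  curve_one : ∀ a, curve a 1 = Q
  simple : ∀ a b, ∀ s ∈ Ioo (0 : ℝ) 1, ∀ t ∈ Icc (0 : ℝ) 1,
    curve a s = curve b t → a = b ∧ s = t
  cell : ℂ → B
  continuous_cell : ContinuousOn cell (Metric.closedBall 0 1)
  smooth_cell : ContMDiffOn 𝓘(ℝ, ℂ) (𝓡 2) ∞ cell (Metric.ball 0 1)
  cell_pos : ∀ z ∈ Metric.ball (0 : ℂ) 1,
    0 < vol (cell z) ![mfderiv 𝓘(ℝ, ℂ) (𝓡 2) cell z (1 : ℂ),
      mfderiv 𝓘(ℝ, ℂ) (𝓡 2) cell z Complex.I]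
  cell_injOn : Set.InjOn cell (Metric.ball 0 1)
  cell_ne_curve : ∀ z ∈ Metric.ball (0 : ℂ) 1, ∀ a, ∀ t ∈ Icc (0 : ℝ) 1, cell z ≠ curve a t
  cell_surj : cell '' Metric.closedBall 0 1 = univ
  boundary_v_inv : ∀ j : Fin ℓ, ∀ s ∈ Icc (0 : ℝ) 1,
    cell (polygonPoint ℓ (4 * j.rev) s) = curve (Sum.inr j) (1 - s)
  boundary_u_inv : ∀ j : Fin ℓ, ∀ s ∈ Icc (0 : ℝ) 1,
    cell (polygonPoint ℓ (4 * j.rev + 1) s) = curve (Sum.inl j) (1 - s)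
  boundary_v : ∀ j : Fin ℓ, ∀ s ∈ Icc (0 : ℝ) 1,
    cell (polygonPoint ℓ (4 * j.rev + 2) s) = curve (Sum.inr j) s
  boundary_u : ∀ j : Fin ℓ, ∀ s ∈ Icc (0 : ℝ) 1,
    cell (polygonPoint ℓ (4 * j.rev + 3) s) = curve (Sum.inl j) s

variable {EM : Type*} [NormedAddCommGroup EM] [NormedSpace ℝ EM]
  {M : Type*} [TopologicalSpace M] [ChartedSpace EM M] [IsManifold 𝓘(ℝ, EM) ∞ M]
  [MulAction Circleᵐᵒᵖ M]
  {EN : Type*} [NormedAddCommGroup EN] [NormedSpace ℝ EN]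
  {N : Type*} [TopologicalSpace N] [ChartedSpace EN N] [IsManifold 𝓘(ℝ, EN) ∞ N]

/-- `πM : M → B` is the reference `U(1)`-bundle with its connection `ωM`: the curvature is
`-2πi vol` with `vol` nowhere zero, the Chern class `(i/2π) ∫ curv = ∫ vol` is `1`, and the
holonomies along the canonical curves are trivial. -/
structure IsReferenceBundle {ℓ : ℕ} {vol : ∀ x : B, TangentSpace (𝓡 2) x [⋀^Fin 2]→L[ℝ] ℝ}
    {Q : B} (c : CanonicalSystem ℓ vol Q) (πM : M → B)
    (ωM : Connection EM M (EuclideanSpace ℝ (Fin 1)) Circle) (QM : M) : Prop where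
  principal : IsPrincipalBundle (EuclideanSpace ℝ (Fin 2)) EM (EuclideanSpace ℝ (Fin 1)) Circle πM
  curv_eq : ∀ (m : M) (u v : TangentSpace 𝓘(ℝ, EM) m),
    ωM.curv m u v = (-(2 * Real.pi * vol (πM m) ![mfderiv 𝓘(ℝ, EM) (𝓡 2) πM m u,
      mfderiv 𝓘(ℝ, EM) (𝓡 2) πM m v])) • circleI
  nondegenerate : ∀ x : B, vol x ≠ 0
  chern : diskIntegral c.cell vol = 1
  base : πM QM = Q
  holonomy_curve : ∀ a, holonomy πM ωM (c.curve a) QM = 1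

/-- `N` is the universal covering `q : N → M` of the total space of the reference `U(1)`-bundle,
with its structure of a principal `Γ_ℝ`-bundle on `B` with connection `ωN`: the subgroup `ℝ` lifts
the action of `U(1)`, the subgroup `Γ` acts by deck transformations (both are contained in the
equivariance of `q` along `Γ_ℝ → U(1)`), the connection is lifted from `M`, and the generators `x_j`
and `y_j` of `Γ` are the classes of the (closed) horizontal lifts to `M` of `u_j` and `v_j`. -/
structure IsReferenceCover {ℓ : ℕ} [NeZero ℓ]
    {vol : ∀ x : B, TangentSpace (𝓡 2) x [⋀^Fin 2]→L[ℝ] ℝ}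
    {Q : B} (c : CanonicalSystem ℓ vol Q) (πM : M → B)
    (ωM : Connection EM M (EuclideanSpace ℝ (Fin 1)) Circle) (QM : M)
    [MulAction (GammaR ℓ)ᵐᵒᵖ N] (q : N → M)
    (ωN : Connection EN N ℝ (GammaR ℓ)) (QN : N) : Prop where
  simply_connected : SimplyConnectedSpace N
  covering : IsCoveringMap q
  principal : IsPrincipalBundle (EuclideanSpace ℝ (Fin 2)) EN ℝ (GammaR ℓ) (fun n => πM (q n))
  morphism : IsConnectionMorphism (fun n => πM (q n)) ωN πM ωM (GammaR.toCircle ℓ) q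
  base : q QN = QM
  generator : ∀ a, ∃ wN : ℝ → N, IsHorizontalLift (fun n => πM (q n)) ωN (c.curve a) wN ∧
    wN 0 = QN ∧ wN 1 = QN <• freeToGammaR ℓ (FreeGroup.of a)

end Reference

end

end CentralYM

open CentralYM

/-!
The four conditions are equivalent because each of them says, in its own way, that the curvature of
`A` is `-X vol`; the condition on the curvature is compared with each of the other three.

Two facts are used repeatedly. First, `X` is central in the Lie algebra and `G` is connected, so
that `X` is fixed by the adjoint representation (`AdC_eq_self`); hence forms with values in `ℝX` are
treated as in the abelian case: moving a curve in `P` by `exp(sX)` adds `ds X` to the pull-back of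
the connection form. Second, the curvature is horizontal (`IsPrincipalBundle.cvr_eq`), hence known
as soon as it is known on lifts of tangent vectors of the surface.

*From the curvature to the morphism* (`exists_preReduction`). The total space `N` of the reference
bundle is simply connected, and its connection has curvature `-2π vol`. A map `N → P` over the
surface that pulls `A` back to `X/2π` times the reference form solves a total differential equation,
whose integrability condition is `curv A = -X vol`. Locally, it is solved by the Frobenius theorem
(`exists_solution_total_differential`, `IsPrincipalBundle.exists_local_lift`); two local solutions
differ by a locally constant element of `G`, since `X` is fixed by the adjoint representation, and
so the solutions form a covering of `N`, which is trivial (`IsPrincipalBundle.exists_lift`).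
Equivariance follows in the same manner (`exists_hom_of_map`). The map carries horizontal curves to
horizontal curves, which are determined by their projection and starting point. Thus it is the
pre-reduction map, provided that every point of `N` is the end of a horizontal curve that starts at
the base point. This holds as the curvature of `N` vanishes nowhere: the horizontal lifts of small
loops move a point in the direction of the fibre (`horizontallyJoined_of_extD_ne_zero`).

*From the morphism to the curvature* (`IsConnectionMorphism.cvr_eq`). The homomorphism is
`t ↦ exp(tX/2π)` on the identity component, so the morphism pulls `A` back to `X/2π` times the
reference form, whose exterior derivative is known.

*From the curvature to the holonomies* (`IsPrincipalBundle.holonomy_boundaryLoop`). Over a disk,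
`vol` is the differential of an explicit radial one-form `η`, and the disk lifts to `P` in such a
way that the connection form becomes `-ηX`. Multiplication by `exp((∫ η)X)` makes the lift of the
boundary horizontal, and the line integral of `η` along the boundary is the area.

*From integrals and holonomies to the curvature.* Disks may be chosen arbitrarily small. The mean
value of the curvature over them tends to its value at the center
(`IsPrincipalBundle.cvr_eq_of_diskIntegral`). Likewise, the holonomy around a circle of radius `ε`
is, up to `o(ε²)`, determined by minus the integral of the curvature over the disk
(`exists_solution_small_circle`, `IsPrincipalBundle.cvr_eq_of_holonomy`).

For computations, tangent spaces are replaced by the model spaces to which they are equal by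
definition: `tD` is the derivative of a map between manifolds, `pull` and `extD` the pull-back and
the exterior derivative of one-forms, and `Connection.co` and `Connection.cvr` the connection form
and the curvature form, with values in the model space of the structure group.
-/

open scoped Topology

namespace CentralYM

noncomputable section

/-! ### Pull-backs of one-forms and naturality of the exterior derivative -/

section PullBack

variable {E : Type*} [NormedAddCommGroup E] [NormedSpace ℝ E]
  {P : Type*} [TopologicalSpace P] [ChartedSpace E P]
  {V : Type*} [NormedAddCommGroup V] [NormedSpace ℝ V]
  {F : Type*} [NormedAddCommGroup F] [NormedSpace ℝ F]
  {Y : Type*} [TopologicalSpace Y] [ChartedSpace F Y]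
  {F' : Type*} [NormedAddCommGroup F'] [NormedSpace ℝ F']
  {Z : Type*} [TopologicalSpace Z] [ChartedSpace F' Z]

/-- The manifold derivative, as a continuous linear map between the model spaces `F` and `E`. -/
def tD (F : Type*) [NormedAddCommGroup F] [NormedSpace ℝ F] (E : Type*) [NormedAddCommGroup E]
    [NormedSpace ℝ E] {P : Type*} [TopologicalSpace P] [ChartedSpace E P]
    {Y : Type*} [TopologicalSpace Y] [ChartedSpace F Y] (f : Y → P) (y : Y) : F →L[ℝ] E :=
  mfderiv 𝓘(ℝ, F) 𝓘(ℝ, E) f y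

variable (F) in
/-- The pull-back of a one-form along a map from a manifold modelled on `F`. -/
def pull (η : P → E →L[ℝ] V) (f : Y → P) (y : Y) : F →L[ℝ] V := (η (f y)).comp (tD F E f y)

theorem pull_apply (η : P → E →L[ℝ] V) (f : Y → P) (y : Y) (v : F) :
    pull F η f y v = η (f y) (tD F E f y v) := rfl

theorem tD_comp {f : Y → P} {g : Z → Y} {z : Z} (hf : MDifferentiableAt 𝓘(ℝ, F) 𝓘(ℝ, E) f (g z))
    (hg : MDifferentiableAt 𝓘(ℝ, F') 𝓘(ℝ, F) g z) :
    tD F' E (fun z => f (g z)) z = (tD F E f (g z)).comp (tD F' F g z) :=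
  mfderiv_comp z hf hg

theorem tD_comp_apply {f : Y → P} {g : Z → Y} {z : Z}
    (hf : MDifferentiableAt 𝓘(ℝ, F) 𝓘(ℝ, E) f (g z))
    (hg : MDifferentiableAt 𝓘(ℝ, F') 𝓘(ℝ, F) g z) (v : F') :
    tD F' E (fun z => f (g z)) z v = tD F E f (g z) (tD F' F g z v) := by
  rw [tD_comp hf hg]; rfl

theorem tD_eq_fderiv (f : F → E) (x : F) : tD F E f x = fderiv ℝ f x := mfderiv_eq_fderiv

theorem tD_congr {f g : Y → P} {y : Y} (h : f =ᶠ[𝓝 y] g) : tD F E f y = tD F E g y := h.mfderiv_eq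

theorem tD_id (y : Y) : tD F F (fun y : Y => y) y = ContinuousLinearMap.id ℝ F := mfderiv_id

theorem tD_const (p : P) (y : Y) : tD F E (fun _ : Y => p) y = 0 := mfderiv_const

/-- A one-form is smooth if its coordinate representations in all preferred charts are. -/
def SmoothForm (η : P → E →L[ℝ] V) : Prop :=
  ∀ p : P, ContDiffOn ℝ ∞ (pull E η (extChartAt 𝓘(ℝ, E) p).symm) (extChartAt 𝓘(ℝ, E) p).target

/-- The antisymmetrized derivative of a one-form on a normed space. -/
def curl (α : F → F →L[ℝ] V) (x u v : F) : V := fderiv ℝ α x u v - fderiv ℝ α x v u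

/-- The exterior derivative of a one-form. -/
def extD (η : P → E →L[ℝ] V) (p : P) (u v : E) : V :=
  curl (pull E η (extChartAt 𝓘(ℝ, E) p).symm) (extChartAt 𝓘(ℝ, E) p p) u v

theorem curl_congr {α β : F → F →L[ℝ] V} {x : F} (h : α =ᶠ[𝓝 x] β) (u v : F) :
    curl α x u v = curl β x u v := by
  rw [curl, curl, h.fderiv_eq]

theorem curl_swap (α : F → F →L[ℝ] V) (x u v : F) : curl α x u v = - curl α x v u := by
  rw [curl, curl, neg_sub]

theorem pull_congr (η : P → E →L[ℝ] V) {f g : Y → P} {x : Y}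
    (h : f =ᶠ[𝓝 x] g) : pull F η f x = pull F η g x := by
  rw [pull, pull, h.eq_of_nhds, tD_congr h]

theorem pull_comp (η : P → E →L[ℝ] V) {f : Y → P} {g : Z → Y}
    {x : Z} (hf : MDifferentiableAt 𝓘(ℝ, F) 𝓘(ℝ, E) f (g x))
    (hg : MDifferentiableAt 𝓘(ℝ, F') 𝓘(ℝ, F) g x) :
    pull F' η (fun x => f (g x)) x = (pull F η f (g x)).comp (tD F' F g x) := by
  rw [pull, tD_comp hf hg]; rfl

theorem pull_pull (η : P → E →L[ℝ] V) {f : Y → P} {g : Z → Y}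
    {x : Z} (hf : MDifferentiableAt 𝓘(ℝ, F) 𝓘(ℝ, E) f (g x))
    (hg : MDifferentiableAt 𝓘(ℝ, F') 𝓘(ℝ, F) g x) :
    pull F' (pull F η f) g x = pull F' η (fun x => f (g x)) x := (pull_comp η hf hg).symm

theorem chart_factor {X : Type*} [TopologicalSpace X] {f : X → P} {x : X} {p : P}
    (hf : ContinuousAt f x) (hp : f x ∈ (extChartAt 𝓘(ℝ, E) p).source) :
    f =ᶠ[𝓝 x] (fun y => (extChartAt 𝓘(ℝ, E) p).symm (extChartAt 𝓘(ℝ, E) p (f y))) := by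
  have h := hf.preimage_mem_nhds ((isOpen_extChartAt_source (I := 𝓘(ℝ, E)) p).mem_nhds hp)
  filter_upwards [h] with y hy
  exact ((extChartAt 𝓘(ℝ, E) p).left_inv hy).symm

variable [IsManifold 𝓘(ℝ, E) ∞ P]

theorem contMDiffAt_extChartAt_symm {p : P} {x : E} (hx : x ∈ (extChartAt 𝓘(ℝ, E) p).target) :
    ContMDiffAt 𝓘(ℝ, E) 𝓘(ℝ, E) ∞ (extChartAt 𝓘(ℝ, E) p).symm x :=
  (contMDiffOn_extChartAt_symm p).contMDiffAt ((isOpen_extChartAt_target p).mem_nhds hx)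

theorem mdifferentiableAt_extChartAt_symm {p : P} {x : E}
    (hx : x ∈ (extChartAt 𝓘(ℝ, E) p).target) :
    MDifferentiableAt 𝓘(ℝ, E) 𝓘(ℝ, E) (extChartAt 𝓘(ℝ, E) p).symm x :=
  (contMDiffAt_extChartAt_symm hx).mdifferentiableAt (by simp)

theorem contMDiffAt_extChartAt_of_mem {p y : P} (hy : y ∈ (extChartAt 𝓘(ℝ, E) p).source) :
    ContMDiffAt 𝓘(ℝ, E) 𝓘(ℝ, E) ∞ (extChartAt 𝓘(ℝ, E) p) y :=
  contMDiffAt_extChartAt' (by simpa using hy)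

theorem mdifferentiableAt_extChartAt_of_mem {p y : P} (hy : y ∈ (extChartAt 𝓘(ℝ, E) p).source) :
    MDifferentiableAt 𝓘(ℝ, E) 𝓘(ℝ, E) (extChartAt 𝓘(ℝ, E) p) y :=
  (contMDiffAt_extChartAt_of_mem hy).mdifferentiableAt (by simp)

theorem tD_chart_symm_comp {p : P} {x : E} (hx : x ∈ (extChartAt 𝓘(ℝ, E) p).target) (v : E) :
    tD E E (extChartAt 𝓘(ℝ, E) p) ((extChartAt 𝓘(ℝ, E) p).symm x)
      (tD E E (extChartAt 𝓘(ℝ, E) p).symm x v) = v := by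
  rw [← tD_comp_apply (mdifferentiableAt_extChartAt_of_mem
    ((extChartAt 𝓘(ℝ, E) p).map_target hx)) (mdifferentiableAt_extChartAt_symm hx)]
  have : (fun z => extChartAt 𝓘(ℝ, E) p ((extChartAt 𝓘(ℝ, E) p).symm z)) =ᶠ[𝓝 x] fun z => z := by
    filter_upwards [(isOpen_extChartAt_target p).mem_nhds hx] with z hz
    exact (extChartAt 𝓘(ℝ, E) p).right_inv hz
  rw [tD_congr this, tD_id]; rfl

theorem tD_symm_chart_comp {p y : P} (hy : y ∈ (extChartAt 𝓘(ℝ, E) p).source) (v : E) :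
    tD E E (extChartAt 𝓘(ℝ, E) p).symm (extChartAt 𝓘(ℝ, E) p y)
      (tD E E (extChartAt 𝓘(ℝ, E) p) y v) = v := by
  rw [← tD_comp_apply (mdifferentiableAt_extChartAt_symm
    ((extChartAt 𝓘(ℝ, E) p).map_source hy)) (mdifferentiableAt_extChartAt_of_mem hy)]
  rw [← tD_congr (f := fun y => y) (chart_factor continuousAt_id hy), tD_id]; rfl

theorem tD_chart_self (p : P) : tD E E (extChartAt 𝓘(ℝ, E) p) p = ContinuousLinearMap.id ℝ E :=
  mfderiv_extChartAt_self

theorem tD_chart_symm_self (p : P) :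
    tD E E (extChartAt 𝓘(ℝ, E) p).symm (extChartAt 𝓘(ℝ, E) p p) = ContinuousLinearMap.id ℝ E := by
  ext v
  have := tD_symm_chart_comp (mem_extChartAt_source (I := 𝓘(ℝ, E)) p) v
  rwa [tD_chart_self] at this

theorem ContMDiffAt.contDiffAt_chart {f : F → P} {x : F} {p : P}
    (hf : ContMDiffAt 𝓘(ℝ, F) 𝓘(ℝ, E) ∞ f x) (hp : f x ∈ (extChartAt 𝓘(ℝ, E) p).source) :
    ContDiffAt ℝ ∞ (fun y => extChartAt 𝓘(ℝ, E) p (f y)) x :=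
  ((contMDiffAt_extChartAt_of_mem hp).comp x hf).contDiffAt

theorem pull_eventually_eq_chart (η : P → E →L[ℝ] V) {f : F → P} {x : F} {p : P}
    (hf : ContMDiffAt 𝓘(ℝ, F) 𝓘(ℝ, E) ∞ f x) (hp : f x ∈ (extChartAt 𝓘(ℝ, E) p).source) :
    pull F η f =ᶠ[𝓝 x] fun y => (pull E η (extChartAt 𝓘(ℝ, E) p).symm
      (extChartAt 𝓘(ℝ, E) p (f y))).comp (fderiv ℝ (fun y => extChartAt 𝓘(ℝ, E) p (f y)) y) := by
  have h1 := (chart_factor hf.continuousAt hp).eventuallyEq_nhds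
  have h2 : ∀ᶠ y in 𝓝 x, DifferentiableAt ℝ (fun y => extChartAt 𝓘(ℝ, E) p (f y)) y := by
    have := ((hf.contDiffAt_chart hp).of_le (m := 1) (by simp)).eventually (by simp)
    exact this.mono fun y hy => hy.differentiableAt (by simp)
  have h3 := hf.continuousAt.preimage_mem_nhds
    ((isOpen_extChartAt_source (I := 𝓘(ℝ, E)) p).mem_nhds hp)
  filter_upwards [h1, h2, h3] with y hy1 hy2 hy3
  rw [pull_congr η hy1, pull_comp η (f := (extChartAt 𝓘(ℝ, E) p).symm)
    (g := fun y => extChartAt 𝓘(ℝ, E) p (f y)) (mdifferentiableAt_extChartAt_symm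
    ((extChartAt 𝓘(ℝ, E) p).map_source hy3)) hy2.mdifferentiableAt, tD_eq_fderiv]

theorem SmoothForm.contDiffAt_pull {η : P → E →L[ℝ] V}
    (hη : SmoothForm η) {f : F → P} {x : F} (hf : ContMDiffAt 𝓘(ℝ, F) 𝓘(ℝ, E) ∞ f x) :
    ContDiffAt ℝ ∞ (pull F η f) x := by
  have hp := mem_extChartAt_source (I := 𝓘(ℝ, E)) (f x)
  refine ContDiffAt.congr_of_eventuallyEq ?_ (pull_eventually_eq_chart η hf hp)
  have h1 := hf.contDiffAt_chart hp
  refine ContDiffAt.clm_comp ?_ (h1.fderiv_right (m := ∞) (by simp))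
  have h2 := (hη (f x)).contDiffAt ((isOpen_extChartAt_target (I := 𝓘(ℝ, E)) (f x)).mem_nhds
    (mem_extChartAt_target (I := 𝓘(ℝ, E)) (f x)))
  exact h2.comp x h1

/-- Naturality of the exterior derivative under a smooth map from a normed space. -/
theorem SmoothForm.curl_pull {η : P → E →L[ℝ] V}
    (hη : SmoothForm η) {f : F → P} {x : F} (hf : ContMDiffAt 𝓘(ℝ, F) 𝓘(ℝ, E) ∞ f x) (u v : F) :
    curl (pull F η f) x u v = extD η (f x) (tD F E f x u) (tD F E f x v) := by
  have hp := mem_extChartAt_source (I := 𝓘(ℝ, E)) (f x)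
  rw [curl_congr (pull_eventually_eq_chart η hf hp)]
  have hm : tD F E f x = fderiv ℝ (fun y => extChartAt 𝓘(ℝ, E) (f x) (f y)) x := by
    rw [← tD_eq_fderiv, tD_comp (mdifferentiableAt_extChartAt_of_mem hp)
      (hf.mdifferentiableAt (by simp)), tD_chart_self]
    rfl
  rw [hm, extD]
  set ψ := extChartAt 𝓘(ℝ, E) (f x)
  set g : F → E := fun y => ψ (f y) with hg
  have hg1 : ContDiffAt ℝ ∞ g x := hf.contDiffAt_chart hp
  have hη1 : ContDiffAt ℝ ∞ (pull E η ψ.symm) (g x) :=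
    (hη (f x)).contDiffAt ((isOpen_extChartAt_target (I := 𝓘(ℝ, E)) (f x)).mem_nhds
    (mem_extChartAt_target (I := 𝓘(ℝ, E)) (f x)))
  have hd1 : DifferentiableAt ℝ (fun y => pull E η ψ.symm (g y)) x :=
    (hη1.comp x hg1).differentiableAt (by simp)
  have hd2 : DifferentiableAt ℝ (fderiv ℝ g) x :=
    (hg1.fderiv_right (m := 1) (by norm_cast)).differentiableAt (by simp)
  have hsymm : IsSymmSndFDerivAt ℝ g x :=
    hg1.isSymmSndFDerivAt (by rw [minSmoothness_of_isRCLikeNormedField]; norm_cast)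
  have hc : fderiv ℝ (fun y => pull E η ψ.symm (g y)) x
      = (fderiv ℝ (pull E η ψ.symm) (g x)).comp (fderiv ℝ g x) :=
    fderiv_comp x (hη1.differentiableAt (by simp)) (hg1.differentiableAt (by simp))
  rw [curl, fderiv_clm_comp hd1 hd2, hc]
  have hs := hsymm u v
  simp only [_root_.add_apply, ContinuousLinearMap.comp_apply,
    ContinuousLinearMap.compL_apply, ContinuousLinearMap.flip_apply, hs, add_sub_add_left_eq_sub]
  rfl

variable [IsManifold 𝓘(ℝ, F) ∞ Y]

/-- Naturality of the exterior derivative under a smooth map of manifolds. -/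
theorem SmoothForm.extD_pull {η : P → E →L[ℝ] V} (hη : SmoothForm η) {f : Y → P}
    (hf : ContMDiff 𝓘(ℝ, F) 𝓘(ℝ, E) ∞ f) (y : Y) (u v : F) :
    extD (pull F η f) y u v = extD η (f y) (tD F E f y u) (tD F E f y v) := by
  have hx := mem_extChartAt_target (I := 𝓘(ℝ, F)) y
  have h1 := contMDiffAt_extChartAt_symm hx
  have h2 : ContMDiffAt 𝓘(ℝ, F) 𝓘(ℝ, E) ∞ (fun z => f ((extChartAt 𝓘(ℝ, F) y).symm z))
    (extChartAt 𝓘(ℝ, F) y y) := (hf _).comp _ h1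
  have h3 : pull F (pull F η f) (extChartAt 𝓘(ℝ, F) y).symm =ᶠ[𝓝 (extChartAt 𝓘(ℝ, F) y y)]
      pull F η (fun z => f ((extChartAt 𝓘(ℝ, F) y).symm z)) := by
    filter_upwards [(isOpen_extChartAt_target y).mem_nhds hx] with z hz
    exact pull_pull η ((hf _).mdifferentiableAt (by simp)) (mdifferentiableAt_extChartAt_symm hz)
  rw [extD, curl_congr h3, hη.curl_pull h2,
    tD_comp ((hf _).mdifferentiableAt (by simp)) (mdifferentiableAt_extChartAt_symm hx),
    tD_chart_symm_self, extChartAt_to_inv]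
  rfl

omit [IsManifold 𝓘(ℝ, F) ∞ Y] in
/-- A one-form that is smooth as a function on the tangent bundle is smooth. -/
theorem SmoothForm.of_tangentBundle [FiniteDimensional ℝ E] {η : P → E →L[ℝ] V}
    (h : ContMDiff 𝓘(ℝ, E).tangent 𝓘(ℝ, V) ∞ (fun z : TangentBundle 𝓘(ℝ, E) P => η z.1 z.2)) :
    SmoothForm η := by
  intro p
  rw [contDiffOn_clm_apply]
  intro v x hx
  apply ContDiffAt.contDiffWithinAt
  rw [← contMDiffAt_iff_contDiffAt]
  have h1 := contMDiffOn_extChartAt_symm (I := 𝓘(ℝ, E)) (n := ∞) p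
  have h2 := h1.contMDiffOn_tangentMapWithin (m := ∞) (by simp)
    (isOpen_extChartAt_target p).uniqueMDiffOn
  have h3 : ContMDiffAt 𝓘(ℝ, E) 𝓘(ℝ, E).tangent ∞
      (fun x : E => (⟨x, v⟩ : TangentBundle 𝓘(ℝ, E) E)) x := by
    rw [Bundle.contMDiffAt_totalSpace]
    exact ⟨contMDiffAt_id, by simpa using contMDiffAt_const⟩
  have h4 : ContMDiffAt 𝓘(ℝ, E).tangent 𝓘(ℝ, E).tangent ∞
      (tangentMapWithin 𝓘(ℝ, E) 𝓘(ℝ, E) (extChartAt 𝓘(ℝ, E) p).symm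
        (extChartAt 𝓘(ℝ, E) p).target) (⟨x, v⟩ : TangentBundle 𝓘(ℝ, E) E) := by
    refine h2.contMDiffAt ?_
    exact ((isOpen_extChartAt_target p).preimage
      (FiberBundle.continuous_proj E (TangentSpace 𝓘(ℝ, E)))).mem_nhds hx
  refine ((h _).comp x (h4.comp x h3)).congr_of_eventuallyEq ?_
  filter_upwards [(isOpen_extChartAt_target (I := 𝓘(ℝ, E)) p).mem_nhds hx] with z hz
  simp only [Function.comp_apply, tangentMapWithin]
  rw [mfderivWithin_of_isOpen (isOpen_extChartAt_target p) hz]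
  rfl

end PullBack

/-! ### The adjoint representation and its derivative -/

section Adjoint

variable {E : Type*} [NormedAddCommGroup E] [NormedSpace ℝ E]
  {G : Type*} [Group G] [TopologicalSpace G] [ChartedSpace E G]

/-- The adjoint representation, on the model space of the group. -/
def AdC (g : G) : E →L[ℝ] E := tD E E (fun h : G => g * h * g⁻¹) 1

variable (G) in
/-- The Lie bracket of the Lie algebra of `G`, on the model space of `G`. -/
def brk (u v : E) : E :=
  Bracket.bracket (L := GroupLieAlgebra 𝓘(ℝ, E) G) (M := GroupLieAlgebra 𝓘(ℝ, E) G) u v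

variable [LieGroup 𝓘(ℝ, E) ∞ G]

theorem contMDiff_conj (g : G) : ContMDiff 𝓘(ℝ, E) 𝓘(ℝ, E) ∞ (fun h : G => g * h * g⁻¹) :=
  (contMDiff_const.mul contMDiff_id).mul contMDiff_const

omit [LieGroup 𝓘(ℝ, E) ∞ G] in
theorem AdC_one : AdC (1 : G) = ContinuousLinearMap.id ℝ E := by
  rw [AdC, ← tD_id (1 : G)]
  congr 1
  ext h
  simp

theorem AdC_mul (g h : G) (v : E) : AdC (g * h) v = AdC g (AdC h v) := by
  have h1 : (fun k : G => g * h * k * (g * h)⁻¹) = fun k => g * (h * k * h⁻¹) * g⁻¹ := by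
    ext k; group
  have h2 : h * 1 * h⁻¹ = 1 := by group
  rw [AdC, h1, tD_comp_apply (F := E) (f := fun k => g * k * g⁻¹) (g := fun k => h * k * h⁻¹)
    ((contMDiff_conj g _).mdifferentiableAt (by simp))
    ((contMDiff_conj h _).mdifferentiableAt (by simp)), h2]
  rfl

variable (G) in
/-- The multiplication of `G` near the identity, in the preferred chart there. -/
def mulC (z : E × E) : E :=
  extChartAt 𝓘(ℝ, E) (1 : G) ((extChartAt 𝓘(ℝ, E) (1 : G)).symm z.1 *
    (extChartAt 𝓘(ℝ, E) (1 : G)).symm z.2)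

variable (G) in
/-- The coordinates of the identity. -/
def oneC : E := extChartAt 𝓘(ℝ, E) (1 : G) 1

variable (G) in
/-- The inverse of the preferred chart at the identity. -/
def symC (x : E) : G := (extChartAt 𝓘(ℝ, E) (1 : G)).symm x

omit [LieGroup 𝓘(ℝ, E) ∞ G] in
theorem symC_oneC : symC G (oneC G : E) = 1 := extChartAt_to_inv 1

theorem contMDiffAt_symC : ContMDiffAt 𝓘(ℝ, E) 𝓘(ℝ, E) ∞ (symC G) (oneC G : E) :=
  contMDiffAt_extChartAt_symm (mem_extChartAt_target (I := 𝓘(ℝ, E)) (1 : G))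

theorem contDiffAt_chart_one {F : Type*} [NormedAddCommGroup F] [NormedSpace ℝ F] {f : F → G}
    {x : F} (hf : ContMDiffAt 𝓘(ℝ, F) 𝓘(ℝ, E) ∞ f x) (h1 : f x = 1) :
    ContDiffAt ℝ ∞ (fun y => extChartAt 𝓘(ℝ, E) (1 : G) (f y)) x :=
  ContMDiffAt.contDiffAt_chart hf (by rw [h1]; exact mem_extChartAt_source _)

theorem contDiffAt_mulC : ContDiffAt ℝ ∞ (mulC G) ((oneC G, oneC G) : E × E) := by
  refine contDiffAt_chart_one (f := fun z : E × E => symC G z.1 * symC G z.2) ?_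
    (by simp [symC_oneC])
  exact ((contMDiffAt_symC (G := G) (E := E)).comp ((oneC G, oneC G) : E × E)
    contDiffAt_fst.contMDiffAt).mul
    ((contMDiffAt_symC (G := G) (E := E)).comp ((oneC G, oneC G) : E × E)
    contDiffAt_snd.contMDiffAt)

variable (G) in
/-- The conjugation `(g, h) ↦ g h g⁻¹` near the identity, in the preferred chart there. -/
def conjC (z : E × E) : E := extChartAt 𝓘(ℝ, E) (1 : G) (symC G z.1 * symC G z.2 * (symC G z.1)⁻¹)

theorem contDiffAt_conjC : ContDiffAt ℝ ∞ (conjC G) ((oneC G, oneC G) : E × E) := by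
  refine contDiffAt_chart_one (f := fun z : E × E => symC G z.1 * symC G z.2 * (symC G z.1)⁻¹) ?_
    (by simp [symC_oneC])
  have h1 := (contMDiffAt_symC (G := G) (E := E)).comp ((oneC G, oneC G) : E × E)
    contDiffAt_fst.contMDiffAt
  have h2 := (contMDiffAt_symC (G := G) (E := E)).comp ((oneC G, oneC G) : E × E)
    contDiffAt_snd.contMDiffAt
  exact (h1.mul h2).mul h1.inv

omit [LieGroup 𝓘(ℝ, E) ∞ G] in
theorem eventually_symC [IsManifold 𝓘(ℝ, E) ∞ G] :
    ∀ᶠ x : E in 𝓝 (oneC G), x ∈ (extChartAt 𝓘(ℝ, E) (1 : G)).target :=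
  (isOpen_extChartAt_target (I := 𝓘(ℝ, E)) (1 : G)).mem_nhds (mem_extChartAt_target (1 : G))

/-- A smooth self-map of the group that is read in the chart at the identity. -/
theorem tD_one_chart {f : G → G} (hf : ContMDiff 𝓘(ℝ, E) 𝓘(ℝ, E) ∞ f)
    (hs : f 1 ∈ (extChartAt 𝓘(ℝ, E) (1 : G)).source) (w : E) :
    tD E E (extChartAt 𝓘(ℝ, E) (1 : G)) (f 1) (tD E E f 1 w) =
      fderiv ℝ (fun y => extChartAt 𝓘(ℝ, E) (1 : G) (f (symC G y))) (oneC G) w := by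
  have hsymm := mdifferentiableAt_extChartAt_symm (mem_extChartAt_target (I := 𝓘(ℝ, E)) (1 : G))
  have e : symC G (oneC G : E) = 1 := symC_oneC
  have hf1 : MDifferentiableAt 𝓘(ℝ, E) 𝓘(ℝ, E) f (symC G (oneC G : E)) :=
    (hf _).mdifferentiableAt (by simp)
  rw [← tD_eq_fderiv, tD_comp_apply (F := E) (f := extChartAt 𝓘(ℝ, E) (1 : G))
    (g := fun y => f (symC G y)) (by rw [e]; exact mdifferentiableAt_extChartAt_of_mem hs)
    (hf1.comp (oneC G : E) hsymm),
    tD_comp_apply (F := E) (f := f) (g := symC G) hf1 hsymm, e]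
  have : tD E E (symC G) (oneC G : E) = ContinuousLinearMap.id ℝ E := tD_chart_symm_self 1
  rw [this]
  rfl

theorem eventually_mulC_differentiable :
    ∀ᶠ z : E × E in 𝓝 (oneC G, oneC G), DifferentiableAt ℝ (mulC G) z := by
  have := ((contDiffAt_mulC (G := G) (E := E)).of_le (m := 1) (by simp)).eventually (by simp)
  exact this.mono fun z hz => hz.differentiableAt (by simp)

theorem eventually_conjC_differentiable :
    ∀ᶠ z : E × E in 𝓝 (oneC G, oneC G), DifferentiableAt ℝ (conjC G) z := by
  have := ((contDiffAt_conjC (G := G) (E := E)).of_le (m := 1) (by simp)).eventually (by simp)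
  exact this.mono fun z hz => hz.differentiableAt (by simp)

omit [LieGroup 𝓘(ℝ, E) ∞ G] in
theorem tendsto_left : Filter.Tendsto (fun x : E => (x, (oneC G : E))) (𝓝 (oneC G))
    (𝓝 (oneC G, oneC G)) :=
  (continuous_id.prodMk continuous_const).tendsto' _ _ rfl

omit [LieGroup 𝓘(ℝ, E) ∞ G] in
theorem tendsto_right : Filter.Tendsto (fun x : E => ((oneC G : E), x)) (𝓝 (oneC G))
    (𝓝 (oneC G, oneC G)) :=
  (continuous_const.prodMk continuous_id).tendsto' _ _ rfl

theorem fderiv_comp_left {f : E × E → E} {x y : E} (hf : DifferentiableAt ℝ f (x, y)) (v : E) :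
    fderiv ℝ (fun a => f (a, y)) x v = fderiv ℝ f (x, y) (v, 0) := by
  have h := HasFDerivAt.comp (g := f) (f := fun a => (a, y)) x hf.hasFDerivAt
    ((hasFDerivAt_id x).prodMk (hasFDerivAt_const y x))
  exact DFunLike.congr_fun h.fderiv v

theorem fderiv_comp_right {f : E × E → E} {x y : E} (hf : DifferentiableAt ℝ f (x, y)) (v : E) :
    fderiv ℝ (fun a => f (x, a)) y v = fderiv ℝ f (x, y) (0, v) := by
  have h := HasFDerivAt.comp (g := f) (f := fun a => (x, a)) y hf.hasFDerivAt
    ((hasFDerivAt_const x y).prodMk (hasFDerivAt_id y))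
  exact DFunLike.congr_fun h.fderiv v

theorem eventually_AdC_eq (w : E) : (fun x : E => AdC (symC G x) w) =ᶠ[𝓝 (oneC G)]
    fun x => fderiv ℝ (conjC G) (x, oneC G) (0, w) := by
  filter_upwards [(tendsto_left (G := G)).eventually (eventually_conjC_differentiable (G := G))]
    with x hx
  rw [← fderiv_comp_right hx]
  have h1 : symC G x * 1 * (symC G x)⁻¹ = 1 := by group
  have h2 := tD_one_chart (contMDiff_conj (symC G x))
    (by rw [h1]; exact mem_extChartAt_source (1 : G)) w
  rw [h1, tD_chart_self] at h2
  exact h2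

/-- The relation `g h = (g h g⁻¹) g`, differentiated with respect to `h` at the identity. -/
theorem eventually_mulC_eq (w : E) :
    (fun x : E => fderiv ℝ (mulC G) (x, oneC G) (0, w)) =ᶠ[𝓝 (oneC G)]
    fun x => fderiv ℝ (mulC G) (oneC G, x) (AdC (symC G x) w, 0) := by
  have h0 := (contMDiffAt_symC (G := G) (E := E)).continuousAt.preimage_mem_nhds
    ((isOpen_extChartAt_source (I := 𝓘(ℝ, E)) (1 : G)).mem_nhds
      (by rw [symC_oneC]; exact mem_extChartAt_source (1 : G)))
  filter_upwards [(tendsto_left (G := G)).eventually (eventually_mulC_differentiable (G := G)),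
    (tendsto_right (G := G)).eventually (eventually_mulC_differentiable (G := G)),
    (tendsto_left (G := G)).eventually (eventually_conjC_differentiable (G := G)),
    eventually_AdC_eq (G := G) w, eventually_symC (G := G)] with x hx1 hx2 hx3 hx4 hx5
  rw [← fderiv_comp_right hx1, hx4, ← fderiv_comp_right hx3]
  set g := symC G x
  have hc : conjC G (x, oneC G) = oneC G := by
    rw [conjC, symC_oneC, mul_one, mul_inv_cancel]; rfl
  rw [← hc] at hx2
  have hd : DifferentiableAt ℝ (fun y => conjC G (x, y)) (oneC G) :=
    hx3.comp (oneC G) ((differentiableAt_const x).prodMk differentiableAt_id)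
  have hcomp := hx2.hasFDerivAt.comp (oneC G) (hd.hasFDerivAt.prodMk (hasFDerivAt_const x (oneC G)))
  have he : (fun y : E => mulC G (x, y)) =ᶠ[𝓝 (oneC G)]
      (mulC G) ∘ fun y => (conjC G (x, y), x) := by
    have hcont : ContinuousAt (fun y : E => symC G x * symC G y * (symC G x)⁻¹) (oneC G) := by
      have := topologicalGroup_of_lieGroup 𝓘(ℝ, E) ∞ (G := G)
      exact (continuousAt_const.mul (contMDiffAt_symC (G := G) (E := E)).continuousAt).mul
        continuousAt_const
    have h2 := hcont.preimage_mem_nhds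
      ((isOpen_extChartAt_source (I := 𝓘(ℝ, E)) (1 : G)).mem_nhds
      (by simp [symC_oneC]))
    filter_upwards [h2] with y hy
    have : (extChartAt 𝓘(ℝ, E) (1 : G)).symm (conjC G (x, y)) =
      symC G x * symC G y * (symC G x)⁻¹ := (extChartAt 𝓘(ℝ, E) (1 : G)).left_inv hy
    simp only [Function.comp_apply, mulC, this]
    congr 1
    change symC G x * symC G y = _ * symC G x
    group
  rw [he.fderiv_eq, hcomp.fderiv, hc]
  rfl

theorem eventually_mulC_right : (fun x : E => mulC G (x, oneC G)) =ᶠ[𝓝 (oneC G)] fun x => x := by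
  filter_upwards [eventually_symC (G := G)] with x hx
  have : symC G (oneC G : E) = 1 := symC_oneC
  change extChartAt 𝓘(ℝ, E) (1 : G) (symC G x * symC G (oneC G)) = x
  rw [this, mul_one]
  exact (extChartAt 𝓘(ℝ, E) (1 : G)).right_inv hx

theorem eventually_mulC_left : (fun x : E => mulC G (oneC G, x)) =ᶠ[𝓝 (oneC G)] fun x => x := by
  filter_upwards [eventually_symC (G := G)] with x hx
  have : symC G (oneC G : E) = 1 := symC_oneC
  change extChartAt 𝓘(ℝ, E) (1 : G) (symC G (oneC G) * symC G x) = x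
  rw [this, one_mul]
  exact (extChartAt 𝓘(ℝ, E) (1 : G)).right_inv hx

theorem fderiv_mulC_left (v : E) : fderiv ℝ (mulC G) (oneC G, oneC G) (v, 0) = v := by
  rw [← fderiv_comp_left ((contDiffAt_mulC (G := G)).differentiableAt (by simp)),
    eventually_mulC_right.fderiv_eq]
  simp

theorem fderiv_mulC_right (v : E) : fderiv ℝ (mulC G) (oneC G, oneC G) (0, v) = v := by
  rw [← fderiv_comp_right ((contDiffAt_mulC (G := G)).differentiableAt (by simp)),
    eventually_mulC_left.fderiv_eq]
  simp

theorem hasFDerivAt_fderiv_mulC : HasFDerivAt (fderiv ℝ (mulC G))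
    (fderiv ℝ (fderiv ℝ (mulC G)) (oneC G, oneC G)) ((oneC G, oneC G) : E × E) :=
  (((contDiffAt_mulC (G := G) (E := E)).fderiv_right (m := 1) (by norm_cast)).differentiableAt
    (by simp)).hasFDerivAt

theorem hasFDerivAt_fderiv_mulC_left (w : E) :
    HasFDerivAt (fun x : E => fderiv ℝ (mulC G) (x, oneC G) (0, w))
      ((ContinuousLinearMap.apply ℝ E ((0, w) : E × E)).comp
        ((fderiv ℝ (fderiv ℝ (mulC G)) (oneC G, oneC G)).comp
          ((ContinuousLinearMap.id ℝ E).prod 0))) (oneC G) :=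
  (ContinuousLinearMap.apply ℝ E ((0, w) : E × E)).hasFDerivAt.comp (oneC G : E)
    (HasFDerivAt.comp (f := fun x : E => (x, (oneC G : E))) (oneC G : E)
      (hasFDerivAt_fderiv_mulC (G := G))
      ((hasFDerivAt_id (oneC G : E)).prodMk (hasFDerivAt_const (oneC G : E) (oneC G : E))))

theorem contDiffAt_AdC_symC (w : E) : ContDiffAt ℝ ∞ (fun x : E => AdC (symC G x) w) (oneC G) := by
  refine ContDiffAt.congr_of_eventuallyEq ?_ (eventually_AdC_eq w)
  have h := (contDiffAt_conjC (G := G) (E := E)).fderiv_right (m := ∞) (by simp)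
  exact (ContDiffAt.comp (f := fun x : E => (x, (oneC G : E))) (oneC G : E) h
    (contDiffAt_id.prodMk contDiffAt_const)).clm_apply contDiffAt_const

/-- The derivative of the adjoint representation at the identity, in terms of the second derivative
of the multiplication. -/
theorem fderiv_AdC_symC (v w : E) : fderiv ℝ (fun x : E => AdC (symC G x) w) (oneC G) v =
    fderiv ℝ (fderiv ℝ (mulC G)) (oneC G, oneC G) (v, 0) (0, w) -
    fderiv ℝ (fderiv ℝ (mulC G)) (oneC G, oneC G) (w, 0) (0, v) := by
  have hD := ((contDiffAt_AdC_symC (G := G) w).differentiableAt (by simp)).hasFDerivAt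
  have h1 := (hasFDerivAt_fderiv_mulC_left (G := G) w).congr_of_eventuallyEq
    (eventually_mulC_eq (G := G) w).symm
  have h2 := (HasFDerivAt.comp (f := fun x : E => ((oneC G : E), x)) (oneC G : E)
    (hasFDerivAt_fderiv_mulC (G := G)) ((hasFDerivAt_const (oneC G : E) (oneC G : E)).prodMk
      (hasFDerivAt_id (oneC G : E)))).clm_apply
      (hD.prodMk (hasFDerivAt_const (0 : E) (oneC G : E)))
  have h3 := DFunLike.congr_fun (h1.unique h2) v
  have hA : AdC (symC G (oneC G : E)) w = w := by rw [symC_oneC, AdC_one]; rfl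
  have hs : fderiv ℝ (fderiv ℝ (mulC G)) (oneC G, oneC G) (0, v) (w, 0) =
      fderiv ℝ (fderiv ℝ (mulC G)) (oneC G, oneC G) (w, 0) (0, v) :=
    (contDiffAt_mulC (G := G) (E := E)).isSymmSndFDerivAt
      (by rw [minSmoothness_of_isRCLikeNormedField]; norm_cast) _ _
  simp only [ContinuousLinearMap.comp_apply, ContinuousLinearMap.apply_apply,
    ContinuousLinearMap.prod_apply, ContinuousLinearMap.id_apply, _root_.zero_apply,
    _root_.add_apply, ContinuousLinearMap.flip_apply, Function.comp_apply, hA] at h3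
  rw [h3, hs, fderiv_mulC_left]
  abel

/-- The left-invariant vector field with value `w` at the identity, in the chart at the identity. -/
theorem leftInvariant_coord (w : E) :
    (fun x : E => (mfderivWithin 𝓘(ℝ, E) 𝓘(ℝ, E) (extChartAt 𝓘(ℝ, E) (1 : G)).symm
      (range 𝓘(ℝ, E)) x).inverse (mulInvariantVectorField (I := 𝓘(ℝ, E))
      (w : GroupLieAlgebra 𝓘(ℝ, E) G) ((extChartAt 𝓘(ℝ, E) (1 : G)).symm x)) : E → E)
    =ᶠ[𝓝 (oneC G)] fun x => fderiv ℝ (mulC G) (x, oneC G) (0, w) := by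
  filter_upwards [(tendsto_left (G := G)).eventually (eventually_mulC_differentiable (G := G)),
    eventually_symC (G := G)] with x hx1 hx2
  have h1 : ContinuousLinearMap.inverse (tD E E (extChartAt 𝓘(ℝ, E) (1 : G)).symm x) =
      tD E E (extChartAt 𝓘(ℝ, E) (1 : G)) (symC G x) := by
    refine ContinuousLinearMap.inverse_eq ?_ ?_
    · ext v
      have := tD_symm_chart_comp ((extChartAt 𝓘(ℝ, E) (1 : G)).map_target hx2) v
      rwa [(extChartAt 𝓘(ℝ, E) (1 : G)).right_inv hx2] at this
    · ext v
      exact tD_chart_symm_comp hx2 v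
  have h2 := tD_one_chart (f := fun h => symC G x * h) (contMDiff_mul_left (I := 𝓘(ℝ, E)))
    (by rw [mul_one]; exact (extChartAt 𝓘(ℝ, E) (1 : G)).map_target hx2) w
  rw [mul_one] at h2
  rw [← fderiv_comp_right hx1]
  refine Eq.trans ?_ h2
  rw [← h1]
  have h3 : mfderivWithin 𝓘(ℝ, E) 𝓘(ℝ, E) (extChartAt 𝓘(ℝ, E) (1 : G)).symm
      (range 𝓘(ℝ, E)) x = mfderiv 𝓘(ℝ, E) 𝓘(ℝ, E) (extChartAt 𝓘(ℝ, E) (1 : G)).symm x := by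
    rw [modelWithCornersSelf_coe, range_id, mfderivWithin_univ]
  rw [h3]
  rfl

/-- The Lie bracket is the antisymmetrized mixed second derivative of the multiplication at the
identity. -/
theorem brk_eq (v w : E) : brk G v w =
    fderiv ℝ (fderiv ℝ (mulC G)) (oneC G, oneC G) (v, 0) (0, w) -
    fderiv ℝ (fderiv ℝ (mulC G)) (oneC G, oneC G) (w, 0) (0, v) := by
  have h : brk G v w = VectorField.lieBracket ℝ
      (fun x : E => fderiv ℝ (mulC G) (x, oneC G) (0, v))
      (fun x : E => fderiv ℝ (mulC G) (x, oneC G) (0, w)) (oneC G) := by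
    refine Eq.trans (VectorField.mlieBracketWithin_apply (I := 𝓘(ℝ, E))
      (V := mulInvariantVectorField (I := 𝓘(ℝ, E)) (v : GroupLieAlgebra 𝓘(ℝ, E) G))
      (W := mulInvariantVectorField (I := 𝓘(ℝ, E)) (w : GroupLieAlgebra 𝓘(ℝ, E) G))
      (s := univ) (x₀ := (1 : G))) ?_
    rw [mfderiv_extChartAt_self]
    refine Eq.trans (DFunLike.congr_fun (ContinuousLinearMap.inverse_id (R := ℝ) (M := E)) _) ?_
    have hr : ∀ (V W : E → E) (x : E), VectorField.lieBracketWithin ℝ V W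
        ((extChartAt 𝓘(ℝ, E) (1 : G)).symm ⁻¹' univ ∩ range 𝓘(ℝ, E)) x =
        VectorField.lieBracket ℝ V W x := by
      intro V W x
      rw [preimage_univ, univ_inter, modelWithCornersSelf_coe, range_id,
        VectorField.lieBracketWithin_univ]
    exact (hr _ _ _).trans (Filter.EventuallyEq.lieBracket_vectorField_eq (leftInvariant_coord v)
      (leftInvariant_coord w))
  rw [h, VectorField.lieBracket, (hasFDerivAt_fderiv_mulC_left (G := G) w).fderiv,
    (hasFDerivAt_fderiv_mulC_left (G := G) v).fderiv, fderiv_mulC_right, fderiv_mulC_right]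
  rfl

/-- The derivative of the adjoint representation at the identity is the Lie bracket. -/
theorem hasFDerivAt_AdC_symC (w : E) :
    ∃ D : E →L[ℝ] E, HasFDerivAt (fun x : E => AdC (symC G x) w) D (oneC G) ∧
      ∀ v, D v = brk G v w := by
  refine ⟨_, ((contDiffAt_AdC_symC (G := G) w).differentiableAt (by simp)).hasFDerivAt, fun v => ?_⟩
  rw [brk_eq, fderiv_AdC_symC]

end Adjoint

/-! ### One-parameter groups and the exponential map -/

section OneParam

variable {E : Type*} [NormedAddCommGroup E] [NormedSpace ℝ E]
  {G : Type*} [Group G] [TopologicalSpace G] [ChartedSpace E G]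

/-- `γ` is a smooth one-parameter group with velocity `X` at time `0`. -/
structure IsOneParam (γ : ℝ → G) (X : E) : Prop where
  smooth : ContMDiff 𝓘(ℝ, ℝ) 𝓘(ℝ, E) ∞ γ
  add : ∀ s t, γ (s + t) = γ s * γ t
  deriv : tD ℝ E γ 0 1 = X

theorem IsOneParam.zero {γ : ℝ → G} {X : E} (h : IsOneParam γ X) : γ 0 = 1 := by
  have := h.add 0 0
  rw [add_zero] at this
  exact left_eq_mul.1 this

theorem IsOneParam.neg {γ : ℝ → G} {X : E} (h : IsOneParam γ X) (t : ℝ) : γ (-t) = (γ t)⁻¹ := by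
  rw [eq_inv_iff_mul_eq_one, ← h.add, neg_add_cancel, h.zero]

variable [LieGroup 𝓘(ℝ, E) ∞ G]

/-- A vector that is killed by all brackets is invariant under the adjoint representation near the
identity. -/
theorem eventually_AdC_eq_self {X : E} (hX : ∀ Y : E, brk G Y X = 0) :
    ∀ᶠ x : E in 𝓝 (oneC G), AdC (symC G x) X = X := by
  have := topologicalGroup_of_lieGroup 𝓘(ℝ, E) ∞ (G := G)
  obtain ⟨D, hD, hD'⟩ := hasFDerivAt_AdC_symC (G := G) X
  have hD0 : D = 0 := by ext v; rw [hD' v, hX]; rfl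
  subst hD0
  obtain ⟨ε, hε, hball⟩ := Metric.eventually_nhds_iff_ball.1 (eventually_symC (G := G) (E := E))
  have hd : ∀ x ∈ Metric.ball (oneC G : E) ε,
      HasFDerivAt (fun x : E => AdC (symC G x) X) (0 : E →L[ℝ] E) x := by
    intro x hx
    set g := symC G x with hg
    let h : E → E := fun y => extChartAt 𝓘(ℝ, E) (1 : G) (g⁻¹ * symC G y)
    have hxs : ContMDiffAt 𝓘(ℝ, E) 𝓘(ℝ, E) ∞ (symC G) x := contMDiffAt_extChartAt_symm (hball x hx)
    have hsm : ContMDiffAt 𝓘(ℝ, E) 𝓘(ℝ, E) ∞ (fun y => g⁻¹ * symC G y) x :=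
      contMDiffAt_const.mul hxs
    have h1 : g⁻¹ * symC G x = 1 := inv_mul_cancel g
    have hh : DifferentiableAt ℝ h x := (contDiffAt_chart_one hsm h1).differentiableAt (by simp)
    have hhx : h x = oneC G := by simp only [h, h1]; rfl
    have hev : (fun y => AdC (symC G y) X) =ᶠ[𝓝 x] fun y => AdC g (AdC (symC G (h y)) X) := by
      have := hsm.continuousAt.preimage_mem_nhds
        ((isOpen_extChartAt_source (I := 𝓘(ℝ, E)) (1 : G)).mem_nhds
          (by rw [h1]; exact mem_extChartAt_source (1 : G)))
      filter_upwards [this] with y hy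
      have hy' : symC G (h y) = g⁻¹ * symC G y := (extChartAt 𝓘(ℝ, E) (1 : G)).left_inv hy
      rw [← AdC_mul, hy', mul_inv_cancel_left]
    refine HasFDerivAt.congr_of_eventuallyEq ?_ hev
    rw [← hhx] at hD
    have := (AdC g).hasFDerivAt.comp x (hD.comp x hh.hasFDerivAt)
    rw [ContinuousLinearMap.zero_comp, ContinuousLinearMap.comp_zero] at this
    exact this
  filter_upwards [Metric.ball_mem_nhds (oneC G : E) hε] with x hx
  have := (convex_ball (oneC G : E) ε).is_const_of_fderivWithin_eq_zero (𝕜 := ℝ)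
    (f := fun x : E => AdC (symC G x) X)
    (fun y hy => (hd y hy).differentiableAt.differentiableWithinAt)
    (fun y hy => by
      rw [fderivWithin_of_isOpen Metric.isOpen_ball hy, (hd y hy).fderiv]) hx
    (Metric.mem_ball_self hε)
  simp only [symC_oneC, AdC_one] at this
  exact this

/-- On a connected group, a vector that is killed by all brackets is invariant under the adjoint
representation. -/
theorem AdC_eq_self [ConnectedSpace G] {X : E} (hX : ∀ Y : E, brk G Y X = 0) (g : G) :
    AdC g X = X := by
  have := topologicalGroup_of_lieGroup 𝓘(ℝ, E) ∞ (G := G)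
  let K : Subgroup G :=
    { carrier := {g | AdC g X = X}
      mul_mem' := fun {a b} ha hb => by
        simp only [Set.mem_ofPred_eq] at ha hb ⊢
        rw [AdC_mul, hb, ha]
      one_mem' := by simp [AdC_one]
      inv_mem' := fun {a} ha => by
        simp only [Set.mem_ofPred_eq] at ha ⊢
        have h1 : AdC (a⁻¹ * a) X = X := by simp [AdC_one]
        rwa [AdC_mul, ha] at h1 }
  have hK : (K : Set G) ∈ 𝓝 (1 : G) := by
    have h1 : ContinuousAt (extChartAt 𝓘(ℝ, E) (1 : G)) 1 := continuousAt_extChartAt 1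
    have h2 := h1.preimage_mem_nhds (eventually_AdC_eq_self (G := G) hX)
    filter_upwards [h2, (isOpen_extChartAt_source (I := 𝓘(ℝ, E)) (1 : G)).mem_nhds
      (mem_extChartAt_source (1 : G))] with k hk hk'
    have h3 : symC G (extChartAt 𝓘(ℝ, E) (1 : G) k) = k := (extChartAt 𝓘(ℝ, E) (1 : G)).left_inv hk'
    have h4 : AdC (symC G (extChartAt 𝓘(ℝ, E) (1 : G) k)) X = X := hk
    rwa [h3] at h4
  have hopen : IsOpen (K : Set G) := Subgroup.isOpen_of_mem_nhds K hK
  have hclosed : IsClosed (K : Set G) := Subgroup.isClosed_of_isOpen K hopen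
  have huniv : (K : Set G) = univ := IsClopen.eq_univ ⟨hclosed, hopen⟩ ⟨1, K.one_mem⟩
  have : g ∈ (K : Set G) := by rw [huniv]; trivial
  exact this

variable [CompleteSpace E] [T2Space G]

omit [CompleteSpace E] [T2Space G] in
theorem lieGroup_minSmoothness : LieGroup 𝓘(ℝ, E) (minSmoothness ℝ 3) G := by
  rw [minSmoothness_of_isRCLikeNormedField]
  exact LieGroup.of_le (m := 3) (n := ∞) (by norm_cast)

variable (G) in
/-- The left-invariant vector field with value `X` at the identity. -/
def leftInv (X : E) (g : G) : TangentSpace 𝓘(ℝ, E) g :=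
  mulInvariantVectorField (I := 𝓘(ℝ, E)) (X : GroupLieAlgebra 𝓘(ℝ, E) G) g

variable (G) in
/-- The value of the left-invariant vector field `leftInv G X`, as a vector of the model space. -/
def leftInvC (X : E) (g : G) : E := tD E E (fun k : G => g * k) 1 X

omit [CompleteSpace E] [T2Space G] in
theorem contMDiff_leftInvariant (X : E) :
    ContMDiff 𝓘(ℝ, E) 𝓘(ℝ, E).tangent 1
      (fun g => (⟨g, leftInv G X g⟩ : TangentBundle 𝓘(ℝ, E) G)) := by
  have := lieGroup_minSmoothness (E := E) (G := G)
  refine (contMDiff_mulInvariantVectorField (I := 𝓘(ℝ, E))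
    (X : GroupLieAlgebra 𝓘(ℝ, E) G)).of_le ?_
  rw [minSmoothness_of_isRCLikeNormedField]
  norm_num

omit [CompleteSpace E] [T2Space G] in
theorem leftInvariant_mul (X : E) (g h : G) :
    leftInvC G X (g * h) = tD E E (fun k : G => g * k) h (leftInvC G X h) := by
  have h1 : (fun k : G => g * h * k) = fun k => g * (h * k) := by ext k; exact mul_assoc _ _ _
  have h2 : ∀ a : G, ContMDiff 𝓘(ℝ, E) 𝓘(ℝ, E) ∞ (fun k : G => a * k) := fun a =>
    contMDiff_mul_left
  have h3 : tD E E (fun k : G => g * h * k) 1 X =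
      tD E E (fun k : G => g * k) (h * 1) (tD E E (fun k : G => h * k) 1 X) := by
    rw [h1, tD_comp_apply (F := E) (f := fun k : G => g * k) (g := fun k : G => h * k)
      ((h2 g _).mdifferentiableAt (by simp)) ((h2 h _).mdifferentiableAt (by simp))]
  rw [mul_one] at h3
  exact h3

omit [CompleteSpace E] [T2Space G] in
theorem isMIntegralCurveOn_mul_left {X : E} {γ : ℝ → G} {s : Set ℝ}
    (h : IsMIntegralCurveOn γ (leftInv G X) s) (g : G) :
    IsMIntegralCurveOn (fun t => g * γ t) (leftInv G X) s := by
  intro t ht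
  have h1 : HasMFDerivAt 𝓘(ℝ, E) 𝓘(ℝ, E) (fun k : G => g * k) (γ t)
      (mfderiv 𝓘(ℝ, E) 𝓘(ℝ, E) (fun k : G => g * k) (γ t)) :=
    ((contMDiff_mul_left (I := 𝓘(ℝ, E)) (n := ∞) (a := g) (γ t)).mdifferentiableAt
      (by simp)).hasMFDerivAt
  have h2 := h1.comp_hasMFDerivWithinAt t (h t ht)
  have h4 : (1 : ℝ →L[ℝ] ℝ).smulRight (leftInvC G X (g * γ t)) =
      (tD E E (fun k : G => g * k) (γ t)).comp
        ((1 : ℝ →L[ℝ] ℝ).smulRight (leftInvC G X (γ t))) := by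
    ext
    simp [leftInvariant_mul X g (γ t)]
  exact h4 ▸ h2

variable (G) in
theorem exists_isMIntegralCurve_leftInvariant (X : E) :
    ∃ γ : ℝ → G, γ 0 = 1 ∧ IsMIntegralCurve γ (leftInv G X) := by
  have hM : IsManifold 𝓘(ℝ, E) 1 G := IsManifold.of_le (n := ∞) (by simp)
  obtain ⟨γ, h0, hγ⟩ := exists_isMIntegralCurveAt_of_contMDiffAt_boundaryless (t₀ := 0)
    (contMDiff_leftInvariant X (1 : G))
  rw [isMIntegralCurveAt_iff'] at hγ
  obtain ⟨ε, hε, hγ⟩ := hγ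
  refine exists_isMIntegralCurve_of_isMIntegralCurveOn (contMDiff_leftInvariant X) hε ?_ 1
  intro g
  refine ⟨fun t => g * γ t, by simp [h0], ?_⟩
  have := isMIntegralCurveOn_mul_left hγ g
  rwa [Real.ball_eq_Ioo, zero_sub, zero_add] at this

variable (G) in
/-- The integral curve through the identity of a left-invariant vector field. -/
def expCurve (X : E) : ℝ → G :=
  (exists_isMIntegralCurve_leftInvariant G X).choose

theorem expCurve_zero (X : E) : expCurve G X 0 = 1 :=
  (exists_isMIntegralCurve_leftInvariant G X).choose_spec.1

theorem expCurve_integral (X : E) :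
    IsMIntegralCurve (expCurve G X) (leftInv G X) :=
  (exists_isMIntegralCurve_leftInvariant G X).choose_spec.2

omit [CompleteSpace E] in
theorem integralCurve_unique {X : E} {γ γ' : ℝ → G}
    (h : IsMIntegralCurve γ (leftInv G X))
    (h' : IsMIntegralCurve γ' (leftInv G X)) (h0 : γ 0 = γ' 0) : γ = γ' := by
  have hM : IsManifold 𝓘(ℝ, E) 1 G := IsManifold.of_le (n := ∞) (by simp)
  exact isMIntegralCurve_Ioo_eq_of_contMDiff_boundaryless (contMDiff_leftInvariant X) h h' h0

theorem lieExp_eq_expCurve (X : E) : lieExp (X : GroupLieAlgebra 𝓘(ℝ, E) G) = expCurve G X 1 := by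
  have h : ∃ g : G, ∃ γ : ℝ → G,
    γ 0 = 1 ∧ IsMIntegralCurve γ (leftInv G X) ∧ γ 1 = g :=
    ⟨_, expCurve G X, expCurve_zero X, expCurve_integral X, rfl⟩
  obtain ⟨γ, h0, h1, h2⟩ := Classical.epsilon_spec h
  refine h2.symm.trans ?_
  rw [integralCurve_unique h1 (expCurve_integral (G := G) X) (h0.trans (expCurve_zero X).symm)]

theorem lieExp_smul (X : E) (t : ℝ) :
    lieExp ((t • X : E) : GroupLieAlgebra 𝓘(ℝ, E) G) = expCurve G X t := by
  rw [lieExp_eq_expCurve]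
  have h1 := (expCurve_integral (G := G) X).comp_mul t
  have h2 : (t • leftInv G X) = leftInv G (t • X) := by
    ext g
    exact ((tD E E (fun k : G => g * k) 1).map_smul t X).symm
  rw [h2] at h1
  rw [integralCurve_unique (expCurve_integral (t • X)) h1
    (by simp [expCurve_zero])]
  simp

theorem expCurve_add (X : E) (s t : ℝ) :
    expCurve G X (s + t) = expCurve G X s * expCurve G X t := by
  have h1 := (expCurve_integral (G := G) X).comp_add s
  have h2 : IsMIntegralCurve (fun t => expCurve G X s * expCurve G X t) (leftInv G X) := by
    rw [isMIntegralCurve_iff_isMIntegralCurveOn]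
    exact isMIntegralCurveOn_mul_left ((expCurve_integral (G := G) X).isMIntegralCurveOn univ) _
  have := congrFun (integralCurve_unique h1 h2 (by simp [expCurve_zero])) t
  simpa [add_comm] using this

theorem tD_expCurve (X : E) (t : ℝ) :
    tD ℝ E (expCurve G X) t 1 = leftInvC G X (expCurve G X t) := by
  have h := (expCurve_integral (G := G) X t).mfderiv
  have h1 : tD ℝ E (expCurve G X) t 1 =
    ((1 : ℝ →L[ℝ] ℝ).smulRight (leftInvC G X (expCurve G X t))) 1 :=
    DFunLike.congr_fun h (1 : ℝ)
  rw [h1]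
  simp

omit [CompleteSpace E] [T2Space G] in
theorem contDiffAt_mulC_left {x : E} (hx : x ∈ (extChartAt 𝓘(ℝ, E) (1 : G)).target) :
    ContDiffAt ℝ ∞ (mulC G) ((x, oneC G) : E × E) := by
  have h1 : ContMDiffAt 𝓘(ℝ, E) 𝓘(ℝ, E) ∞ (symC G) x := contMDiffAt_extChartAt_symm hx
  refine ContMDiffAt.contDiffAt_chart (f := fun z : E × E => symC G z.1 * symC G z.2) ?_ ?_
  · exact (h1.comp ((x, oneC G) : E × E) contDiffAt_fst.contMDiffAt).mul
      ((contMDiffAt_symC (G := G) (E := E)).comp ((x, oneC G) : E × E) contDiffAt_snd.contMDiffAt)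
  · rw [symC_oneC, mul_one]
    exact (extChartAt 𝓘(ℝ, E) (1 : G)).map_target hx

theorem contMDiffAt_expCurve_zero (X : E) :
    ContMDiffAt 𝓘(ℝ, ℝ) 𝓘(ℝ, E) ∞ (expCurve G X) 0 := by
  have hF : ContDiffOn ℝ ∞ (fun x : E => fderiv ℝ (mulC G) (x, oneC G) (0, X))
      (extChartAt 𝓘(ℝ, E) (1 : G)).target := by
    intro x hx
    have h := (contDiffAt_mulC_left (G := G) hx).fderiv_right (m := ∞) (by simp)
    exact ((ContDiffAt.comp (f := fun x : E => (x, (oneC G : E))) x h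
      (contDiffAt_id.prodMk contDiffAt_const)).clm_apply contDiffAt_const).contDiffWithinAt
  have hcont : Continuous (expCurve G X) := (expCurve_integral (G := G) X).continuous
  let u : ℝ → E := fun t => extChartAt 𝓘(ℝ, E) (1 : G) (expCurve G X t)
  have hu0 : u 0 = oneC G := by simp only [u, expCurve_zero]; rfl
  have hs : ∀ᶠ t in 𝓝 (0 : ℝ), expCurve G X t ∈ (extChartAt 𝓘(ℝ, E) (1 : G)).source :=
    hcont.continuousAt.preimage_mem_nhds
      ((isOpen_extChartAt_source (I := 𝓘(ℝ, E)) (1 : G)).mem_nhds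
        (by rw [expCurve_zero]; exact mem_extChartAt_source (1 : G)))
  have hucont : ContinuousAt u 0 := by
    refine ContinuousAt.comp (g := extChartAt 𝓘(ℝ, E) (1 : G)) ?_ hcont.continuousAt
    rw [expCurve_zero]; exact continuousAt_extChartAt 1
  have hu : ∀ᶠ t in 𝓝 (0 : ℝ), HasDerivAt u (fderiv ℝ (mulC G) (u t, oneC G) (0, X)) t := by
    have h1 := (hu0 ▸ hucont.tendsto : Filter.Tendsto u (𝓝 0) (𝓝 (oneC G))).eventually
      ((tendsto_left (G := G)).eventually (eventually_mulC_differentiable (G := G)))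
    filter_upwards [hs, h1] with t ht ht1
    have hmd : MDifferentiableAt 𝓘(ℝ, ℝ) 𝓘(ℝ, E) (expCurve G X) t :=
      (expCurve_integral (G := G) X t).mdifferentiableAt
    have hd : DifferentiableAt ℝ u t :=
      ((mdifferentiableAt_extChartAt_of_mem ht).comp t hmd).differentiableAt
    have e : fderiv ℝ u t 1 = fderiv ℝ (mulC G) (u t, oneC G) (0, X) := by
      rw [← tD_eq_fderiv, tD_comp_apply (F := E) (f := extChartAt 𝓘(ℝ, E) (1 : G))
        (g := expCurve G X) (mdifferentiableAt_extChartAt_of_mem ht) hmd, tD_expCurve,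
        ← fderiv_comp_right ht1, leftInvC]
      have h2 := tD_one_chart (f := fun h => expCurve G X t * h) (contMDiff_mul_left (I := 𝓘(ℝ, E)))
        (by rw [mul_one]; exact ht) X
      rw [mul_one] at h2
      rw [h2]
      have h3 : (extChartAt 𝓘(ℝ, E) (1 : G)).symm (u t) = expCurve G X t :=
        (extChartAt 𝓘(ℝ, E) (1 : G)).left_inv ht
      simp only [mulC, h3]
      rfl
    have := hd.hasFDerivAt.hasDerivAt
    rwa [e] at this
  obtain ⟨ε, hε, hall⟩ := Metric.eventually_nhds_iff_ball.1 (hu.and hs)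
  have hIcc : Icc (-(ε / 2)) (ε / 2) ⊆ Metric.ball (0 : ℝ) ε := by
    intro t ht
    rw [Metric.mem_ball, Real.dist_eq, sub_zero, abs_lt]
    exact ⟨by linarith [ht.1], by linarith [ht.2]⟩
  have hsol : ContDiffOn ℝ ∞ u (Icc (-(ε / 2)) (ε / 2)) := by
    refine ODE.contDiffOn_enat_Icc_of_hasDerivWithinAt (n := ⊤)
      (f := fun _ x => fderiv ℝ (mulC G) (x, oneC G) (0, X))
      (u := (extChartAt 𝓘(ℝ, E) (1 : G)).target) ?_
      (fun t ht => (hall t (hIcc ht)).1.hasDerivWithinAt)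
      (fun t ht => (extChartAt 𝓘(ℝ, E) (1 : G)).map_source (hall t (hIcc ht)).2)
    exact hF.comp contDiffOn_snd fun z hz => hz.2
  have hu2 : ContDiffAt ℝ ∞ u 0 := hsol.contDiffAt (Icc_mem_nhds (by linarith) (by linarith))
  have h3 : ContMDiffAt 𝓘(ℝ, ℝ) 𝓘(ℝ, E) ∞ (fun t => symC G (u t)) 0 := by
    refine ContMDiffAt.comp (0 : ℝ) (g := symC G) ?_ hu2.contMDiffAt
    rw [hu0]
    exact contMDiffAt_symC
  refine h3.congr_of_eventuallyEq ?_
  filter_upwards [hs] with t ht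
  exact ((extChartAt 𝓘(ℝ, E) (1 : G)).left_inv ht).symm

theorem isOneParam_expCurve (X : E) : IsOneParam (expCurve G X) X where
  smooth := by
    intro t
    have h1 : expCurve G X = fun s => expCurve G X t * expCurve G X (s - t) := by
      ext s
      rw [← expCurve_add, add_sub_cancel]
    rw [h1]
    refine contMDiffAt_const.mul ?_
    refine ContMDiffAt.comp t (g := expCurve G X) ?_
      (contDiff_id.sub contDiff_const).contMDiff.contMDiffAt
    simp only [sub_self]
    exact contMDiffAt_expCurve_zero X
  add := expCurve_add X
  deriv := by
    rw [tD_expCurve, leftInvC, expCurve_zero]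
    simp only [one_mul, tD_id]
    rfl

end OneParam

/-! ### The Frobenius theorem for total differential equations -/

section Frobenius

variable {F : Type*} [NormedAddCommGroup F] [NormedSpace ℝ F]
  {E : Type*} [NormedAddCommGroup E] [NormedSpace ℝ E]

/-- The Picard–Lindelöf theorem, with the information that the solution stays in the ball. -/
theorem exists_solution_mem_closedBall [CompleteSpace E] {f : ℝ → E → E} {tmin tmax : ℝ}
    {t₀ : Icc tmin tmax} {x₀ : E} {a L K : NNReal} (hf : IsPicardLindelof f t₀ x₀ a 0 L K) :
    ∃ α : ℝ → E, α t₀ = x₀ ∧ (∀ t, α t ∈ Metric.closedBall x₀ a) ∧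
      ∀ t ∈ Icc tmin tmax, HasDerivWithinAt α (f t (α t)) (Icc tmin tmax) t := by
  have hx : x₀ ∈ Metric.closedBall x₀ (0 : NNReal) := Metric.mem_closedBall_self le_rfl
  obtain ⟨α, hα⟩ := ODE.FunSpace.exists_isFixedPt_next hf hx
  refine ⟨α.compProj, by rw [ODE.FunSpace.compProj_val, ← hα, ODE.FunSpace.next_apply₀],
    fun t => α.compProj_mem_closedBall hf.mul_max_le, fun t ht ↦ ?_⟩
  apply ODE.hasDerivWithinAt_picard_Icc t₀.2 hf.continuousOn_uncurry
    α.continuous_compProj.continuousOn (fun _ ht' ↦ α.compProj_mem_closedBall hf.mul_max_le)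
    x₀ ht |>.congr_of_mem _ ht
  intro t' ht'
  nth_rw 1 [← hα]
  rw [ODE.FunSpace.compProj_of_mem ht', ODE.FunSpace.next_apply]

/-- Quantitative form of the smoothness and integrability of a total differential equation
`du = Φ(y, u)` on a ball around `z₀`. -/
structure FrobeniusBounds (Φ : F × E → F →L[ℝ] E) (z₀ : F × E) (R : ℝ) (C K₁ K₂ : NNReal) :
    Prop where
  pos : 0 < R
  diff : ∀ z ∈ Metric.ball z₀ R, DifferentiableAt ℝ Φ z
  bound : ∀ z ∈ Metric.ball z₀ R, ‖Φ z‖ ≤ C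
  lip : LipschitzOnWith K₁ Φ (Metric.ball z₀ R)
  lip' : LipschitzOnWith K₂ (fderiv ℝ Φ) (Metric.ball z₀ R)
  integrable : ∀ z ∈ Metric.ball z₀ R, ∀ v w,
    fderiv ℝ Φ z (v, Φ z v) w = fderiv ℝ Φ z (w, Φ z w) v

theorem exists_frobeniusBounds {Φ : F × E → F →L[ℝ] E} {z₀ : F × E} (hΦ : ContDiffAt ℝ ∞ Φ z₀)
    (hint : ∀ᶠ z in 𝓝 z₀, ∀ v w, fderiv ℝ Φ z (v, Φ z v) w = fderiv ℝ Φ z (w, Φ z w) v) :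
    ∃ R C K₁ K₂, FrobeniusBounds Φ z₀ R C K₁ K₂ := by
  obtain ⟨K₁, s₁, hs₁, h₁⟩ := (hΦ.of_le (m := 1) (by simp)).exists_lipschitzOnWith
  obtain ⟨K₂, s₂, hs₂, h₂⟩ :=
    (hΦ.fderiv_right (m := 1) (by norm_cast)).exists_lipschitzOnWith
  have h3 : ∀ᶠ z in 𝓝 z₀, ‖Φ z‖ < ‖Φ z₀‖ + 1 :=
    hΦ.continuousAt.norm.eventually (gt_mem_nhds (by simp))
  have h4 : ∀ᶠ z in 𝓝 z₀, DifferentiableAt ℝ Φ z :=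
    ((hΦ.of_le (m := 1) (by simp)).eventually (by simp)).mono fun z hz =>
      hz.differentiableAt (by simp)
  obtain ⟨R, hR, hall⟩ := Metric.eventually_nhds_iff_ball.1
    ((((hint.and h3).and h4).and hs₁).and hs₂)
  refine ⟨R, ⟨‖Φ z₀‖ + 1, by positivity⟩, K₁, K₂, hR, fun z hz => (hall z hz).1.1.2,
    fun z hz => (hall z hz).1.1.1.2.le, h₁.mono fun z hz => (hall z hz).1.2,
    h₂.mono fun z hz => (hall z hz).2, fun z hz => (hall z hz).1.1.1.1⟩

variable {Φ : F × E → F →L[ℝ] E} {y₀ : F} {u₀ : E} {R : ℝ} {C K₁ K₂ : NNReal}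

theorem FrobeniusBounds.norm_fderiv_le (h : FrobeniusBounds Φ (y₀, u₀) R C K₁ K₂) {z : F × E}
    (hz : z ∈ Metric.ball (y₀, u₀) R) : ‖fderiv ℝ Φ z‖ ≤ K₁ :=
  norm_fderiv_le_of_lipschitzOn ℝ (Metric.isOpen_ball.mem_nhds hz) h.lip

theorem FrobeniusBounds.taylor (h : FrobeniusBounds Φ (y₀, u₀) R C K₁ K₂) {z k : F × E}
    (hz : z ∈ Metric.ball (y₀, u₀) R) (hk : z + k ∈ Metric.ball (y₀, u₀) R) :
    ‖Φ (z + k) - Φ z - fderiv ℝ Φ z k‖ ≤ K₂ * ‖k‖ * ‖k‖ := by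
  have hseg : segment ℝ z (z + k) ⊆ Metric.ball (y₀, u₀) R :=
    (convex_ball (y₀, u₀) R).segment_subset hz hk
  have := (convex_segment z (z + k)).norm_image_sub_le_of_norm_fderiv_le' (𝕜 := ℝ)
    (f := Φ) (φ := fderiv ℝ Φ z) (C := K₂ * ‖k‖) (fun x hx => h.diff x (hseg hx)) (fun x hx => ?_)
    (left_mem_segment ℝ z (z + k)) (right_mem_segment ℝ z (z + k))
  · simpa using this
  · refine (h.lip'.norm_sub_le (hseg hx) hz).trans ?_
    gcongr
    have := norm_sub_le_of_mem_segment hx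
    simpa using this

/-- The solutions of `du = Φ(y, u)` along the rays that start at `y₀`. -/
theorem FrobeniusBounds.exists_ray [CompleteSpace E]
    (h : FrobeniusBounds Φ (y₀, u₀) R C K₁ K₂) {ρ : NNReal} (hρR : ρ < R)
    (hρC : C * ρ ≤ R / 4) {x : F} (hx : ‖x‖ ≤ ρ) :
    ∃ α : ℝ → E, α 0 = u₀ ∧ (∀ t, α t ∈ Metric.closedBall u₀ (R / 4)) ∧
      ∀ t ∈ Icc (0 : ℝ) 1, HasDerivWithinAt α (Φ (y₀ + t • x, α t) x) (Icc 0 1) t := by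
  have hR := h.pos
  obtain ⟨a, ha⟩ : ∃ a : NNReal, (a : ℝ) = R / 4 := ⟨⟨R / 4, by linarith⟩, rfl⟩
  rw [← ha] at hρC ⊢
  have hmem : ∀ t ∈ Icc (0 : ℝ) 1, ∀ w ∈ Metric.closedBall u₀ a,
      (y₀ + t • x, w) ∈ Metric.ball (y₀, u₀) R := by
    intro t ht w hw
    rw [← ball_prod_same]
    refine ⟨?_, ?_⟩
    · simp only [Metric.mem_ball, dist_self_add_left, norm_smul, Real.norm_eq_abs,
        abs_of_nonneg ht.1]
      nlinarith [ht.1, ht.2, norm_nonneg x]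
    · exact Metric.closedBall_subset_ball (by linarith) hw
  have hcd : ContinuousOn Φ (Metric.ball (y₀, u₀) R) := h.lip.continuousOn
  have hPL : IsPicardLindelof (fun t w => Φ (y₀ + t • x, w) x) (⟨0, by simp⟩ : Icc (0 : ℝ) 1) u₀
      a 0 (C * ρ) (K₁ * ρ) := by
    refine ⟨fun t ht => ?_, fun w hw => ?_, fun t ht w hw => ?_, ?_⟩
    · refine LipschitzOnWith.of_dist_le_mul fun w hw w' hw' => ?_
      rw [dist_eq_norm, ← _root_.sub_apply]
      refine (ContinuousLinearMap.le_opNorm _ _).trans ?_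
      have h1 := h.lip.norm_sub_le (hmem t ht w hw) (hmem t ht w' hw')
      have h2 : ‖((y₀ + t • x, w) : F × E) - (y₀ + t • x, w')‖ = dist w w' := by
        simp [dist_eq_norm, Prod.norm_def]
      rw [h2] at h1
      have h3 : ‖Φ (y₀ + t • x, w) - Φ (y₀ + t • x, w')‖ * ‖x‖ ≤ (K₁ * dist w w') * ρ := by
        gcongr
      refine h3.trans (le_of_eq ?_)
      push_cast
      ring
    · refine ContinuousOn.clm_apply (hcd.comp ?_ fun t ht => hmem t ht w hw) continuousOn_const
      fun_prop
    · refine (ContinuousLinearMap.le_opNorm _ _).trans ?_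
      push_cast
      have := h.bound _ (hmem t ht w hw)
      gcongr
    · simpa using hρC
  obtain ⟨α, h0, hα, hd⟩ := exists_solution_mem_closedBall hPL
  exact ⟨α, h0, hα, hd⟩

/-- Comparison of two neighbouring rays: `U(t) + t Φ(y₀ + t x, U(t)) h` solves, up to an error that
is quadratic in `h`, the equation along the ray in direction `x + h`; this is where integrability
enters. -/
theorem FrobeniusBounds.compare
    (h : FrobeniusBounds Φ (y₀, u₀) R C K₁ K₂) {ρ : NNReal} (hρR : ρ < R)
    {x k : F} (hx : ‖x‖ ≤ ρ) (hxk : ‖x + k‖ ≤ ρ) (hk : C * ‖k‖ ≤ R / 4) {U V : ℝ → E}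
    (hU0 : U 0 = u₀) (hUb : ∀ t, U t ∈ Metric.closedBall u₀ (R / 4))
    (hU : ∀ t ∈ Icc (0 : ℝ) 1, HasDerivWithinAt U (Φ (y₀ + t • x, U t) x) (Icc 0 1) t)
    (hV0 : V 0 = u₀) (hVb : ∀ t, V t ∈ Metric.closedBall u₀ (R / 4))
    (hV : ∀ t ∈ Icc (0 : ℝ) 1,
      HasDerivWithinAt V (Φ (y₀ + t • (x + k), V t) (x + k)) (Icc 0 1) t) :
    ‖V 1 - U 1 - Φ (y₀ + x, U 1) k‖ ≤
      (K₂ * (1 + C) * (1 + C) * ρ + K₁ * (1 + C)) * ‖k‖ ^ 2 * Real.exp (K₁ * ρ + 1) := by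
  have hR := h.pos
  set M : ℝ := (K₂ * (1 + C) * (1 + C) * ρ + K₁ * (1 + C)) * ‖k‖ ^ 2 with hM
  have hM0 : 0 ≤ M := by positivity
  have hmemx : ∀ t ∈ Icc (0 : ℝ) 1, ∀ x : F, ‖x‖ ≤ ρ → ∀ w ∈ Metric.closedBall u₀ (R / 2),
      (y₀ + t • x, w) ∈ Metric.ball (y₀, u₀) R := by
    intro t ht x hx w hw
    rw [← ball_prod_same]
    refine ⟨?_, ?_⟩
    · simp only [Metric.mem_ball, dist_self_add_left, norm_smul, Real.norm_eq_abs,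
        abs_of_nonneg ht.1]
      nlinarith [ht.1, ht.2, norm_nonneg x]
    · exact Metric.closedBall_subset_ball (by linarith) hw
  have hsub : Metric.closedBall u₀ (R / 4) ⊆ Metric.closedBall u₀ (R / 2) :=
    Metric.closedBall_subset_closedBall (by linarith)
  set Y : ℝ → E := fun t => U t + t • Φ (y₀ + t • x, U t) k with hY
  have hYb : ∀ t ∈ Icc (0 : ℝ) 1, Y t ∈ Metric.closedBall u₀ (R / 2) := by
    intro t ht
    have h1 := hUb t
    have h2 := h.bound _ (hmemx t ht x hx (U t) (hsub (hUb t)))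
    rw [Metric.mem_closedBall, dist_eq_norm] at h1 ⊢
    have h3 : ‖t • Φ (y₀ + t • x, U t) k‖ ≤ R / 4 := by
      rw [norm_smul, Real.norm_eq_abs, abs_of_nonneg ht.1]
      have h4 : ‖Φ (y₀ + t • x, U t) k‖ ≤ C * ‖k‖ :=
        (ContinuousLinearMap.le_opNorm _ _).trans (by gcongr)
      nlinarith [ht.1, ht.2, norm_nonneg (Φ (y₀ + t • x, U t) k)]
    calc ‖Y t - u₀‖ = ‖(U t - u₀) + t • Φ (y₀ + t • x, U t) k‖ := by
          congr 1; simp only [hY]; abel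
      _ ≤ _ := (norm_add_le _ _).trans (by linarith)
  have hYd : ∀ t ∈ Icc (0 : ℝ) 1, HasDerivWithinAt Y
      (Φ (y₀ + t • x, U t) x + (Φ (y₀ + t • x, U t) k +
        t • fderiv ℝ Φ (y₀ + t • x, U t) (x, Φ (y₀ + t • x, U t) x) k)) (Icc 0 1) t := by
    intro t ht
    have h1 : HasDerivWithinAt (fun t : ℝ => (y₀ + t • x, U t)) (x, Φ (y₀ + t • x, U t) x)
        (Icc 0 1) t := by
      refine HasDerivWithinAt.prodMk ?_ (hU t ht)
      simpa using ((hasDerivWithinAt_id t (Icc (0 : ℝ) 1)).smul_const x).const_add y₀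
    have h2 := (h.diff _ (hmemx t ht x hx (U t) (hsub (hUb t)))).hasFDerivAt
    have h3 : HasDerivWithinAt (fun t : ℝ => Φ (y₀ + t • x, U t))
        (fderiv ℝ Φ (y₀ + t • x, U t) (x, Φ (y₀ + t • x, U t) x)) (Icc 0 1) t :=
      h2.comp_hasDerivWithinAt t h1
    have h4 : HasDerivWithinAt (fun t : ℝ => Φ (y₀ + t • x, U t) k)
        (fderiv ℝ Φ (y₀ + t • x, U t) (x, Φ (y₀ + t • x, U t) x) k) (Icc 0 1) t := by
      simpa using h3.clm_apply (hasDerivWithinAt_const t (Icc 0 1) k)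
    have h5 : HasDerivWithinAt (fun t : ℝ => t • Φ (y₀ + t • x, U t) k)
        (t • fderiv ℝ Φ (y₀ + t • x, U t) (x, Φ (y₀ + t • x, U t) x) k +
          (1 : ℝ) • Φ (y₀ + t • x, U t) k) (Icc 0 1) t :=
      HasDerivWithinAt.smul (hasDerivWithinAt_id t (Icc (0 : ℝ) 1)) h4
    refine ((hU t ht).add h5).congr_deriv ?_
    rw [one_smul, add_comm (t • _)]
  have key := dist_le_of_approx_trajectories_ODE_of_mem (f := Y) (g := V) (a := 0) (b := 1)
    (v := fun t w => Φ (y₀ + t • (x + k), w) (x + k)) (K := K₁ * ρ + 1)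
    (s := fun _ => Metric.closedBall u₀ (R / 2)) (δ := 0) (εf := M) (εg := 0)
    (f' := fun t => Φ (y₀ + t • x, U t) x + (Φ (y₀ + t • x, U t) k +
        t • fderiv ℝ Φ (y₀ + t • x, U t) (x, Φ (y₀ + t • x, U t) x) k))
    (g' := fun t => Φ (y₀ + t • (x + k), V t) (x + k)) ?_ ?_ ?_ ?_ ?_ ?_ ?_ ?_ ?_ ?_ 1 (by simp)
  · have h1 : ((K₁ * ρ + 1 : NNReal) : ℝ) ≠ 0 := by positivity
    rw [gronwallBound_of_K_ne_0 h1, dist_comm, dist_eq_norm] at key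
    have h2 : V 1 - Y 1 = V 1 - U 1 - Φ (y₀ + x, U 1) k := by
      simp only [hY, one_smul]; abel
    rw [h2] at key
    refine key.trans ?_
    push_cast
    simp only [zero_mul, zero_add, add_zero, sub_zero, mul_one]
    have h3 : M / (K₁ * ρ + 1 : ℝ) ≤ M := div_le_self hM0 (by
      have : (0 : ℝ) ≤ K₁ * ρ := by positivity
      linarith)
    have h4 : Real.exp (K₁ * ρ + 1 : ℝ) - 1 ≤ Real.exp (K₁ * ρ + 1) := by linarith
    have h5 : 0 ≤ Real.exp (K₁ * ρ + 1 : ℝ) - 1 := by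
      have : (1 : ℝ) ≤ Real.exp (K₁ * ρ + 1) := Real.one_le_exp (by positivity)
      linarith
    exact mul_le_mul h3 h4 h5 hM0
  · intro t ht
    have ht' : t ∈ Icc (0 : ℝ) 1 := ⟨ht.1, ht.2.le⟩
    refine LipschitzOnWith.of_dist_le_mul fun w hw w' hw' => ?_
    rw [dist_eq_norm, ← _root_.sub_apply]
    refine (ContinuousLinearMap.le_opNorm _ _).trans ?_
    have h1 := h.lip.norm_sub_le (hmemx t ht' _ hxk w hw) (hmemx t ht' _ hxk w' hw')
    have h2 : ‖((y₀ + t • (x + k), w) : F × E) - (y₀ + t • (x + k), w')‖ = dist w w' := by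
      simp [dist_eq_norm, Prod.norm_def]
    rw [h2] at h1
    have h3 : ‖Φ (y₀ + t • (x + k), w) - Φ (y₀ + t • (x + k), w')‖ * ‖x + k‖ ≤
        (K₁ * dist w w') * ρ := by gcongr
    refine h3.trans ?_
    push_cast
    nlinarith [dist_nonneg (x := w) (y := w')]
  · exact fun t ht => (hYd t ht).continuousWithinAt
  · exact fun t ht => ((hYd t ⟨ht.1, ht.2.le⟩).mono_of_mem_nhdsWithin
      (Icc_mem_nhdsGE_of_mem ht))
  · intro t ht
    have ht' : t ∈ Icc (0 : ℝ) 1 := ⟨ht.1, ht.2.le⟩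
    set z : F × E := (y₀ + t • x, U t) with hz
    have hzm : z ∈ Metric.ball (y₀, u₀) R := hmemx t ht' x hx (U t) (hsub (hUb t))
    set d : F × E := t • ((k, Φ z k) : F × E) with hd
    have hzd : ((y₀ + t • (x + k), Y t) : F × E) = z + d := by
      simp [hz, hd, hY, smul_add, add_assoc]
    have hzdm : z + d ∈ Metric.ball (y₀, u₀) R := by
      rw [← hzd]; exact hmemx t ht' _ hxk _ (hYb t ht')
    have h1 := h.taylor hzm hzdm
    have hb := h.bound z hzm
    have hdn : ‖d‖ ≤ (1 + C) * ‖k‖ := by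
      rw [hd, norm_smul, Real.norm_eq_abs, abs_of_nonneg ht.1]
      have h3 : ‖((k, Φ z k) : F × E)‖ ≤ (1 + C) * ‖k‖ := by
        rw [Prod.norm_def]
        have h4 : ‖Φ z k‖ ≤ C * ‖k‖ := (ContinuousLinearMap.le_opNorm _ _).trans (by gcongr)
        have h5 : 0 ≤ C * ‖k‖ := by positivity
        exact max_le (by nlinarith [norm_nonneg k]) (by nlinarith [norm_nonneg k])
      nlinarith [ht.1, ht.2, norm_nonneg ((k, Φ z k) : F × E)]
    have hcancel : fderiv ℝ Φ z d x = t • fderiv ℝ Φ z (x, Φ z x) k := by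
      rw [hd, map_smul, _root_.smul_apply, h.integrable z hzm k x]
    rw [dist_comm, dist_eq_norm]
    have hrw : Φ (y₀ + t • (x + k), Y t) (x + k) - (Φ z x + (Φ z k +
        t • fderiv ℝ Φ z (x, Φ z x) k)) =
        (Φ (z + d) - Φ z - fderiv ℝ Φ z d) (x + k) + fderiv ℝ Φ z d k := by
      rw [hzd, ← hcancel]
      simp only [_root_.sub_apply, map_add]
      abel
    rw [hrw]
    refine (norm_add_le _ _).trans ?_
    have e1 : ‖(Φ (z + d) - Φ z - fderiv ℝ Φ z d) (x + k)‖ ≤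
        (K₂ * ((1 + C) * ‖k‖) * ((1 + C) * ‖k‖)) * ρ := by
      refine (ContinuousLinearMap.le_opNorm _ _).trans ?_
      refine mul_le_mul (h1.trans (by gcongr)) hxk (norm_nonneg _) (by positivity)
    have e2 : ‖fderiv ℝ Φ z d k‖ ≤ K₁ * ((1 + C) * ‖k‖) * ‖k‖ := by
      refine (ContinuousLinearMap.le_opNorm _ _).trans ?_
      gcongr
      refine (ContinuousLinearMap.le_opNorm _ _).trans ?_
      gcongr
      exact h.norm_fderiv_le hzm
    refine (add_le_add e1 e2).trans (le_of_eq ?_)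
    rw [hM]; ring
  · exact fun t ht => hYb t ⟨ht.1, ht.2.le⟩
  · exact fun t ht => (hV t ht).continuousWithinAt
  · exact fun t ht => ((hV t ⟨ht.1, ht.2.le⟩).mono_of_mem_nhdsWithin
      (Icc_mem_nhdsGE_of_mem ht))
  · intro t ht; simp
  · exact fun t ht => hsub (hVb t)
  · simp [hY, hU0, hV0]

theorem contDiffOn_of_total_differential {u : F → E} {y₀ : F} {r : ℝ} {O : Set (F × E)}
    (hO : ContDiffOn ℝ ∞ Φ O) (hmem : ∀ y ∈ Metric.ball y₀ r, (y, u y) ∈ O)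
    (hu : ∀ y ∈ Metric.ball y₀ r, HasFDerivAt u (Φ (y, u y)) y) :
    ContDiffOn ℝ ∞ u (Metric.ball y₀ r) := by
  rw [contDiffOn_infty]
  intro n
  induction n with
  | zero => exact contDiffOn_zero.2 fun y hy => (hu y hy).continuousAt.continuousWithinAt
  | succ n ih =>
    have : ((n + 1 : ℕ) : WithTop ℕ∞) = (n : WithTop ℕ∞) + 1 := by push_cast; rfl
    rw [this, contDiffOn_succ_iff_fderiv_of_isOpen Metric.isOpen_ball]
    refine ⟨fun y hy => (hu y hy).differentiableAt.differentiableWithinAt, by simp, ?_⟩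
    have h1 : ContDiffOn ℝ n (fun y => Φ (y, u y)) (Metric.ball y₀ r) :=
      (hO.of_le (by exact_mod_cast le_top)).comp (contDiffOn_id.prodMk ih) hmem
    exact h1.congr fun y hy => (hu y hy).fderiv

/-- The Frobenius theorem: the total differential equation `du = Φ(y, u)` has a smooth local
solution with any given initial value if its integrability condition holds. -/
theorem exists_solution_total_differential [CompleteSpace E] {Φ : F × E → F →L[ℝ] E} {y₀ : F}
    {u₀ : E} (hΦ : ∀ᶠ z in 𝓝 (y₀, u₀), ContDiffAt ℝ ∞ Φ z)
    (hint : ∀ᶠ z in 𝓝 (y₀, u₀), ∀ v w,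
      fderiv ℝ Φ z (v, Φ z v) w = fderiv ℝ Φ z (w, Φ z w) v) :
    ∃ u : F → E, u y₀ = u₀ ∧ ∃ r > 0, ContDiffOn ℝ ∞ u (Metric.ball y₀ r) ∧
      ∀ y ∈ Metric.ball y₀ r, HasFDerivAt u (Φ (y, u y)) y := by
  obtain ⟨R, C, K₁, K₂, h⟩ := exists_frobeniusBounds hΦ.self_of_nhds hint
  have hR := h.pos
  obtain ⟨ρ, hρ0, hρR, hρC⟩ : ∃ ρ : NNReal, 0 < ρ ∧ (ρ : ℝ) < R ∧ C * ρ ≤ R / 4 := by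
    refine ⟨⟨R / (4 * (C + 1)), by positivity⟩, ?_, ?_, ?_⟩
    · change (0 : ℝ) < R / (4 * (C + 1)); positivity
    · change R / (4 * (C + 1)) < R
      rw [div_lt_iff₀ (by positivity)]
      nlinarith [C.2]
    · change C * (R / (4 * (C + 1))) ≤ R / 4
      rw [mul_div_assoc', div_le_div_iff₀ (by positivity) (by positivity)]
      nlinarith [C.2]
  have hex : ∀ x : F, ∃ α : ℝ → E, ‖x‖ ≤ ρ → α 0 = u₀ ∧
      (∀ t, α t ∈ Metric.closedBall u₀ (R / 4)) ∧
      ∀ t ∈ Icc (0 : ℝ) 1, HasDerivWithinAt α (Φ (y₀ + t • x, α t) x) (Icc 0 1) t := by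
    intro x
    by_cases hx : ‖x‖ ≤ ρ
    · obtain ⟨α, hα⟩ := h.exists_ray hρR hρC hx
      exact ⟨α, fun _ => hα⟩
    · exact ⟨0, fun h => absurd h hx⟩
  choose U hU using hex
  set u : F → E := fun y => U (y - y₀) 1 with hu
  have hderiv : ∀ y ∈ Metric.ball y₀ ρ, HasFDerivAt u (Φ (y, u y)) y := by
    intro y hy
    have hy' : ‖y - y₀‖ < ρ := by rwa [← dist_eq_norm]
    rw [hasFDerivAt_iff_isLittleO_nhds_zero]
    have hO : (fun k : F => u (y + k) - u y - Φ (y, u y) k) =O[𝓝 0] fun k => ‖k‖ ^ 2 := by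
      refine Asymptotics.IsBigO.of_bound ((K₂ * (1 + C) * (1 + C) * ρ + K₁ * (1 + C)) *
        Real.exp (K₁ * ρ + 1)) ?_
      have e1 : ∀ᶠ k : F in 𝓝 0, ‖y - y₀ + k‖ < ρ := by
        have : ContinuousAt (fun k : F => ‖y - y₀ + k‖) 0 := by fun_prop
        exact this.eventually (gt_mem_nhds (by simpa using hy'))
      have e2 : ∀ᶠ k : F in 𝓝 0, C * ‖k‖ < R / 4 := by
        have : ContinuousAt (fun k : F => C * ‖k‖) 0 := by fun_prop
        exact this.eventually (gt_mem_nhds (by simp; positivity))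
      filter_upwards [e1, e2] with k hk1 hk2
      obtain ⟨a1, a2, a3⟩ := hU (y - y₀) hy'.le
      obtain ⟨b1, b2, b3⟩ := hU (y - y₀ + k) hk1.le
      have := h.compare hρR hy'.le hk1.le hk2.le a1 a2 a3 b1 b2 b3
      have e3 : y + k - y₀ = y - y₀ + k := by abel
      simp only [hu, e3]
      rw [add_sub_cancel] at this
      refine this.trans (le_of_eq ?_)
      simp
      ring
    refine hO.trans_isLittleO ?_
    exact Asymptotics.isLittleO_norm_right.1
      ((Asymptotics.isLittleO_pow_id (𝕜 := ℝ) (n := 2) (by norm_num)).comp_tendsto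
        (tendsto_norm_zero (E := F)))
  have hu0 : u y₀ = u₀ := by
    obtain ⟨a1, a2, a3⟩ := hU 0 (by simp)
    have hconst : ∀ t ∈ Icc (0 : ℝ) 1, U 0 t = U 0 0 := by
      refine constant_of_has_deriv_right_zero (fun t ht => (a3 t ht).continuousWithinAt)
        fun t ht => ?_
      have := (a3 t ⟨ht.1, ht.2.le⟩).mono_of_mem_nhdsWithin (Icc_mem_nhdsGE_of_mem ht)
      simpa using this
    simp only [hu, sub_self]
    rw [hconst 1 (by simp), a1]
  have hcont : ContinuousAt (fun y => (y, u y)) y₀ :=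
    continuousAt_id.prodMk (hderiv y₀ (Metric.mem_ball_self hρ0)).continuousAt
  have hev : ∀ᶠ y in 𝓝 y₀, ContDiffAt ℝ ∞ Φ (y, u y) := by
    refine hcont.eventually ?_
    simp only [hu0]
    exact hΦ
  obtain ⟨r, hr, hball⟩ := Metric.eventually_nhds_iff_ball.1 hev
  refine ⟨u, hu0, min r ρ, lt_min hr hρ0, ?_, fun y hy =>
    hderiv y (Metric.ball_subset_ball (min_le_right _ _) hy)⟩
  exact contDiffOn_of_total_differential (O := {z | ContDiffAt ℝ ∞ Φ z})
    (fun z hz => ContDiffAt.contDiffWithinAt hz)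
    (fun y hy => hball y (Metric.ball_subset_ball (min_le_left _ _) hy))
    fun y hy => hderiv y (Metric.ball_subset_ball (min_le_right _ _) hy)

end Frobenius

/-! ### Connections on principal bundles -/

section PrincipalBundles

variable {EB : Type*} [NormedAddCommGroup EB] [NormedSpace ℝ EB]
  {B : Type*} [TopologicalSpace B] [ChartedSpace EB B]
  {E : Type*} [NormedAddCommGroup E] [NormedSpace ℝ E]
  {P : Type*} [TopologicalSpace P] [ChartedSpace E P]
  {EG : Type*} [NormedAddCommGroup EG] [NormedSpace ℝ EG]
  {G : Type*} [Group G] [TopologicalSpace G] [ChartedSpace EG G] [MulAction Gᵐᵒᵖ P]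
  {F : Type*} [NormedAddCommGroup F] [NormedSpace ℝ F]
  {Y : Type*} [TopologicalSpace Y] [ChartedSpace F Y]

section Connection

variable [IsManifold 𝓘(ℝ, E) ∞ P]

/-- The connection form, with values in the model space of the group. -/
def Connection.co (A : Connection E P EG G) (p : P) : E →L[ℝ] EG :=
  (lieCoord (E₁ := EG) (G := G)).toContinuousLinearMap.comp (A.form p)

/-- The curvature form, with values in the model space of the group. -/
def Connection.cvr (A : Connection E P EG G) (p : P) (u v : E) : EG :=
  extD A.co p u v + brk G (A.co p u) (A.co p v)

theorem Connection.smoothForm_co [FiniteDimensional ℝ E] (A : Connection E P EG G) :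
    SmoothForm A.co := SmoothForm.of_tangentBundle A.smooth

/-- The fundamental vector at `p` of the element `X` of the Lie algebra. -/
def fund (G : Type*) [Group G] [TopologicalSpace G] [ChartedSpace EG G] [MulAction Gᵐᵒᵖ P]
    (p : P) (X : EG) : E := tD EG E (fun g : G => p <• g) 1 X

theorem Connection.co_fund (A : Connection E P EG G) (p : P) (X : EG) :
    A.co p (fund G p X) = X := by
  have h : A.co (p <• (1 : G)) (fund G p X) = X := A.vertical p X
  simpa using h

theorem Connection.co_act (A : Connection E P EG G) (g : G) (p : P) (v : E) :
    A.co (p <• g) (tD E E (fun p : P => p <• g) p v) = AdC g⁻¹ (A.co p v) := A.equivariant g p v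

end Connection

/-- The left-invariant (Maurer–Cartan) form of the group. -/
def maurerCartan (g : G) : EG →L[ℝ] EG := tD EG EG (fun k : G => g⁻¹ * k) g

theorem maurerCartan_injective [LieGroup 𝓘(ℝ, EG) ∞ G] (g : G) {w : EG}
    (h : maurerCartan g w = 0) : w = 0 := by
  have h2 : ∀ a : G, ContMDiff 𝓘(ℝ, EG) 𝓘(ℝ, EG) ∞ (fun k : G => a * k) := fun a =>
    contMDiff_mul_left
  have h1 := tD_comp_apply (F' := EG) (F := EG) (E := EG) (f := fun k : G => g * k)
    (g := fun k : G => g⁻¹ * k) (z := g)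
    ((h2 g _).mdifferentiableAt (by simp)) ((h2 g⁻¹ _).mdifferentiableAt (by simp)) w
  have h3 : (fun z : G => g * (g⁻¹ * z)) = fun z => z := by ext; simp
  have h4 : tD EG EG (fun k : G => g⁻¹ * k) g w = 0 := h
  rw [h3, tD_id, h4, map_zero] at h1
  exact h1

theorem contMDiff_act_right (hP : ContMDiff (𝓘(ℝ, E).prod 𝓘(ℝ, EG)) 𝓘(ℝ, E) ∞
    (fun z : P × G => z.1 <• z.2)) (p : P) :
    ContMDiff 𝓘(ℝ, EG) 𝓘(ℝ, E) ∞ (fun g : G => p <• g) :=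
  hP.comp (contMDiff_const.prodMk contMDiff_id)

theorem contMDiff_act_left (hP : ContMDiff (𝓘(ℝ, E).prod 𝓘(ℝ, EG)) 𝓘(ℝ, E) ∞
    (fun z : P × G => z.1 <• z.2)) (g : G) :
    ContMDiff 𝓘(ℝ, E) 𝓘(ℝ, E) ∞ (fun p : P => p <• g) :=
  hP.comp (contMDiff_id.prodMk contMDiff_const)

theorem tD_act (hP : ContMDiff (𝓘(ℝ, E).prod 𝓘(ℝ, EG)) 𝓘(ℝ, E) ∞ (fun z : P × G => z.1 <• z.2))
    {f : Y → P} {g : Y → G} {y : Y}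
    (hf : MDifferentiableAt 𝓘(ℝ, F) 𝓘(ℝ, E) f y) (hg : MDifferentiableAt 𝓘(ℝ, F) 𝓘(ℝ, EG) g y)
    (v : F) : tD F E (fun y => f y <• g y) y v =
      tD E E (fun p : P => p <• g y) (f y) (tD F E f y v) +
      tD EG E (fun k : G => f y <• k) (g y) (tD F EG g y v) := by
  have hΨ : MDifferentiableAt (𝓘(ℝ, E).prod 𝓘(ℝ, EG)) 𝓘(ℝ, E) (fun z : P × G => z.1 <• z.2)
    (f y, g y) := (hP _).mdifferentiableAt (by simp)
  have h1 := mfderiv_comp y hΨ (hf.prodMk hg)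
  have h2 := mfderiv_prodMk hf hg
  rw [h2] at h1
  have h3 := DFunLike.congr_fun h1 v
  refine h3.trans ?_
  exact mfderiv_prod_eq_add_apply hΨ

theorem tD_act_right [LieGroup 𝓘(ℝ, EG) ∞ G]
    (hP : ContMDiff (𝓘(ℝ, E).prod 𝓘(ℝ, EG)) 𝓘(ℝ, E) ∞ (fun z : P × G => z.1 <• z.2))
    (p : P) (g : G) (w : EG) :
    tD EG E (fun k : G => p <• k) g w = fund G (p <• g) (maurerCartan g w) := by
  have h1 : (fun k : G => p <• k) = fun k => (p <• g) <• (g⁻¹ * k) := by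
    ext k
    rw [← mul_smul, ← MulOpposite.op_mul, mul_inv_cancel_left]
  have h2 : ContMDiff 𝓘(ℝ, EG) 𝓘(ℝ, EG) ∞ (fun k : G => g⁻¹ * k) := contMDiff_mul_left
  rw [h1, tD_comp_apply (F := EG) (f := fun k : G => (p <• g) <• k) (g := fun k : G => g⁻¹ * k)
    ((contMDiff_act_right hP _ _).mdifferentiableAt (by simp))
    ((h2 _).mdifferentiableAt (by simp)), inv_mul_cancel]
  rfl

section Connection

variable [IsManifold 𝓘(ℝ, E) ∞ P]

/-- The connection form along a product `f(y) g(y)`. -/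
theorem Connection.co_tD_act [LieGroup 𝓘(ℝ, EG) ∞ G] (A : Connection E P EG G)
    (hP : ContMDiff (𝓘(ℝ, E).prod 𝓘(ℝ, EG)) 𝓘(ℝ, E) ∞ (fun z : P × G => z.1 <• z.2))
    {f : Y → P} {g : Y → G} {y : Y}
    (hf : MDifferentiableAt 𝓘(ℝ, F) 𝓘(ℝ, E) f y) (hg : MDifferentiableAt 𝓘(ℝ, F) 𝓘(ℝ, EG) g y)
    (v : F) : A.co (f y <• g y) (tD F E (fun y => f y <• g y) y v) =
      AdC (g y)⁻¹ (A.co (f y) (tD F E f y v)) + maurerCartan (g y) (tD F EG g y v) := by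
  rw [tD_act hP hf hg, map_add, A.co_act, tD_act_right hP, A.co_fund]

end Connection

/-! ### The fibres of a principal bundle -/

variable {π : P → B}

variable (G) in
/-- The element `g` of the structure group with `p' = p g`. -/
def actDiv (p p' : P) : G := Classical.epsilon fun g : G => p' = p <• g

omit [TopologicalSpace P] [TopologicalSpace G] in
theorem act_act (p : P) (g h : G) : (p <• g) <• h = p <• (g * h) := by
  rw [MulOpposite.op_mul, mul_smul]

theorem IsPrincipalBundle.exists_local_div (hP : IsPrincipalBundle EB E EG G π)
    (x : B) : ∃ U : Set B, IsOpen U ∧ x ∈ U ∧ ∃ τ : P → G,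
      ContMDiffOn 𝓘(ℝ, E) 𝓘(ℝ, EG) ∞ τ (π ⁻¹' U) ∧
      ∀ p ∈ π ⁻¹' U, ∀ p', π p = π p' → p' = p <• ((τ p)⁻¹ * τ p') := by
  obtain ⟨U, s, τ, hU, hx, hs, hsπ, hτ, hst⟩ := hP.locally_trivial x
  refine ⟨U, hU, hx, τ, hτ, fun p hp p' h => ?_⟩
  have h1 : s (π p) <• τ p = p := hst p hp
  have h2 : s (π p') <• τ p' = p' := hst p' (by rw [mem_preimage, ← h]; exact hp)
  calc p' = s (π p) <• τ p' := by rw [h, h2]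
    _ = (s (π p) <• τ p) <• ((τ p)⁻¹ * τ p') := by rw [act_act, mul_inv_cancel_left]
    _ = p <• ((τ p)⁻¹ * τ p') := by rw [h1]

theorem IsPrincipalBundle.exists_act_eq (hP : IsPrincipalBundle EB E EG G π) {p p' : P}
    (h : π p = π p') : ∃ g : G, p' = p <• g := by
  obtain ⟨U, hU, hx, τ, hτ, hst⟩ := hP.exists_local_div (π p)
  exact ⟨_, hst p hx p' h⟩

theorem IsPrincipalBundle.act_actDiv (hP : IsPrincipalBundle EB E EG G π) {p p' : P}
    (h : π p = π p') : p <• actDiv G p p' = p' :=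
  (Classical.epsilon_spec (hP.exists_act_eq h)).symm

theorem IsPrincipalBundle.act_injective (hP : IsPrincipalBundle EB E EG G π) (p : P) {g h : G}
    (e : p <• g = p <• h) : g = h := by
  have h1 : p <• (g * h⁻¹) = p := by
    rw [MulOpposite.op_mul, mul_smul, e, ← mul_smul, ← MulOpposite.op_mul, mul_inv_cancel]
    simp
  exact mul_inv_eq_one.1 (hP.free p _ h1)

theorem IsPrincipalBundle.actDiv_eq (hP : IsPrincipalBundle EB E EG G π) {p p' : P} {g : G}
    (h : p' = p <• g) : actDiv G p p' = g := by
  refine hP.act_injective p ?_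
  rw [hP.act_actDiv (by rw [h, hP.proj_act]), h]

variable [LieGroup 𝓘(ℝ, EG) ∞ G]

theorem IsPrincipalBundle.contMDiffWithinAt_actDiv (hP : IsPrincipalBundle EB E EG G π)
    {f f' : Y → P} {s : Set Y} {y : Y} (hf : ContMDiffWithinAt 𝓘(ℝ, F) 𝓘(ℝ, E) ∞ f s y)
    (hf' : ContMDiffWithinAt 𝓘(ℝ, F) 𝓘(ℝ, E) ∞ f' s y) (hy : y ∈ s)
    (h : ∀ z ∈ s, π (f z) = π (f' z)) :
    ContMDiffWithinAt 𝓘(ℝ, F) 𝓘(ℝ, EG) ∞ (fun z => actDiv G (f z) (f' z)) s y := by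
  obtain ⟨U, hU, hx, τ, hτ, hdiv'⟩ := hP.exists_local_div (π (f y))
  have hdiv : ∀ p ∈ π ⁻¹' U, ∀ p', π p = π p' → actDiv G p p' = (τ p)⁻¹ * τ p' :=
    fun p hp p' h => hP.actDiv_eq (hdiv' p hp p' h)
  have hU' : IsOpen (π ⁻¹' U) := hU.preimage hP.smooth_proj.continuous
  have h1 : ContMDiffWithinAt 𝓘(ℝ, F) 𝓘(ℝ, EG) ∞ (fun z => τ (f z)) s y :=
    ContMDiffAt.comp_contMDiffWithinAt y (hτ.contMDiffAt (hU'.mem_nhds hx)) hf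
  have h2 : ContMDiffWithinAt 𝓘(ℝ, F) 𝓘(ℝ, EG) ∞ (fun z => τ (f' z)) s y :=
    ContMDiffAt.comp_contMDiffWithinAt y
      (hτ.contMDiffAt (hU'.mem_nhds (by rw [mem_preimage, ← h y hy]; exact hx))) hf'
  refine (h1.inv.mul h2).congr_of_eventuallyEq ?_ (hdiv _ hx _ (h y hy))
  filter_upwards [hf.continuousWithinAt (hU'.mem_nhds hx), self_mem_nhdsWithin] with z hz hz'
  exact hdiv _ hz _ (h z hz')

/-- A function into a manifold whose derivative vanishes is locally constant. -/
theorem eventually_eq_of_tD_eq_zero {P : Type*} [TopologicalSpace P] [ChartedSpace E P]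
    [IsManifold 𝓘(ℝ, E) ∞ P] [IsManifold 𝓘(ℝ, F) ∞ Y] {g : Y → P} {y : Y}
    (hg : ∀ᶠ z in 𝓝 y, MDifferentiableAt 𝓘(ℝ, F) 𝓘(ℝ, E) g z ∧ tD F E g z = 0) :
    ∀ᶠ z in 𝓝 y, g z = g y := by
  have hx := mem_extChartAt_target (I := 𝓘(ℝ, F)) y
  set x := extChartAt 𝓘(ℝ, F) y y
  have e : (extChartAt 𝓘(ℝ, F) y).symm x = y := extChartAt_to_inv y
  have hc := (contMDiffAt_extChartAt_symm hx).continuousAt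
  have hgc : ContinuousAt g y := hg.self_of_nhds.1.continuousAt
  have h1 : ∀ᶠ z in 𝓝 x, z ∈ (extChartAt 𝓘(ℝ, F) y).target :=
    (isOpen_extChartAt_target y).mem_nhds hx
  have h2 : ∀ᶠ z in 𝓝 y, g z ∈ (extChartAt 𝓘(ℝ, E) (g y)).source :=
    hgc.preimage_mem_nhds ((isOpen_extChartAt_source (I := 𝓘(ℝ, E)) (g y)).mem_nhds
      (mem_extChartAt_source (g y)))
  have h3 : ∀ᶠ z in 𝓝 x, (MDifferentiableAt 𝓘(ℝ, F) 𝓘(ℝ, E) g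
      ((extChartAt 𝓘(ℝ, F) y).symm z) ∧ tD F E g ((extChartAt 𝓘(ℝ, F) y).symm z) = 0) ∧
      g ((extChartAt 𝓘(ℝ, F) y).symm z) ∈ (extChartAt 𝓘(ℝ, E) (g y)).source := by
    have hc' : Filter.Tendsto (extChartAt 𝓘(ℝ, F) y).symm (𝓝 x) (𝓝 y) := by
      have := hc.tendsto
      rwa [e] at this
    exact hc'.eventually (hg.and h2)
  obtain ⟨r, hr, hall⟩ := Metric.eventually_nhds_iff_ball.1 (h1.and h3)
  set u : F → E := fun z => extChartAt 𝓘(ℝ, E) (g y) (g ((extChartAt 𝓘(ℝ, F) y).symm z)) with hu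
  have hd : ∀ z ∈ Metric.ball x r, HasFDerivAt u (0 : F →L[ℝ] E) z := by
    intro z hz
    obtain ⟨a1, ⟨a2, a3⟩, a4⟩ := hall z hz
    have b1 := mdifferentiableAt_extChartAt_symm a1
    have b2 := mdifferentiableAt_extChartAt_of_mem a4
    have b4 : MDifferentiableAt 𝓘(ℝ, F) 𝓘(ℝ, E)
      (fun z => g ((extChartAt 𝓘(ℝ, F) y).symm z)) z := a2.comp z b1
    have b3 : DifferentiableAt ℝ u z := (b2.comp z b4).differentiableAt
    have b5 : fderiv ℝ u z = 0 := by
      rw [← tD_eq_fderiv, tD_comp (F := E) (f := extChartAt 𝓘(ℝ, E) (g y))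
        (g := fun z => g ((extChartAt 𝓘(ℝ, F) y).symm z)) b2 b4,
        tD_comp (F := F) (f := g) (g := (extChartAt 𝓘(ℝ, F) y).symm) a2 b1, a3]
      simp
    rw [← b5]
    exact b3.hasFDerivAt
  have hconst : ∀ z ∈ Metric.ball x r, u z = u x := fun z hz =>
    (convex_ball x r).is_const_of_fderivWithin_eq_zero (𝕜 := ℝ)
      (fun w hw => (hd w hw).differentiableAt.differentiableWithinAt)
      (fun w hw => by rw [fderivWithin_of_isOpen Metric.isOpen_ball hw, (hd w hw).fderiv])
      hz (Metric.mem_ball_self hr)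
  have h4 : ∀ᶠ z in 𝓝 y, extChartAt 𝓘(ℝ, F) y z ∈ Metric.ball x r :=
    (continuousAt_extChartAt y).preimage_mem_nhds (Metric.ball_mem_nhds x hr)
  filter_upwards [h4, (isOpen_extChartAt_source (I := 𝓘(ℝ, F)) y).mem_nhds
    (mem_extChartAt_source y)] with z hz hz'
  have b1 := hconst _ hz
  have b2 := (hall _ hz).2.2
  have b3 : (extChartAt 𝓘(ℝ, F) y).symm (extChartAt 𝓘(ℝ, F) y z) = z :=
    (extChartAt 𝓘(ℝ, F) y).left_inv hz'
  simp only [hu, e] at b1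
  rw [b3] at b1 b2
  exact (extChartAt 𝓘(ℝ, E) (g y)).injOn b2 (mem_extChartAt_source (g y)) b1

/-- A path in a Hausdorff space that is locally constant on the open interval is constant. -/
theorem eq_of_locally_constant_Ioo {T : Type*} [TopologicalSpace T] [T2Space T] {g : ℝ → T}
    {a b : ℝ} (hab : a < b) (hc : ContinuousOn g (Icc a b))
    (hg : ∀ t ∈ Ioo a b, ∀ᶠ s in 𝓝 t, g s = g t) : ∀ t ∈ Icc a b, g t = g a := by
  have hloc : IsLocallyConstant (fun t : Ioo a b => g t) := by
    rw [IsLocallyConstant.iff_eventually_eq]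
    intro t
    exact continuous_subtype_val.continuousAt.eventually (hg t t.2)
  have hpre : PreconnectedSpace (Ioo a b) := Subtype.preconnectedSpace isPreconnected_Ioo
  obtain ⟨m, hm⟩ : (Ioo a b).Nonempty := nonempty_Ioo.2 hab
  have h1 : EqOn g (fun _ => g m) (Ioo a b) := fun t ht =>
    hloc.apply_eq_of_isPreconnected isPreconnected_univ (x := ⟨t, ht⟩) (y := ⟨m, hm⟩)
      (mem_univ _) (mem_univ _)
  have h2 : EqOn g (fun _ => g m) (Icc a b) := h1.of_subset_closure hc continuousOn_const
    Ioo_subset_Icc_self (by rw [closure_Ioo hab.ne])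
  intro t ht
  rw [h2 ht, h2 (left_mem_Icc.2 hab.le)]

section Unique

variable [IsManifold 𝓘(ℝ, E) ∞ P] [IsManifold 𝓘(ℝ, F) ∞ Y]

/-- Two lifts of the same map along which the connection form takes the same, `Ad`-invariant,
values differ locally by a constant element of the structure group. -/
theorem IsPrincipalBundle.eventually_actDiv_eq (hP : IsPrincipalBundle EB E EG G π)
    (A : Connection E P EG G) {f f' : Y → P} {s : Set Y} (hs : IsOpen s)
    (hf : ContMDiffOn 𝓘(ℝ, F) 𝓘(ℝ, E) ∞ f s) (hf' : ContMDiffOn 𝓘(ℝ, F) 𝓘(ℝ, E) ∞ f' s)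
    (h : ∀ z ∈ s, π (f z) = π (f' z))
    (hω : ∀ z ∈ s, ∀ v, A.co (f' z) (tD F E f' z v) = A.co (f z) (tD F E f z v))
    (hAd : ∀ z ∈ s, ∀ v, ∀ g : G, AdC g (A.co (f z) (tD F E f z v)) = A.co (f z) (tD F E f z v))
    {y : Y} (hy : y ∈ s) : ∀ᶠ z in 𝓝 y, actDiv G (f z) (f' z) = actDiv G (f y) (f' y) := by
  refine eventually_eq_of_tD_eq_zero (E := EG) (F := F) (g := fun z => actDiv G (f z) (f' z)) ?_
  filter_upwards [hs.mem_nhds hy] with z hz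
  have h1 : MDifferentiableAt 𝓘(ℝ, F) 𝓘(ℝ, EG) (fun z => actDiv G (f z) (f' z)) z :=
    ((hP.contMDiffWithinAt_actDiv (hf z hz) (hf' z hz) hz h).contMDiffAt
      (hs.mem_nhds hz)).mdifferentiableAt (by simp)
  have h2 : MDifferentiableAt 𝓘(ℝ, F) 𝓘(ℝ, E) f z :=
    (hf.contMDiffAt (hs.mem_nhds hz)).mdifferentiableAt (by simp)
  refine ⟨h1, ?_⟩
  ext v
  have h3 := A.co_tD_act hP.smooth_act h2 h1 v
  have h4 : (fun z => f z <• actDiv G (f z) (f' z)) =ᶠ[𝓝 z] f' := by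
    filter_upwards [hs.mem_nhds hz] with w hw
    exact hP.act_actDiv (h w hw)
  rw [tD_congr h4, hP.act_actDiv (h z hz), hω z hz, hAd z hz, left_eq_add] at h3
  exact maurerCartan_injective _ h3

/-- Two paths with the same projection along which the connection form takes the same,
`Ad`-invariant, values differ by a constant element of the structure group. -/
theorem IsPrincipalBundle.curve_actDiv_eq [T2Space G] (hP : IsPrincipalBundle EB E EG G π)
    (A : Connection E P EG G) {f f' : ℝ → P}
    (hf : ContMDiffOn 𝓘(ℝ, ℝ) 𝓘(ℝ, E) ∞ f (Icc 0 1))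
    (hf' : ContMDiffOn 𝓘(ℝ, ℝ) 𝓘(ℝ, E) ∞ f' (Icc 0 1))
    (h : ∀ z ∈ Icc (0 : ℝ) 1, π (f z) = π (f' z))
    (hω : ∀ z ∈ Ioo (0 : ℝ) 1, A.co (f' z) (tD ℝ E f' z 1) = A.co (f z) (tD ℝ E f z 1))
    (hAd : ∀ z ∈ Ioo (0 : ℝ) 1, ∀ g : G,
      AdC g (A.co (f z) (tD ℝ E f z 1)) = A.co (f z) (tD ℝ E f z 1)) :
    ∀ t ∈ Icc (0 : ℝ) 1, f' t = f t <• actDiv G (f 0) (f' 0) := by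
  have hv : ∀ v : ℝ, v = v • (1 : ℝ) := fun v => by simp
  have key : ∀ t ∈ Icc (0 : ℝ) 1, actDiv G (f t) (f' t) = actDiv G (f 0) (f' 0) := by
    refine eq_of_locally_constant_Ioo one_pos (fun t ht =>
      (hP.contMDiffWithinAt_actDiv (hf t ht) (hf' t ht) ht h).continuousWithinAt) fun t ht => ?_
    refine hP.eventually_actDiv_eq A isOpen_Ioo (hf.mono Ioo_subset_Icc_self)
      (hf'.mono Ioo_subset_Icc_self) (fun z hz => h z (Ioo_subset_Icc_self hz)) ?_ ?_ ht
    · intro z hz v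
      rw [hv v, map_smul, map_smul, map_smul, map_smul, hω z hz]
    · intro z hz v g
      rw [hv v, map_smul, map_smul, map_smul, hAd z hz]
  intro t ht
  rw [← key t ht, hP.act_actDiv (h t ht)]

end Unique

end PrincipalBundles

/-! ### Local lifts with prescribed connection form -/

section LocalLift

variable {EB : Type*} [NormedAddCommGroup EB] [NormedSpace ℝ EB]
  {B : Type*} [TopologicalSpace B] [ChartedSpace EB B]
  {E : Type*} [NormedAddCommGroup E] [NormedSpace ℝ E] [FiniteDimensional ℝ E]
  {P : Type*} [TopologicalSpace P] [ChartedSpace E P] [IsManifold 𝓘(ℝ, E) ∞ P]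
  {EG : Type*} [NormedAddCommGroup EG] [NormedSpace ℝ EG] [CompleteSpace EG]
  {G : Type*} [Group G] [TopologicalSpace G] [ChartedSpace EG G] [LieGroup 𝓘(ℝ, EG) ∞ G]
  [MulAction Gᵐᵒᵖ P]
  {F : Type*} [NormedAddCommGroup F] [NormedSpace ℝ F]
  {π : P → B}

omit [CompleteSpace EG] in
theorem brk_smul_smul_self (X : EG) (a b : ℝ) : brk G (a • X) (b • X) = 0 := by
  have h1 : ∀ c : ℝ, ((c • X, 0) : EG × EG) = c • (X, 0) := by intro c; simp
  have h2 : ∀ c : ℝ, ((0, c • X) : EG × EG) = c • (0, X) := by intro c; simp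
  simp only [brk_eq, h1, h2, map_smul, _root_.smul_apply]
  rw [smul_comm, sub_self]

/-- Pulling back a scalar one-form to a product and multiplying it with `X`, as a linear map. -/
def fstSmul (F : Type*) [NormedAddCommGroup F] [NormedSpace ℝ F] (X : EG) :
    (F →L[ℝ] ℝ) →L[ℝ] (F × EG →L[ℝ] EG) :=
  (ContinuousLinearMap.compL ℝ (F × EG) ℝ EG (ContinuousLinearMap.toSpanSingleton ℝ X)).comp
    ((ContinuousLinearMap.compL ℝ (F × EG) F ℝ).flip (ContinuousLinearMap.fst ℝ F EG))

omit [CompleteSpace EG] in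
/-- If a family of linear equations `Ω z (v, Φ z v) = 0` is solved by `Φ` and `Ω` is closed on the
solutions, then `Φ` satisfies the integrability condition of the Frobenius theorem. -/
theorem integrable_of_curl_eq_zero {Ω : F × EG → F × EG →L[ℝ] EG} {Φ : F × EG → F →L[ℝ] EG}
    {z : F × EG} (hΩ : DifferentiableAt ℝ Ω z) (hΦ : DifferentiableAt ℝ Φ z)
    (h0 : ∀ᶠ z in 𝓝 z, ∀ v, Ω z (v, Φ z v) = 0)
    (hinj : ∀ w, Ω z (0, w) = 0 → w = 0) (v w : F)
    (hc : curl Ω z (v, Φ z v) (w, Φ z w) = 0) :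
    fderiv ℝ Φ z (v, Φ z v) w = fderiv ℝ Φ z (w, Φ z w) v := by
  have key : ∀ (ξ : F × EG) (v : F), fderiv ℝ Ω z ξ (v, Φ z v) + Ω z (0, fderiv ℝ Φ z ξ v) = 0 := by
    intro ξ v
    have h1 : HasFDerivAt (fun z => Φ z v) _ z := hΦ.hasFDerivAt.clm_apply (hasFDerivAt_const v z)
    have h2 : HasFDerivAt (fun z => ((v, Φ z v) : F × EG)) _ z := (hasFDerivAt_const v z).prodMk h1
    have h3 : HasFDerivAt (fun z => Ω z (v, Φ z v)) _ z := hΩ.hasFDerivAt.clm_apply h2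
    have h4 : HasFDerivAt (fun z => Ω z (v, Φ z v)) (0 : F × EG →L[ℝ] EG) z :=
      (hasFDerivAt_const (0 : EG) z).congr_of_eventuallyEq (by
        filter_upwards [h0] with z hz using hz v)
    have h5 := DFunLike.congr_fun (h3.unique h4) ξ
    simp only [_root_.add_apply, ContinuousLinearMap.comp_apply, ContinuousLinearMap.flip_apply,
      ContinuousLinearMap.prod_apply, _root_.zero_apply, map_zero, zero_add] at h5
    rw [add_comm]
    exact h5
  have h1 := key (v, Φ z v) w
  have h2 := key (w, Φ z w) v
  have h3 : Ω z (0, fderiv ℝ Φ z (v, Φ z v) w - fderiv ℝ Φ z (w, Φ z w) v) = 0 := by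
    have e : ((0 : F), fderiv ℝ Φ z (v, Φ z v) w - fderiv ℝ Φ z (w, Φ z w) v) =
      (0, fderiv ℝ Φ z (v, Φ z v) w) - (0, fderiv ℝ Φ z (w, Φ z w) v) := by simp
    rw [e, map_sub, eq_neg_of_add_eq_zero_right h1, eq_neg_of_add_eq_zero_right h2]
    rw [curl] at hc
    rw [neg_sub_neg, ← neg_sub, hc, neg_zero]
  exact sub_eq_zero.1 (hinj _ h3)

/-- The map `(y, x) ↦ g(y) symC(x)`, a lift of the identity to the total space over the product of the
domain of a local section `g` with the chart of the structure group at the identity. -/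
def actChart (G : Type*) [Group G] [TopologicalSpace G] [ChartedSpace EG G] [MulAction Gᵐᵒᵖ P]
    (g : F → P) (z : F × EG) : P := g z.1 <• symC G z.2

omit [FiniteDimensional ℝ E] [IsManifold 𝓘(ℝ, E) ∞ P] [CompleteSpace EG] in
theorem eventually_contMDiffAt_actChart
    (hP : ContMDiff (𝓘(ℝ, E).prod 𝓘(ℝ, EG)) 𝓘(ℝ, E) ∞ (fun z : P × G => z.1 <• z.2)) {g : F → P}
    {y₀ : F} (hg : ∀ᶠ y in 𝓝 y₀, ContMDiffAt 𝓘(ℝ, F) 𝓘(ℝ, E) ∞ g y) :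
    ∀ᶠ z in 𝓝 (y₀, (oneC G : EG)), ContMDiffAt 𝓘(ℝ, F × EG) 𝓘(ℝ, E) ∞ (actChart G g) z := by
  have hfst : Filter.Tendsto Prod.fst (𝓝 (y₀, (oneC G : EG))) (𝓝 y₀) :=
    continuous_fst.tendsto' _ _ rfl
  have hsnd : Filter.Tendsto Prod.snd (𝓝 (y₀, (oneC G : EG))) (𝓝 (oneC G : EG)) :=
    continuous_snd.tendsto' _ _ rfl
  filter_upwards [hfst.eventually hg, hsnd.eventually (eventually_symC (G := G))] with z hz1 hz3
  have h2 : ContMDiffAt 𝓘(ℝ, F × EG) 𝓘(ℝ, E) ∞ (fun z : F × EG => g z.1) z :=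
    hz1.comp z contDiffAt_fst.contMDiffAt
  have h3 : ContMDiffAt 𝓘(ℝ, F × EG) 𝓘(ℝ, EG) ∞ (fun z : F × EG => symC G z.2) z :=
    ContMDiffAt.comp z (g := symC G) (contMDiffAt_extChartAt_symm hz3)
      contDiffAt_snd.contMDiffAt
  exact (hP _).comp z (h2.prodMk h3)

omit [FiniteDimensional ℝ E] [CompleteSpace EG] in
theorem Connection.pull_actChart_inr (A : Connection E P EG G)
    (hP : ContMDiff (𝓘(ℝ, E).prod 𝓘(ℝ, EG)) 𝓘(ℝ, E) ∞ (fun z : P × G => z.1 <• z.2)) {g : F → P}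
    {y₀ : F} (hg : ∀ᶠ y in 𝓝 y₀, ContMDiffAt 𝓘(ℝ, F) 𝓘(ℝ, E) ∞ g y) (w : EG) :
    pull (F × EG) A.co (actChart (EG := EG) G g) (y₀, oneC G) (0, w) = w := by
  have hΨ := (eventually_contMDiffAt_actChart (G := G) hP hg).self_of_nhds
  have h1 : MDifferentiableAt 𝓘(ℝ, F × EG) 𝓘(ℝ, E) (actChart (EG := EG) G g)
      ((fun w : EG => (y₀, w)) (oneC G)) := hΨ.mdifferentiableAt (by simp)
  have h2 : DifferentiableAt ℝ (fun w : EG => (y₀, w)) (oneC G) := by fun_prop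
  have h3 := tD_comp_apply (F := F × EG) (f := actChart (EG := EG) G g)
    (g := fun w : EG => (y₀, w)) h1
    h2.mdifferentiableAt w
  have h4 : tD EG (F × EG) (fun w : EG => (y₀, w)) (oneC G) w = (0, w) := by
    have h5 : HasFDerivAt (fun w : EG => (y₀, w))
      ((0 : EG →L[ℝ] F).prod (ContinuousLinearMap.id ℝ EG)) (oneC G) :=
      (hasFDerivAt_const y₀ (oneC G : EG)).prodMk (hasFDerivAt_id (oneC G : EG))
    rw [tD_eq_fderiv, h5.fderiv]
    rfl
  have h5 := tD_comp_apply (F := EG) (f := fun k : G => g y₀ <• k) (g := symC G)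
    (z := (oneC G : EG)) ((contMDiff_act_right hP _ _).mdifferentiableAt (by simp))
    ((contMDiffAt_symC (G := G)).mdifferentiableAt (by simp)) w
  have h6 : tD EG EG (symC G) (oneC G : EG) = ContinuousLinearMap.id ℝ EG := tD_chart_symm_self 1
  have h7 : actChart (EG := EG) G g (y₀, oneC G) = g y₀ := by simp only [actChart, symC_oneC]; simp
  rw [h4] at h3
  rw [h6, symC_oneC] at h5
  have h8 : tD (F × EG) E (actChart (EG := EG) G g) (y₀, oneC G) (0, w) = fund G (g y₀) w :=
    h3.symm.trans h5
  rw [pull_apply, h7, h8, A.co_fund]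

/-- The linear equations `Ω z (v, w) = 0` are solved by `w = Φ z v`, where `Φ` is smooth near a point
where `Ω` is the identity on the second factor. -/
theorem exists_solution_linear {Ω : F × EG → F × EG →L[ℝ] EG} {z₀ : F × EG}
    (hΩ : ∀ᶠ z in 𝓝 z₀, ContDiffAt ℝ ∞ Ω z) (h0 : ∀ w, Ω z₀ (0, w) = w) :
    ∃ Φ : F × EG → F →L[ℝ] EG, (∀ᶠ z in 𝓝 z₀, ContDiffAt ℝ ∞ Φ z) ∧
      (∀ᶠ z in 𝓝 z₀, ∀ v, Ω z (v, Φ z v) = 0) ∧ ∀ᶠ z in 𝓝 z₀, ∀ w, Ω z (0, w) = 0 → w = 0 := by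
  let b : F × EG → EG →L[ℝ] EG := fun z => (Ω z).comp (ContinuousLinearMap.inr ℝ F EG)
  let c : F × EG → F →L[ℝ] EG := fun z => (Ω z).comp (ContinuousLinearMap.inl ℝ F EG)
  have hb0 : b z₀ = ContinuousLinearEquiv.refl ℝ EG := by
    ext w
    exact h0 w
  have hb : ∀ᶠ z in 𝓝 z₀, ContDiffAt ℝ ∞ b z := by
    filter_upwards [hΩ] with z hz
    exact hz.clm_comp contDiffAt_const
  have hc : ∀ᶠ z in 𝓝 z₀, ContDiffAt ℝ ∞ c z := by
    filter_upwards [hΩ] with z hz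
    exact hz.clm_comp contDiffAt_const
  have hinv : ∀ᶠ z in 𝓝 z₀, ∃ e : EG ≃L[ℝ] EG, (e : EG →L[ℝ] EG) = b z := by
    have h1 := ContinuousLinearEquiv.nhds (ContinuousLinearEquiv.refl ℝ EG)
    rw [← hb0] at h1
    exact hb.self_of_nhds.continuousAt.eventually h1
  refine ⟨fun z => -((b z).inverse.comp (c z)), ?_, ?_, ?_⟩
  · filter_upwards [hb, hc, hinv] with z hz1 hz2 hz3
    obtain ⟨e, he⟩ := hz3
    have h1 : ContDiffAt ℝ ∞ (ContinuousLinearMap.inverse : (EG →L[ℝ] EG) → EG →L[ℝ] EG) (b z) := by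
      rw [← he]
      exact contDiffAt_map_inverse e
    exact ((h1.comp z hz1).clm_comp hz2).neg
  · filter_upwards [hinv] with z hz v
    obtain ⟨e, he⟩ := hz
    have h4 : (-((b z).inverse.comp (c z))) v = -(e.symm (c z v)) := by
      change -((b z).inverse (c z v)) = _
      rw [← he, ContinuousLinearMap.inverse_equiv]
      rfl
    rw [h4]
    have h1 : ((v, -(e.symm (c z v))) : F × EG) = ContinuousLinearMap.inl ℝ F EG v +
      ContinuousLinearMap.inr ℝ F EG (-(e.symm (c z v))) := by simp
    have h2 : Ω z (ContinuousLinearMap.inr ℝ F EG (-(e.symm (c z v)))) =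
      b z (-(e.symm (c z v))) := rfl
    have h3 : Ω z (ContinuousLinearMap.inl ℝ F EG v) = c z v := rfl
    rw [h1, map_add, h2, h3, ← he, map_neg]
    simp
  · filter_upwards [hinv] with z hz w hw
    obtain ⟨e, he⟩ := hz
    have h1 : e w = 0 := by
      rw [← ContinuousLinearEquiv.coe_coe, he]; exact hw
    simpa using h1

/-- Local existence of lifts with prescribed connection form, over a normed space: if the
curvature of `A`, evaluated on lifts of tangent vectors of the image of `f`, is `dκ X`, then `f` has
local lifts on which the connection form is `κ X`. -/
theorem IsPrincipalBundle.exists_local_lift (hP : IsPrincipalBundle EB E EG G π)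
    (A : Connection E P EG G) {f : F → B} {κ : F → F →L[ℝ] ℝ} {X : EG}
    {y₀ : F} (hf : ∀ᶠ y in 𝓝 y₀, ContMDiffAt 𝓘(ℝ, F) 𝓘(ℝ, EB) ∞ f y)
    (hκ : ∀ᶠ y in 𝓝 y₀, ContDiffAt ℝ ∞ κ y)
    (hcurv : ∀ᶠ y in 𝓝 y₀, ∀ p, π p = f y → ∀ (u v : F) (u' v' : E),
      tD E EB π p u' = tD F EB f y u →
      tD E EB π p v' = tD F EB f y v → A.cvr p u' v' = curl κ y u v • X) :
    ∃ r > 0, ∃ lam : F → P, ContMDiffOn 𝓘(ℝ, F) 𝓘(ℝ, E) ∞ lam (Metric.ball y₀ r) ∧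
      ∀ y ∈ Metric.ball y₀ r, π (lam y) = f y ∧
        ∀ v, A.co (lam y) (tD F E lam y v) = κ y v • X := by
  obtain ⟨U, s, τ, hU, hx, hs, hsπ, hτ, hst⟩ := hP.locally_trivial (f y₀)
  set z₀ : F × EG := (y₀, oneC G) with hz₀
  let Ψ : F × EG → P := actChart G fun y => s (f y)
  have hfst : Filter.Tendsto Prod.fst (𝓝 z₀) (𝓝 y₀) := continuous_fst.tendsto' _ _ rfl
  have hsnd : Filter.Tendsto Prod.snd (𝓝 z₀) (𝓝 (oneC G : EG)) := continuous_snd.tendsto' _ _ rfl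
  have hfU : ∀ᶠ y in 𝓝 y₀, f y ∈ U :=
    hf.self_of_nhds.continuousAt.preimage_mem_nhds (hU.mem_nhds hx)
  have hsf : ∀ᶠ y in 𝓝 y₀, ContMDiffAt 𝓘(ℝ, F) 𝓘(ℝ, E) ∞ (fun y => s (f y)) y := by
    filter_upwards [hf, hfU] with y hy1 hy2 using (hs.contMDiffAt (hU.mem_nhds hy2)).comp y hy1
  have hΨ : ∀ᶠ z in 𝓝 z₀, ContMDiffAt 𝓘(ℝ, F × EG) 𝓘(ℝ, E) ∞ Ψ z :=
    eventually_contMDiffAt_actChart hP.smooth_act hsf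
  have hπΨ : ∀ᶠ z in 𝓝 z₀, π (Ψ z) = f z.1 := by
    filter_upwards [hfst.eventually hfU] with z hz
    exact (hP.proj_act _ _).trans (hsπ _ hz)
  let Ω : F × EG → F × EG →L[ℝ] EG := fun z => pull (F × EG) A.co Ψ z - fstSmul F X (κ z.1)
  have hΩ : ∀ᶠ z in 𝓝 z₀, ContDiffAt ℝ ∞ Ω z := by
    filter_upwards [hΨ, hfst.eventually hκ] with z hz1 hz2
    exact (A.smoothForm_co.contDiffAt_pull hz1).sub
      ((fstSmul F X).contDiff.contDiffAt.comp z (hz2.comp z contDiffAt_fst))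
  obtain ⟨Φ, hΦ, hsol, hinj⟩ := exists_solution_linear hΩ fun w => by
    have h1 := A.pull_actChart_inr hP.smooth_act hsf w
    change pull (F × EG) A.co Ψ z₀ (0, w) - κ y₀ 0 • X = w
    rw [h1, map_zero, zero_smul, sub_zero]
  have hform : ∀ᶠ z in 𝓝 z₀, ∀ v, A.co (Ψ z) (tD (F × EG) E Ψ z (v, Φ z v)) = κ z.1 v • X := by
    filter_upwards [hsol] with z hz v
    exact sub_eq_zero.1 (hz v)
  have hproj : ∀ᶠ z in 𝓝 z₀, ∀ v w, tD E EB π (Ψ z) (tD (F × EG) E Ψ z (v, w)) =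
      tD F EB f z.1 v := by
    filter_upwards [hΨ, hfst.eventually hf, hπΨ.eventually_nhds] with z hz1 hz2 hz3 v w
    rw [← tD_comp_apply (F := E) (f := π) (g := Ψ)
      ((hP.smooth_proj _).mdifferentiableAt (by simp)) (hz1.mdifferentiableAt (by simp)),
      tD_congr hz3]
    have h1 : DifferentiableAt ℝ (Prod.fst : F × EG → F) z := differentiableAt_fst
    rw [tD_comp_apply (F := F) (f := f) (g := Prod.fst) (hz2.mdifferentiableAt (by simp))
      h1.mdifferentiableAt, tD_eq_fderiv, fderiv_fst]
    rfl
  have hint : ∀ᶠ z in 𝓝 z₀, ∀ v w,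
      fderiv ℝ Φ z (v, Φ z v) w = fderiv ℝ Φ z (w, Φ z w) v := by
    filter_upwards [hΩ, hΦ, hsol.eventually_nhds, hinj, hΨ, hfst.eventually hκ, hform, hproj,
      hfst.eventually hcurv, hπΨ] with z a1 a2 a3 a4 a5 a6 a7 a8 a9 a10 v w
    refine integrable_of_curl_eq_zero (a1.differentiableAt (by simp))
      (a2.differentiableAt (by simp)) a3 a4 v w ?_
    have d1 : DifferentiableAt ℝ (pull (F × EG) A.co Ψ) z :=
      (A.smoothForm_co.contDiffAt_pull a5).differentiableAt (by simp)
    have d2 : HasFDerivAt (fun z : F × EG => fstSmul F X (κ z.1))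
        ((fstSmul F X).comp ((fderiv ℝ κ z.1).comp (ContinuousLinearMap.fst ℝ F EG))) z :=
      (fstSmul F X).hasFDerivAt.comp z
        ((a6.differentiableAt (by simp)).hasFDerivAt.comp z hasFDerivAt_fst)
    have d3 : fderiv ℝ Ω z = fderiv ℝ (pull (F × EG) A.co Ψ) z -
      (fstSmul F X).comp ((fderiv ℝ κ z.1).comp (ContinuousLinearMap.fst ℝ F EG)) :=
      (d1.hasFDerivAt.sub d2).fderiv
    have d4 : curl Ω z (v, Φ z v) (w, Φ z w) =
        curl (pull (F × EG) A.co Ψ) z (v, Φ z v) (w, Φ z w) - curl κ z.1 v w • X := by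
      have d5 : ∀ ξ η : F × EG, (fstSmul F X).comp ((fderiv ℝ κ z.1).comp
          (ContinuousLinearMap.fst ℝ F EG)) ξ η = (fderiv ℝ κ z.1 ξ.1 η.1) • X := fun _ _ => rfl
      rw [curl, d3, _root_.sub_apply, _root_.sub_apply, _root_.sub_apply, _root_.sub_apply,
        d5, d5, curl, curl, sub_smul]
      abel
    have d6 := a9 (Ψ z) a10 v w _ _ (a8 v (Φ z v)) (a8 w (Φ z w))
    rw [Connection.cvr, a7, a7, brk_smul_smul_self, add_zero] at d6
    rw [d4, A.smoothForm_co.curl_pull a5, d6, sub_self]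
  obtain ⟨u, hu0, r, hr, hu1, hu2⟩ := exists_solution_total_differential hΦ hint
  have hucont : Filter.Tendsto (fun y => (y, u y)) (𝓝 y₀) (𝓝 z₀) := by
    have h1 : ContinuousAt (fun y => (y, u y)) y₀ :=
      continuousAt_id.prodMk (hu2 y₀ (Metric.mem_ball_self hr)).continuousAt
    have h2 := h1.tendsto
    rwa [hu0] at h2
  obtain ⟨r', hr', hall⟩ := Metric.eventually_nhds_iff_ball.1
    (hucont.eventually ((hΨ.and hπΨ).and hform))
  refine ⟨min r r', lt_min hr hr', fun y => Ψ (y, u y), ?_, ?_⟩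
  · intro y hy
    have h1 := Metric.ball_subset_ball (min_le_left r r') hy
    have h2 := hall y (Metric.ball_subset_ball (min_le_right r r') hy)
    have h3 : ContDiffAt ℝ ∞ (fun y => (y, u y)) y :=
      contDiffAt_id.prodMk (hu1.contDiffAt (Metric.isOpen_ball.mem_nhds h1))
    exact (ContMDiffAt.comp y (g := Ψ) h2.1.1 h3.contMDiffAt).contMDiffWithinAt
  · intro y hy
    have h1 := Metric.ball_subset_ball (min_le_left r r') hy
    have h2 := hall y (Metric.ball_subset_ball (min_le_right r r') hy)
    refine ⟨h2.1.2, fun v => ?_⟩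
    have h3 : HasFDerivAt (fun y => (y, u y)) ((ContinuousLinearMap.id ℝ F).prod (Φ (y, u y))) y :=
      (hasFDerivAt_id y).prodMk (hu2 y h1)
    rw [tD_comp_apply (F := F × EG) (f := Ψ) (g := fun y => (y, u y))
      (h2.1.1.mdifferentiableAt (by simp)) h3.differentiableAt.mdifferentiableAt, tD_eq_fderiv,
      h3.fderiv]
    exact h2.2 v

end LocalLift

/-! ### Global lifts over simply connected manifolds -/

section Cocycle

variable {Y : Type*} [TopologicalSpace Y] {G : Type*} [Group G]

/-- The covering space with discrete fibre `G` that is glued from products by a locally constant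
cocycle. -/
def cocycleCore [TopologicalSpace G] [DiscreteTopology G] (U : Y → Set Y)
    (hU : ∀ i, IsOpen (U i)) (hmem : ∀ i, i ∈ U i)
    (c : Y → Y → Y → G)
    (hc : ∀ i j, ∀ x ∈ U i ∩ U j, ∀ᶠ z in 𝓝 x, c i j z = c i j x)
    (hcomp : ∀ i j k, ∀ x ∈ U i ∩ U j ∩ U k, c k j x * c j i x = c k i x) :
    FiberBundleCore Y Y (G) where
  baseSet := U
  isOpen_baseSet := hU
  indexAt := id
  mem_baseSet_at := hmem
  coordChange i j x g := c j i x * g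
  coordChange_self i x hx v := by
    have := hcomp i i i x ⟨⟨hx, hx⟩, hx⟩
    have h1 : c i i x = 1 := by simpa using this
    change c i i x * v = v
    rw [h1, one_mul]
  continuousOn_coordChange i j := by
    rintro ⟨x, g⟩ ⟨hx, -⟩
    refine ContinuousAt.continuousWithinAt ?_
    have h1 : ∀ᶠ p : Y × G in 𝓝 (x, g), c j i p.1 = c j i x ∧ p.2 = g := by
      refine ((continuous_fst.tendsto (x, g)).eventually (hc j i x ⟨hx.2, hx.1⟩)).and ?_
      exact (continuous_snd.tendsto (x, g)).eventually
        ((isOpen_discrete {g}).mem_nhds rfl)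
    refine (continuousAt_const (y := c j i x * g)).congr ?_
    filter_upwards [h1] with p hp
    rw [hp.1, hp.2]
  coordChange_comp i j k x hx v := by
    rw [← mul_assoc, hcomp i j k x hx]

/-- On a simply connected space, every locally constant cocycle is trivial. -/
theorem exists_cocycle_trivialization [SimplyConnectedSpace Y] [LocallyPathConnectedSpace Y]
    (U : Y → Set Y) (hU : ∀ i, IsOpen (U i)) (hmem : ∀ i, i ∈ U i)
    (c : Y → Y → Y → G)
    (hc : ∀ i j, ∀ x ∈ U i ∩ U j, ∀ᶠ z in 𝓝 x, c i j z = c i j x)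
    (hcomp : ∀ i j k, ∀ x ∈ U i ∩ U j ∩ U k, c k j x * c j i x = c k i x) (y₀ : Y) (g₀ : G) :
    ∃ h : Y → Y → G, h y₀ y₀ = g₀ ∧ (∀ i j, ∀ x ∈ U i ∩ U j, h i x = c i j x * h j x) ∧
      ∀ i, ∀ x ∈ U i, ∀ᶠ z in 𝓝 x, h i z = h i x := by
  let _ : TopologicalSpace G := ⊥
  have _ : DiscreteTopology G := ⟨rfl⟩
  let Z := cocycleCore U hU hmem c hc hcomp
  have hcov : IsCoveringMap (Bundle.TotalSpace.proj : Bundle.TotalSpace (G) Z.Fiber → Y) :=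
    FiberBundle.isCoveringMap
  obtain ⟨S, ⟨hS0, hS⟩, -⟩ := hcov.existsUnique_continuousMap_lifts (ContinuousMap.id Y) y₀
    (⟨y₀, g₀⟩ : Bundle.TotalSpace (G) Z.Fiber) rfl
  have hproj : ∀ x, (S x).proj = x := fun x => congrFun hS x
  let h : Y → Y → G := fun i x => (Z.localTriv i (S x)).2
  let σ : Y → G := fun x => (S x).2
  have hval : ∀ i x, h i x = c i x x * σ x := by
    intro i x
    have h1 : h i x = c i (S x).proj (S x).proj * σ x := rfl
    rw [h1, hproj]
  refine ⟨h, ?_, ?_, ?_⟩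
  · have h1 := hcomp y₀ y₀ y₀ y₀ ⟨⟨hmem _, hmem _⟩, hmem _⟩
    have h2 : c y₀ y₀ y₀ = 1 := by simpa using h1
    rw [hval, h2, one_mul]
    change (S y₀).2 = g₀
    rw [hS0]
  · intro i j x hx
    rw [hval, hval, ← mul_assoc, hcomp x j i x ⟨⟨hmem x, hx.2⟩, hx.1⟩]
  · intro i x hx
    have h1 : ContinuousAt (fun z => (Z.localTriv i (S z)).2) x := by
      have h2 : S x ∈ (Z.localTriv i).source := by
        rw [Z.mem_localTriv_source]
        change (S x).proj ∈ U i
        rw [hproj]; exact hx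
      exact continuous_snd.continuousAt.comp
        (((Z.localTriv i).continuousAt h2).comp S.continuous.continuousAt)
    exact h1.eventually ((isOpen_discrete {(Z.localTriv i (S x)).2}).mem_nhds rfl)

end Cocycle

section GlobalLift

variable {EB : Type*} [NormedAddCommGroup EB] [NormedSpace ℝ EB]
  {B : Type*} [TopologicalSpace B] [ChartedSpace EB B]
  {E : Type*} [NormedAddCommGroup E] [NormedSpace ℝ E] [FiniteDimensional ℝ E]
  {P : Type*} [TopologicalSpace P] [ChartedSpace E P] [IsManifold 𝓘(ℝ, E) ∞ P]
  {EG : Type*} [NormedAddCommGroup EG] [NormedSpace ℝ EG] [CompleteSpace EG]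
  {G : Type*} [Group G] [TopologicalSpace G] [ChartedSpace EG G] [LieGroup 𝓘(ℝ, EG) ∞ G]
  [MulAction Gᵐᵒᵖ P]
  {F : Type*} [NormedAddCommGroup F] [NormedSpace ℝ F]
  {Y : Type*} [TopologicalSpace Y] [ChartedSpace F Y] [IsManifold 𝓘(ℝ, F) ∞ Y]
  {π : P → B}

theorem IsPrincipalBundle.exists_local_lift_manifold (hP : IsPrincipalBundle EB E EG G π)
    (A : Connection E P EG G) {f : Y → B} (hf : ContMDiff 𝓘(ℝ, F) 𝓘(ℝ, EB) ∞ f)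
    {κ : Y → F →L[ℝ] ℝ} (hκ : SmoothForm κ) {X : EG}
    (hcurv : ∀ y p, π p = f y → ∀ (u v : F) (u' v' : E), tD E EB π p u' = tD F EB f y u →
      tD E EB π p v' = tD F EB f y v → A.cvr p u' v' = extD κ y u v • X) (y₀ : Y) :
    ∃ U : Set Y, IsOpen U ∧ y₀ ∈ U ∧ ∃ lam : Y → P, ContMDiffOn 𝓘(ℝ, F) 𝓘(ℝ, E) ∞ lam U ∧
      ∀ y ∈ U, π (lam y) = f y ∧ ∀ v, A.co (lam y) (tD F E lam y v) = κ y v • X := by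
  set x₀ := extChartAt 𝓘(ℝ, F) y₀ y₀ with hx₀
  set ψ := extChartAt 𝓘(ℝ, F) y₀ with hψ
  have htarget : ∀ᶠ x in 𝓝 x₀, x ∈ ψ.target :=
    (isOpen_extChartAt_target y₀).mem_nhds (mem_extChartAt_target (I := 𝓘(ℝ, F)) y₀)
  obtain ⟨r, hr, lam, hlam, hprop⟩ := hP.exists_local_lift A (f := fun x => f (ψ.symm x))
    (κ := pull F κ ψ.symm) (X := X) (y₀ := x₀) (by
      filter_upwards [htarget] with x hx
      exact (hf _).comp x (contMDiffAt_extChartAt_symm hx)) (by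
      filter_upwards [htarget] with x hx
      exact hκ.contDiffAt_pull (contMDiffAt_extChartAt_symm hx)) (by
      filter_upwards [htarget] with x hx p hp u v u' v' hu hv
      have h1 := mdifferentiableAt_extChartAt_symm hx
      have h2 : MDifferentiableAt 𝓘(ℝ, F) 𝓘(ℝ, EB) f (ψ.symm x) := (hf _).mdifferentiableAt (by simp)
      rw [tD_comp_apply (F := F) (f := f) (g := ψ.symm) h2 h1] at hu hv
      rw [hκ.curl_pull (contMDiffAt_extChartAt_symm hx)]
      exact hcurv _ p hp _ _ u' v' hu hv)
  refine ⟨ψ.source ∩ ψ ⁻¹' Metric.ball x₀ r, ?_, ?_, fun y => lam (ψ y), ?_, ?_⟩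
  · exact (continuousOn_extChartAt y₀).isOpen_inter_preimage (isOpen_extChartAt_source y₀)
      Metric.isOpen_ball
  · exact ⟨mem_extChartAt_source y₀, Metric.mem_ball_self hr⟩
  · intro y hy
    exact ((hlam.contMDiffAt (Metric.isOpen_ball.mem_nhds hy.2)).comp y
      (contMDiffAt_extChartAt_of_mem hy.1)).contMDiffWithinAt
  · intro y hy
    have h1 := hprop _ hy.2
    have e : ψ.symm (ψ y) = y := ψ.left_inv hy.1
    rw [e] at h1
    refine ⟨h1.1, fun v => ?_⟩
    rw [tD_comp_apply (F := F) (f := lam) (g := ψ)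
      ((hlam.contMDiffAt (Metric.isOpen_ball.mem_nhds hy.2)).mdifferentiableAt (by simp))
      (mdifferentiableAt_extChartAt_of_mem hy.1), h1.2, pull_apply, e, tD_symm_chart_comp hy.1]

omit [FiniteDimensional ℝ E] [CompleteSpace EG] [IsManifold 𝓘(ℝ, F) ∞ Y] in
/-- Right translation preserves a connection form with `Ad`-invariant values. -/
theorem Connection.co_tD_act_const (A : Connection E P EG G)
    (hP : ContMDiff (𝓘(ℝ, E).prod 𝓘(ℝ, EG)) 𝓘(ℝ, E) ∞ (fun z : P × G => z.1 <• z.2))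
    {f : Y → P} {y : Y} (hf : MDifferentiableAt 𝓘(ℝ, F) 𝓘(ℝ, E) f y) (g : G) (v : F) :
    A.co (f y <• g) (tD F E (fun y => f y <• g) y v) = AdC g⁻¹ (A.co (f y) (tD F E f y v)) := by
  have h := A.co_tD_act hP hf (g := fun _ => g) mdifferentiableAt_const v
  rw [h, tD_const]
  simp

/-- Existence of lifts with prescribed connection form over a simply connected manifold: if the
curvature of `A`, evaluated on lifts of tangent vectors of the image of `f`, is `dκ X`, then `f` has
a lift on which the connection form is `κ X`. -/
theorem IsPrincipalBundle.exists_lift [SimplyConnectedSpace Y]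
    (hP : IsPrincipalBundle EB E EG G π)
    (A : Connection E P EG G) {f : Y → B} (hf : ContMDiff 𝓘(ℝ, F) 𝓘(ℝ, EB) ∞ f)
    {κ : Y → F →L[ℝ] ℝ} (hκ : SmoothForm κ) {X : EG} (hX : ∀ g : G, AdC g X = X)
    (hcurv : ∀ y p, π p = f y → ∀ (u v : F) (u' v' : E), tD E EB π p u' = tD F EB f y u →
      tD E EB π p v' = tD F EB f y v → A.cvr p u' v' = extD κ y u v • X)
    {y₀ : Y} {p₀ : P} (h₀ : π p₀ = f y₀) :
    ∃ lam : Y → P, ContMDiff 𝓘(ℝ, F) 𝓘(ℝ, E) ∞ lam ∧ lam y₀ = p₀ ∧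
      ∀ y, π (lam y) = f y ∧ ∀ v, A.co (lam y) (tD F E lam y v) = κ y v • X := by
  have : LocallyPathConnectedSpace Y := ChartedSpace.locallyPathConnectedSpace F Y
  choose U hU hmem L hL hprop using hP.exists_local_lift_manifold A hf hκ hcurv
  let c : Y → Y → Y → G := fun i j x => actDiv G (L i x) (L j x)
  have hπ : ∀ i j, ∀ x ∈ U i ∩ U j, π (L i x) = π (L j x) := by
    intro i j x hx
    rw [(hprop i x hx.1).1, (hprop j x hx.2).1]
  have hc : ∀ i j, ∀ x ∈ U i ∩ U j, ∀ᶠ z in 𝓝 x, c i j z = c i j x := by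
    intro i j x hx
    refine hP.eventually_actDiv_eq A ((hU i).inter (hU j)) ((hL i).mono inter_subset_left)
      ((hL j).mono inter_subset_right) (hπ i j) ?_ ?_ hx
    · intro z hz v
      rw [(hprop i z hz.1).2, (hprop j z hz.2).2]
    · intro z hz v g
      rw [(hprop i z hz.1).2, map_smul, hX]
  have hcomp : ∀ i j k, ∀ x ∈ U i ∩ U j ∩ U k, c k j x * c j i x = c k i x := by
    intro i j k x hx
    refine (hP.actDiv_eq ?_).symm
    rw [← act_act, hP.act_actDiv (hπ k j x ⟨hx.2, hx.1.2⟩),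
      hP.act_actDiv (hπ j i x ⟨hx.1.2, hx.1.1⟩)]
  obtain ⟨h, h0, h1, h2⟩ := exists_cocycle_trivialization U hU hmem c hc hcomp y₀
    (actDiv G (L y₀ y₀) p₀)
  let lam : Y → P := fun y => L y y <• h y y
  have hlam : ∀ y, lam =ᶠ[𝓝 y] fun z => L y z <• h y y := by
    intro y
    filter_upwards [h2 y y (hmem y), (hU y).mem_nhds (hmem y)] with z hz hz'
    have h3 : h y y = c y z z * h z z := by rw [← hz, h1 y z z ⟨hz', hmem z⟩]
    rw [h3, ← act_act, hP.act_actDiv (hπ y z z ⟨hz', hmem z⟩)]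
  refine ⟨lam, fun y => ?_, ?_, fun y => ⟨?_, fun v => ?_⟩⟩
  · refine ContMDiffAt.congr_of_eventuallyEq ?_ (hlam y)
    exact (contMDiff_act_left hP.smooth_act _ _).comp y
      ((hL y).contMDiffAt ((hU y).mem_nhds (hmem y)))
  · change L y₀ y₀ <• h y₀ y₀ = p₀
    rw [h0, hP.act_actDiv (by rw [(hprop y₀ y₀ (hmem y₀)).1, h₀])]
  · change π (L y y <• h y y) = f y
    rw [hP.proj_act, (hprop y y (hmem y)).1]
  · rw [tD_congr (hlam y)]
    change A.co (L y y <• h y y) _ = _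
    rw [A.co_tD_act_const hP.smooth_act (f := L y)
      (((hL y).contMDiffAt ((hU y).mem_nhds (hmem y))).mdifferentiableAt (by simp)),
      (hprop y y (hmem y)).2, map_smul, hX]

end GlobalLift

/-! ### The curvature is horizontal -/

section Horizontal

variable {EB : Type*} [NormedAddCommGroup EB] [NormedSpace ℝ EB]
  {B : Type*} [TopologicalSpace B] [ChartedSpace EB B]
  {E : Type*} [NormedAddCommGroup E] [NormedSpace ℝ E]
  {P : Type*} [TopologicalSpace P] [ChartedSpace E P] [IsManifold 𝓘(ℝ, E) ∞ P]
  {EG : Type*} [NormedAddCommGroup EG] [NormedSpace ℝ EG]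
  {G : Type*} [Group G] [TopologicalSpace G] [ChartedSpace EG G] [LieGroup 𝓘(ℝ, EG) ∞ G]
  [MulAction Gᵐᵒᵖ P]
  {π : P → B}

theorem IsPrincipalBundle.eq_fund (hP : IsPrincipalBundle EB E EG G π) (A : Connection E P EG G)
    {p : P} {v : E} (h : tD E EB π p v = 0) : v = fund G p (A.co p v) := by
  obtain ⟨U, s, τ, hU, hx, hs, hsπ, hτ, hst⟩ := hP.locally_trivial (π p)
  have hU' : IsOpen (π ⁻¹' U) := hU.preimage hP.smooth_proj.continuous
  have h1 : MDifferentiableAt 𝓘(ℝ, E) 𝓘(ℝ, EB) π p := (hP.smooth_proj p).mdifferentiableAt (by simp)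
  have h2 : MDifferentiableAt 𝓘(ℝ, EB) 𝓘(ℝ, E) s (π p) :=
    (hs.contMDiffAt (hU.mem_nhds hx)).mdifferentiableAt (by simp)
  have h3 : MDifferentiableAt 𝓘(ℝ, E) 𝓘(ℝ, EG) τ p :=
    (hτ.contMDiffAt (hU'.mem_nhds hx)).mdifferentiableAt (by simp)
  have h4 : (fun p => s (π p) <• τ p) =ᶠ[𝓝 p] fun p => p := by
    filter_upwards [hU'.mem_nhds hx] with p' hp' using hst p' hp'
  have h5 := tD_act hP.smooth_act (f := fun p => s (π p)) (g := τ) (y := p)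
    (MDifferentiableAt.comp (I' := 𝓘(ℝ, EB)) p h2 h1) h3 v
  rw [tD_congr h4, tD_id, tD_comp_apply (F := EB) (f := s) (g := π) h2 h1, h, map_zero, map_zero,
    zero_add, tD_act_right hP.smooth_act, hst p hx] at h5
  have h6 : v = fund G p (maurerCartan (τ p) (tD E EG τ p v)) := h5
  nth_rewrite 2 [h6]
  rw [A.co_fund]
  exact h6

theorem IsOneParam.maurerCartan_eq {γ : ℝ → G} {X : EG} (h : IsOneParam γ X) (s : ℝ) :
    maurerCartan (γ s) (tD ℝ EG γ s 1) = X := by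
  have h2 : ContMDiff 𝓘(ℝ, EG) 𝓘(ℝ, EG) ∞ (fun k : G => (γ s)⁻¹ * k) := contMDiff_mul_left
  have h1 := tD_comp_apply (F' := ℝ) (F := EG) (E := EG) (f := fun k : G => (γ s)⁻¹ * k)
    (g := γ) (z := s) ((h2 _).mdifferentiableAt (by simp))
    ((h.smooth s).mdifferentiableAt (by simp)) 1
  have h3 : (fun r => (γ s)⁻¹ * γ r) = fun r => γ (r - s) := by
    ext r
    rw [← h.neg, ← h.add]
    congr 1
    ring
  have h4 : HasDerivAt (fun r : ℝ => r - s) 1 s := (hasDerivAt_id s).sub_const s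
  have h5 : tD ℝ ℝ (fun r : ℝ => r - s) s 1 = 1 := by
    rw [tD_eq_fderiv]; exact h4.deriv
  rw [h3, tD_comp_apply (F := ℝ) (f := γ) (g := fun r => r - s)
    ((h.smooth _).mdifferentiableAt (by simp)) h4.differentiableAt.mdifferentiableAt, h5,
    sub_self, h.deriv] at h1
  exact h1.symm

theorem brk_add_left (u u' v : EG) : brk G (u + u') v = brk G u v + brk G u' v := by
  have h1 : ((u + u', 0) : EG × EG) = (u, 0) + (u', 0) := by simp
  have h2 : ((0, u + u') : EG × EG) = (0, u) + (0, u') := by simp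
  simp only [brk_eq, h1, h2, map_add, _root_.add_apply]
  abel

theorem brk_swap (u v : EG) : brk G u v = - brk G v u := by
  simp only [brk_eq, neg_sub]

theorem brk_neg_left (u v : EG) : brk G (-u) v = - brk G u v := by
  have h1 : ((-u, 0) : EG × EG) = -(u, 0) := by simp
  have h2 : ((0, -u) : EG × EG) = -(0, u) := by simp
  simp only [brk_eq, h1, h2, map_neg, _root_.neg_apply]
  abel

/-- The derivative of `s ↦ Ad(γ(s)⁻¹) w` along a one-parameter group. -/
theorem IsOneParam.hasDerivAt_AdC_inv {γ : ℝ → G} {X : EG} (h : IsOneParam γ X) (w : EG) :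
    HasDerivAt (fun s => AdC (γ s)⁻¹ w) (- brk G X w) 0 := by
  obtain ⟨D, hD, hD'⟩ := hasFDerivAt_AdC_symC (G := G) w
  let ζ : ℝ → EG := fun s => extChartAt 𝓘(ℝ, EG) (1 : G) (γ (-s))
  have hγ : ContMDiff 𝓘(ℝ, ℝ) 𝓘(ℝ, EG) ∞ fun s => γ (-s) := h.smooth.comp contDiff_neg.contMDiff
  have h0 : γ (-0) = 1 := by rw [neg_zero, h.zero]
  have hs : γ (-0) ∈ (extChartAt 𝓘(ℝ, EG) (1 : G)).source := by
    rw [h0]; exact mem_extChartAt_source (1 : G)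
  have hζ0 : ζ 0 = oneC G := by simp only [ζ, h0]; rfl
  have hζ : DifferentiableAt ℝ ζ 0 :=
    ((contMDiffAt_extChartAt_of_mem hs).comp (0 : ℝ) (hγ 0)).contDiffAt.differentiableAt (by simp)
  have hn : HasDerivAt (fun s : ℝ => -s) (-1) 0 := hasDerivAt_neg 0
  have h1 : tD ℝ ℝ (fun s : ℝ => -s) 0 1 = (-1 : ℝ) • 1 := by
    rw [tD_eq_fderiv, smul_eq_mul, mul_one]; exact hn.deriv
  have h2 : fderiv ℝ ζ 0 1 = -X := by
    rw [← tD_eq_fderiv, tD_comp_apply (F := EG) (f := extChartAt 𝓘(ℝ, EG) (1 : G))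
      (g := fun s => γ (-s)) (mdifferentiableAt_extChartAt_of_mem hs)
      ((hγ 0).mdifferentiableAt (by simp)), h0, tD_chart_self,
      tD_comp_apply (F := ℝ) (f := γ) (g := fun s => -s)
      ((h.smooth _).mdifferentiableAt (by simp)) hn.differentiableAt.mdifferentiableAt, h1,
      map_smul, neg_zero, h.deriv]
    simp
  have h3 : HasDerivAt ζ (-X) 0 := by
    have := hζ.hasFDerivAt.hasDerivAt
    rwa [h2] at this
  rw [← hζ0] at hD
  have h4 := hD.comp_hasDerivAt (0 : ℝ) h3
  rw [hD', brk_neg_left] at h4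
  refine h4.congr_of_eventuallyEq ?_
  have h5 : ∀ᶠ s in 𝓝 (0 : ℝ), γ (-s) ∈ (extChartAt 𝓘(ℝ, EG) (1 : G)).source :=
    (hγ 0).continuousAt.preimage_mem_nhds
      ((isOpen_extChartAt_source (I := 𝓘(ℝ, EG)) (1 : G)).mem_nhds hs)
  filter_upwards [h5] with s hs
  have h6 : symC G (ζ s) = γ (-s) := (extChartAt 𝓘(ℝ, EG) (1 : G)).left_inv hs
  simp only [Function.comp_apply, h6, h.neg]

variable [FiniteDimensional ℝ E] [CompleteSpace EG] [T2Space G]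

/-- The curvature vanishes on fundamental vectors: the connection form is computed on the surface
`(s, t) ↦ c(t) exp(s Y)`. -/
theorem Connection.cvr_fund (A : Connection E P EG G)
    (hP : ContMDiff (𝓘(ℝ, E).prod 𝓘(ℝ, EG)) 𝓘(ℝ, E) ∞ (fun z : P × G => z.1 <• z.2))
    (p : P) (Y : EG) (u : E) : A.cvr p (fund G p Y) u = 0 := by
  have hγ := isOneParam_expCurve (G := G) Y
  set γ := expCurve G Y
  set ψ := extChartAt 𝓘(ℝ, E) p
  let ℓ : ℝ × ℝ → E := fun z => ψ p + z.2 • u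
  let f : ℝ × ℝ → P := fun z => ψ.symm (ℓ z)
  let g : ℝ × ℝ → G := fun z => γ z.1
  let Q : ℝ × ℝ → P := fun z => f z <• g z
  have hℓ : ContDiff ℝ ∞ ℓ := contDiff_const.add (contDiff_snd.smul contDiff_const)
  have hℓd : ∀ z, HasFDerivAt ℓ ((ContinuousLinearMap.snd ℝ ℝ ℝ).smulRight u) z := fun z =>
    (hasFDerivAt_snd.smul_const u).const_add _
  have hℓ0 : ℓ 0 = ψ p := by simp [ℓ]
  have hf0 : f 0 = p := by simp only [f, hℓ0]; exact extChartAt_to_inv p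
  have hg0 : g 0 = 1 := hγ.zero
  have hmem : ∀ᶠ z in 𝓝 (0 : ℝ × ℝ), ℓ z ∈ ψ.target := by
    refine hℓ.continuous.continuousAt.eventually ((isOpen_extChartAt_target p).mem_nhds ?_)
    rw [hℓ0]
    exact mem_extChartAt_target (I := 𝓘(ℝ, E)) p
  have hfs : ∀ z, ℓ z ∈ ψ.target → ContMDiffAt 𝓘(ℝ, ℝ × ℝ) 𝓘(ℝ, E) ∞ f z := fun z hz =>
    ContMDiffAt.comp z (g := ψ.symm) (contMDiffAt_extChartAt_symm hz) hℓ.contMDiff.contMDiffAt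
  have hgs : ContMDiff 𝓘(ℝ, ℝ × ℝ) 𝓘(ℝ, EG) ∞ g := hγ.smooth.comp contDiff_fst.contMDiff
  have hgd : ∀ z ξ, tD (ℝ × ℝ) EG g z ξ = ξ.1 • tD ℝ EG γ z.1 1 := by
    intro z ξ
    have h1 : DifferentiableAt ℝ (Prod.fst : ℝ × ℝ → ℝ) z := differentiableAt_fst
    rw [tD_comp_apply (F := ℝ) (f := γ) (g := Prod.fst) ((hγ.smooth _).mdifferentiableAt (by simp))
      h1.mdifferentiableAt, tD_eq_fderiv, fderiv_fst, ← map_smul]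
    congr 1
    simp
  have hfd : ∀ z, ℓ z ∈ ψ.target → ∀ ξ, tD (ℝ × ℝ) E f z ξ = ξ.2 • tD E E ψ.symm (ℓ z) u := by
    intro z hz ξ
    rw [tD_comp_apply (F := E) (f := ψ.symm) (g := ℓ) (mdifferentiableAt_extChartAt_symm hz)
      (hℓd z).differentiableAt.mdifferentiableAt, tD_eq_fderiv, (hℓd z).fderiv, ← map_smul]
    rfl
  have hQ : ContMDiffAt 𝓘(ℝ, ℝ × ℝ) 𝓘(ℝ, E) ∞ Q 0 :=
    (hP _).comp 0 ((hfs 0 hmem.self_of_nhds).prodMk (hgs 0))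
  have hQ0 : Q 0 = p := by simp only [Q, hf0, hg0]; simp
  have hα : ∀ z, ℓ z ∈ ψ.target → ∀ ξ : ℝ × ℝ, pull (ℝ × ℝ) A.co Q z ξ =
      AdC (γ z.1)⁻¹ (A.co (f z) (ξ.2 • tD E E ψ.symm (ℓ z) u)) + ξ.1 • Y := by
    intro z hz ξ
    have h1 := A.co_tD_act hP (f := f) (g := g) ((hfs z hz).mdifferentiableAt (by simp))
      ((hgs z).mdifferentiableAt (by simp)) ξ
    rw [hgd, hfd z hz, map_smul (maurerCartan (g z)), hγ.maurerCartan_eq] at h1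
    exact h1
  have hu0 : tD E E ψ.symm (ℓ 0) u = u := by
    rw [hℓ0, tD_chart_symm_self]; rfl
  have hsm := (A.smoothForm_co.contDiffAt_pull hQ).differentiableAt (by simp)
  have hd : ∀ ξ η : ℝ × ℝ, HasDerivAt (fun r : ℝ => pull (ℝ × ℝ) A.co Q (r • ξ) η)
      (fderiv ℝ (pull (ℝ × ℝ) A.co Q) 0 ξ η) 0 := by
    intro ξ η
    have h1 : HasDerivAt (fun r : ℝ => r • ξ) ξ 0 := by
      simpa using (hasDerivAt_id (0 : ℝ)).smul_const ξ
    have h2 : HasFDerivAt (pull (ℝ × ℝ) A.co Q) (fderiv ℝ (pull (ℝ × ℝ) A.co Q) 0)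
        ((fun r : ℝ => r • ξ) 0) := by
      simpa using hsm.hasFDerivAt
    have h3 : HasDerivAt (fun r : ℝ => pull (ℝ × ℝ) A.co Q (r • ξ))
      (fderiv ℝ (pull (ℝ × ℝ) A.co Q) 0 ξ) 0 :=
      HasFDerivAt.comp_hasDerivAt (f := fun r : ℝ => r • ξ) (0 : ℝ) h2 h1
    simpa using h3.clm_apply (hasDerivAt_const (0 : ℝ) η)
  have e1 : fderiv ℝ (pull (ℝ × ℝ) A.co Q) 0 (0, 1) (1, 0) = 0 := by
    refine (hd (0, 1) (1, 0)).unique ((hasDerivAt_const (0 : ℝ) Y).congr_of_eventuallyEq ?_)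
    have h1 : Filter.Tendsto (fun r : ℝ => r • ((0, 1) : ℝ × ℝ)) (𝓝 0) (𝓝 0) :=
      (continuous_id.smul continuous_const).tendsto' _ _ (by simp)
    filter_upwards [h1.eventually hmem] with r hr
    rw [hα _ hr]
    simp
  have e2 : fderiv ℝ (pull (ℝ × ℝ) A.co Q) 0 (1, 0) (0, 1) = - brk G Y (A.co p u) := by
    refine (hd (1, 0) (0, 1)).unique ((hγ.hasDerivAt_AdC_inv (A.co p u)).congr_of_eventuallyEq ?_)
    have h1 : Filter.Tendsto (fun r : ℝ => r • ((1, 0) : ℝ × ℝ)) (𝓝 0) (𝓝 0) :=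
      (continuous_id.smul continuous_const).tendsto' _ _ (by simp)
    filter_upwards [h1.eventually hmem] with r hr
    have h2 : ℓ (r • ((1, 0) : ℝ × ℝ)) = ℓ 0 := by simp [ℓ]
    have h3 : f (r • ((1, 0) : ℝ × ℝ)) = p := by
      rw [← hf0]; simp only [f, h2]
    rw [hα _ hr, h2, h3, hu0]
    simp
  have hdQ : ∀ ξ, tD (ℝ × ℝ) E Q 0 ξ = ξ.2 • u + ξ.1 • fund G p Y := by
    intro ξ
    have h1 := tD_act hP (f := f) (g := g) ((hfs 0 hmem.self_of_nhds).mdifferentiableAt (by simp))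
      ((hgs 0).mdifferentiableAt (by simp)) ξ
    have h2 : (fun p : P => p <• (1 : G)) = fun p => p := by ext; simp
    rw [hgd, hfd 0 hmem.self_of_nhds, hf0, hg0, hu0, h2, tD_id] at h1
    refine h1.trans ?_
    congr 1
    rw [map_smul]
    congr 1
    change tD EG E (fun k : G => p <• k) 1 (tD ℝ EG γ 0 1) = _
    rw [hγ.deriv]
    rfl
  have h1 := A.smoothForm_co.curl_pull hQ (1, 0) (0, 1)
  rw [hdQ, hdQ, hQ0, curl, e1, e2] at h1
  simp only [zero_smul, one_smul, zero_add, add_zero, sub_zero] at h1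
  rw [Connection.cvr, ← h1, A.co_fund]
  abel

omit [FiniteDimensional ℝ E] in
theorem curl_add_left {V : Type*} [NormedAddCommGroup V] [NormedSpace ℝ V] (α : E → E →L[ℝ] V)
    (x u u' v : E) : curl α x (u + u') v = curl α x u v + curl α x u' v := by
  simp only [curl, map_add, _root_.add_apply]
  abel

omit [FiniteDimensional ℝ E] [CompleteSpace EG] [T2Space G] in
theorem Connection.cvr_add_left (A : Connection E P EG G) (p : P) (u u' v : E) :
    A.cvr p (u + u') v = A.cvr p u v + A.cvr p u' v := by
  simp only [Connection.cvr, extD, curl_add_left, map_add, brk_add_left]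
  abel

omit [FiniteDimensional ℝ E] [CompleteSpace EG] [T2Space G] in
theorem Connection.cvr_swap (A : Connection E P EG G) (p : P) (u v : E) :
    A.cvr p u v = - A.cvr p v u := by
  rw [Connection.cvr, Connection.cvr, extD, curl_swap, brk_swap, extD]
  abel

/-- The curvature depends only on the projections of its arguments to the base. -/
theorem IsPrincipalBundle.cvr_eq (hP : IsPrincipalBundle EB E EG G π) (A : Connection E P EG G)
    {p : P} {u u' v v' : E} (hu : tD E EB π p u = tD E EB π p u')
    (hv : tD E EB π p v = tD E EB π p v') : A.cvr p u v = A.cvr p u' v' := by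
  have key : ∀ {u u' : E} (v : E), tD E EB π p u = tD E EB π p u' →
      A.cvr p u v = A.cvr p u' v := by
    intro u u' v h
    have h1 : tD E EB π p (u - u') = 0 := by rw [map_sub, h, sub_self]
    have h2 := hP.eq_fund A h1
    have h3 : u = u' + fund G p (A.co p (u - u')) := by rw [← h2]; abel
    rw [h3, A.cvr_add_left, A.cvr_fund hP.smooth_act, add_zero]
  rw [key v hu, A.cvr_swap, key u' hv, ← A.cvr_swap]

end Horizontal

/-! ### Horizontal lifts and holonomy -/

section Lifts

variable {EB : Type*} [NormedAddCommGroup EB] [NormedSpace ℝ EB]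
  {B : Type*} [TopologicalSpace B] [ChartedSpace EB B]
  {E : Type*} [NormedAddCommGroup E] [NormedSpace ℝ E]
  {P : Type*} [TopologicalSpace P] [ChartedSpace E P] [IsManifold 𝓘(ℝ, E) ∞ P]
  {EG : Type*} [NormedAddCommGroup EG] [NormedSpace ℝ EG]
  {G : Type*} [Group G] [TopologicalSpace G] [ChartedSpace EG G]
  [MulAction Gᵐᵒᵖ P]
  {EN : Type*} [NormedAddCommGroup EN] [NormedSpace ℝ EN]
  {N : Type*} [TopologicalSpace N] [ChartedSpace EN N] [IsManifold 𝓘(ℝ, EN) ∞ N]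
  {EK : Type*} [NormedAddCommGroup EK] [NormedSpace ℝ EK]
  {K : Type*} [Group K] [TopologicalSpace K] [ChartedSpace EK K]
  [MulAction Kᵐᵒᵖ N]
  {π : P → B} {πN : N → B}

omit [TopologicalSpace B] in
theorem IsHorizontalLift.co_eq_zero {A : Connection E P EG G} {w : ℝ → B} {wP : ℝ → P}
    (h : IsHorizontalLift π A w wP) {t : ℝ} (ht : t ∈ Ioo (0 : ℝ) 1) :
    A.co (wP t) (tD ℝ E wP t 1) = 0 := by
  have h1 := h.horizontal t (Ioo_subset_Icc_self ht)
  rw [mfderivWithin_of_mem_nhds (Icc_mem_nhds ht.1 ht.2)] at h1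
  exact h1

omit [TopologicalSpace B] in
theorem IsHorizontalLift.mdifferentiableAt {A : Connection E P EG G} {w : ℝ → B} {wP : ℝ → P}
    (h : IsHorizontalLift π A w wP) {t : ℝ} (ht : t ∈ Ioo (0 : ℝ) 1) :
    MDifferentiableAt 𝓘(ℝ, ℝ) 𝓘(ℝ, E) wP t :=
  (h.smooth.contMDiffAt (Icc_mem_nhds ht.1 ht.2)).mdifferentiableAt (by simp)

omit [TopologicalSpace B] in
/-- By continuity, a path need only be shown to be horizontal at the interior points. -/
theorem IsHorizontalLift.of_interior (A : Connection E P EG G) {w : ℝ → B} {wP : ℝ → P}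
    (hs : ContMDiffOn 𝓘(ℝ, ℝ) 𝓘(ℝ, E) ∞ wP (Icc 0 1)) (hl : ∀ t ∈ Icc (0 : ℝ) 1, π (wP t) = w t)
    (hh : ∀ t ∈ Ioo (0 : ℝ) 1, A.co (wP t) (tD ℝ E wP t 1) = 0) : IsHorizontalLift π A w wP := by
  refine ⟨hs, hl, ?_⟩
  have h1 := hs.continuousOn_tangentMapWithin (by simp)
    (uniqueMDiffOn_iff_uniqueDiffOn.2 (uniqueDiffOn_Icc one_pos))
  have h2 : Continuous fun t : ℝ => (⟨t, 1⟩ : TangentBundle 𝓘(ℝ, ℝ) ℝ) := by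
    have h3 : ∀ v : ℝ, ContMDiff 𝓘(ℝ, ℝ) 𝓘(ℝ, ℝ).tangent ∞
        (fun x : ℝ => (⟨x, v⟩ : TangentBundle 𝓘(ℝ, ℝ) ℝ)) := by
      intro v x
      rw [Bundle.contMDiffAt_totalSpace]
      exact ⟨contMDiffAt_id, by simpa using contMDiffAt_const⟩
    exact (h3 1).continuous
  have h3 : ContinuousOn (fun t : ℝ => lieCoord (A.form (wP t)
      (mfderivWithin 𝓘(ℝ, ℝ) 𝓘(ℝ, E) wP (Icc 0 1) t (1 : ℝ)))) (Icc 0 1) :=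
    A.smooth.continuous.comp_continuousOn (h1.comp h2.continuousOn fun t ht => ht)
  have h4 : EqOn (fun t : ℝ => lieCoord (A.form (wP t)
      (mfderivWithin 𝓘(ℝ, ℝ) 𝓘(ℝ, E) wP (Icc 0 1) t (1 : ℝ)))) (fun _ => (0 : EG)) (Ioo 0 1) := by
    intro t ht
    have h5 := hh t ht
    simp only
    rw [mfderivWithin_of_mem_nhds (Icc_mem_nhds ht.1 ht.2)]
    exact h5
  intro t ht
  exact h4.of_subset_closure h3 continuousOn_const Ioo_subset_Icc_self
    (by rw [closure_Ioo zero_ne_one]) ht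

omit [TopologicalSpace B] in
/-- Horizontal lifts are preserved by maps that respect horizontality. -/
theorem IsHorizontalLift.map {ωN : Connection EN N EK K} {A : Connection E P EG G} {w : ℝ → B}
    {wN : ℝ → N} (h : IsHorizontalLift πN ωN w wN) {lam : N → P}
    (hlam : ContMDiff 𝓘(ℝ, EN) 𝓘(ℝ, E) ∞ lam) (hπ : ∀ n, π (lam n) = πN n)
    (hh : ∀ n v, ωN.co n v = 0 → A.co (lam n) (tD EN E lam n v) = 0) :
    IsHorizontalLift π A w (fun t => lam (wN t)) := by
  refine .of_interior A (hlam.comp_contMDiffOn h.smooth) (fun t ht => ?_) fun t ht => ?_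
  · rw [hπ, h.lift t ht]
  · rw [tD_comp_apply (F := EN) (f := lam) (g := wN) ((hlam _).mdifferentiableAt (by simp))
      (h.mdifferentiableAt ht)]
    exact hh _ _ (h.co_eq_zero ht)

variable [LieGroup 𝓘(ℝ, EG) ∞ G]

theorem IsPrincipalBundle.horizontalLift_unique [T2Space G] (hP : IsPrincipalBundle EB E EG G π)
    {A : Connection E P EG G} {w : ℝ → B} {wP wP' : ℝ → P} (h : IsHorizontalLift π A w wP)
    (h' : IsHorizontalLift π A w wP') (h0 : wP 0 = wP' 0) : ∀ t ∈ Icc (0 : ℝ) 1, wP' t = wP t := by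
  intro t ht
  have h1 := hP.curve_actDiv_eq A h.smooth h'.smooth
    (fun z hz => (h.lift z hz).trans (h'.lift z hz).symm)
    (fun z hz => (h'.co_eq_zero hz).trans (h.co_eq_zero hz).symm)
    (fun z hz g => by rw [h.co_eq_zero hz, map_zero]) t ht
  have h2 : actDiv G (wP 0) (wP' 0) = 1 := hP.actDiv_eq (by rw [h0]; simp)
  rw [h1, h2]
  simp

/-- The holonomy is computed by any horizontal lift. -/
theorem IsPrincipalBundle.holonomy_eq [T2Space G] (hP : IsPrincipalBundle EB E EG G π)
    {A : Connection E P EG G} {w : ℝ → B} {wP : ℝ → P} {q : P} {g : G}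
    (h : IsHorizontalLift π A w wP) (h0 : wP 0 = q) (h1 : wP 1 = q <• g) :
    holonomy π A w q = g := by
  have hex : ∃ g : G, ∃ wP : ℝ → P, IsHorizontalLift π A w wP ∧ wP 0 = q ∧ wP 1 = q <• g :=
    ⟨g, wP, h, h0, h1⟩
  obtain ⟨wP', h', h0', h1'⟩ := Classical.epsilon_spec hex
  have h2 := hP.horizontalLift_unique h h' (h0.trans h0'.symm) 1 (by simp)
  rw [h1, h1'] at h2
  exact hP.act_injective q h2

theorem maurerCartan_leftInvC (X : EG) (g : G) : maurerCartan g (leftInvC G X g) = X := by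
  have h2 : ∀ a : G, ContMDiff 𝓘(ℝ, EG) 𝓘(ℝ, EG) ∞ (fun k : G => a * k) := fun a =>
    contMDiff_mul_left
  have h1 := tD_comp_apply (F' := EG) (F := EG) (E := EG) (f := fun k : G => g⁻¹ * k)
    (g := fun k : G => g * k) (z := 1)
    ((h2 _ _).mdifferentiableAt (by simp)) ((h2 _ _).mdifferentiableAt (by simp)) X
  have h3 : (fun z : G => g⁻¹ * (g * z)) = fun z => z := by ext; simp
  rw [h3, tD_id, mul_one] at h1
  exact h1.symm

theorem IsOneParam.eq_expCurve [CompleteSpace EG] [T2Space G] {γ : ℝ → G} {X : EG}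
    (h : IsOneParam γ X) : γ = expCurve G X := by
  refine integralCurve_unique (X := X) (fun t => ?_) (expCurve_integral X)
    (h.zero.trans (expCurve_zero X).symm)
  have h1 : tD ℝ EG γ t 1 = leftInvC G X (γ t) := by
    have h2 : maurerCartan (γ t) (tD ℝ EG γ t 1 - leftInvC G X (γ t)) = 0 := by
      rw [map_sub, h.maurerCartan_eq, maurerCartan_leftInvC, sub_self]
    exact sub_eq_zero.1 (maurerCartan_injective _ h2)
  have h3 : tD ℝ EG γ t = (1 : ℝ →L[ℝ] ℝ).smulRight (leftInvC G X (γ t)) := by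
    ext
    simp [h1]
  have h4 : HasMFDerivAt 𝓘(ℝ, ℝ) 𝓘(ℝ, EG) γ t (tD ℝ EG γ t) :=
    ((h.smooth t).mdifferentiableAt (by simp)).hasMFDerivAt
  rw [h3] at h4
  exact h4

/-- A map between principal bundles that relates the connection forms by `L`, with `Ad`-invariant
values, is equivariant along a homomorphism of the structure groups with derivative `L`, provided
that the adjoint representation of the first group is trivial. -/
theorem exists_hom_of_map [T2Space G] [ConnectedSpace N] (hN : IsPrincipalBundle EB EN EK K πN)
    (hP : IsPrincipalBundle EB E EG G π) (ωN : Connection EN N EK K) (A : Connection E P EG G)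
    (hK : ∀ (k : K) (v : EK), AdC k v = v) {L : EK →L[ℝ] EG} (hL : ∀ (g : G) v, AdC g (L v) = L v)
    {lam : N → P} (hlam : ContMDiff 𝓘(ℝ, EN) 𝓘(ℝ, E) ∞ lam) (hπ : ∀ n, π (lam n) = πN n)
    (hh : ∀ n v, A.co (lam n) (tD EN E lam n v) = L (ωN.co n v)) :
    ∃ χ : K →* G, ContMDiff 𝓘(ℝ, EK) 𝓘(ℝ, EG) ∞ χ ∧ (∀ n k, lam (n <• k) = lam n <• χ k) ∧
      ∀ v, tD EK EG χ 1 v = L v := by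
  obtain ⟨n₀⟩ : Nonempty N := inferInstance
  let χ : K → G := fun k => actDiv G (lam n₀) (lam (n₀ <• k))
  have hπk : ∀ n k, π (lam n) = π (lam (n <• k)) := fun n k => by rw [hπ, hπ, hN.proj_act]
  have hact : ∀ k : K, ContMDiff 𝓘(ℝ, EN) 𝓘(ℝ, EN) ∞ (fun n : N => n <• k) :=
    contMDiff_act_left hN.smooth_act
  have hequiv : ∀ n k, lam (n <• k) = lam n <• χ k := by
    intro n k
    have hloc : IsLocallyConstant fun n => actDiv G (lam n) (lam (n <• k)) := by
      rw [IsLocallyConstant.iff_eventually_eq]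
      intro n
      refine hP.eventually_actDiv_eq A isOpen_univ hlam.contMDiffOn
        (hlam.comp (hact k)).contMDiffOn (fun n _ => hπk n k) ?_ ?_ (mem_univ n)
      · intro n _ v
        have h1 : A.co (lam (n <• k)) (tD EN E (fun n => lam (n <• k)) n v) =
            L (ωN.co (n <• k) (tD EN EN (fun n : N => n <• k) n v)) := by
          rw [tD_comp_apply (F := EN) (f := lam) (g := fun n : N => n <• k)
            ((hlam _).mdifferentiableAt (by simp)) ((hact k _).mdifferentiableAt (by simp)), hh]
        rw [hh, ← hK k⁻¹ (ωN.co n v), ← ωN.co_act]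
        exact h1
      · intro n _ v g
        rw [hh, hL]
    have h2 : actDiv G (lam n) (lam (n <• k)) = χ k :=
      hloc.apply_eq_of_isPreconnected isPreconnected_univ (mem_univ n) (mem_univ n₀)
    rw [← h2, hP.act_actDiv (hπk n k)]
  have hχ : ContMDiff 𝓘(ℝ, EK) 𝓘(ℝ, EG) ∞ χ := by
    rw [← contMDiffOn_univ]
    intro k hk
    refine hP.contMDiffWithinAt_actDiv contMDiffWithinAt_const ?_ hk fun k _ => hπk n₀ k
    exact ((hlam _).comp k (contMDiff_act_right hN.smooth_act n₀ k)).contMDiffWithinAt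
  refine ⟨MonoidHom.mk' χ fun k k' => ?_, hχ, hequiv, fun v => ?_⟩
  · refine hP.act_injective (lam n₀) ?_
    rw [← hequiv, ← act_act, hequiv, hequiv, act_act]
  · have hone : χ 1 = 1 := hP.actDiv_eq (by simp)
    have h1 : tD EN E lam n₀ (fund K n₀ v) = fund G (lam n₀) (tD EK EG χ 1 v) := by
      have h2 : (fun k => lam (n₀ <• k)) = fun k => lam n₀ <• χ k := by
        ext k; exact hequiv n₀ k
      have h3 := tD_comp_apply (F := EN) (f := lam) (g := fun k : K => n₀ <• k) (z := 1)
        ((hlam _).mdifferentiableAt (by simp))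
        ((contMDiff_act_right hN.smooth_act n₀ 1).mdifferentiableAt (by simp)) v
      have h4 := tD_comp_apply (F := EG) (f := fun g : G => lam n₀ <• g) (g := χ) (z := 1)
        ((contMDiff_act_right hP.smooth_act _ _).mdifferentiableAt (by simp))
        ((hχ 1).mdifferentiableAt (by simp)) v
      rw [h2, h4, hone] at h3
      have h5 : n₀ <• (1 : K) = n₀ := by simp
      rw [h5] at h3
      exact h3.symm
    have h6 := hh n₀ (fund K n₀ v)
    rw [h1, A.co_fund, ωN.co_fund] at h6
    exact h6

end Lifts

/-! ### Line integrals along small circles -/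

section SmallCircles

variable {V : Type*} [NormedAddCommGroup V] [NormedSpace ℝ V] [CompleteSpace V]

/-- The counterclockwise parametrization `t ↦ e^{2πit}` of the unit circle. -/
def circ (t : ℝ) : ℂ := Complex.exp (2 * Real.pi * t * Complex.I)

theorem contDiff_circ : ContDiff ℝ ∞ circ := by
  have h : ContDiff ℝ ∞ (fun t : ℝ => (2 * Real.pi * t * Complex.I : ℂ)) :=
    (contDiff_const.mul Complex.ofRealCLM.contDiff).mul contDiff_const
  exact h.cexp

theorem hasDerivAt_circ (t : ℝ) : HasDerivAt circ (2 * Real.pi * Complex.I * circ t) t := by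
  have h : HasDerivAt (fun t : ℝ => (2 * Real.pi * t * Complex.I : ℂ))
      (2 * Real.pi * 1 * Complex.I) t :=
    (((Complex.ofRealCLM.hasDerivAt (x := t)).const_mul _).mul_const _)
  refine h.cexp.congr_deriv ?_
  change _ = 2 * Real.pi * Complex.I * Complex.exp (2 * Real.pi * t * Complex.I)
  ring

theorem circ_zero : circ 0 = 1 := by simp [circ]

theorem circ_one : circ 1 = 1 := by simp [circ, Complex.exp_two_pi_mul_I]

theorem norm_circ (t : ℝ) : ‖circ t‖ = 1 := by
  have : (2 * Real.pi * t * Complex.I : ℂ) = ((2 * Real.pi * t : ℝ) : ℂ) * Complex.I := by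
    push_cast; ring
  simp only [circ]
  rw [this, Complex.norm_exp_ofReal_mul_I]

theorem circ_eq (t : ℝ) : circ t = ((Real.cos (2 * Real.pi * t) : ℝ) : ℂ) +
    ((Real.sin (2 * Real.pi * t) : ℝ) : ℂ) * Complex.I := by
  rw [circ, Complex.ofReal_cos, Complex.ofReal_sin, ← Complex.exp_mul_I]
  push_cast
  ring_nf

theorem continuous_circ : Continuous circ := contDiff_circ.continuous

theorem norm_circ_sub_one_le (t : ℝ) : ‖circ t - 1‖ ≤ 2 := by
  refine (norm_sub_le _ _).trans ?_
  rw [norm_circ]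
  norm_num

theorem norm_deriv_circ (t : ℝ) : ‖(2 * Real.pi * Complex.I * circ t : ℂ)‖ = 2 * Real.pi := by
  simp [norm_circ, abs_of_pos Real.pi_pos]

theorem integral_deriv_circ (L : ℂ →L[ℝ] V) :
    ∫ t in (0 : ℝ)..1, L (2 * Real.pi * Complex.I * circ t) = 0 := by
  have h : ∀ t ∈ uIcc (0 : ℝ) 1, HasDerivAt (fun t => L (circ t))
      (L (2 * Real.pi * Complex.I * circ t)) t := fun t _ =>
    L.hasFDerivAt.comp_hasDerivAt t (hasDerivAt_circ t)
  rw [intervalIntegral.integral_eq_sub_of_hasDerivAt h, circ_one, circ_zero, sub_self]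
  refine (L.continuous.comp ?_).intervalIntegrable _ _
  exact continuous_const.mul continuous_circ

/-- The integral of a one-form with linear coefficients over the unit circle. -/
theorem integral_linear_circ (D : ℂ →L[ℝ] ℂ →L[ℝ] V) :
    ∫ t in (0 : ℝ)..1, D (circ t - 1) (2 * Real.pi * Complex.I * circ t) =
      Real.pi • (D 1 Complex.I - D Complex.I 1) := by
  have hlin : ∀ (L : ℂ →L[ℝ] V) (a b : ℝ), L (a + b * Complex.I) = a • L 1 + b • L Complex.I := by
    intro L a b
    have : (a + b * Complex.I : ℂ) = a • (1 : ℂ) + b • Complex.I := by simp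
    rw [this, map_add, map_smul, map_smul]
  -- an antiderivative of the integrand
  have h : ∀ t ∈ uIcc (0 : ℝ) 1, HasDerivAt (fun t : ℝ => (Real.pi * t) •
      (D 1 Complex.I - D Complex.I 1) - D 1 (circ t) +
      (Real.sin (4 * Real.pi * t) / 4) • (D 1 Complex.I + D Complex.I 1) -
      (Real.cos (4 * Real.pi * t) / 4) • (D Complex.I Complex.I - D 1 1))
      (D (circ t - 1) (2 * Real.pi * Complex.I * circ t)) t := by
    intro t _
    have h1 : HasDerivAt (fun t : ℝ => Real.pi * t) (Real.pi * 1) t :=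
      (hasDerivAt_id t).const_mul _
    have h2 : HasDerivAt (fun t : ℝ => 4 * Real.pi * t) (4 * Real.pi * 1) t :=
      (hasDerivAt_id t).const_mul _
    have h3 := (D 1).hasFDerivAt.comp_hasDerivAt t (hasDerivAt_circ t)
    refine ((((h1.smul_const (D 1 Complex.I - D Complex.I 1)).sub h3).add
      ((h2.sin.div_const 4).smul_const (D 1 Complex.I + D Complex.I 1))).sub
      ((h2.cos.div_const 4).smul_const (D Complex.I Complex.I - D 1 1))).congr_deriv ?_
    have e1 : (2 * Real.pi * Complex.I * circ t : ℂ) =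
        ((-(2 * Real.pi * Real.sin (2 * Real.pi * t)) : ℝ) : ℂ) +
        ((2 * Real.pi * Real.cos (2 * Real.pi * t) : ℝ) : ℂ) * Complex.I := by
      rw [circ_eq]
      push_cast
      linear_combination (2 * Real.pi * Complex.sin (2 * Real.pi * t)) * Complex.I_sq
    have e2 : D (circ t - 1) = Real.cos (2 * Real.pi * t) • D 1 +
        Real.sin (2 * Real.pi * t) • D Complex.I - D 1 := by
      rw [map_sub, circ_eq]
      have : (((Real.cos (2 * Real.pi * t) : ℝ) : ℂ) + ((Real.sin (2 * Real.pi * t) : ℝ) : ℂ) *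
        Complex.I) = Real.cos (2 * Real.pi * t) • (1 : ℂ) +
          Real.sin (2 * Real.pi * t) • Complex.I := by simp
      rw [this, map_add, map_smul, map_smul]
    have e3 : 4 * Real.pi * t = 2 * (2 * Real.pi * t) := by ring
    rw [e2, e1, e3, Real.sin_two_mul, Real.cos_two_mul']
    simp only [_root_.add_apply, _root_.sub_apply, _root_.smul_apply, hlin]
    have hcs := Real.sin_sq_add_cos_sq (2 * Real.pi * t)
    have hD : Real.pi • (D 1 Complex.I - D Complex.I 1) =
      ((Real.sin (2 * Real.pi * t) ^ 2 + Real.cos (2 * Real.pi * t) ^ 2) * Real.pi) •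
        (D 1 Complex.I - D Complex.I 1) := by rw [hcs, one_mul]
    rw [mul_one, hD]
    module
  rw [intervalIntegral.integral_eq_sub_of_hasDerivAt h]
  · have e : (4 * Real.pi * 1 : ℝ) = ((2 : ℕ) : ℝ) * (2 * Real.pi) := by push_cast; ring
    rw [circ_one, circ_zero, e, Real.cos_nat_mul_two_pi, ← mul_assoc]
    have e' : Real.sin (((2 : ℕ) : ℝ) * 2 * Real.pi) = 0 := by
      have := Real.sin_nat_mul_pi 4
      rw [← this]; norm_num
    rw [e']
    simp
  · refine Continuous.intervalIntegrable ?_ _ _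
    have h1 : Continuous fun t => D (circ t - 1) :=
      D.continuous.comp (continuous_circ.sub continuous_const)
    exact h1.clm_apply (continuous_const.mul continuous_circ)

/-- Over a small circle through the center of the chart, the integral of a one-form is the area of
the disk times the curl, up to higher order terms. -/
theorem tendsto_integral_small_circle {α : ℂ → ℂ →L[ℝ] V} (hd : DifferentiableAt ℝ α 0)
    (hc : ∀ᶠ z in 𝓝 0, ContinuousAt α z) :
    Filter.Tendsto (fun r : ℝ => (r ^ 2)⁻¹ • ∫ t in (0 : ℝ)..1, α (r • (circ t - 1))
      (r • (2 * Real.pi * Complex.I * circ t))) (𝓝[≠] 0) (𝓝 (Real.pi • curl α 0 1 Complex.I)) := by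
  set D := fderiv ℝ α 0 with hD
  rw [Metric.tendsto_nhdsWithin_nhds]
  intro ε hε
  have hε' : 0 < ε / (4 * Real.pi + 1) := by positivity
  have hlit := hd.hasFDerivAt.isLittleO.def hε'
  obtain ⟨δ, hδ, hball⟩ := Metric.eventually_nhds_iff.1 (hlit.and hc)
  refine ⟨δ / 2, by positivity, fun r hr0 hr => ?_⟩
  have hr0 : r ≠ 0 := hr0
  rw [dist_zero_right, Real.norm_eq_abs] at hr
  have hz : ∀ t, dist (r • (circ t - 1)) 0 < δ := by
    intro t
    rw [dist_zero_right, norm_smul, Real.norm_eq_abs]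
    have := norm_circ_sub_one_le t
    have := abs_nonneg r
    nlinarith [norm_nonneg (circ t - 1)]
  have hcont : Continuous fun t => α (r • (circ t - 1)) := by
    refine continuous_iff_continuousAt.2 fun t => ?_
    exact ContinuousAt.comp (f := fun t => r • (circ t - 1)) (hball (hz t)).2
      ((continuous_circ.sub continuous_const).const_smul r).continuousAt
  have hc' : Continuous fun t => (r • (2 * Real.pi * Complex.I * circ t) : ℂ) :=
    (continuous_const.mul continuous_circ).const_smul r
  have hi1 := (hcont.clm_apply hc').intervalIntegrable (μ := MeasureTheory.volume) 0 1
  have hc2 : Continuous fun t => α 0 (r • (2 * Real.pi * Complex.I * circ t)) :=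
    (α 0).continuous.comp hc'
  have hi2 := hc2.intervalIntegrable (μ := MeasureTheory.volume) 0 1
  have hcD : Continuous fun t => D (r • (circ t - 1)) :=
    D.continuous.comp ((continuous_circ.sub continuous_const).const_smul r)
  have hi3 := (hcD.clm_apply hc').intervalIntegrable (μ := MeasureTheory.volume) 0 1
  have key : (∫ t in (0 : ℝ)..1, α (r • (circ t - 1)) (r • (2 * Real.pi * Complex.I * circ t))) -
      r ^ 2 • Real.pi • curl α 0 1 Complex.I =
      ∫ t in (0 : ℝ)..1, (α (r • (circ t - 1)) - α 0 - D (r • (circ t - 1)))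
        (r • (2 * Real.pi * Complex.I * circ t)) := by
    have e1 : ∫ t in (0 : ℝ)..1, (α 0) (r • (2 * Real.pi * Complex.I * circ t)) = 0 := by
      simp only [map_smul]
      rw [intervalIntegral.integral_smul, integral_deriv_circ, smul_zero]
    have e2 : ∫ t in (0 : ℝ)..1, (D (r • (circ t - 1))) (r • (2 * Real.pi * Complex.I * circ t)) =
        r ^ 2 • Real.pi • curl α 0 1 Complex.I := by
      have : curl α 0 1 Complex.I = D 1 Complex.I - D Complex.I 1 := rfl
      rw [this, ← integral_linear_circ, ← intervalIntegral.integral_smul]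
      refine intervalIntegral.integral_congr fun t _ => ?_
      simp only [map_smul, _root_.smul_apply, smul_smul, pow_two]
    simp only [_root_.sub_apply]
    rw [intervalIntegral.integral_sub (hi1.sub hi2) hi3, intervalIntegral.integral_sub hi1 hi2]
    rw [e1, e2, sub_zero]
  have hbound : ‖∫ t in (0 : ℝ)..1, (α (r • (circ t - 1)) - α 0 - D (r • (circ t - 1)))
      (r • (2 * Real.pi * Complex.I * circ t))‖ ≤
      (ε / (4 * Real.pi + 1) * (2 * |r|) * (|r| * (2 * Real.pi))) * |(1 : ℝ) - 0| := by
    refine intervalIntegral.norm_integral_le_of_norm_le_const fun t _ => ?_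
    refine (ContinuousLinearMap.le_opNorm _ _).trans ?_
    rw [norm_smul r, norm_deriv_circ, Real.norm_eq_abs]
    refine mul_le_mul_of_nonneg_right ?_ (by positivity)
    have h1 := (hball (hz t)).1
    rw [sub_zero, norm_smul, Real.norm_eq_abs] at h1
    refine h1.trans (mul_le_mul_of_nonneg_left ?_ hε'.le)
    rw [mul_comm]
    exact mul_le_mul_of_nonneg_right (norm_circ_sub_one_le t) (abs_nonneg r)
  have hr2 : (0 : ℝ) < r ^ 2 := by positivity
  have e : (r ^ 2)⁻¹ • (∫ t in (0 : ℝ)..1, α (r • (circ t - 1))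
      (r • (2 * Real.pi * Complex.I * circ t))) - Real.pi • curl α 0 1 Complex.I =
      (r ^ 2)⁻¹ • ((∫ t in (0 : ℝ)..1, α (r • (circ t - 1))
        (r • (2 * Real.pi * Complex.I * circ t))) - r ^ 2 • Real.pi • curl α 0 1 Complex.I) := by
    rw [smul_sub, smul_smul (r ^ 2)⁻¹, inv_mul_cancel₀ hr2.ne', one_smul]
  rw [dist_eq_norm, e, key, norm_smul, Real.norm_of_nonneg (inv_nonneg.2 hr2.le)]
  calc (r ^ 2)⁻¹ * _ ≤ (r ^ 2)⁻¹ *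
      ((ε / (4 * Real.pi + 1) * (2 * |r|) * (|r| * (2 * Real.pi))) * |(1 : ℝ) - 0|) :=
        mul_le_mul_of_nonneg_left hbound (inv_nonneg.2 hr2.le)
    _ = ε / (4 * Real.pi + 1) * (4 * Real.pi) := by
        have h2 : |r| ^ 2 = r ^ 2 := sq_abs r
        rw [sub_zero, abs_one]
        field_simp
        rw [h2]
        ring
    _ < ε := by
        rw [div_mul_eq_mul_div, div_lt_iff₀ (by positivity)]
        nlinarith

/-- A primitive of a smooth function is smooth. -/
theorem contDiff_integral {φ : ℝ → V} (hφ : ContDiff ℝ ∞ φ) (a : ℝ) :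
    ContDiff ℝ ∞ (fun t => ∫ s in a..t, φ s) := by
  have h : ∀ t, HasDerivAt (fun t => ∫ s in a..t, φ s) (φ t) t := fun t =>
    intervalIntegral.integral_hasDerivAt_right (hφ.continuous.intervalIntegrable _ _)
      (hφ.continuous.stronglyMeasurableAtFilter _ _) hφ.continuous.continuousAt
  rw [contDiff_infty_iff_deriv]
  refine ⟨fun t => (h t).differentiableAt, ?_⟩
  have : deriv (fun t => ∫ s in a..t, φ s) = φ := funext fun t => (h t).deriv
  rw [this]
  exact hφ

end SmallCircles

/-! ### Points joined by horizontal curves -/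

section Joined

variable {E : Type*} [NormedAddCommGroup E] [NormedSpace ℝ E]
  {P : Type*} [TopologicalSpace P] [ChartedSpace E P] [IsManifold 𝓘(ℝ, E) ∞ P]
  {EG : Type*} [NormedAddCommGroup EG] [NormedSpace ℝ EG]
  {G : Type*} [Group G] [TopologicalSpace G] [ChartedSpace EG G]
  [MulAction Gᵐᵒᵖ P]
  {B : Type*} {π : P → B}

/-- A smooth curve on the whole real line that is horizontal for the connection `A`. -/
structure IsHorizontalCurve (A : Connection E P EG G) (c : ℝ → P) : Prop where
  smooth : ContMDiff 𝓘(ℝ, ℝ) 𝓘(ℝ, E) ∞ c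
  horizontal : ∀ t, A.co (c t) (tD ℝ E c t 1) = 0

/-- `p` and `p'` are the ends of a horizontal curve. The curve is required to rest outside of
`[0, 1]`, so that such curves can be concatenated. -/
def HorizontallyJoined (A : Connection E P EG G) (p p' : P) : Prop :=
  ∃ c : ℝ → P, IsHorizontalCurve A c ∧ (∀ t ≤ 0, c t = p) ∧ ∀ t, 1 ≤ t → c t = p'

theorem IsHorizontalCurve.comp {A : Connection E P EG G} {c : ℝ → P} (h : IsHorizontalCurve A c)
    {σ : ℝ → ℝ} (hσ : ContDiff ℝ ∞ σ) : IsHorizontalCurve A (fun t => c (σ t)) := by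
  refine ⟨h.smooth.comp hσ.contMDiff, fun t => ?_⟩
  rw [tD_comp_apply (F := ℝ) (f := c) (g := σ) ((h.smooth _).mdifferentiableAt (by simp))
    ((hσ.contMDiff _).mdifferentiableAt (by simp))]
  have : tD ℝ ℝ σ t 1 = tD ℝ ℝ σ t 1 • (1 : ℝ) := by simp
  rw [this, map_smul, map_smul, h.horizontal, smul_zero]

theorem IsHorizontalCurve.congr {A : Connection E P EG G} {c : ℝ → P}
    (h : ∀ t, ∃ c', IsHorizontalCurve A c' ∧ c =ᶠ[𝓝 t] c') : IsHorizontalCurve A c := by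
  constructor
  · intro t
    obtain ⟨c', h', e⟩ := h t
    exact (h'.smooth t).congr_of_eventuallyEq e
  · intro t
    obtain ⟨c', h', e⟩ := h t
    rw [tD_congr e, e.eq_of_nhds, h'.horizontal]

theorem IsHorizontalCurve.joined {A : Connection E P EG G} {c : ℝ → P}
    (h : IsHorizontalCurve A c) : HorizontallyJoined A (c 0) (c 1) :=
  ⟨_, h.comp Real.smoothTransition.contDiff,
    fun t ht => by rw [Real.smoothTransition.zero_of_nonpos ht],
    fun t ht => by rw [Real.smoothTransition.one_of_one_le ht]⟩

theorem HorizontallyJoined.symm {A : Connection E P EG G} {p p' : P}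
    (h : HorizontallyJoined A p p') : HorizontallyJoined A p' p := by
  obtain ⟨c, hc, h0, h1⟩ := h
  have := (hc.comp (σ := fun t => 1 - t) (by fun_prop)).joined
  rwa [sub_zero, sub_self, h0 0 le_rfl, h1 1 le_rfl] at this

theorem HorizontallyJoined.trans {A : Connection E P EG G} {p p' p'' : P}
    (h : HorizontallyJoined A p p') (h' : HorizontallyJoined A p' p'') :
    HorizontallyJoined A p p'' := by
  obtain ⟨c, hc, h0, h1⟩ := h
  obtain ⟨d, hd, h2, h3⟩ := h'
  refine ⟨fun t => if t ≤ 1 / 2 then c (3 * t) else d (3 * t - 2),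
    IsHorizontalCurve.congr fun t => ?_, fun t ht => ?_, fun t ht => ?_⟩
  · rcases lt_or_ge t (1 / 2) with ht | ht
    · refine ⟨_, hc.comp (σ := fun t => 3 * t) (by fun_prop), ?_⟩
      filter_upwards [gt_mem_nhds ht] with s hs
      rw [if_pos hs.le]
    · refine ⟨_, hd.comp (σ := fun t => 3 * t - 2) (by fun_prop), ?_⟩
      filter_upwards [lt_mem_nhds (show 1 / 3 < t by linarith)] with s hs
      split_ifs with h
      · rw [h1 _ (by linarith), h2 _ (by linarith)]
      · rfl
  · dsimp only
    rw [if_pos (by linarith), h0 _ (by linarith)]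
  · dsimp only
    rw [if_neg (by linarith), h3 _ (by linarith)]

theorem HorizontallyJoined.exists_lift {A : Connection E P EG G} {p p' : P}
    (h : HorizontallyJoined A p p') :
    ∃ c : ℝ → P, IsHorizontalLift π A (fun t => π (c t)) c ∧ c 0 = p ∧ c 1 = p' := by
  obtain ⟨c, hc, h0, h1⟩ := h
  exact ⟨c, .of_interior A hc.smooth.contMDiffOn (fun _ _ => rfl) fun t _ => hc.horizontal t,
    h0 0 le_rfl, h1 1 le_rfl⟩

variable [LieGroup 𝓘(ℝ, EG) ∞ G]

theorem HorizontallyJoined.act {A : Connection E P EG G}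
    (hP : ContMDiff (𝓘(ℝ, E).prod 𝓘(ℝ, EG)) 𝓘(ℝ, E) ∞ (fun z : P × G => z.1 <• z.2)) {p p' : P}
    (h : HorizontallyJoined A p p') (g : G) : HorizontallyJoined A (p <• g) (p' <• g) := by
  obtain ⟨c, hc, h0, h1⟩ := h
  refine ⟨fun t => c t <• g, ⟨(contMDiff_act_left hP g).comp hc.smooth, fun t => ?_⟩,
    fun t ht => congrArg (· <• g) (h0 t ht), fun t ht => congrArg (· <• g) (h1 t ht)⟩
  rw [A.co_tD_act_const hP ((hc.smooth t).mdifferentiableAt (by simp)), hc.horizontal, map_zero]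

/-- Translation of a curve by a curve in a one-parameter group changes the value of the connection
form on the velocity by the speed of the latter. -/
theorem Connection.co_act_oneParam (A : Connection E P EG G)
    (hP : ContMDiff (𝓘(ℝ, E).prod 𝓘(ℝ, EG)) 𝓘(ℝ, E) ∞ (fun z : P × G => z.1 <• z.2))
    {γ : ℝ → G} {X : EG} (hγ : IsOneParam γ X) (hX : ∀ g : G, AdC g X = X) {f : ℝ → P}
    {h : ℝ → ℝ} {t a b : ℝ} (hf : MDifferentiableAt 𝓘(ℝ, ℝ) 𝓘(ℝ, E) f t) (hh : HasDerivAt h a t)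
    (hb : A.co (f t) (tD ℝ E f t 1) = b • X) :
    A.co (f t <• γ (h t)) (tD ℝ E (fun t => f t <• γ (h t)) t 1) = (b + a) • X := by
  have h1 : MDifferentiableAt 𝓘(ℝ, ℝ) 𝓘(ℝ, EG) γ (h t) := (hγ.smooth _).mdifferentiableAt (by simp)
  have h2 : MDifferentiableAt 𝓘(ℝ, ℝ) 𝓘(ℝ, ℝ) h t := hh.differentiableAt.mdifferentiableAt
  rw [A.co_tD_act (F := ℝ) (f := f) (g := fun t => γ (h t)) hP hf (h1.comp t h2), hb, map_smul, hX,
    tD_comp_apply (F := ℝ) (f := γ) (g := h) h1 h2, tD_eq_fderiv, ← toSpanSingleton_deriv,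
    hh.deriv, ContinuousLinearMap.toSpanSingleton_apply, one_smul]
  have : tD ℝ EG γ (h t) a = a • tD ℝ EG γ (h t) 1 := by rw [← map_smul, smul_eq_mul, mul_one]
  rw [this, map_smul, hγ.maurerCartan_eq, add_smul]

end Joined

section Reachability

/-- A subgroup of the real line that contains a non-trivial interval is the whole line. -/
theorem mem_of_uIcc_subset {T : AddSubgroup ℝ} {a : ℝ} (ha : a ≠ 0) (h : ∀ b ∈ uIcc 0 a, b ∈ T)
    (t : ℝ) : t ∈ T := by
  have h1 : ∀ θ ∈ Icc (0 : ℝ) 1, θ * a ∈ T := by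
    intro θ hθ
    refine h _ ?_
    rcases le_total 0 a with h0 | h0
    · rw [uIcc_of_le h0]
      exact ⟨mul_nonneg hθ.1 h0, mul_le_of_le_one_left h0 hθ.2⟩
    · rw [uIcc_of_ge h0]
      exact ⟨by nlinarith [hθ.2], mul_nonpos_of_nonneg_of_nonpos hθ.1 h0⟩
  have h2 : t = ⌊t / a⌋ • (1 * a) + Int.fract (t / a) * a := by
    rw [zsmul_eq_mul, one_mul, ← add_mul, Int.floor_add_fract, div_mul_cancel₀ _ ha]
  rw [h2]
  exact T.add_mem (T.zsmul_mem (h1 1 (by simp)) _)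
    (h1 _ ⟨Int.fract_nonneg _, (Int.fract_lt_one _).le⟩)

theorem continuous_integral_small_circle {V : Type*} [NormedAddCommGroup V] [NormedSpace ℝ V]
    {α : ℂ → ℂ →L[ℝ] V} {ρ : ℝ → ℝ} (hρ : Continuous ρ)
    (hα : ∀ τ t, ContinuousAt α (ρ τ • (circ t - 1))) :
    Continuous fun τ => ∫ t in (0 : ℝ)..1, α (ρ τ • (circ t - 1))
      (ρ τ • (2 * Real.pi * Complex.I * circ t)) := by
  refine intervalIntegral.continuous_parametric_intervalIntegral_of_continuous' ?_ 0 1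
  have c1 : Continuous fun z : ℝ × ℝ => ρ z.1 := hρ.comp continuous_fst
  have c2 : Continuous fun z : ℝ × ℝ => circ z.2 := continuous_circ.comp continuous_snd
  have c3 : Continuous fun z : ℝ × ℝ => ρ z.1 • (circ z.2 - 1) := c1.smul (c2.sub continuous_const)
  have c4 : Continuous fun z : ℝ × ℝ => α (ρ z.1 • (circ z.2 - 1)) :=
    continuous_iff_continuousAt.2 fun z =>
      (hα z.1 z.2).comp_of_eq (f := fun z : ℝ × ℝ => ρ z.1 • (circ z.2 - 1)) c3.continuousAt rfl
  have c5 : Continuous fun z : ℝ × ℝ => (2 * Real.pi * Complex.I * circ z.2 : ℂ) :=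
    continuous_const.mul c2
  exact c4.clm_apply (c1.smul c5)

variable {EN : Type*} [NormedAddCommGroup EN] [NormedSpace ℝ EN] [FiniteDimensional ℝ EN]
  {N : Type*} [TopologicalSpace N] [ChartedSpace EN N] [IsManifold 𝓘(ℝ, EN) ∞ N]
  {K : Type*} [Group K] [TopologicalSpace K] [ChartedSpace ℝ K] [LieGroup 𝓘(ℝ, ℝ) ∞ K]
  [MulAction Kᵐᵒᵖ N]
  {F : Type*} [NormedAddCommGroup F] [NormedSpace ℝ F]

/-- For a one-dimensional structure group, a curve is made horizontal by an integral. -/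
theorem isHorizontalCurve_act_integral (ωN : Connection EN N ℝ K)
    (hN : ContMDiff (𝓘(ℝ, EN).prod 𝓘(ℝ, ℝ)) 𝓘(ℝ, EN) ∞ (fun z : N × K => z.1 <• z.2))
    {γ : ℝ → K} (hγ : IsOneParam γ (1 : ℝ)) (hAd : ∀ k : K, AdC k (1 : ℝ) = 1)
    {f : F → N} {y : ℝ → F} (hy : ContDiff ℝ ∞ y)
    (hf : ∀ t, ContMDiffAt 𝓘(ℝ, F) 𝓘(ℝ, EN) ∞ f (y t)) :
    IsHorizontalCurve ωN
      (fun t => f (y t) <• γ (-∫ s in (0 : ℝ)..t, pull F ωN.co f (y s) (deriv y s))) := by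
  have hy' : ContDiff ℝ ∞ (deriv y) := (contDiff_infty_iff_deriv.1 hy).2
  have hint : ContDiff ℝ ∞ (fun s => pull F ωN.co f (y s) (deriv y s)) := by
    refine contDiff_iff_contDiffAt.2 fun s => ?_
    exact ((ωN.smoothForm_co.contDiffAt_pull (hf s)).comp s hy.contDiffAt).clm_apply
      hy'.contDiffAt
  have hI := (contDiff_integral hint 0).neg
  have hfy : ContMDiff 𝓘(ℝ, ℝ) 𝓘(ℝ, EN) ∞ (fun t => f (y t)) := fun t =>
    (hf t).comp t hy.contMDiff.contMDiffAt
  refine ⟨hN.comp (hfy.prodMk (hγ.smooth.comp hI.contMDiff)), fun t => ?_⟩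
  have hd : HasDerivAt (fun t => -∫ s in (0 : ℝ)..t, pull F ωN.co f (y s) (deriv y s))
      (-(pull F ωN.co f (y t) (deriv y t))) t :=
    (intervalIntegral.integral_hasDerivAt_right (hint.continuous.intervalIntegrable _ _)
      (hint.continuous.stronglyMeasurableAtFilter _ _) hint.continuous.continuousAt).neg
  rw [ωN.co_act_oneParam (b := pull F ωN.co f (y t) (deriv y t)) hN hγ hAd
    ((hfy t).mdifferentiableAt (by simp)) hd, add_neg_cancel, zero_smul]
  rw [tD_comp_apply (F := F) (f := f) (g := y) ((hf t).mdifferentiableAt (by simp))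
    ((hy.contMDiff t).mdifferentiableAt (by simp)), tD_eq_fderiv, fderiv_apply_one_eq_deriv,
    pull_apply, smul_eq_mul, mul_one]

/-- The vertical displacements that arise from small horizontal loops form an interval; hence all
vertical displacements arise from horizontal loops. -/
theorem horizontallyJoined_act (ωN : Connection EN N ℝ K)
    (hN : ContMDiff (𝓘(ℝ, EN).prod 𝓘(ℝ, ℝ)) 𝓘(ℝ, EN) ∞ (fun z : N × K => z.1 <• z.2))
    {γ : ℝ → K} (hγ : IsOneParam γ (1 : ℝ)) (hAd : ∀ k : K, AdC k (1 : ℝ) = 1)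
    {n : N} {u v : EN} (hn : extD ωN.co n u v ≠ 0) (t : ℝ) :
    HorizontallyJoined ωN n (n <• γ t) := by
  -- the vertical displacements form a subgroup
  let T : AddSubgroup ℝ :=
    { carrier := {t | HorizontallyJoined ωN n (n <• γ t)}
      add_mem' := by
        intro a b ha hb
        have := ha.trans (hb.act hN (γ a))
        change HorizontallyJoined ωN n (n <• γ (a + b))
        rwa [act_act, ← hγ.add, add_comm] at this
      zero_mem' := by
        change HorizontallyJoined ωN n (n <• γ 0)
        have h : IsHorizontalCurve ωN (fun _ : ℝ => n) := ⟨contMDiff_const, fun t => by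
          rw [tD_const, _root_.zero_apply, map_zero]⟩
        rw [hγ.zero]
        simpa using h.joined
      neg_mem' := by
        intro a ha
        have := (HorizontallyJoined.act hN ha (γ (-a))).symm
        rwa [act_act, ← hγ.add, add_neg_cancel, hγ.zero, MulOpposite.op_one, one_smul] at this }
  suffices h : ∃ a : ℝ, a ≠ 0 ∧ ∀ b ∈ uIcc 0 a, b ∈ T by
    obtain ⟨a, ha, h⟩ := h
    exact mem_of_uIcc_subset ha h t
  let φ := extChartAt 𝓘(ℝ, EN) n
  let L : ℂ →L[ℝ] EN := Complex.reCLM.smulRight u + Complex.imCLM.smulRight v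
  let f : ℂ → N := fun z => φ.symm (φ n + L z)
  have hmem : ∀ᶠ z in 𝓝 (0 : ℂ), φ n + L z ∈ φ.target := by
    have hc : ContinuousAt (fun z => φ n + L z) 0 := by fun_prop
    refine hc.eventually_mem ?_
    rw [map_zero, add_zero]
    exact extChartAt_target_mem_nhds n
  have hL : ContDiff ℝ ∞ (fun z : ℂ => φ n + L z) := contDiff_const.add L.contDiff
  have hfs : ∀ᶠ z in 𝓝 (0 : ℂ), ContMDiffAt 𝓘(ℝ, ℂ) 𝓘(ℝ, EN) ∞ f z := by
    filter_upwards [hmem] with z hz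
    exact (contMDiffAt_extChartAt_symm hz).comp z hL.contMDiff.contMDiffAt
  have hf0 : f 0 = n := by
    change φ.symm (φ n + L 0) = n
    rw [map_zero, add_zero]
    exact extChartAt_to_inv n
  have hfd : ∀ w, tD ℂ EN f 0 w = L w := by
    intro w
    have h1 : MDifferentiableAt 𝓘(ℝ, EN) 𝓘(ℝ, EN) φ.symm (φ n + L 0) :=
      mdifferentiableAt_extChartAt_symm hmem.self_of_nhds
    rw [tD_comp_apply (F := EN) (f := φ.symm) (g := fun z : ℂ => φ n + L z) h1
      ((hL.contMDiff 0).mdifferentiableAt (by simp)), tD_eq_fderiv, fderiv_const_add, L.fderiv,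
      map_zero, add_zero, tD_chart_symm_self]
    rfl
  have hcurl : curl (pull ℂ ωN.co f) 0 1 Complex.I ≠ 0 := by
    rw [ωN.smoothForm_co.curl_pull hfs.self_of_nhds, hfd, hfd, hf0]
    simpa [L] using hn
  have hαs : ∀ᶠ z in 𝓝 (0 : ℂ), ContDiffAt ℝ ∞ (pull ℂ ωN.co f) z := by
    filter_upwards [hfs] with z hz using ωN.smoothForm_co.contDiffAt_pull hz
  set α := pull ℂ ωN.co f with hα
  let H : ℝ → ℝ := fun r => ∫ t in (0 : ℝ)..1, α (r • (circ t - 1))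
      (r • (2 * Real.pi * Complex.I * circ t))
  have hlim := tendsto_integral_small_circle (α := α)
    (hαs.self_of_nhds.differentiableAt (by simp)) (hαs.mono fun z hz => hz.continuousAt)
  have hne : ∀ᶠ r in 𝓝[≠] (0 : ℝ), H r ≠ 0 := by
    filter_upwards [hlim.eventually_ne (smul_ne_zero Real.pi_pos.ne' hcurl)] with r hr h0
    exact hr (by rw [show (∫ t in (0 : ℝ)..1, α (r • (circ t - 1))
      (r • (2 * Real.pi * Complex.I * circ t))) = 0 from h0, smul_zero])
  obtain ⟨δ, hδ, hball⟩ := Metric.eventually_nhds_iff.1 hfs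
  obtain ⟨r, hr, hrδ, hr0⟩ : ∃ r, H r ≠ 0 ∧ r < δ / 2 ∧ 0 < r := by
    have h1 : ∀ᶠ r in 𝓝[>] (0 : ℝ), H r ≠ 0 := hne.filter_mono
      (nhdsWithin_mono _ fun x hx => ne_of_gt hx)
    have h2 : ∀ᶠ r in 𝓝[>] (0 : ℝ), r < δ / 2 :=
      nhdsWithin_le_nhds (gt_mem_nhds (by positivity))
    exact (h1.and (h2.and self_mem_nhdsWithin)).exists
  have hsmall : ∀ ρ ∈ Icc 0 r, ∀ t, dist (ρ • (circ t - 1)) 0 < δ := by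
    intro ρ hρ t
    rw [dist_zero_right, norm_smul, Real.norm_of_nonneg hρ.1]
    have := norm_circ_sub_one_le t
    nlinarith [norm_nonneg (circ t - 1), hρ.1, hρ.2]
  have hT : ∀ ρ ∈ Icc 0 r, -H ρ ∈ T := by
    intro ρ hρ
    have hy : ContDiff ℝ ∞ (fun t => ρ • (circ t - 1)) :=
      (contDiff_circ.sub contDiff_const).const_smul ρ
    have hc := isHorizontalCurve_act_integral ωN hN hγ hAd hy (f := f)
      (fun t => hball (hsmall ρ hρ t))
    have h1 := hc.joined
    have hdy : deriv (fun t => ρ • (circ t - 1)) =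
        fun t => ρ • (2 * Real.pi * Complex.I * circ t) :=
      funext fun t => (((hasDerivAt_circ t).sub_const 1).const_smul ρ).deriv
    rw [hdy, circ_zero, circ_one, sub_self, smul_zero, hf0, intervalIntegral.integral_same,
      neg_zero, hγ.zero, MulOpposite.op_one, one_smul] at h1
    exact h1
  have hσ : ∀ τ, r * Real.smoothTransition τ ∈ Icc 0 r := fun τ =>
    ⟨mul_nonneg hr0.le (Real.smoothTransition.nonneg τ),
      mul_le_of_le_one_right hr0.le (Real.smoothTransition.le_one τ)⟩
  have hHc : Continuous fun τ => -H (r * Real.smoothTransition τ) := by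
    exact (continuous_integral_small_circle (continuous_const.mul Real.smoothTransition.continuous)
      fun τ t => (ωN.smoothForm_co.contDiffAt_pull (hball (hsmall _ (hσ τ) t))).continuousAt).neg
  refine ⟨-H r, neg_ne_zero.2 hr, fun b hb => ?_⟩
  have hb' := intermediate_value_uIcc (a := 0) (b := 1) hHc.continuousOn
  have e0 : -H (r * Real.smoothTransition 0) = 0 := by
    rw [Real.smoothTransition.zero_of_nonpos le_rfl]
    simp [H]
  have e1 : -H (r * Real.smoothTransition 1) = -H r := by
    rw [Real.smoothTransition.one_of_one_le le_rfl, mul_one]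
  rw [e0, e1] at hb'
  obtain ⟨τ, -, hτ⟩ := hb' hb
  rw [← hτ]
  exact hT _ (hσ τ)

/-- If the curvature of a connection with one-dimensional structure group vanishes nowhere, then any
two points of the (connected) total space are joined by a horizontal curve. -/
theorem horizontallyJoined_of_extD_ne_zero [ConnectedSpace N] (ωN : Connection EN N ℝ K)
    (hN : ContMDiff (𝓘(ℝ, EN).prod 𝓘(ℝ, ℝ)) 𝓘(ℝ, EN) ∞ (fun z : N × K => z.1 <• z.2))
    {γ : ℝ → K} (hγ : IsOneParam γ (1 : ℝ)) (hAd : ∀ k : K, AdC k (1 : ℝ) = 1)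
    (hn : ∀ n, ∃ u v : EN, extD ωN.co n u v ≠ 0) (n n' : N) : HorizontallyJoined ωN n n' := by
  have _ : Std.Symm (HorizontallyJoined ωN) := ⟨fun _ _ h => h.symm⟩
  refine PreconnectedSpace.induction₂ (HorizontallyJoined ωN) (fun n => ?_)
    ⟨fun _ _ _ h h' => h.trans h'⟩ n n'
  let φ := extChartAt 𝓘(ℝ, EN) n
  obtain ⟨δ, hδ, hball⟩ := Metric.mem_nhds_iff.1 (extChartAt_target_mem_nhds (I := 𝓘(ℝ, EN)) n)
  have h1 : ∀ᶠ m in 𝓝 n, φ m ∈ Metric.ball (φ n) δ :=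
    (continuousAt_extChartAt n).eventually_mem (Metric.ball_mem_nhds _ hδ)
  filter_upwards [h1, extChartAt_source_mem_nhds (I := 𝓘(ℝ, EN)) n] with m hm hms
  let y : ℝ → EN := fun t => φ n + Real.smoothTransition t • (φ m - φ n)
  have hy : ContDiff ℝ ∞ y := contDiff_const.add (Real.smoothTransition.contDiff.smul contDiff_const)
  have hyb : ∀ t, y t ∈ φ.target := by
    intro t
    refine hball ?_
    rw [Metric.mem_ball, dist_eq_norm] at hm ⊢
    rw [add_sub_cancel_left, norm_smul, Real.norm_of_nonneg (Real.smoothTransition.nonneg t)]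
    exact (mul_le_of_le_one_left (norm_nonneg _) (Real.smoothTransition.le_one t)).trans_lt hm
  have h2 := (isHorizontalCurve_act_integral ωN hN hγ hAd hy (f := φ.symm)
    (fun t => contMDiffAt_extChartAt_symm (hyb t))).joined
  have e0 : φ.symm (y 0) = n := by
    simp only [y, Real.smoothTransition.zero_of_nonpos le_rfl, zero_smul, add_zero]
    exact extChartAt_to_inv n
  have e1 : φ.symm (y 1) = m := by
    simp only [y, Real.smoothTransition.one_of_one_le le_rfl, one_smul, add_sub_cancel]
    exact φ.left_inv hms
  rw [e0, e1, intervalIntegral.integral_same, neg_zero, hγ.zero, MulOpposite.op_one, one_smul] at h2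
  obtain ⟨u, v, huv⟩ := hn m
  exact h2.trans (horizontallyJoined_act ωN hN hγ hAd huv _).symm

end Reachability

/-! ### Local sections -/

section Sections

variable {EB : Type*} [NormedAddCommGroup EB] [NormedSpace ℝ EB]
  {B : Type*} [TopologicalSpace B] [ChartedSpace EB B]
  {EG : Type*} [NormedAddCommGroup EG] [NormedSpace ℝ EG]
  {G : Type*} [Group G] [TopologicalSpace G] [ChartedSpace EG G]
  {EP : Type*} [NormedAddCommGroup EP] [NormedSpace ℝ EP]
  {P : Type*} [TopologicalSpace P] [ChartedSpace EP P] [MulAction Gᵐᵒᵖ P]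
  {π : P → B}

/-- A smooth local section through a given point of the total space. -/
theorem IsPrincipalBundle.exists_section (hP : IsPrincipalBundle EB EP EG G π) (p : P) :
    ∃ (U : Set B) (s : B → P), IsOpen U ∧ π p ∈ U ∧ ContMDiffOn 𝓘(ℝ, EB) 𝓘(ℝ, EP) ∞ s U ∧
      (∀ y ∈ U, π (s y) = y) ∧ s (π p) = p := by
  obtain ⟨U, s, τ, hU, hx, hs, hπ, -, hτ⟩ := hP.locally_trivial (π p)
  refine ⟨U, fun y => s y <• τ p, hU, hx, (contMDiff_act_left hP.smooth_act _).comp_contMDiffOn hs,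
    fun y hy => ?_, hτ p hx⟩
  rw [hP.proj_act, hπ y hy]

theorem IsPrincipalBundle.tD_surjective (hP : IsPrincipalBundle EB EP EG G π) (p : P) (w : EB) :
    ∃ u, tD EP EB π p u = w := by
  obtain ⟨U, s, hU, hx, hs, hπ, hsp⟩ := hP.exists_section p
  refine ⟨tD EB EP s (π p) w, ?_⟩
  have h1 := tD_comp_apply (F := EP) (f := π) (g := s) (z := π p)
    ((hP.smooth_proj _).mdifferentiableAt (by simp))
    ((hs.contMDiffAt (hU.mem_nhds hx)).mdifferentiableAt (by simp)) w
  have h2 : (fun z => π (s z)) =ᶠ[𝓝 (π p)] fun z => z := by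
    filter_upwards [hU.mem_nhds hx] with y hy using hπ y hy
  rw [tD_congr h2, tD_id, hsp] at h1
  exact h1.symm

end Sections

/-! ### The reference bundles -/

section Reference

theorem isOneParam_ofReal {ℓ : ℕ} [NeZero ℓ] :
    IsOneParam (GammaR.ofReal : ℝ → GammaR ℓ) (1 : ℝ) where
  smooth := by
    have h := GammaR.contMDiff_line (1 : GammaR ℓ)
    simpa using h
  add := GammaR.ofReal_add
  deriv := by
    have h := GammaR.contMDiff_line (1 : GammaR ℓ)
    simp only [one_mul] at h
    have h1 : (extChartAt 𝓘(ℝ, ℝ) (1 : GammaR ℓ)) ∘ GammaR.ofReal = fun t => t := by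
      ext t
      have := GammaR.chart_apply (1 : GammaR ℓ) t
      rw [one_mul] at this
      exact this
    have h2 := tD_comp_apply (F' := ℝ) (F := ℝ) (E := ℝ)
      (f := extChartAt 𝓘(ℝ, ℝ) (1 : GammaR ℓ)) (g := GammaR.ofReal) (z := 0)
      (mdifferentiableAt_extChartAt_of_mem (by
        rw [GammaR.ofReal_zero]; exact mem_extChartAt_source _))
      ((h 0).mdifferentiableAt (by simp)) 1
    rw [GammaR.ofReal_zero, tD_chart_self] at h2
    have h3 : (fun z : ℝ => extChartAt 𝓘(ℝ, ℝ) (1 : GammaR ℓ) (GammaR.ofReal z)) = fun t => t := h1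
    rw [h3, tD_id] at h2
    exact h2.symm

theorem GammaR.AdC_eq {ℓ : ℕ} [NeZero ℓ] (k : GammaR ℓ) (v : ℝ) : AdC k v = v := by
  have h : (fun h : GammaR ℓ => k * h * k⁻¹) =ᶠ[𝓝 1] fun h => h := by
    have h1 : range (fun t : ℝ => (1 : GammaR ℓ) * GammaR.ofReal t) ∈ 𝓝 (1 : GammaR ℓ) :=
      (GammaR.isOpenEmbedding 1).isOpen_range.mem_nhds ⟨0, by simp [GammaR.ofReal_zero]⟩
    filter_upwards [h1]
    rintro _ ⟨t, rfl⟩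
    simp only [one_mul]
    rw [GammaR.ofReal_comm, mul_assoc, mul_inv_cancel, mul_one]
  rw [AdC, tD_congr h, tD_id]
  rfl

/-- The element `i` of the Lie algebra of `U(1)`, in the model space of `U(1)`. -/
def circI : EuclideanSpace ℝ (Fin 1) := circleI

theorem circI_ne_zero : circI ≠ 0 := by
  intro h0
  have h1 : MDifferentiableAt 𝓘(ℝ, ℝ) (𝓡 1) Circle.exp 0 :=
    (contMDiff_circleExp 0).mdifferentiableAt (by simp : (1 : WithTop ℕ∞) ≠ 0)
  have _ := finrank_real_complex_fact'
  have h2 : MDifferentiableAt (𝓡 1) 𝓘(ℝ, ℂ) (fun z : Circle => (z : ℂ)) (Circle.exp 0) :=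
    (@contMDiff_coe_sphere (n := 1) (E := ℂ) (m := 1) _ _ finrank_real_complex_fact'
      _).mdifferentiableAt (by simp)
  have h3 := tD_comp_apply (F := EuclideanSpace ℝ (Fin 1)) (f := fun z : Circle => (z : ℂ))
    (g := Circle.exp) h2 h1 (1 : ℝ)
  have h4 : tD ℝ (EuclideanSpace ℝ (Fin 1)) Circle.exp 0 (1 : ℝ) = 0 := h0
  rw [h4, map_zero] at h3
  have h5 : HasDerivAt (fun t : ℝ => (Circle.exp t : ℂ))
      (Complex.exp (0 * Complex.I) * (1 * Complex.I)) 0 := by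
    simp only [Circle.coe_exp]
    have := ((Complex.ofRealCLM.hasDerivAt (x := 0)).mul_const Complex.I).cexp
    simpa using this
  rw [tD_eq_fderiv, fderiv_apply_one_eq_deriv, h5.deriv] at h3
  simp at h3

theorem exists_eq_smul_circI (v : EuclideanSpace ℝ (Fin 1)) :
    ∃ c : ℝ, v = c • circI := by
  have h := (finrank_eq_one_iff_of_nonzero' (K := ℝ) _ circI_ne_zero).1 finrank_euclideanSpace_fin v
  exact h.imp fun c hc => hc.symm

theorem brk_circle (u v : EuclideanSpace ℝ (Fin 1)) : brk Circle u v = 0 := by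
  obtain ⟨a, rfl⟩ := exists_eq_smul_circI u
  obtain ⟨b, rfl⟩ := exists_eq_smul_circI v
  have _ : LieGroup (𝓡 1) ∞ Circle := LieGroup.of_le (n := ω) le_top
  exact brk_smul_smul_self _ a b

theorem lieMap_toCircle {ℓ : ℕ} [NeZero ℓ] (t : ℝ)
    (h : ContMDiff 𝓘(ℝ, ℝ) (𝓡 1) ∞ (GammaR.toCircle ℓ)) :
    tD ℝ (EuclideanSpace ℝ (Fin 1)) (GammaR.toCircle ℓ) 1 t = t • circI := by
  have h1 := tD_comp_apply (F' := ℝ) (F := ℝ) (E := EuclideanSpace ℝ (Fin 1))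
    (f := GammaR.toCircle ℓ) (g := GammaR.ofReal) (z := 0)
    ((h _).mdifferentiableAt (by simp)) ((isOneParam_ofReal.smooth 0).mdifferentiableAt (by simp)) 1
  rw [GammaR.ofReal_zero, isOneParam_ofReal.deriv] at h1
  have h2 : t = t • (1 : ℝ) := by simp
  rw [h2, map_smul, ← h1, smul_eq_mul, mul_one]
  rfl

variable {B : Type*} [TopologicalSpace B] [ChartedSpace (EuclideanSpace ℝ (Fin 2)) B]
  {ℓ : ℕ} [NeZero ℓ] {vol : ∀ x : B, TangentSpace (𝓡 2) x [⋀^Fin 2]→L[ℝ] ℝ} {Q : B}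
  {c : CanonicalSystem ℓ vol Q}
  {EM : Type*} [NormedAddCommGroup EM] [NormedSpace ℝ EM] [FiniteDimensional ℝ EM]
  {M : Type*} [TopologicalSpace M]
  [ChartedSpace EM M] [IsManifold 𝓘(ℝ, EM) ∞ M] [MulAction Circleᵐᵒᵖ M]
  {πM : M → B} {ωM : Connection EM M (EuclideanSpace ℝ (Fin 1)) Circle} {QM : M}
  {EN : Type*} [NormedAddCommGroup EN] [NormedSpace ℝ EN] [FiniteDimensional ℝ EN]
  {N : Type*} [TopologicalSpace N]
  [ChartedSpace EN N] [IsManifold 𝓘(ℝ, EN) ∞ N] [MulAction (GammaR ℓ)ᵐᵒᵖ N]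
  {q : N → M} {ωN : Connection EN N ℝ (GammaR ℓ)} {QN : N}

/-- The value of a two-form on two tangent vectors, with the tangent spaces of the surface
identified with the model space. -/
def form2 {V : Type*} [NormedAddCommGroup V] [NormedSpace ℝ V]
    (β : ∀ x : B, TangentSpace (𝓡 2) x [⋀^Fin 2]→L[ℝ] V) (x : B)
    (u v : EuclideanSpace ℝ (Fin 2)) : V := β x ![u, v]

omit [FiniteDimensional ℝ EM] [NeZero ℓ] in
theorem IsReferenceBundle.extD_co (hM : IsReferenceBundle c πM ωM QM) (m : M) (u v : EM) :
    extD ωM.co m u v = (-(2 * Real.pi * form2 vol (πM m)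
      (tD EM (EuclideanSpace ℝ (Fin 2)) πM m u) (tD EM (EuclideanSpace ℝ (Fin 2)) πM m v))) •
        circleI := by
  have h1 : ωM.cvr m u v = _ := hM.curv_eq m u v
  have h2 : ωM.cvr m u v = extD ωM.co m u v + brk Circle (ωM.co m u) (ωM.co m v) := rfl
  rw [brk_circle, add_zero] at h2
  rw [← h2, h1]
  rfl

theorem extD_smulRight {E V : Type*} [NormedAddCommGroup E] [NormedSpace ℝ E]
    [NormedAddCommGroup V] [NormedSpace ℝ V] {P : Type*} [TopologicalSpace P] [ChartedSpace E P]
    [IsManifold 𝓘(ℝ, E) ∞ P]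
    {η : P → E →L[ℝ] ℝ} (hη : SmoothForm η) (X : V) (p : P) (u v : E) :
    extD (fun p => (η p).smulRight X) p u v = extD η p u v • X := by
  let L : (E →L[ℝ] ℝ) →L[ℝ] (E →L[ℝ] V) := ContinuousLinearMap.smulRightL ℝ E V |>.flip X
  have hd : DifferentiableAt ℝ (pull E η (extChartAt 𝓘(ℝ, E) p).symm)
      (extChartAt 𝓘(ℝ, E) p p) :=
    (hη.contDiffAt_pull (contMDiffAt_extChartAt_symm (mem_extChartAt_target p))).differentiableAt
      (by simp)
  have h1 : pull E (fun p => (η p).smulRight X) (extChartAt 𝓘(ℝ, E) p).symm =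
      fun x => L (pull E η (extChartAt 𝓘(ℝ, E) p).symm x) := rfl
  have h2 := L.hasFDerivAt.comp (extChartAt 𝓘(ℝ, E) p p) hd.hasFDerivAt
  have h3 : fderiv ℝ (fun x => L (pull E η (extChartAt 𝓘(ℝ, E) p).symm x))
      (extChartAt 𝓘(ℝ, E) p p) = _ := h2.fderiv
  rw [extD, h1, curl, h3, extD, curl, sub_smul]
  rfl

theorem IsReferenceCover.extD_co (hM : IsReferenceBundle c πM ωM QM)
    (hN : IsReferenceCover c πM ωM QM q ωN QN) (n : N) (u v : EN) :
    extD ωN.co n u v = -(2 * Real.pi * form2 vol (πM (q n))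
      (tD EN (EuclideanSpace ℝ (Fin 2)) (fun n => πM (q n)) n u)
      (tD EN (EuclideanSpace ℝ (Fin 2)) (fun n => πM (q n)) n v)) := by
  have hq := hN.morphism.smooth_map
  have hcomp : ∀ w, tD EN (EuclideanSpace ℝ (Fin 2)) (fun n => πM (q n)) n w =
      tD EM (EuclideanSpace ℝ (Fin 2)) πM (q n) (tD EN EM q n w) := fun w =>
    tD_comp_apply (F := EM) (f := πM) (g := q)
      ((hM.principal.smooth_proj _).mdifferentiableAt (by simp))
      ((hq _).mdifferentiableAt (by simp)) w
  have h1 := ωM.smoothForm_co.extD_pull hq n u v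
  have h2 : pull EN ωM.co q = fun n => (ωN.co n).smulRight
      circI := by
    funext n
    ext1 w
    have h3 : ωM.co (q n) (tD EN EM q n w) =
      tD ℝ (EuclideanSpace ℝ (Fin 1)) (GammaR.toCircle ℓ) 1 (ωN.co n w) := hN.morphism.map_form n w
    rw [pull_apply, h3, lieMap_toCircle _ hN.morphism.smooth_hom]
    rfl
  rw [h2, extD_smulRight ωN.smoothForm_co, hM.extD_co, ← hcomp, ← hcomp] at h1
  exact smul_left_injective ℝ circI_ne_zero h1

variable {EG : Type*} [NormedAddCommGroup EG] [NormedSpace ℝ EG] [CompleteSpace EG]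
  {G : Type*} [Group G] [TopologicalSpace G] [T2Space G]
  [ChartedSpace EG G] [LieGroup 𝓘(ℝ, EG) ∞ G]
  {EP : Type*} [NormedAddCommGroup EP] [NormedSpace ℝ EP] [FiniteDimensional ℝ EP]
  {P : Type*} [TopologicalSpace P]
  [ChartedSpace EP P] [IsManifold 𝓘(ℝ, EP) ∞ P] [MulAction Gᵐᵒᵖ P]
  {π : P → B}

omit [FiniteDimensional ℝ EN] [CompleteSpace EG] [FiniteDimensional ℝ EP] in
/-- A map between principal bundles with connection that preserves horizontal vectors is the
pre-reduction map if all points of the source are joined to the base point. -/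
theorem IsPrincipalBundle.isPreReductionMap
    (hP : IsPrincipalBundle (EuclideanSpace ℝ (Fin 2)) EP EG G π)
    {A : Connection EP P EG G} {πN : N → B} {QP : P} {lam : N → P}
    (hlam : ContMDiff 𝓘(ℝ, EN) 𝓘(ℝ, EP) ∞ lam) (hπ : ∀ n, π (lam n) = πN n)
    (hh : ∀ n v, ωN.co n v = 0 → A.co (lam n) (tD EN EP lam n v) = 0) (h0 : lam QN = QP)
    (hj : ∀ n, HorizontallyJoined ωN QN n) : IsPreReductionMap πN ωN π A QN QP lam := by
  intro T T'
  constructor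
  · rintro rfl
    obtain ⟨wt, h, h0', h1⟩ := (hj T).exists_lift (π := πN)
    exact ⟨wt, fun t => lam (wt t), h, h0', h1, h.map hlam hπ hh, (congrArg lam h0').trans h0,
      congrArg lam h1⟩
  · rintro ⟨wt, w', h, h0', h1, h', h2, h3⟩
    have := hP.horizontalLift_unique (h.map hlam hπ hh) h'
      (((congrArg lam h0').trans h0).trans h2.symm) 1 (by simp)
    rw [← h3, this, h1]

/-- A connection with curvature `-X vol` receives a morphism from the reference bundle: since the
total space of the latter is simply connected and carries a connection of curvature `-2π vol`, the
equation for the map can be integrated. -/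
theorem exists_preReduction (hM : IsReferenceBundle c πM ωM QM)
    (hN : IsReferenceCover c πM ωM QM q ωN QN)
    (hP : IsPrincipalBundle (EuclideanSpace ℝ (Fin 2)) EP EG G π) {QP : P} (hQP : π QP = Q)
    (A : Connection EP P EG G) {X : EG} (hX : ∀ g : G, AdC g X = X)
    (hA : ∀ p u v, A.cvr p u v = -(form2 vol (π p) (tD EP (EuclideanSpace ℝ (Fin 2)) π p u)
      (tD EP (EuclideanSpace ℝ (Fin 2)) π p v) • X))
    (hj : ∀ n, HorizontallyJoined ωN QN n) :
    ∃ (lam : N → P) (χ : GammaR ℓ →* G),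
      IsPreReductionMap (fun n => πM (q n)) ωN π A QN QP lam ∧
      IsConnectionMorphism (fun n => πM (q n)) ωN π A χ lam ∧
      FreeGroup.lift (fun a => holonomy π A (c.curve a) QP) = χ.comp (freeToGammaR ℓ) ∧
      ∀ t : ℝ, χ (GammaR.ofReal (2 * Real.pi * t)) = lieExp (E₁ := EG) (G := G) (t • X) := by
  have hpi : (2 * Real.pi) ≠ 0 := by positivity
  let Z : EG := (2 * Real.pi)⁻¹ • X
  have hZ : ∀ g : G, AdC g Z = Z := fun g => by rw [map_smul, hX]
  have _ := hN.simply_connected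
  obtain ⟨lam, hlam, hlam0, h⟩ := hP.exists_lift A (f := fun n => πM (q n))
    hN.principal.smooth_proj ωN.smoothForm_co hZ (fun n p hp u v u' v' hu hv => by
      rw [hA, hu, hv, hp, hN.extD_co hM, smul_smul, ← neg_smul]
      congr 1
      field_simp) (y₀ := QN) (p₀ := QP) (by
        rw [hQP, hN.base, hM.base])
  let L : ℝ →L[ℝ] EG := (1 : ℝ →L[ℝ] ℝ).smulRight Z
  have hL : ∀ t, L t = t • Z := fun t => rfl
  obtain ⟨χ, hχ, hact, hχL⟩ := exists_hom_of_map hN.principal hP ωN A GammaR.AdC_eq (L := L)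
    (fun g v => by rw [hL, map_smul, hZ]) hlam (fun n => (h n).1) (fun n v => (h n).2 v)
  have hπ : ∀ n, π (lam n) = πM (q n) := fun n => (h n).1
  have hh : ∀ n v, ωN.co n v = 0 → A.co (lam n) (tD EN EP lam n v) = 0 := fun n v hv => by
    rw [(h n).2, hv, zero_smul]
  refine ⟨lam, χ, hP.isPreReductionMap hlam hπ hh hlam0 hj,
    ⟨hχ, hlam, hπ, hact, fun n v => ?_⟩, FreeGroup.ext_hom _ _ fun a => ?_, fun t => ?_⟩
  · exact ((h n).2 v).trans (hχL (ωN.co n v)).symm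
  · obtain ⟨wN, hw, h0, h1⟩ := hN.generator a
    rw [FreeGroup.lift_apply_of]
    refine hP.holonomy_eq (hw.map hlam hπ hh) ?_ ?_
    · rw [h0, hlam0]
    · rw [h1, hact, hlam0]
      rfl
  · have hγ : IsOneParam (fun t => χ (GammaR.ofReal t)) Z := by
      refine ⟨hχ.comp isOneParam_ofReal.smooth, fun s t => ?_, ?_⟩
      · rw [GammaR.ofReal_add, map_mul]
      · rw [tD_comp_apply (F := ℝ) (f := χ) (g := GammaR.ofReal) ((hχ _).mdifferentiableAt (by simp))
          ((isOneParam_ofReal.smooth 0).mdifferentiableAt (by simp)), isOneParam_ofReal.deriv,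
          GammaR.ofReal_zero, hχL, hL, one_smul]
    have h1 := congrFun hγ.eq_expCurve (2 * Real.pi * t)
    have h2 : (2 * Real.pi * t) • Z = t • X := by
      rw [smul_smul]
      congr 1
      field_simp
    have h3 := lieExp_smul (G := G) Z (2 * Real.pi * t)
    rw [h2] at h3
    exact h1.trans h3.symm

/-- Horizontal curves join any two points of the total space of the reference bundle, as its
curvature vanishes nowhere; hence the pre-reduction map is defined everywhere. -/
theorem IsReferenceCover.horizontallyJoined (hM : IsReferenceBundle c πM ωM QM)
    (hN : IsReferenceCover c πM ωM QM q ωN QN) (n n' : N) :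
    HorizontallyJoined ωN n n' := by
  have _ := hN.simply_connected
  refine horizontallyJoined_of_extD_ne_zero ωN hN.principal.smooth_act isOneParam_ofReal
    (fun k => GammaR.AdC_eq k 1) (fun n => ?_) n n'
  by_contra! h0
  refine hM.nondegenerate (πM (q n)) (ContinuousAlternatingMap.ext fun w => ?_)
  obtain ⟨u, hu⟩ := hN.principal.tD_surjective n (w 0)
  obtain ⟨v, hv⟩ := hN.principal.tD_surjective n (w 1)
  have h1 := h0 u v
  rw [hN.extD_co hM, hu, hv] at h1
  have h2 : form2 vol (πM (q n)) (w 0) (w 1) = 0 := by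
    have := Real.pi_ne_zero
    simpa [this] using h1
  have h3 : w = ![w 0, w 1] := by
    ext i
    fin_cases i <;> rfl
  rw [h3]
  exact h2

/-- A morphism from the reference bundle that is `t ↦ exp(tX/2π)` on the subgroup `ℝ` pulls the
connection form back to `X/2π` times the reference form, which determines the curvature. -/
theorem IsConnectionMorphism.cvr_eq (hM : IsReferenceBundle c πM ωM QM)
    (hN : IsReferenceCover c πM ωM QM q ωN QN)
    (hP : IsPrincipalBundle (EuclideanSpace ℝ (Fin 2)) EP EG G π)
    {A : Connection EP P EG G} {X : EG} (hX : ∀ g : G, AdC g X = X) {lam : N → P}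
    {χ : GammaR ℓ →* G} (h : IsConnectionMorphism (fun n => πM (q n)) ωN π A χ lam)
    (hχ : ∀ t : ℝ, χ (GammaR.ofReal (2 * Real.pi * t)) = lieExp (E₁ := EG) (G := G) (t • X))
    (p : P) (u v : EP) :
    A.cvr p u v = -(form2 vol (π p) (tD EP (EuclideanSpace ℝ (Fin 2)) π p u)
      (tD EP (EuclideanSpace ℝ (Fin 2)) π p v) • X) := by
  have hpi : (2 * Real.pi) ≠ 0 := by positivity
  let Z : EG := (2 * Real.pi)⁻¹ • X
  have hZ : ∀ g : G, AdC g Z = Z := fun g => by rw [map_smul, hX]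
  have hγ : (fun t : ℝ => χ (GammaR.ofReal t)) = fun t => expCurve G X ((2 * Real.pi)⁻¹ * t) := by
    funext t
    have h1 := (hχ ((2 * Real.pi)⁻¹ * t)).trans (lieExp_smul X ((2 * Real.pi)⁻¹ * t))
    rwa [← mul_assoc, mul_inv_cancel₀ hpi, one_mul] at h1
  have hL1 : tD ℝ EG χ 1 1 = Z := by
    have h1 := tD_comp_apply (F := ℝ) (f := χ) (g := GammaR.ofReal) (z := 0)
      ((h.smooth_hom _).mdifferentiableAt (by simp))
      ((isOneParam_ofReal.smooth 0).mdifferentiableAt (by simp)) 1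
    rw [isOneParam_ofReal.deriv, GammaR.ofReal_zero, hγ] at h1
    have h2 : HasDerivAt (fun t : ℝ => (2 * Real.pi)⁻¹ * t) ((2 * Real.pi)⁻¹ * 1) 0 :=
      (hasDerivAt_id (0 : ℝ)).const_mul _
    have h3 := tD_comp_apply (F' := ℝ) (F := ℝ) (f := expCurve G X)
      (g := fun t : ℝ => (2 * Real.pi)⁻¹ * t) (z := 0)
      (((isOneParam_expCurve X).smooth _).mdifferentiableAt (by simp))
      h2.differentiableAt.mdifferentiableAt (1 : ℝ)
    rw [tD_eq_fderiv, fderiv_apply_one_eq_deriv, h2.deriv, mul_zero,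
      ← smul_eq_mul _ (1 : ℝ), map_smul,
      (isOneParam_expCurve X).deriv] at h3
    exact h1.symm.trans h3
  have hL : ∀ t : ℝ, tD ℝ EG χ 1 t = t • Z := fun t => by
    rw [← hL1, ← map_smul, smul_eq_mul, mul_one]
  obtain ⟨n, hn⟩ : ∃ n, πM (q n) = π p := by
    obtain ⟨U, s, -, -, hx, -, hs, -⟩ := hN.principal.locally_trivial (π p)
    exact ⟨s (π p), hs _ hx⟩
  obtain ⟨g, rfl⟩ := hP.exists_act_eq (p := lam n) (p' := p) ((h.proj_map n).trans hn)
  let f : N → P := fun n => lam n <• g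
  have hf : ContMDiff 𝓘(ℝ, EN) 𝓘(ℝ, EP) ∞ f :=
    (contMDiff_act_left hP.smooth_act g).comp h.smooth_map
  have hform : ∀ n w, A.co (f n) (tD EN EP f n w) = ωN.co n w • Z := by
    intro n w
    have h1 : A.co (lam n) (tD EN EP lam n w) = tD ℝ EG χ 1 (ωN.co n w) := h.map_form n w
    rw [A.co_tD_act_const hP.smooth_act ((h.smooth_map n).mdifferentiableAt (by simp)), h1, hL,
      map_smul, hZ]
  have hproj : ∀ w, tD EP (EuclideanSpace ℝ (Fin 2)) π (f n) (tD EN EP f n w) =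
      tD EN (EuclideanSpace ℝ (Fin 2)) (fun n => πM (q n)) n w := by
    intro w
    rw [← tD_comp_apply (F := EP) (f := π) (g := f) ((hP.smooth_proj _).mdifferentiableAt (by simp))
      ((hf n).mdifferentiableAt (by simp))]
    have h1 : (fun n => π (f n)) = fun n => πM (q n) := funext fun n =>
      (hP.proj_act _ g).trans (h.proj_map n)
    rw [h1]
  have hcvr : ∀ u v, A.cvr (f n) (tD EN EP f n u) (tD EN EP f n v) =
      extD ωN.co n u v • Z := by
    intro u v
    have h1 : A.cvr (f n) (tD EN EP f n u) (tD EN EP f n v) =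
      extD A.co (f n) (tD EN EP f n u) (tD EN EP f n v) +
      brk G (A.co (f n) (tD EN EP f n u)) (A.co (f n) (tD EN EP f n v)) := rfl
    have h2 : pull EN A.co f = fun n => (ωN.co n).smulRight Z := by
      funext n
      ext1 w
      exact hform n w
    rw [h1, hform, hform, brk_smul_smul_self, add_zero, ← A.smoothForm_co.extD_pull hf, h2,
      extD_smulRight ωN.smoothForm_co]
  obtain ⟨u', hu⟩ := hN.principal.tD_surjective n (tD EP (EuclideanSpace ℝ (Fin 2)) π (f n) u)
  obtain ⟨v', hv⟩ := hN.principal.tD_surjective n (tD EP (EuclideanSpace ℝ (Fin 2)) π (f n) v)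
  have h1 := hP.cvr_eq A (p := f n) (u := u) (u' := tD EN EP f n u') (v := v)
    (v' := tD EN EP f n v') (by rw [hproj, hu]) (by rw [hproj, hv])
  change A.cvr (f n) u v = -(form2 vol (π (f n)) (tD EP (EuclideanSpace ℝ (Fin 2)) π (f n) u)
      (tD EP (EuclideanSpace ℝ (Fin 2)) π (f n) v) • X)
  have h2 : π (f n) = πM (q n) := (hP.proj_act _ g).trans (h.proj_map n)
  rw [h1, hcvr, hN.extD_co hM, hu, hv, h2, smul_smul, ← neg_smul]
  congr 1
  field_simp

end Reference

/-! ### A radial potential of a two-form on the plane -/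

section RadialPotential

/-- The function `K` for which `K (x dy - y dx)` is a potential of the two-form `g dx ∧ dy`. -/
def radialPotential (g : ℂ → ℝ) (z : ℂ) : ℝ := ∫ t in (0 : ℝ)..1, t * g (t • z)

/-- The potential is a convolution with a parameter, evaluated at `0`. -/
theorem contDiff_radialPotential {g : ℂ → ℝ} (hg : ContDiff ℝ ∞ g) :
    ContDiff ℝ ∞ (radialPotential g) := by
  let χ : ContDiffBump (0 : ℝ) := ⟨1, 2, one_pos, one_lt_two⟩
  let f : ℝ → ℝ := (Ioc 0 1).indicator fun t => t
  let G : ℂ → ℝ → ℝ := fun p x => χ x * g ((-x) • p)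
  have hf : MeasureTheory.LocallyIntegrable f MeasureTheory.volume := by
    refine MeasureTheory.Integrable.locallyIntegrable ?_
    rw [MeasureTheory.integrable_indicator_iff measurableSet_Ioc]
    exact (continuous_id.integrableOn_Icc (a := 0) (b := 1)).mono_set Ioc_subset_Icc_self
  have hG : ContDiffOn ℝ ((⊤ : ℕ∞) : WithTop ℕ∞) ↿G (univ ×ˢ univ) := by
    refine ContDiff.contDiffOn ?_
    have h1 : ContDiff ℝ ∞ fun z : ℂ × ℝ => χ z.2 * g ((-z.2) • z.1) :=
      (χ.contDiff.comp contDiff_snd).mul (hg.comp (contDiff_snd.neg.smul contDiff_fst))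
    exact h1
  have h := MeasureTheory.contDiffOn_convolution_right_with_param (μ := MeasureTheory.volume)
    (ContinuousLinearMap.mul ℝ ℝ) isOpen_univ (isCompact_closedBall (0 : ℝ) 2)
    (fun p x _ hx => ?_) hf hG
  · rw [univ_prod_univ, contDiffOn_univ] at h
    have h2 : ContDiff ℝ ∞ fun p : ℂ => (p, (0 : ℝ)) := contDiff_id.prodMk contDiff_const
    have h3 := h.comp h2
    convert h3 using 1
    funext p
    change radialPotential g p = ∫ t, f t * (χ (0 - t) * g ((-(0 - t)) • p))
    rw [radialPotential, intervalIntegral.integral_of_le zero_le_one,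
      ← MeasureTheory.integral_indicator measurableSet_Ioc]
    congr 1
    funext t
    simp only [f, indicator]
    split_ifs with ht
    · have : χ (0 - t) = 1 := by
        refine χ.one_of_mem_closedBall ?_
        rw [Metric.mem_closedBall, dist_zero_right, zero_sub, norm_neg, Real.norm_eq_abs,
          abs_of_pos ht.1]
        exact ht.2
      rw [this, one_mul, zero_sub, neg_neg]
    · rw [zero_mul]
  · have : χ x = 0 := by
      refine χ.zero_of_le_dist ?_
      rw [Metric.mem_closedBall, not_le] at hx
      exact hx.le
    change χ x * _ = 0
    rw [this, zero_mul]

theorem radialPotential_euler {g : ℂ → ℝ} (hg : ContDiff ℝ ∞ g) (z : ℂ) :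
    2 * radialPotential g z + fderiv ℝ (radialPotential g) z z = g z := by
  have h1 : (fun s : ℝ => s ^ 2 * radialPotential g (s • z)) =
      fun s => ∫ τ in (0 : ℝ)..s, τ * g (τ • z) := by
    funext s
    have h := intervalIntegral.mul_integral_comp_mul_left (a := 0) (b := 1)
      (f := fun τ : ℝ => τ * g (τ • z)) (c := s)
    rw [mul_zero, mul_one] at h
    rw [← h, radialPotential, pow_two, mul_assoc, ← intervalIntegral.integral_const_mul]
    congr 1
    refine intervalIntegral.integral_congr fun t _ => ?_
    change s * (t * g (t • s • z)) = s * t * g ((s * t) • z)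
    rw [smul_smul, mul_comm t s]
    ring
  have hK := ((contDiff_radialPotential hg).differentiable (by simp) z).hasFDerivAt
  have h2 : HasDerivAt (fun s : ℝ => s • z) ((1 : ℝ) • z) 1 := (hasDerivAt_id 1).smul_const z
  have h3 : HasDerivAt (fun s : ℝ => radialPotential g (s • z))
      (fderiv ℝ (radialPotential g) z ((1 : ℝ) • z)) 1 :=
    HasFDerivAt.comp_hasDerivAt (l := radialPotential g) (l' := fderiv ℝ (radialPotential g) z)
      (f := fun s : ℝ => s • z) 1 (by rwa [one_smul]) h2
  have h4 := ((hasDerivAt_id (1 : ℝ)).pow 2).mul h3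
  have hc : Continuous fun τ : ℝ => τ * g (τ • z) :=
    continuous_id.mul (hg.continuous.comp (continuous_id.smul continuous_const))
  have h5 : HasDerivAt (fun s => ∫ τ in (0 : ℝ)..s, τ * g (τ • z)) (1 * g ((1 : ℝ) • z)) 1 :=
    intervalIntegral.integral_hasDerivAt_right (hc.intervalIntegrable _ _)
      (hc.stronglyMeasurableAtFilter _ _) hc.continuousAt
  have h6 : HasDerivAt (fun s : ℝ => s ^ 2 * radialPotential g (s • z)) _ 1 := h4
  rw [h1] at h6
  have h7 := h6.unique h5
  simp only [one_smul, id] at h7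
  norm_num at h7
  linarith

/-- The one-form `x dy - y dx` on the plane. -/
def rotForm : ℂ →L[ℝ] ℂ →L[ℝ] ℝ :=
  Complex.reCLM.smulRight Complex.imCLM - Complex.imCLM.smulRight Complex.reCLM

theorem rotForm_apply (z w : ℂ) : rotForm z w = z.re * w.im - z.im * w.re := rfl

/-- The potential `K (x dy - y dx)`. -/
def radialForm (g : ℂ → ℝ) (z : ℂ) : ℂ →L[ℝ] ℝ := radialPotential g z • rotForm z

theorem contDiff_radialForm {g : ℂ → ℝ} (hg : ContDiff ℝ ∞ g) : ContDiff ℝ ∞ (radialForm g) :=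
  (contDiff_radialPotential hg).smul rotForm.contDiff

theorem curl_radialForm {g : ℂ → ℝ} (hg : ContDiff ℝ ∞ g) (z : ℂ) :
    curl (radialForm g) z 1 Complex.I = g z := by
  have hK := ((contDiff_radialPotential hg).differentiable (by simp) z).hasFDerivAt
  have h : fderiv ℝ (radialForm g) z = _ := (hK.smul rotForm.hasFDerivAt).fderiv
  have h1 : z = z.re • (1 : ℂ) + z.im • Complex.I := by simp
  have h2 : fderiv ℝ (radialPotential g) z z = z.re * fderiv ℝ (radialPotential g) z 1 +
      z.im * fderiv ℝ (radialPotential g) z Complex.I := by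
    conv_lhs => rw [h1]
    rw [map_add, map_smul, map_smul, smul_eq_mul, smul_eq_mul, ← h1]
  rw [← radialPotential_euler hg z, h2, curl, h]
  simp [rotForm_apply]
  ring

theorem radialForm_circ (g : ℂ → ℝ) (t : ℝ) :
    radialForm g (circ t) (2 * Real.pi * Complex.I * circ t) =
      2 * Real.pi * radialPotential g (circ t) := by
  have h := Real.sin_sq_add_cos_sq (2 * Real.pi * t)
  have hc : circ t = Complex.mk (Real.cos (2 * Real.pi * t)) (Real.sin (2 * Real.pi * t)) := by
    rw [circ_eq]
    apply Complex.ext <;> simp only [Complex.add_re, Complex.add_im, Complex.mul_re, Complex.mul_im,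
      Complex.ofReal_re, Complex.ofReal_im, Complex.I_re, Complex.I_im] <;> ring
  change radialPotential g (circ t) * rotForm (circ t) (2 * Real.pi * Complex.I * circ t) = _
  have h2 : rotForm (circ t) (2 * Real.pi * Complex.I * circ t) = 2 * Real.pi := by
    have h3 : (2 * Real.pi * Complex.I * circ t : ℂ) = Complex.mk
        (-(2 * Real.pi * Real.sin (2 * Real.pi * t))) (2 * Real.pi * Real.cos (2 * Real.pi * t)) := by
      rw [hc]
      apply Complex.ext <;> simp
    rw [rotForm_apply, h3, hc]
    linear_combination (2 * Real.pi) * h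
  rw [h2, mul_comm]

/-- Integration in polar coordinates. -/
theorem integral_radialPotential_circ {g : ℂ → ℝ} (hg : ContDiff ℝ ∞ g) (a : ℝ) :
    ∫ t in a..a + 1, 2 * Real.pi * radialPotential g (circ t) =
      ∫ z in Metric.ball (0 : ℂ) 1, g z := by
  have hper : Function.Periodic (fun t => 2 * Real.pi * radialPotential g (circ t)) 1 := by
    intro t
    have : circ (t + 1) = circ t := by
      simp only [circ]
      push_cast
      rw [mul_add, add_mul, mul_one, Complex.exp_add, Complex.exp_two_pi_mul_I, mul_one]
    simp only [this]
  rw [hper.intervalIntegral_add_eq a (-(1 / 2)), ← MeasureTheory.integral_indicator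
    Metric.isOpen_ball.measurableSet, ← Complex.integral_comp_polarCoord_symm]
  -- both sides are integrals over `(0, 1) × (-π, π)`
  have h1 : ∀ φ ∈ Ioo (-Real.pi) Real.pi, radialPotential g (circ ((2 * Real.pi)⁻¹ * φ)) =
      ∫ r in Ioo (0 : ℝ) 1, r * g (Complex.polarCoord.symm (r, φ)) := by
    intro φ _
    rw [radialPotential, intervalIntegral.integral_of_le zero_le_one,
      MeasureTheory.integral_Ioc_eq_integral_Ioo]
    refine MeasureTheory.setIntegral_congr_fun measurableSet_Ioo fun r _ => ?_
    have h2 : 2 * Real.pi * ((2 * Real.pi)⁻¹ * φ) = φ := by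
      have := Real.pi_ne_zero
      field_simp
    have h3 : r • circ ((2 * Real.pi)⁻¹ * φ) = Complex.polarCoord.symm (r, φ) := by
      rw [circ_eq, h2, Complex.polarCoord_symm_apply]
      simp [mul_add]
    change r * g _ = _
    rw [h3]
  have h4 : ∫ t in (-(1 / 2) : ℝ)..-(1 / 2) + 1, 2 * Real.pi * radialPotential g (circ t) =
      ∫ φ in Ioo (-Real.pi) Real.pi, ∫ r in Ioo (0 : ℝ) 1,
        r * g (Complex.polarCoord.symm (r, φ)) := by
    have hpi := Real.pi_pos
    have h5 := intervalIntegral.mul_integral_comp_mul_left (a := -Real.pi) (b := Real.pi)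
      (f := fun t => 2 * Real.pi * radialPotential g (circ t)) (c := (2 * Real.pi)⁻¹)
    have e1 : (2 * Real.pi)⁻¹ * -Real.pi = -(1 / 2) := by field_simp
    have e2 : (2 * Real.pi)⁻¹ * Real.pi = -(1 / 2) + 1 := by field_simp; norm_num
    rw [e1, e2] at h5
    rw [← h5, intervalIntegral.integral_of_le (by linarith),
      MeasureTheory.integral_Ioc_eq_integral_Ioo, ← MeasureTheory.integral_const_mul]
    refine MeasureTheory.setIntegral_congr_fun measurableSet_Ioo fun φ hφ => ?_
    change (2 * Real.pi)⁻¹ * (2 * Real.pi * _) = _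
    rw [h1 φ hφ, ← mul_assoc, inv_mul_cancel₀ (by positivity), one_mul]
  have hc : Continuous fun p : ℝ × ℝ => p.1 * g (Complex.polarCoord.symm p) := by
    refine continuous_fst.mul (hg.continuous.comp ?_)
    have : (Complex.polarCoord.symm : ℝ × ℝ → ℂ) =
      fun p => (p.1 * (Real.cos p.2 + Real.sin p.2 * Complex.I) : ℂ) :=
      funext fun p => Complex.polarCoord_symm_apply p
    rw [this]
    fun_prop
  have hint : MeasureTheory.IntegrableOn (fun p : ℝ × ℝ => p.1 * g (Complex.polarCoord.symm p))
      (Ioo 0 1 ×ˢ Ioo (-Real.pi) Real.pi) (MeasureTheory.volume.prod MeasureTheory.volume) := by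
    refine MeasureTheory.IntegrableOn.mono_set (t := Icc 0 1 ×ˢ Icc (-Real.pi) Real.pi) ?_
      (prod_mono Ioo_subset_Icc_self Ioo_subset_Icc_self)
    exact hc.continuousOn.integrableOn_compact (isCompact_Icc.prod isCompact_Icc)
  have h6 : ∫ p in polarCoord.target, p.1 • (Metric.ball (0 : ℂ) 1).indicator (fun z => g z)
      (Complex.polarCoord.symm p) =
      ∫ p in Ioo (0 : ℝ) 1 ×ˢ Ioo (-Real.pi) Real.pi, p.1 * g (Complex.polarCoord.symm p) := by
    have hm : MeasurableSet (Ioo (0 : ℝ) 1 ×ˢ Ioo (-Real.pi) Real.pi) :=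
      measurableSet_Ioo.prod measurableSet_Ioo
    have hsub : Ioo (0 : ℝ) 1 ×ˢ Ioo (-Real.pi) Real.pi ⊆ polarCoord.target :=
      prod_mono Ioo_subset_Ioi_self le_rfl
    rw [MeasureTheory.setIntegral_eq_of_subset_of_forall_sdiff_eq_zero
      polarCoord.open_target.measurableSet hsub]
    · refine MeasureTheory.setIntegral_congr_fun hm fun p hp => ?_
      have : Complex.polarCoord.symm p ∈ Metric.ball (0 : ℂ) 1 := by
        rw [Metric.mem_ball, dist_zero_right, Complex.norm_polarCoord_symm, abs_of_pos hp.1.1]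
        exact hp.1.2
      simp only [indicator_of_mem this, smul_eq_mul]
    · intro p hp
      have hp0 : p ∈ Ioi (0 : ℝ) ×ˢ Ioo (-Real.pi) Real.pi := hp.1
      have : Complex.polarCoord.symm p ∉ Metric.ball (0 : ℂ) 1 := by
        intro h
        rw [Metric.mem_ball, dist_zero_right, Complex.norm_polarCoord_symm] at h
        exact hp.2 ⟨⟨hp0.1, (le_abs_self _).trans_lt h⟩, hp0.2⟩
      rw [indicator_of_notMem this, smul_zero]
  have h7 := MeasureTheory.setIntegral_prod_swap (μ := MeasureTheory.volume)
    (ν := MeasureTheory.volume) (Ioo (0 : ℝ) 1) (Ioo (-Real.pi) Real.pi)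
    (fun p : ℝ × ℝ => p.1 * g (Complex.polarCoord.symm p))
  rw [h4, h6]
  refine Eq.trans ?_ h7
  rw [MeasureTheory.setIntegral_prod]
  · rfl
  · exact hint.swap

end RadialPotential

/-! ### Forms on vector spaces, immersions -/

section FormsOnVectorSpaces

variable {F : Type*} [NormedAddCommGroup F] [NormedSpace ℝ F]
  {V : Type*} [NormedAddCommGroup V] [NormedSpace ℝ V]

theorem pull_id (κ : F → F →L[ℝ] V) : pull F κ (fun z : F => z) = κ := by
  funext z
  ext1 w
  rw [pull_apply, tD_id]
  rfl

theorem smoothForm_of_contDiff {κ : F → F →L[ℝ] V} (h : ContDiff ℝ ∞ κ) : SmoothForm κ := by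
  intro p
  have h1 : ((extChartAt 𝓘(ℝ, F) p).symm : F → F) = fun z => z := by
    rw [extChartAt_model_space_eq_id]
    rfl
  rw [h1, pull_id]
  exact h.contDiffOn

theorem extD_eq_curl {κ : F → F →L[ℝ] V} (h : ContDiff ℝ ∞ κ) (z u v : F) :
    extD κ z u v = curl κ z u v := by
  have h1 := (smoothForm_of_contDiff h).curl_pull (f := fun z : F => z) (x := z)
    contMDiffAt_id u v
  rw [pull_id, tD_id] at h1
  exact h1.symm

theorem curl_complex (α : ℂ → ℂ →L[ℝ] V) (z u v : ℂ) :
    curl α z u v = (u.re * v.im - u.im * v.re) • curl α z 1 Complex.I := by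
  have h : ∀ w : ℂ, w = w.re • (1 : ℂ) + w.im • Complex.I := fun w => by simp
  have h1 : ∀ u v : ℂ, fderiv ℝ α z u v = (u.re * v.re) • fderiv ℝ α z 1 1 +
      (u.re * v.im) • fderiv ℝ α z 1 Complex.I + (u.im * v.re) • fderiv ℝ α z Complex.I 1 +
      (u.im * v.im) • fderiv ℝ α z Complex.I Complex.I := by
    intro u v
    conv_lhs => rw [h u, h v]
    simp only [map_add, map_smul, _root_.add_apply, _root_.smul_apply]
    module
  rw [curl, h1 u v, h1 v u, curl]
  module

theorem curl_const_smul {α : F → F →L[ℝ] V} {z : F} (h : DifferentiableAt ℝ α z) (c : ℝ) (u v : F) :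
    curl (fun z => c • α z) z u v = c • curl α z u v := by
  have h1 : fderiv ℝ (fun z => c • α z) z = c • fderiv ℝ α z := fderiv_const_smul h c
  rw [curl, h1, curl, smul_sub]
  rfl

theorem contDiffAt_curl {α : F → F →L[ℝ] V} {z : F} (h : ContDiffAt ℝ ∞ α z) (u v : F) :
    ContDiffAt ℝ ∞ (fun z => curl α z u v) z := by
  have h1 : ContDiffAt ℝ ∞ (fderiv ℝ α) z := h.fderiv_right (by simp)
  exact ((h1.clm_apply contDiffAt_const).clm_apply contDiffAt_const).sub
    ((h1.clm_apply contDiffAt_const).clm_apply contDiffAt_const)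

end FormsOnVectorSpaces

section Immersion

variable {T : Type*} [NormedAddCommGroup T] [NormedSpace ℝ T]
  {F : Type*} [NormedAddCommGroup F] [NormedSpace ℝ F] [FiniteDimensional ℝ F]
  {EB : Type*} [NormedAddCommGroup EB] [NormedSpace ℝ EB] [FiniteDimensional ℝ EB]
  {B : Type*} [TopologicalSpace B] [ChartedSpace EB B] [IsManifold 𝓘(ℝ, EB) ∞ B]

/-- A continuous lift of a smooth map through a local diffeomorphism is smooth. -/
theorem contDiffWithinAt_of_comp_immersion (hdim : Module.finrank ℝ F = Module.finrank ℝ EB)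
    {Φ : F → B} {θ : T → F} {s : Set T} {t : T} (ht : t ∈ s)
    (hΦ : ContMDiffAt 𝓘(ℝ, F) 𝓘(ℝ, EB) ∞ Φ (θ t))
    (hinj : Function.Injective (tD F EB Φ (θ t))) (hθ : ContinuousWithinAt θ s t)
    (hw : ContMDiffWithinAt 𝓘(ℝ, T) 𝓘(ℝ, EB) ∞ (fun t => Φ (θ t)) s t) :
    ContDiffWithinAt ℝ ∞ θ s t := by
  let φ := extChartAt 𝓘(ℝ, EB) (Φ (θ t))
  have hsrc : Φ (θ t) ∈ φ.source := mem_extChartAt_source _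
  have hΨ : ContDiffAt ℝ ∞ (fun z => φ (Φ z)) (θ t) := hΦ.contDiffAt_chart hsrc
  have hD : fderiv ℝ (fun z => φ (Φ z)) (θ t) = tD F EB Φ (θ t) := by
    ext1 v
    rw [← tD_eq_fderiv, tD_comp_apply (F := EB) (f := φ) (g := Φ)
      (mdifferentiableAt_extChartAt_of_mem hsrc) (hΦ.mdifferentiableAt (by simp)), tD_chart_self]
    rfl
  let e : F ≃L[ℝ] EB := (LinearMap.linearEquivOfInjective
    (tD F EB Φ (θ t)).toLinearMap hinj hdim).toContinuousLinearEquiv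
  have he : HasFDerivAt (fun z => φ (Φ z)) (e : F →L[ℝ] EB) (θ t) := by
    have h1 := (hΨ.differentiableAt (by simp)).hasFDerivAt
    rw [hD] at h1
    have : (e : F →L[ℝ] EB) = tD F EB Φ (θ t) := by ext; rfl
    rwa [this]
  have := FiniteDimensional.complete ℝ F
  have hg := hΨ.to_localInverse he (by simp)
  have hleft := (hΨ.hasStrictFDerivAt' he (by simp)).eventually_left_inverse
  have hφw : ContDiffWithinAt ℝ ∞ (fun t => φ (Φ (θ t))) s t :=
    ((contMDiffAt_extChartAt_of_mem hsrc).comp_contMDiffWithinAt t hw).contDiffWithinAt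
  have h2 := hg.comp_contDiffWithinAt_of_eq (x := t) (f := fun t => φ (Φ (θ t))) hφw rfl
  refine h2.congr_of_eventuallyEq ?_ ?_
  · filter_upwards [hθ.eventually hleft] with t' ht'
    exact ht'.symm
  · exact (hθ.eventually hleft).self_of_nhdsWithin ht |>.symm

end Immersion

/-! ### Holonomy around disks -/

section Disks

variable {EB : Type*} [NormedAddCommGroup EB] [NormedSpace ℝ EB]
  {B : Type*} [TopologicalSpace B] [ChartedSpace EB B]

/-- A disk extends to a smooth map on the whole plane. -/
theorem EmbeddedDisk.exists_extension (Δ : EmbeddedDisk EB B) :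
    ∃ f : ℂ → B, ContMDiff 𝓘(ℝ, ℂ) 𝓘(ℝ, EB) ∞ f ∧ ∀ z ∈ Metric.closedBall (0 : ℂ) 1,
      f z = Δ.toFun z := by
  obtain ⟨U, hU, hsub, hΔ⟩ := Δ.smooth
  obtain ⟨δ, hδ, hδU⟩ := (isCompact_closedBall (0 : ℂ) 1).exists_cthickening_subset_open hU hsub
  rw [cthickening_closedBall hδ.le zero_le_one] at hδU
  let χ : ContDiffBump (0 : ℂ) := ⟨1, 1 + δ, one_pos, by linarith⟩
  have hs : ContDiff ℝ ∞ fun z : ℂ => χ z • z := χ.contDiff.smul contDiff_id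
  have hmem : ∀ z : ℂ, χ z • z ∈ U := by
    intro z
    refine hδU ?_
    rw [Metric.mem_closedBall, dist_zero_right, norm_smul, Real.norm_of_nonneg χ.nonneg]
    by_cases hz : 1 + δ ≤ ‖z‖
    · rw [χ.zero_of_le_dist (by rwa [dist_zero_right]), zero_mul]
      positivity
    · have := χ.le_one (x := z)
      have := χ.nonneg (x := z)
      nlinarith [norm_nonneg z]
  refine ⟨fun z => Δ.toFun (χ z • z), fun z => ?_, fun z hz => ?_⟩
  · exact ContMDiffAt.comp (f := fun z : ℂ => χ z • z) z (hΔ.contMDiffAt (hU.mem_nhds (hmem z)))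
      hs.contMDiff.contMDiffAt
  · dsimp only
    rw [χ.one_of_mem_closedBall hz, one_smul]

variable [IsManifold 𝓘(ℝ, EB) ∞ B] [FiniteDimensional ℝ EB]

/-- The angular function of a smooth loop around the boundary of a disk is smooth. -/
theorem EmbeddedDisk.contDiffOn_angle (hdim : Module.finrank ℝ EB = 2) (Δ : EmbeddedDisk EB B)
    {w : ℝ → B} (hw : ContMDiffOn 𝓘(ℝ, ℝ) 𝓘(ℝ, EB) ∞ w (Icc 0 1)) {θ : ℝ → ℝ}
    (hθ : ContinuousOn θ (Icc 0 1))
    (h : ∀ t ∈ Icc (0 : ℝ) 1, w t = Δ.toFun (circ (θ t))) : ContDiffOn ℝ ∞ θ (Icc 0 1) := by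
  intro t ht
  obtain ⟨U, hU, hsub, hΔ⟩ := Δ.smooth
  let ζ : ℝ → ℂ := fun t => 2 * Real.pi * θ t * Complex.I
  have hcirc : ∀ t, Complex.exp (ζ t) = circ (θ t) := fun t => rfl
  have hmem : ∀ t, circ (θ t) ∈ Metric.closedBall (0 : ℂ) 1 := fun t => by
    rw [Metric.mem_closedBall, dist_zero_right, norm_circ]
  have hΔt : ContMDiffAt 𝓘(ℝ, ℂ) 𝓘(ℝ, EB) ∞ Δ.toFun (Complex.exp (ζ t)) :=
    hΔ.contMDiffAt (hU.mem_nhds (hsub (hmem t)))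
  have hexp : ContDiff ℝ ∞ Complex.exp := Complex.contDiff_exp
  have hζ : ContDiffWithinAt ℝ ∞ ζ (Icc 0 1) t := by
    refine contDiffWithinAt_of_comp_immersion (EB := EB) (by rw [hdim, Complex.finrank_real_complex])
      (Φ := fun z => Δ.toFun (Complex.exp z)) ht
      (hΔt.comp (ζ t) hexp.contMDiff.contMDiffAt) ?_ ?_ ?_
    · have h1 : ∀ v, tD ℂ EB (fun z => Δ.toFun (Complex.exp z)) (ζ t) v =
          tD ℂ EB Δ.toFun (Complex.exp (ζ t)) (Complex.exp (ζ t) * v) := by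
        intro v
        rw [tD_comp_apply (F := ℂ) (f := Δ.toFun) (g := Complex.exp)
          (hΔt.mdifferentiableAt (by simp))
          ((hexp.contMDiff (ζ t)).mdifferentiableAt (by simp)), tD_eq_fderiv]
        have h2 : HasFDerivAt Complex.exp _ (ζ t) :=
          (Complex.hasDerivAt_exp (ζ t)).complexToReal_fderiv
        rw [h2.fderiv]
        rfl
      intro v v' hv
      rw [h1, h1] at hv
      exact mul_left_cancel₀ (Complex.exp_ne_zero _) (Δ.immersion _ (hmem t) hv)
    · have h1 : ContinuousWithinAt (fun t => (θ t : ℂ)) (Icc 0 1) t :=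
        Complex.continuous_ofReal.continuousAt.comp_continuousWithinAt (hθ t ht)
      exact (continuousWithinAt_const.mul h1).mul continuousWithinAt_const
    · exact (hw t ht).congr (fun t ht => (h t ht).symm) (h t ht).symm
  have h2 : θ = fun t => (2 * Real.pi)⁻¹ * Complex.imCLM (ζ t) := by
    funext t
    have := Real.pi_ne_zero
    simp [ζ]
    field_simp
  rw [h2]
  exact contDiffWithinAt_const.mul (Complex.imCLM.contDiff.comp_contDiffWithinAt hζ)

end Disks

section BoundaryHolonomy

variable {B : Type*} [TopologicalSpace B] [ChartedSpace (EuclideanSpace ℝ (Fin 2)) B]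
  {ℓ : ℕ} [NeZero ℓ] {vol : ∀ x : B, TangentSpace (𝓡 2) x [⋀^Fin 2]→L[ℝ] ℝ} {Q : B}
  {c : CanonicalSystem ℓ vol Q}
  {EM : Type*} [NormedAddCommGroup EM] [NormedSpace ℝ EM] [FiniteDimensional ℝ EM]
  {M : Type*} [TopologicalSpace M]
  [ChartedSpace EM M] [IsManifold 𝓘(ℝ, EM) ∞ M] [MulAction Circleᵐᵒᵖ M]
  {πM : M → B} {ωM : Connection EM M (EuclideanSpace ℝ (Fin 1)) Circle} {QM : M}
  {EN : Type*} [NormedAddCommGroup EN] [NormedSpace ℝ EN] [FiniteDimensional ℝ EN]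
  {N : Type*} [TopologicalSpace N]
  [ChartedSpace EN N] [IsManifold 𝓘(ℝ, EN) ∞ N] [MulAction (GammaR ℓ)ᵐᵒᵖ N]
  {q : N → M} {ωN : Connection EN N ℝ (GammaR ℓ)} {QN : N}

/-- Locally, the area form has a smooth potential: a multiple of the pull-back of the reference
connection form along a local section. -/
theorem IsReferenceCover.exists_potential {F : Type*} [NormedAddCommGroup F] [NormedSpace ℝ F]
    (hM : IsReferenceBundle c πM ωM QM) (hN : IsReferenceCover c πM ωM QM q ωN QN) {f : F → B}
    {z₀ : F} (hf : ∀ᶠ z in 𝓝 z₀, ContMDiffAt 𝓘(ℝ, F) (𝓡 2) ∞ f z) :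
    ∃ α : F → F →L[ℝ] ℝ, ∀ᶠ z in 𝓝 z₀, ContDiffAt ℝ ∞ α z ∧ ∀ u v,
      form2 vol (f z) (tD F (EuclideanSpace ℝ (Fin 2)) f z u)
        (tD F (EuclideanSpace ℝ (Fin 2)) f z v) = curl α z u v := by
  obtain ⟨n, hn⟩ : ∃ n, πM (q n) = f z₀ := by
    obtain ⟨U, s, -, -, hx, -, hs, -⟩ := hN.principal.locally_trivial (f z₀)
    exact ⟨s (f z₀), hs _ hx⟩
  obtain ⟨U, s, hU, hx, hs, hπ, -⟩ := hN.principal.exists_section n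
  rw [hn] at hx
  let g : F → N := fun z => s (f z)
  have hfU : ∀ᶠ z in 𝓝 z₀, f z ∈ U :=
    hf.self_of_nhds.continuousAt.eventually_mem (hU.mem_nhds hx)
  refine ⟨fun z => (-(2 * Real.pi)⁻¹) • pull F ωN.co g z, ?_⟩
  filter_upwards [hf.eventually_nhds, hfU.eventually_nhds] with z hz hzU
  have hg : ContMDiffAt 𝓘(ℝ, F) 𝓘(ℝ, EN) ∞ g z :=
    (hs.contMDiffAt (hU.mem_nhds hzU.self_of_nhds)).comp z hz.self_of_nhds
  have hpull := ωN.smoothForm_co.contDiffAt_pull hg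
  refine ⟨hpull.const_smul _, fun u v => ?_⟩
  have hproj : ∀ w, tD EN (EuclideanSpace ℝ (Fin 2)) (fun n => πM (q n)) (g z) (tD F EN g z w) =
      tD F (EuclideanSpace ℝ (Fin 2)) f z w := by
    intro w
    rw [← tD_comp_apply (F := EN) (f := fun n => πM (q n)) (g := g)
      ((hN.principal.smooth_proj _).mdifferentiableAt (by simp)) (hg.mdifferentiableAt (by simp))]
    have : (fun z => πM (q (g z))) =ᶠ[𝓝 z] f := by
      filter_upwards [hzU] with y hy using hπ _ hy
    rw [tD_congr this]
  have hz' : πM (q (g z)) = f z := hπ _ hzU.self_of_nhds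
  rw [curl_const_smul (hpull.differentiableAt (by simp)), ωN.smoothForm_co.curl_pull hg,
    hN.extD_co hM, hproj, hproj, hz', smul_eq_mul]
  have := Real.pi_ne_zero
  field_simp

theorem IsReferenceCover.contDiff_vol2 {F : Type*} [NormedAddCommGroup F] [NormedSpace ℝ F]
    (hM : IsReferenceBundle c πM ωM QM) (hN : IsReferenceCover c πM ωM QM q ωN QN) {f : F → B}
    {z₀ : F} (hf : ∀ᶠ z in 𝓝 z₀, ContMDiffAt 𝓘(ℝ, F) (𝓡 2) ∞ f z) (u v : F) :
    ContDiffAt ℝ ∞ (fun z => form2 vol (f z) (tD F (EuclideanSpace ℝ (Fin 2)) f z u)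
        (tD F (EuclideanSpace ℝ (Fin 2)) f z v)) z₀ := by
  obtain ⟨α, hα⟩ := hN.exists_potential hM hf
  exact (contDiffAt_curl hα.self_of_nhds.1 u v).congr_of_eventuallyEq
    (hα.mono fun z hz => hz.2 u v)

theorem IsReferenceCover.vol2_complex (hM : IsReferenceBundle c πM ωM QM)
    (hN : IsReferenceCover c πM ωM QM q ωN QN) {f : ℂ → B} {z : ℂ}
    (hf : ∀ᶠ z in 𝓝 z, ContMDiffAt 𝓘(ℝ, ℂ) (𝓡 2) ∞ f z) (u v : ℂ) :
    form2 vol (f z) (tD ℂ (EuclideanSpace ℝ (Fin 2)) f z u)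
      (tD ℂ (EuclideanSpace ℝ (Fin 2)) f z v) = (u.re * v.im - u.im * v.re) *
    form2 vol (f z) (tD ℂ (EuclideanSpace ℝ (Fin 2)) f z 1)
      (tD ℂ (EuclideanSpace ℝ (Fin 2)) f z Complex.I) := by
  obtain ⟨α, hα⟩ := hN.exists_potential hM hf
  rw [hα.self_of_nhds.2, hα.self_of_nhds.2, curl_complex, smul_eq_mul]

variable {EG : Type*} [NormedAddCommGroup EG] [NormedSpace ℝ EG] [CompleteSpace EG]
  {G : Type*} [Group G] [TopologicalSpace G] [T2Space G]
  [ChartedSpace EG G] [LieGroup 𝓘(ℝ, EG) ∞ G]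
  {EP : Type*} [NormedAddCommGroup EP] [NormedSpace ℝ EP] [FiniteDimensional ℝ EP]
  {P : Type*} [TopologicalSpace P]
  [ChartedSpace EP P] [IsManifold 𝓘(ℝ, EP) ∞ P] [MulAction Gᵐᵒᵖ P]
  {π : P → B}

/-- The holonomy around a disk of a connection with curvature `-X vol`. Over the disk, `vol` has a
potential, so that the disk lifts to a map to the total space whose pull-back of the connection form
is known; along the boundary, it is made horizontal by a curve in `exp(ℝX)`. -/
theorem IsPrincipalBundle.holonomy_boundaryLoop [IsManifold (𝓡 2) ∞ B]
    (hM : IsReferenceBundle c πM ωM QM) (hN : IsReferenceCover c πM ωM QM q ωN QN)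
    (hP : IsPrincipalBundle (EuclideanSpace ℝ (Fin 2)) EP EG G π)
    (A : Connection EP P EG G) {X : EG} (hX : ∀ g : G, AdC g X = X)
    (hA : ∀ p u v, A.cvr p u v = -(form2 vol (π p) (tD EP (EuclideanSpace ℝ (Fin 2)) π p u)
      (tD EP (EuclideanSpace ℝ (Fin 2)) π p v) • X))
    (Δ : EmbeddedDisk (EuclideanSpace ℝ (Fin 2)) B) {w : ℝ → B} (hw : IsBoundaryLoop Δ w) {q' : P}
    (hq' : π q' = w 0) :
    holonomy π A w q' = lieExp (E₁ := EG) (G := G) (diskIntegral Δ.toFun vol • X) := by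
  obtain ⟨hws, θ, hθ, hθ1, hwθ⟩ := hw
  have hwθ' : ∀ t ∈ Icc (0 : ℝ) 1, w t = Δ.toFun (circ (θ t)) := hwθ
  obtain ⟨f, hf, hfΔ⟩ := Δ.exists_extension
  let g : ℂ → ℝ := fun z => form2 vol (f z) (tD ℂ (EuclideanSpace ℝ (Fin 2)) f z 1)
    (tD ℂ (EuclideanSpace ℝ (Fin 2)) f z Complex.I)
  have hg : ContDiff ℝ ∞ g := contDiff_iff_contDiffAt.2 fun z =>
    hN.contDiff_vol2 hM (Filter.Eventually.of_forall hf) 1 Complex.I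
  have harea : diskIntegral Δ.toFun vol = ∫ z in Metric.ball (0 : ℂ) 1, g z := by
    refine MeasureTheory.setIntegral_congr_fun Metric.isOpen_ball.measurableSet fun z hz => ?_
    have h1 : f =ᶠ[𝓝 z] Δ.toFun := by
      filter_upwards [Metric.isOpen_ball.mem_nhds hz] with y hy
        using hfΔ y (Metric.ball_subset_closedBall hy)
    change form2 vol (Δ.toFun z) (tD ℂ (EuclideanSpace ℝ (Fin 2)) Δ.toFun z 1)
      (tD ℂ (EuclideanSpace ℝ (Fin 2)) Δ.toFun z Complex.I) = g z
    rw [← tD_congr h1, ← h1.eq_of_nhds]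
  let κ : ℂ → ℂ →L[ℝ] ℝ := fun z => (-1 : ℝ) • radialForm g z
  have hκ : ContDiff ℝ ∞ κ := (contDiff_radialForm hg).const_smul (-1 : ℝ)
  have hmem : ∀ t, circ (θ t) ∈ Metric.closedBall (0 : ℂ) 1 := fun t => by
    rw [Metric.mem_closedBall, dist_zero_right, norm_circ]
  obtain ⟨lam, hlam, hlam0, h⟩ := hP.exists_lift A hf (smoothForm_of_contDiff hκ) hX
    (fun z p hp u v u' v' hu hv => by
      rw [hA, hu, hv, hp, extD_eq_curl hκ,
        curl_const_smul ((contDiff_radialForm hg).differentiable (by simp) z), curl_complex,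
        curl_radialForm hg, hN.vol2_complex hM (Filter.Eventually.of_forall hf), smul_eq_mul,
        smul_eq_mul, neg_one_mul, neg_smul]) (y₀ := circ (θ 0)) (p₀ := q') (by
        rw [hq', hwθ' 0 (by simp), hfΔ _ (hmem 0)])
  -- the horizontal curve over the unit circle
  let S : ℝ → ℝ := fun φ => ∫ t in θ 0..φ, 2 * Real.pi * radialPotential g (circ t)
  have hint : ContDiff ℝ ∞ fun t => 2 * Real.pi * radialPotential g (circ t) :=
    contDiff_const.mul ((contDiff_radialPotential hg).comp contDiff_circ)
  let γ := expCurve G X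
  have hγ : IsOneParam γ X := isOneParam_expCurve X
  have hlc : ContMDiff 𝓘(ℝ, ℝ) 𝓘(ℝ, EP) ∞ fun φ => lam (circ φ) :=
    hlam.comp contDiff_circ.contMDiff
  have hμ : IsHorizontalCurve A fun φ => lam (circ φ) <• γ (S φ) := by
    refine ⟨hP.smooth_act.comp (hlc.prodMk (hγ.smooth.comp
      (contDiff_integral hint _).contMDiff)), fun φ => ?_⟩
    have hS : HasDerivAt S (2 * Real.pi * radialPotential g (circ φ)) φ :=
      intervalIntegral.integral_hasDerivAt_right (hint.continuous.intervalIntegrable _ _)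
        (hint.continuous.stronglyMeasurableAtFilter _ _) hint.continuous.continuousAt
    rw [A.co_act_oneParam (b := -(2 * Real.pi * radialPotential g (circ φ))) hP.smooth_act hγ hX
      ((hlc φ).mdifferentiableAt (by simp)) hS, neg_add_cancel, zero_smul]
    rw [tD_comp_apply (F := ℂ) (f := lam) (g := circ) ((hlam _).mdifferentiableAt (by simp))
      ((contDiff_circ.contMDiff φ).mdifferentiableAt (by simp)), tD_eq_fderiv,
      fderiv_apply_one_eq_deriv, (hasDerivAt_circ φ).deriv, (h _).2]
    change ((-1 : ℝ) * radialForm g (circ φ) _) • X = _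
    rw [radialForm_circ, neg_one_mul]
  have hθs := Δ.contDiffOn_angle (by simp) hws hθ hwθ'
  have hlift : IsHorizontalLift π A w fun t => lam (circ (θ t)) <• γ (S (θ t)) := by
    refine .of_interior A (hμ.smooth.comp_contMDiffOn hθs.contMDiffOn) (fun t ht => ?_)
      fun t ht => ?_
    · rw [hP.proj_act, (h _).1, hfΔ _ (hmem t), hwθ' t ht]
    · have h1 : MDifferentiableAt 𝓘(ℝ, ℝ) 𝓘(ℝ, ℝ) θ t :=
        ((hθs.contDiffAt (Icc_mem_nhds ht.1 ht.2)).differentiableAt (by simp)).mdifferentiableAt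
      rw [tD_comp_apply (F := ℝ) (f := fun φ => lam (circ φ) <• γ (S φ)) (g := θ)
        ((hμ.smooth _).mdifferentiableAt (by simp)) h1]
      have : tD ℝ ℝ θ t 1 = tD ℝ ℝ θ t 1 • (1 : ℝ) := by simp
      rw [this, map_smul, map_smul, hμ.horizontal, smul_zero]
  have hend : circ (θ 1) = circ (θ 0) := by
    rw [hθ1]
    simp only [circ]
    push_cast
    rw [mul_add, add_mul, mul_one, Complex.exp_add, Complex.exp_two_pi_mul_I, mul_one]
  refine (hP.holonomy_eq hlift ?_ ?_).trans (lieExp_smul X _).symm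
  · have : S (θ 0) = 0 := intervalIntegral.integral_same
    change lam (circ (θ 0)) <• γ (S (θ 0)) = q'
    rw [this, hγ.zero, hlam0, MulOpposite.op_one, one_smul]
  · rw [hend, hlam0, harea, ← integral_radialPotential_circ hg (θ 0), hθ1]

end BoundaryHolonomy

/-! ### Small disks and small circles -/

section Averages

variable {V : Type*} [NormedAddCommGroup V] [NormedSpace ℝ V] [CompleteSpace V]

/-- The integral over the disk of radius `ε` that is centered at `-ε`, divided by `ε²`. -/
theorem tendsto_integral_small_disk {h : ℂ → V} (hc : ∀ᶠ z in 𝓝 0, ContinuousAt h z) :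
    Filter.Tendsto (fun ε : ℝ => ∫ z in Metric.ball (0 : ℂ) 1, h (ε • (z - 1))) (𝓝 0)
      (𝓝 (Real.pi • h 0)) := by
  rw [Metric.tendsto_nhds_nhds]
  intro η hη
  have hη' : 0 < η / (Real.pi + 1) := by positivity
  obtain ⟨δ, hδ, hball⟩ := Metric.eventually_nhds_iff.1
    ((Metric.continuousAt_iff'.1 hc.self_of_nhds _ hη').and hc)
  refine ⟨δ / 2, by positivity, fun ε hε => ?_⟩
  rw [dist_zero_right, Real.norm_eq_abs] at hε
  have hz : ∀ z ∈ Metric.closedBall (0 : ℂ) 1, dist (ε • (z - 1)) 0 < δ := by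
    intro z hz
    rw [mem_closedBall_zero_iff] at hz
    rw [dist_zero_right, norm_smul, Real.norm_eq_abs]
    have h1 : ‖z - 1‖ ≤ 2 := (norm_sub_le _ _).trans (by rw [norm_one]; linarith)
    have := abs_nonneg ε
    nlinarith [norm_nonneg (z - 1)]
  have hcont : ContinuousOn (fun z : ℂ => h (ε • (z - 1))) (Metric.closedBall 0 1) := fun z hz' =>
    (ContinuousAt.comp (f := fun z : ℂ => ε • (z - 1)) (hball (hz z hz')).2
      (by fun_prop)).continuousWithinAt
  have hi : MeasureTheory.IntegrableOn (fun z : ℂ => h (ε • (z - 1))) (Metric.ball 0 1) :=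
    (hcont.integrableOn_compact (isCompact_closedBall _ _)).mono_set Metric.ball_subset_closedBall
  have hvol : MeasureTheory.volume.real (Metric.ball (0 : ℂ) 1) = Real.pi := by
    rw [MeasureTheory.measureReal_def, Complex.volume_ball]
    simp
  have hfin : MeasureTheory.volume (Metric.ball (0 : ℂ) 1) < ⊤ := MeasureTheory.measure_ball_lt_top
  have hi0 : MeasureTheory.IntegrableOn (fun _ : ℂ => h 0) (Metric.ball 0 1) :=
    MeasureTheory.integrableOn_const hfin.ne
  have e : (∫ z in Metric.ball (0 : ℂ) 1, h (ε • (z - 1))) - Real.pi • h 0 =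
      ∫ z in Metric.ball (0 : ℂ) 1, (h (ε • (z - 1)) - h 0) := by
    rw [MeasureTheory.integral_sub hi hi0, MeasureTheory.setIntegral_const, hvol]
  rw [dist_eq_norm, e]
  calc _ ≤ η / (Real.pi + 1) * MeasureTheory.volume.real (Metric.ball (0 : ℂ) 1) := by
        refine MeasureTheory.norm_setIntegral_le_of_norm_le_const hfin fun z hz' => ?_
        rw [← dist_eq_norm]
        exact (hball (hz z (Metric.ball_subset_closedBall hz'))).1.le
    _ = η / (Real.pi + 1) * Real.pi := by rw [hvol]
    _ < η := by
        rw [div_mul_eq_mul_div, div_lt_iff₀ (by positivity)]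
        nlinarith

end Averages

section SmallCircleEquations

variable {E : Type*} [NormedAddCommGroup E] [NormedSpace ℝ E] [CompleteSpace E]

/-- Over the small circles through the center of the chart, the total differential equation
`du = Φ(z, u)` with `Φ(0, x₀) = 0` has solutions that start at `x₀`. Up to higher order terms, the
end point is found by fixing the second argument of `Φ` at `x₀`, as the solution differs from `x₀`
by a term of order `ε²`, and the length of the circle is of order `ε`. -/
theorem exists_solution_small_circle {Φ : ℂ × E → ℂ →L[ℝ] E} {x₀ : E}
    (hΦ : ∀ᶠ z in 𝓝 (0, x₀), ContDiffAt ℝ ∞ Φ z) (h0 : Φ (0, x₀) = 0) :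
    ∃ u : ℝ → ℝ → E,
      (∀ᶠ ε in 𝓝[>] (0 : ℝ), u ε 0 = x₀ ∧ ContDiffOn ℝ ∞ (u ε) (Icc 0 1) ∧
        ∀ t ∈ Icc (0 : ℝ) 1, HasDerivWithinAt (u ε) (Φ (ε • (circ t - 1), u ε t)
          (ε • (2 * Real.pi * Complex.I * circ t))) (Icc 0 1) t) ∧
      (∀ U ∈ 𝓝 ((0 : ℂ), x₀), ∀ᶠ ε in 𝓝[>] (0 : ℝ), ∀ t ∈ Icc (0 : ℝ) 1,
        (ε • (circ t - 1), u ε t) ∈ U) ∧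
      Filter.Tendsto (fun ε => (ε ^ 2)⁻¹ • (u ε 1 - x₀)) (𝓝[>] 0)
        (𝓝 (Real.pi • curl (fun z => Φ (z, x₀)) 0 1 Complex.I)) := by
  obtain ⟨K, s, hs, hK⟩ := (hΦ.self_of_nhds.of_le (m := 1) (by simp)).exists_lipschitzOnWith
  obtain ⟨δ, hδ, hball⟩ := Metric.eventually_nhds_iff_ball.1 (hΦ.and hs)
  set C : ℝ := 4 * Real.pi * K + 1 with hC
  have hC0 : 0 < C := by positivity
  have hmem : ∀ {ε ρ : ℝ}, 0 < ε → 2 * ε < ρ → C * ε ^ 2 < ρ → ∀ t, ∀ x ∈ Metric.closedBall x₀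
      (C * ε ^ 2), ((ε • (circ t - 1), x) : ℂ × E) ∈ Metric.ball ((0 : ℂ), x₀) ρ := by
    intro ε ρ hε h1 h2 t x hx
    rw [Metric.mem_ball, Prod.dist_eq]
    refine max_lt ?_ ((Metric.mem_closedBall.1 hx).trans_lt h2)
    rw [dist_zero_right, norm_smul, Real.norm_of_nonneg hε.le]
    have := norm_circ_sub_one_le t
    nlinarith
  let f : ℝ → ℝ → E → E := fun ε t x =>
    Φ (ε • (circ t - 1), x) (ε • (2 * Real.pi * Complex.I * circ t))
  have hv : ∀ {ε : ℝ}, 0 < ε → ∀ t, ‖ε • (2 * Real.pi * Complex.I * circ t)‖ = 2 * Real.pi * ε := by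
    intro ε hε t
    rw [norm_smul, norm_deriv_circ, Real.norm_of_nonneg hε.le, mul_comm]
  have hLip : ∀ {ε : ℝ}, 0 < ε → 2 * ε < δ → C * ε ^ 2 < δ → ∀ t,
      ∀ x ∈ Metric.closedBall x₀ (C * ε ^ 2), ∀ y ∈ Metric.closedBall x₀ (C * ε ^ 2),
      ‖f ε t x - f ε t y‖ ≤ K * ‖x - y‖ * (2 * Real.pi * ε) := by
    intro ε hε h1 h2 t x hx y hy
    have h3 := hK.norm_sub_le (hball _ (hmem hε h1 h2 t x hx)).2
      (hball _ (hmem hε h1 h2 t y hy)).2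
    have h4 : ‖((ε • (circ t - 1), x) : ℂ × E) - (ε • (circ t - 1), y)‖ = ‖x - y‖ := by
      rw [Prod.mk_sub_mk, sub_self, Prod.norm_mk, norm_zero, max_eq_right (norm_nonneg _)]
    rw [h4] at h3
    change ‖(Φ _ - Φ _) _‖ ≤ _
    refine (ContinuousLinearMap.le_opNorm _ _).trans ?_
    rw [hv hε]
    exact mul_le_mul_of_nonneg_right h3 (by positivity)
  have hbd : ∀ {ε : ℝ}, 0 < ε → 2 * ε < δ → C * ε ^ 2 < δ → C * ε ≤ 1 → ∀ t,
      ∀ x ∈ Metric.closedBall x₀ (C * ε ^ 2), ‖f ε t x‖ ≤ C * ε ^ 2 := by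
    intro ε hε h1 h2 h3 t x hx
    have h4 := hK.norm_sub_le (hball _ (hmem hε h1 h2 t x hx)).2 (mem_of_mem_nhds hs)
    have h5 : ‖((ε • (circ t - 1), x) : ℂ × E) - (0, x₀)‖ ≤ 2 * ε := by
      rw [Prod.mk_sub_mk, sub_zero, Prod.norm_mk]
      refine max_le ?_ ?_
      · rw [norm_smul, Real.norm_of_nonneg hε.le]
        have := norm_circ_sub_one_le t
        nlinarith
      · rw [← dist_eq_norm]
        refine (Metric.mem_closedBall.1 hx).trans ?_
        nlinarith
    rw [h0, sub_zero] at h4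
    refine (ContinuousLinearMap.le_opNorm _ _).trans ?_
    rw [hv hε]
    have h6 : ‖Φ (ε • (circ t - 1), x)‖ ≤ K * (2 * ε) :=
      h4.trans (mul_le_mul_of_nonneg_left h5 K.2)
    have := mul_le_mul_of_nonneg_right h6 (by positivity : 0 ≤ 2 * Real.pi * ε)
    rw [hC]
    nlinarith [sq_nonneg ε]
  have hcd : ∀ {ε : ℝ}, 0 < ε → 2 * ε < δ → C * ε ^ 2 < δ → ContDiffOn ℝ ∞
      (Function.uncurry (f ε)) (Icc 0 1 ×ˢ Metric.closedBall x₀ (C * ε ^ 2)) := by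
    intro ε hε h1 h2 z hz
    have h3 := (hball _ (hmem hε h1 h2 z.1 z.2 hz.2)).1
    have h4 : ContDiff ℝ ∞ fun z : ℝ × E => circ z.1 := contDiff_circ.comp contDiff_fst
    have h5 : ContDiff ℝ ∞ fun z : ℝ × E => (ε • (circ z.1 - 1), z.2) :=
      ((h4.sub contDiff_const).const_smul ε).prodMk contDiff_snd
    have h6 : ContDiff ℝ ∞ fun z : ℝ × E => (ε • (2 * Real.pi * Complex.I * circ z.1) : ℂ) :=
      (contDiff_const.mul h4).const_smul ε
    exact ((ContDiffAt.comp (g := Φ) z h3 h5.contDiffAt).clm_apply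
      h6.contDiffAt).contDiffWithinAt
  have hex : ∀ ε : ℝ, ∃ u : ℝ → E, 0 < ε → 2 * ε < δ → C * ε ^ 2 < δ → C * ε ≤ 1 →
      u 0 = x₀ ∧ (∀ t, u t ∈ Metric.closedBall x₀ (C * ε ^ 2)) ∧
      ∀ t ∈ Icc (0 : ℝ) 1, HasDerivWithinAt u (f ε t (u t)) (Icc 0 1) t := by
    intro ε
    by_cases h : 0 < ε ∧ 2 * ε < δ ∧ C * ε ^ 2 < δ ∧ C * ε ≤ 1
    · obtain ⟨hε, h1, h2, h3⟩ := h
      have hPL : IsPicardLindelof (f ε) (⟨0, by simp⟩ : Icc (0 : ℝ) 1) x₀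
          ⟨C * ε ^ 2, by positivity⟩ 0 ⟨C * ε ^ 2, by positivity⟩
          (K * ⟨2 * Real.pi * ε, by positivity⟩) := by
        refine ⟨fun t ht => ?_, fun x hx => ?_, fun t ht x hx => hbd hε h1 h2 h3 t x hx, ?_⟩
        · refine LipschitzOnWith.of_dist_le_mul fun x hx y hy => ?_
          rw [dist_eq_norm, dist_eq_norm]
          refine (hLip hε h1 h2 t x hx y hy).trans (le_of_eq ?_)
          change _ = (K : ℝ) * (2 * Real.pi * ε) * _
          ring
        · exact ((hcd hε h1 h2).continuousOn).comp (f := fun t : ℝ => (t, x)) (by fun_prop)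
            fun t ht => ⟨ht, hx⟩
        · change C * ε ^ 2 * max ((1 : ℝ) - 0) (0 - 0) ≤ C * ε ^ 2 - 0
          norm_num
      obtain ⟨u, hu0, hu1, hu2⟩ := exists_solution_mem_closedBall hPL
      exact ⟨u, fun _ _ _ _ => ⟨hu0, hu1, hu2⟩⟩
    · exact ⟨fun _ => x₀, fun a b c d => (h ⟨a, b, c, d⟩).elim⟩
  choose u hu using hex
  have hsmall : ∀ {ρ : ℝ}, 0 < ρ → ∀ᶠ ε in 𝓝[>] (0 : ℝ),
      0 < ε ∧ 2 * ε < ρ ∧ C * ε ^ 2 < ρ ∧ C * ε ≤ 1 := by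
    intro ρ hρ
    have h1 : ∀ᶠ ε in 𝓝 (0 : ℝ), 2 * ε < ρ :=
      (continuous_const.mul continuous_id).continuousAt.eventually (gt_mem_nhds (by simpa using hρ))
    have h2 : ∀ᶠ ε in 𝓝 (0 : ℝ), C * ε ^ 2 < ρ :=
      (continuous_const.mul (continuous_id.pow 2)).continuousAt.eventually
        (gt_mem_nhds (by simpa using hρ))
    have h3 : ∀ᶠ ε in 𝓝 (0 : ℝ), C * ε < 1 :=
      (continuous_const.mul continuous_id).continuousAt.eventually (gt_mem_nhds (by simp))
    filter_upwards [nhdsWithin_le_nhds h1, nhdsWithin_le_nhds h2, nhdsWithin_le_nhds h3,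
      self_mem_nhdsWithin] with ε a b c d
    exact ⟨d, a, b, c.le⟩
  refine ⟨u, ?_, fun U hU => ?_, ?_⟩
  · filter_upwards [hsmall hδ] with ε ⟨hε, h1, h2, h3⟩
    obtain ⟨hu0, hu1, hu2⟩ := hu ε hε h1 h2 h3
    exact ⟨hu0, ODE.contDiffOn_enat_Icc_of_hasDerivWithinAt (n := ⊤) (hcd hε h1 h2) hu2
      fun t _ => hu1 t, hu2⟩
  · obtain ⟨ρ, hρ, hρU⟩ := Metric.mem_nhds_iff.1 hU
    filter_upwards [hsmall hδ, hsmall hρ] with ε ⟨hε, h1, h2, h3⟩ ⟨_, h4, h5, _⟩ t _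
    exact hρU (hmem hε h4 h5 t _ ((hu ε hε h1 h2 h3).2.1 t))
  · have hx₀ : Filter.Tendsto (fun z : ℂ => (z, x₀)) (𝓝 0) (𝓝 (0, x₀)) :=
      (continuous_id.prodMk continuous_const).tendsto' _ _ rfl
    have hα : ∀ᶠ z in 𝓝 (0 : ℂ), ContDiffAt ℝ ∞ (fun z => Φ (z, x₀)) z := by
      filter_upwards [hx₀.eventually hΦ] with z hz
      exact ContDiffAt.comp (g := Φ) z hz (contDiffAt_id.prodMk contDiffAt_const)
    have hlim := (tendsto_integral_small_circle (hα.self_of_nhds.differentiableAt (by simp))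
      (hα.mono fun z hz => hz.continuousAt)).mono_left
      (nhdsWithin_mono (0 : ℝ) (fun x hx => (ne_of_gt hx : x ≠ 0)) : 𝓝[>] (0 : ℝ) ≤ 𝓝[≠] 0)
    refine tendsto_of_tendsto_of_dist hlim ?_
    refine squeeze_zero_norm' (a := fun ε : ℝ => K * C * (2 * Real.pi) * ε) ?_ ?_
    · filter_upwards [hsmall hδ] with ε ⟨hε, h1, h2, h3⟩
      obtain ⟨hu0, hu1, hu2⟩ := hu ε hε h1 h2 h3
      have hx : x₀ ∈ Metric.closedBall x₀ (C * ε ^ 2) := Metric.mem_closedBall_self (by positivity)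
      have huc : ContinuousOn (u ε) (Icc 0 1) := fun t ht => (hu2 t ht).continuousWithinAt
      have hc1 : ContinuousOn (fun t => f ε t (u ε t)) (Icc 0 1) :=
        (hcd hε h1 h2).continuousOn.comp (f := fun t => (t, u ε t)) (continuousOn_id.prodMk huc)
          fun t ht => ⟨ht, hu1 t⟩
      have hc2 : ContinuousOn (fun t => f ε t x₀) (Icc 0 1) :=
        (hcd hε h1 h2).continuousOn.comp (f := fun t : ℝ => (t, x₀)) (by fun_prop)
          fun t ht => ⟨ht, hx⟩
      have hi1 := hc1.intervalIntegrable_of_Icc (μ := MeasureTheory.volume) zero_le_one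
      have hi2 := hc2.intervalIntegrable_of_Icc (μ := MeasureTheory.volume) zero_le_one
      have h4 := intervalIntegral.integral_eq_sub_of_hasDerivAt_of_le zero_le_one huc
        (fun t ht => (hu2 t (Ioo_subset_Icc_self ht)).hasDerivAt (Icc_mem_nhds ht.1 ht.2)) hi1
      rw [hu0] at h4
      rw [Real.norm_of_nonneg dist_nonneg, dist_comm, dist_eq_norm, ← smul_sub, ← h4,
        ← intervalIntegral.integral_sub hi1 hi2, norm_smul, norm_inv,
        Real.norm_of_nonneg (sq_nonneg ε)]
      have h5 : ‖∫ t in (0 : ℝ)..1, (f ε t (u ε t) - f ε t x₀)‖ ≤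
          K * (C * ε ^ 2) * (2 * Real.pi * ε) * |(1 : ℝ) - 0| := by
        refine intervalIntegral.norm_integral_le_of_norm_le_const fun t _ => ?_
        refine (hLip hε h1 h2 t _ (hu1 t) x₀ hx).trans ?_
        have h6 : ‖u ε t - x₀‖ ≤ C * ε ^ 2 := by
          rw [← dist_eq_norm]; exact hu1 t
        gcongr
      rw [sub_zero, abs_one, mul_one] at h5
      calc (ε ^ 2)⁻¹ * _ ≤ (ε ^ 2)⁻¹ * (K * (C * ε ^ 2) * (2 * Real.pi * ε)) := by gcongr
        _ = K * C * (2 * Real.pi) * ε := by field_simp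
    · have : Filter.Tendsto (fun ε : ℝ => K * C * (2 * Real.pi) * ε) (𝓝 0) (𝓝 0) :=
        (continuous_const.mul continuous_id).tendsto' _ _ (by simp)
      exact this.mono_left nhdsWithin_le_nhds

end SmallCircleEquations

section Parametrizations

variable {EB : Type*} [NormedAddCommGroup EB] [NormedSpace ℝ EB] [FiniteDimensional ℝ EB]
  {B : Type*} [TopologicalSpace B] [ChartedSpace EB B] [IsManifold 𝓘(ℝ, EB) ∞ B]

theorem exists_complex_parametrization (hdim : Module.finrank ℝ EB = 2) (b : B) :
    ∃ f : ℂ → B, f 0 = b ∧ Function.Surjective (tD ℂ EB f 0) ∧ ∃ δ > 0,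
      ContMDiffOn 𝓘(ℝ, ℂ) 𝓘(ℝ, EB) ∞ f (Metric.ball 0 δ) ∧ InjOn f (Metric.ball 0 δ) ∧
      ∀ z ∈ Metric.ball (0 : ℂ) δ, Function.Injective (tD ℂ EB f z) := by
  obtain ⟨L⟩ : Nonempty (ℂ ≃L[ℝ] EB) :=
    FiniteDimensional.nonempty_continuousLinearEquiv_of_finrank_eq (by
      rw [hdim, Complex.finrank_real_complex])
  let φ := extChartAt 𝓘(ℝ, EB) b
  let ψ : ℂ → EB := fun z => φ b + L z
  have hψd : ∀ z, HasFDerivAt ψ (L : ℂ →L[ℝ] EB) z := fun z => L.hasFDerivAt.const_add _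
  have hψ : ContDiff ℝ ∞ ψ := contDiff_const.add L.contDiff
  have h0 : ψ 0 = φ b := by simp [ψ]
  obtain ⟨δ, hδ, hball⟩ := Metric.mem_nhds_iff.1 (hψ.continuous.continuousAt.preimage_mem_nhds
    ((isOpen_extChartAt_target (I := 𝓘(ℝ, EB)) b).mem_nhds
      (by rw [h0]; exact mem_extChartAt_target (I := 𝓘(ℝ, EB)) b)))
  have htD : ∀ z ∈ Metric.ball (0 : ℂ) δ, ∀ w, tD ℂ EB (fun z => φ.symm (ψ z)) z w =
      tD EB EB φ.symm (ψ z) (L w) := by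
    intro z hz w
    rw [tD_comp_apply (F := EB) (f := φ.symm) (g := ψ) (mdifferentiableAt_extChartAt_symm (hball hz))
      (hψd z).differentiableAt.mdifferentiableAt, tD_eq_fderiv, (hψd z).fderiv]
    rfl
  refine ⟨fun z => φ.symm (ψ z), ?_, fun w => ?_, δ, hδ, fun z hz => ?_, fun z hz z' hz' h => ?_,
    fun z hz w w' h => ?_⟩
  · dsimp only
    rw [h0]
    exact extChartAt_to_inv b
  · refine ⟨L.symm w, ?_⟩
    rw [htD 0 (Metric.mem_ball_self hδ), h0, tD_chart_symm_self]
    simp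
  · exact (ContMDiffAt.comp (g := φ.symm) z (contMDiffAt_extChartAt_symm (hball hz))
      hψ.contMDiff.contMDiffAt).contMDiffWithinAt
  · exact L.injective (add_left_cancel (φ.symm.injOn (hball hz) (hball hz') h))
  · rw [htD z hz, htD z hz] at h
    have h1 := congrArg (tD EB EB φ (φ.symm (ψ z))) h
    rw [tD_chart_symm_comp (hball hz), tD_chart_symm_comp (hball hz)] at h1
    exact L.injective h1

omit [FiniteDimensional ℝ EB] [IsManifold 𝓘(ℝ, EB) ∞ B] in
theorem tD_comp_smul_sub {f : ℂ → B} {ε : ℝ} {z : ℂ}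
    (hf : MDifferentiableAt 𝓘(ℝ, ℂ) 𝓘(ℝ, EB) f (ε • (z - 1))) (w : ℂ) :
    tD ℂ EB (fun z => f (ε • (z - 1))) z w = ε • tD ℂ EB f (ε • (z - 1)) w := by
  have h1 : HasFDerivAt (fun z : ℂ => ε • (z - 1)) (ε • ContinuousLinearMap.id ℝ ℂ) z :=
    ((hasFDerivAt_id z).sub_const 1).const_smul ε
  rw [tD_comp_apply (F := ℂ) (f := f) (g := fun z : ℂ => ε • (z - 1)) hf
    h1.differentiableAt.mdifferentiableAt, tD_eq_fderiv, h1.fderiv, ← map_smul]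
  rfl

omit [FiniteDimensional ℝ EB] [IsManifold 𝓘(ℝ, EB) ∞ B] in
/-- The small disks whose boundary circles pass through the center of a parametrization. -/
theorem exists_small_embeddedDisk {f : ℂ → B} {δ : ℝ}
    (hf : ContMDiffOn 𝓘(ℝ, ℂ) 𝓘(ℝ, EB) ∞ f (Metric.ball 0 δ)) (hinj : InjOn f (Metric.ball 0 δ))
    (himm : ∀ z ∈ Metric.ball (0 : ℂ) δ, Function.Injective (tD ℂ EB f z)) {ε : ℝ} (hε : 0 < ε)
    (hεδ : 2 * ε < δ) : ∃ Δ : EmbeddedDisk EB B, Δ.toFun = fun z => f (ε • (z - 1)) := by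
  have hs : ContDiff ℝ ∞ fun z : ℂ => ε • (z - 1) := (contDiff_id.sub contDiff_const).const_smul ε
  have hmem : ∀ z ∈ Metric.closedBall (0 : ℂ) 1, ε • (z - 1) ∈ Metric.ball (0 : ℂ) δ := by
    intro z hz
    rw [mem_closedBall_zero_iff] at hz
    rw [mem_ball_zero_iff, norm_smul, Real.norm_of_nonneg hε.le]
    have h1 : ‖z - 1‖ ≤ 2 := (norm_sub_le _ _).trans (by rw [norm_one]; linarith)
    nlinarith
  have hd : ∀ z ∈ Metric.ball (0 : ℂ) δ, ContMDiffAt 𝓘(ℝ, ℂ) 𝓘(ℝ, EB) ∞ f z := fun z hz =>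
    hf.contMDiffAt (Metric.isOpen_ball.mem_nhds hz)
  refine ⟨⟨fun z => f (ε • (z - 1)), ⟨(fun z : ℂ => ε • (z - 1)) ⁻¹' Metric.ball 0 δ,
    Metric.isOpen_ball.preimage hs.continuous, hmem, fun z hz => ?_⟩, fun z hz z' hz' h => ?_,
    fun z hz => ?_⟩, rfl⟩
  · exact (ContMDiffAt.comp (f := fun z : ℂ => ε • (z - 1)) z (hd _ hz)
      hs.contMDiff.contMDiffAt).contMDiffWithinAt
  · exact sub_left_injective (smul_right_injective ℂ hε.ne' (hinj (hmem z hz) (hmem z' hz') h))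
  · have h1 : Function.Injective (tD ℂ EB (fun z => f (ε • (z - 1))) z) := by
      intro w w' h
      have h2 := (hd _ (hmem z hz)).mdifferentiableAt (by simp)
      rw [tD_comp_smul_sub h2, tD_comp_smul_sub h2] at h
      exact himm _ (hmem z hz) (smul_right_injective EB hε.ne' h)
    exact h1

end Parametrizations

section SmallDiskIntegrals

variable {B : Type*} [TopologicalSpace B] [ChartedSpace (EuclideanSpace ℝ (Fin 2)) B]
  {V : Type*} [NormedAddCommGroup V] [NormedSpace ℝ V] [CompleteSpace V]

theorem tendsto_diskIntegral_small {f : ℂ → B}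
    {β : ∀ x : B, TangentSpace (𝓡 2) x [⋀^Fin 2]→L[ℝ] V}
    (hf : ∀ᶠ z in 𝓝 0, MDifferentiableAt 𝓘(ℝ, ℂ) (𝓡 2) f z)
    (hβ : ∀ᶠ z in 𝓝 0, ContinuousAt (fun z => form2 β (f z)
      (tD ℂ (EuclideanSpace ℝ (Fin 2)) f z 1) (tD ℂ (EuclideanSpace ℝ (Fin 2)) f z Complex.I)) z) :
    Filter.Tendsto (fun ε : ℝ => (ε ^ 2)⁻¹ • diskIntegral (fun z => f (ε • (z - 1))) β) (𝓝[>] 0)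
      (𝓝 (Real.pi • form2 β (f 0) (tD ℂ (EuclideanSpace ℝ (Fin 2)) f 0 1)
        (tD ℂ (EuclideanSpace ℝ (Fin 2)) f 0 Complex.I))) := by
  obtain ⟨δ, hδ, hball⟩ := Metric.eventually_nhds_iff_ball.1 hf
  refine ((tendsto_integral_small_disk hβ).mono_left nhdsWithin_le_nhds).congr' ?_
  have h2 : ∀ᶠ ε in 𝓝 (0 : ℝ), 2 * ε < δ :=
    (continuous_const.mul continuous_id).continuousAt.eventually (gt_mem_nhds (by simpa using hδ))
  filter_upwards [self_mem_nhdsWithin, nhdsWithin_le_nhds h2] with ε hε hεδ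
  have hε : 0 < ε := hε
  have h3 : diskIntegral (fun z => f (ε • (z - 1))) β = ∫ z in Metric.ball (0 : ℂ) 1,
      ε ^ 2 • form2 β (f (ε • (z - 1))) (tD ℂ (EuclideanSpace ℝ (Fin 2)) f (ε • (z - 1)) 1)
        (tD ℂ (EuclideanSpace ℝ (Fin 2)) f (ε • (z - 1)) Complex.I) := by
    refine MeasureTheory.setIntegral_congr_fun Metric.isOpen_ball.measurableSet fun z hz => ?_
    have hz' : ε • (z - 1) ∈ Metric.ball (0 : ℂ) δ := by
      rw [mem_ball_zero_iff] at hz ⊢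
      rw [norm_smul, Real.norm_of_nonneg hε.le]
      have h1 : ‖z - 1‖ ≤ 2 := (norm_sub_le _ _).trans (by rw [norm_one]; linarith)
      nlinarith
    change form2 β (f (ε • (z - 1)))
      (tD ℂ (EuclideanSpace ℝ (Fin 2)) (fun z => f (ε • (z - 1))) z 1)
      (tD ℂ (EuclideanSpace ℝ (Fin 2)) (fun z => f (ε • (z - 1))) z Complex.I) = _
    rw [tD_comp_smul_sub (hball _ hz'), tD_comp_smul_sub (hball _ hz')]
    generalize tD ℂ (EuclideanSpace ℝ (Fin 2)) f (ε • (z - 1)) 1 = a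
    generalize tD ℂ (EuclideanSpace ℝ (Fin 2)) f (ε • (z - 1)) Complex.I = b
    have h4 := (β (f (ε • (z - 1)))).toMultilinearMap.map_smul_univ (fun _ => ε) ![a, b]
    have h5 : (fun i => (fun _ : Fin 2 => ε) i • ![a, b] i) = ![ε • a, ε • b] := by
      ext i
      fin_cases i <;> rfl
    rw [Fin.prod_const] at h4
    exact (congrArg (β (f (ε • (z - 1)))) h5.symm).trans h4
  rw [h3, MeasureTheory.integral_smul, smul_smul, inv_mul_cancel₀ (by positivity), one_smul]

end SmallDiskIntegrals

/-! ### The curvature from small disks -/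

section HorizontalSections

variable {EB : Type*} [NormedAddCommGroup EB] [NormedSpace ℝ EB]
  {B : Type*} [TopologicalSpace B] [ChartedSpace EB B]
  {E : Type*} [NormedAddCommGroup E] [NormedSpace ℝ E] [FiniteDimensional ℝ E]
  {P : Type*} [TopologicalSpace P] [ChartedSpace E P] [IsManifold 𝓘(ℝ, E) ∞ P]
  {EG : Type*} [NormedAddCommGroup EG] [NormedSpace ℝ EG]
  {G : Type*} [Group G] [TopologicalSpace G] [ChartedSpace EG G] [LieGroup 𝓘(ℝ, EG) ∞ G]
  [MulAction Gᵐᵒᵖ P]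
  {F : Type*} [NormedAddCommGroup F] [NormedSpace ℝ F]
  {π : P → B}

omit [FiniteDimensional ℝ E] in
theorem Connection.pull_actChart_inl (A : Connection E P EG G)
    (hP : ContMDiff (𝓘(ℝ, E).prod 𝓘(ℝ, EG)) 𝓘(ℝ, E) ∞ (fun z : P × G => z.1 <• z.2)) {g : F → P}
    {y₀ : F} (hg : ∀ᶠ y in 𝓝 y₀, ContMDiffAt 𝓘(ℝ, F) 𝓘(ℝ, E) ∞ g y) (v : F) :
    pull (F × EG) A.co (actChart (EG := EG) G g) (y₀, oneC G) (v, 0) = pull F A.co g y₀ v := by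
  have hΨ := (eventually_contMDiffAt_actChart (G := G) hP hg).self_of_nhds
  have h1 : MDifferentiableAt 𝓘(ℝ, F × EG) 𝓘(ℝ, E) (actChart (EG := EG) G g)
      ((fun y : F => (y, (oneC G : EG))) y₀) := hΨ.mdifferentiableAt (by simp)
  have h2 : HasFDerivAt (fun y : F => (y, (oneC G : EG)))
      ((ContinuousLinearMap.id ℝ F).prod (0 : F →L[ℝ] EG)) y₀ :=
    (hasFDerivAt_id y₀).prodMk (hasFDerivAt_const (oneC G : EG) y₀)
  have h3 := tD_comp_apply (F := F × EG) (f := actChart (EG := EG) G g)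
    (g := fun y : F => (y, (oneC G : EG))) h1 h2.differentiableAt.mdifferentiableAt v
  have h4 : tD F (F × EG) (fun y : F => (y, (oneC G : EG))) y₀ v = (v, 0) := by
    rw [tD_eq_fderiv, h2.fderiv]
    rfl
  have h5 : (fun y => actChart (EG := EG) G g (y, oneC G)) = g := by
    funext y
    simp only [actChart, symC_oneC]
    simp
  rw [h4, h5] at h3
  have h6 : actChart (EG := EG) G g (y₀, oneC G) = g y₀ := congrFun h5 y₀
  rw [pull_apply, pull_apply, h6, h3]

omit [FiniteDimensional ℝ E] in
/-- Through every point of the total space there are local sections that are horizontal at that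
point. -/
theorem IsPrincipalBundle.exists_section_horizontal (hP : IsPrincipalBundle EB E EG G π)
    (A : Connection E P EG G) {f : F → B} {y₀ : F}
    (hf : ∀ᶠ y in 𝓝 y₀, ContMDiffAt 𝓘(ℝ, F) 𝓘(ℝ, EB) ∞ f y) {p : P} (hp : π p = f y₀) :
    ∃ g : F → P, (∀ᶠ y in 𝓝 y₀, ContMDiffAt 𝓘(ℝ, F) 𝓘(ℝ, E) ∞ g y) ∧
      (∀ᶠ y in 𝓝 y₀, π (g y) = f y) ∧ g y₀ = p ∧ pull F A.co g y₀ = 0 := by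
  obtain ⟨U, s, hU, hx, hs, hπ, hsp⟩ := hP.exists_section p
  rw [hp] at hx hsp
  have hfU : ∀ᶠ y in 𝓝 y₀, f y ∈ U := hf.self_of_nhds.continuousAt.eventually_mem (hU.mem_nhds hx)
  have hsf : ∀ᶠ y in 𝓝 y₀, ContMDiffAt 𝓘(ℝ, F) 𝓘(ℝ, E) ∞ (fun y => s (f y)) y := by
    filter_upwards [hf, hfU] with y hy1 hy2 using (hs.contMDiffAt (hU.mem_nhds hy2)).comp y hy1
  let a : F →L[ℝ] EG := pull F A.co (fun y => s (f y)) y₀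
  let k : F → F × EG := fun y => (y, oneC G - a (y - y₀))
  have hk : ContDiff ℝ ∞ k :=
    contDiff_id.prodMk (contDiff_const.sub (a.contDiff.comp (contDiff_id.sub contDiff_const)))
  have hk0 : k y₀ = (y₀, oneC G) := by simp [k]
  have hkd : HasFDerivAt k ((ContinuousLinearMap.id ℝ F).prod (-a)) y₀ := by
    have h1 : HasFDerivAt (fun y => y - y₀) (ContinuousLinearMap.id ℝ F) y₀ :=
      (hasFDerivAt_id y₀).sub_const y₀
    exact (hasFDerivAt_id y₀).prodMk ((a.hasFDerivAt.comp y₀ h1).const_sub (oneC G))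
  have hkt : Filter.Tendsto k (𝓝 y₀) (𝓝 (y₀, oneC G)) := by
    rw [← hk0]; exact hk.continuous.continuousAt
  have hΨ := eventually_contMDiffAt_actChart (G := G) hP.smooth_act hsf
  refine ⟨fun y => actChart G (fun y => s (f y)) (k y), ?_, ?_, ?_, ?_⟩
  · filter_upwards [hkt.eventually hΨ] with y hy
    exact ContMDiffAt.comp (g := actChart G fun y => s (f y)) y hy hk.contMDiff.contMDiffAt
  · filter_upwards [hfU] with y hy
    exact (hP.proj_act _ _).trans (hπ _ hy)
  · dsimp only
    rw [hk0]
    simp only [actChart, symC_oneC, hsp]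
    simp
  · have h1 : MDifferentiableAt 𝓘(ℝ, F × EG) 𝓘(ℝ, E) (actChart (EG := EG) G fun y => s (f y))
        (k y₀) := by
      rw [hk0]; exact hΨ.self_of_nhds.mdifferentiableAt (by simp)
    ext1 v
    rw [pull_comp (F := F × EG) (f := actChart (EG := EG) G fun y => s (f y)) (g := k) A.co h1
      hkd.differentiableAt.mdifferentiableAt, ContinuousLinearMap.comp_apply, tD_eq_fderiv,
      hkd.fderiv, hk0]
    have h2 : (ContinuousLinearMap.id ℝ F).prod (-a) v = ((v, 0) : F × EG) + (0, -(a v)) := by simp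
    rw [h2, map_add, A.pull_actChart_inl hP.smooth_act hsf, A.pull_actChart_inr hP.smooth_act hsf]
    exact add_neg_cancel _

omit [LieGroup 𝓘(ℝ, EG) ∞ G] in
/-- The pull-back of the curvature. -/
theorem Connection.cvr_pull (A : Connection E P EG G) {g : F → P} {y : F}
    (hg : ContMDiffAt 𝓘(ℝ, F) 𝓘(ℝ, E) ∞ g y) (u v : F) :
    A.cvr (g y) (tD F E g y u) (tD F E g y v) =
      curl (pull F A.co g) y u v + brk G (pull F A.co g y u) (pull F A.co g y v) := by
  rw [A.smoothForm_co.curl_pull hg]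
  rfl

theorem brk_zero_left (v : EG) : brk G 0 v = 0 := by
  have := brk_add_left (G := G) 0 0 v
  rwa [add_zero, left_eq_add] at this

theorem brk_smul_left (a : ℝ) (u v : EG) : brk G (a • u) v = a • brk G u v := by
  have h1 : ((a • u, 0) : EG × EG) = a • (u, 0) := by simp
  have h2 : ((0, a • u) : EG × EG) = a • (0, u) := by simp
  simp only [brk_eq, h1, h2, map_smul, _root_.smul_apply, smul_sub]

theorem continuousAt_brk {Y : Type*} [TopologicalSpace Y] {a b : Y → EG} {y : Y}
    (ha : ContinuousAt a y) (hb : ContinuousAt b y) :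
    ContinuousAt (fun y => brk G (a y) (b y)) y := by
  simp only [brk_eq]
  have h : ∀ {a b : Y → EG}, ContinuousAt a y → ContinuousAt b y → ContinuousAt (fun y =>
      fderiv ℝ (fderiv ℝ (mulC G)) ((oneC G, oneC G) : EG × EG) (a y, 0) (0, b y)) y := by
    intro a b ha hb
    exact ((ContinuousLinearMap.continuous _).continuousAt.comp
      (f := fun y => (a y, (0 : EG))) (ha.prodMk continuousAt_const)).clm_apply
      (continuousAt_const.prodMk hb)
  exact (h ha hb).sub (h hb ha)

variable [CompleteSpace EG]

/-- The horizontal directions over a parametrization with lift `g` are given by a total differential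
equation `dx = Φ(y, x)` for the curves `g(y) symC(x)`. If `g` is horizontal at `y₀`, then the curl of
`Φ` along the section is the negative of the curvature there. -/
theorem IsPrincipalBundle.exists_horizontal_equation (hP : IsPrincipalBundle EB E EG G π)
    (A : Connection E P EG G) {g : F → P} {y₀ : F}
    (hg : ∀ᶠ y in 𝓝 y₀, ContMDiffAt 𝓘(ℝ, F) 𝓘(ℝ, E) ∞ g y) (h0 : pull F A.co g y₀ = 0) :
    ∃ Φ : F × EG → F →L[ℝ] EG, (∀ᶠ z in 𝓝 (y₀, oneC G), ContDiffAt ℝ ∞ Φ z) ∧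
      (∀ᶠ z in 𝓝 (y₀, oneC G), ∀ v,
        pull (F × EG) A.co (actChart (EG := EG) G g) z (v, Φ z v) = 0) ∧
      Φ (y₀, oneC G) = 0 ∧
      ∀ u v, curl (fun y => Φ (y, oneC G)) y₀ u v = -curl (pull F A.co g) y₀ u v := by
  have hΨ := eventually_contMDiffAt_actChart (G := G) hP.smooth_act hg
  let Ω : F × EG → F × EG →L[ℝ] EG := pull (F × EG) A.co (actChart (EG := EG) G g)
  have hΩ : ∀ᶠ z in 𝓝 (y₀, (oneC G : EG)), ContDiffAt ℝ ∞ Ω z := by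
    filter_upwards [hΨ] with z hz using A.smoothForm_co.contDiffAt_pull hz
  obtain ⟨Φ, hΦ, hsol, -⟩ := exists_solution_linear hΩ
    fun w => A.pull_actChart_inr hP.smooth_act hg w
  have hj : ContDiff ℝ ∞ fun y : F => (y, (oneC G : EG)) := contDiff_id.prodMk contDiff_const
  have hjt : Filter.Tendsto (fun y : F => (y, (oneC G : EG))) (𝓝 y₀) (𝓝 (y₀, oneC G)) :=
    hj.continuous.continuousAt
  have hsplit : ∀ z v w, Ω z (v, w) = Ω z (v, 0) + Ω z (0, w) := by
    intro z v w
    rw [← map_add]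
    simp
  have hΦ0 : Φ (y₀, oneC G) = 0 := by
    ext1 v
    have h1 := hsol.self_of_nhds v
    have h2 : Ω (y₀, oneC G) (v, 0) = pull F A.co g y₀ v :=
      A.pull_actChart_inl hP.smooth_act hg v
    have h3 : Ω (y₀, oneC G) (0, Φ (y₀, oneC G) v) = Φ (y₀, oneC G) v :=
      A.pull_actChart_inr hP.smooth_act hg _
    rw [hsplit, h2, h0, h3, _root_.zero_apply, zero_add] at h1
    exact h1
  refine ⟨Φ, hΦ, hsol, hΦ0, ?_⟩
  -- the derivative at `y₀` of the equation for `Φ` along the section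
  let T : F → EG →L[ℝ] EG := fun y => (Ω (y, oneC G)).comp (ContinuousLinearMap.inr ℝ F EG)
  have hT : DifferentiableAt ℝ T y₀ := by
    have h1 : DifferentiableAt ℝ (fun y => Ω (y, oneC G)) y₀ :=
      (ContDiffAt.comp (g := Ω) (f := fun y : F => (y, (oneC G : EG))) y₀ hΩ.self_of_nhds
        hj.contDiffAt).differentiableAt (by simp)
    exact h1.clm_comp (differentiableAt_const _)
  have hT0 : T y₀ = ContinuousLinearMap.id ℝ EG := by
    ext1 w
    exact A.pull_actChart_inr hP.smooth_act hg w
  have hΦd : DifferentiableAt ℝ (fun y => Φ (y, oneC G)) y₀ :=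
    (ContDiffAt.comp (g := Φ) (f := fun y : F => (y, (oneC G : EG))) y₀ hΦ.self_of_nhds
      hj.contDiffAt).differentiableAt (by simp)
  have heq : pull F A.co g =ᶠ[𝓝 y₀] fun y => -((T y).comp (Φ (y, oneC G))) := by
    filter_upwards [hjt.eventually hsol, hg.eventually_nhds] with y hy hgy
    ext1 v
    have h1 := hy v
    have h2 : Ω (y, oneC G) (v, 0) = pull F A.co g y v := A.pull_actChart_inl hP.smooth_act hgy v
    rw [hsplit, h2] at h1
    exact eq_neg_of_add_eq_zero_left h1
  have hder : fderiv ℝ (pull F A.co g) y₀ = -fderiv ℝ (fun y => Φ (y, oneC G)) y₀ := by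
    have h1 := (hT.hasFDerivAt.clm_comp hΦd.hasFDerivAt).neg
    rw [heq.fderiv_eq]
    refine h1.fderiv.trans ?_
    rw [hT0, hΦ0]
    ext u v
    simp
  intro u v
  rw [curl, curl, hder]
  simp only [_root_.neg_apply]
  abel

end HorizontalSections

section Converses

variable {B : Type*} [TopologicalSpace B] [ChartedSpace (EuclideanSpace ℝ (Fin 2)) B]
  [IsManifold (𝓡 2) ∞ B]
  {ℓ : ℕ} [NeZero ℓ] {vol : ∀ x : B, TangentSpace (𝓡 2) x [⋀^Fin 2]→L[ℝ] ℝ} {Q : B}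
  {c : CanonicalSystem ℓ vol Q}
  {EM : Type*} [NormedAddCommGroup EM] [NormedSpace ℝ EM] [FiniteDimensional ℝ EM]
  {M : Type*} [TopologicalSpace M]
  [ChartedSpace EM M] [IsManifold 𝓘(ℝ, EM) ∞ M] [MulAction Circleᵐᵒᵖ M]
  {πM : M → B} {ωM : Connection EM M (EuclideanSpace ℝ (Fin 1)) Circle} {QM : M}
  {EN : Type*} [NormedAddCommGroup EN] [NormedSpace ℝ EN] [FiniteDimensional ℝ EN]
  {N : Type*} [TopologicalSpace N]
  [ChartedSpace EN N] [IsManifold 𝓘(ℝ, EN) ∞ N] [MulAction (GammaR ℓ)ᵐᵒᵖ N]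
  {q : N → M} {ωN : Connection EN N ℝ (GammaR ℓ)} {QN : N}
  {EG : Type*} [NormedAddCommGroup EG] [NormedSpace ℝ EG] [CompleteSpace EG]
  {G : Type*} [Group G] [TopologicalSpace G] [T2Space G]
  [ChartedSpace EG G] [LieGroup 𝓘(ℝ, EG) ∞ G]
  {EP : Type*} [NormedAddCommGroup EP] [NormedSpace ℝ EP] [FiniteDimensional ℝ EP]
  {P : Type*} [TopologicalSpace P]
  [ChartedSpace EP P] [IsManifold 𝓘(ℝ, EP) ∞ P] [MulAction Gᵐᵒᵖ P]
  {π : P → B}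

omit [IsManifold (𝓡 2) ∞ B] in
/-- The curvature at a point is determined by its value on one pair of tangent vectors, which is
computed on a local section that is horizontal there. -/
theorem IsPrincipalBundle.cvr_eq_of_curl (hM : IsReferenceBundle c πM ωM QM)
    (hN : IsReferenceCover c πM ωM QM q ωN QN)
    (hP : IsPrincipalBundle (EuclideanSpace ℝ (Fin 2)) EP EG G π)
    (A : Connection EP P EG G) {X : EG} {f : ℂ → B}
    (hf : ∀ᶠ z in 𝓝 0, ContMDiffAt 𝓘(ℝ, ℂ) (𝓡 2) ∞ f z)
    (hfs : Function.Surjective (tD ℂ (EuclideanSpace ℝ (Fin 2)) f 0)) {g : ℂ → P}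
    (hg : ContMDiffAt 𝓘(ℝ, ℂ) 𝓘(ℝ, EP) ∞ g 0) (hgf : ∀ᶠ z in 𝓝 0, π (g z) = f z)
    (hg0 : pull ℂ A.co g 0 = 0)
    (h : curl (pull ℂ A.co g) 0 1 Complex.I =
      -(form2 vol (f 0) (tD ℂ (EuclideanSpace ℝ (Fin 2)) f 0 1)
        (tD ℂ (EuclideanSpace ℝ (Fin 2)) f 0 Complex.I) • X)) (u v : EP) :
    A.cvr (g 0) u v = -(form2 vol (π (g 0)) (tD EP (EuclideanSpace ℝ (Fin 2)) π (g 0) u)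
      (tD EP (EuclideanSpace ℝ (Fin 2)) π (g 0) v) • X) := by
  have hproj : ∀ ζ, tD EP (EuclideanSpace ℝ (Fin 2)) π (g 0) (tD ℂ EP g 0 ζ) =
      tD ℂ (EuclideanSpace ℝ (Fin 2)) f 0 ζ := by
    intro ζ
    rw [← tD_comp_apply (F := EP) (f := π) (g := g) ((hP.smooth_proj _).mdifferentiableAt (by simp))
      (hg.mdifferentiableAt (by simp)), tD_congr hgf]
  obtain ⟨ζ, hζ⟩ := hfs (tD EP (EuclideanSpace ℝ (Fin 2)) π (g 0) u)
  obtain ⟨ξ, hξ⟩ := hfs (tD EP (EuclideanSpace ℝ (Fin 2)) π (g 0) v)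
  rw [hP.cvr_eq A (u' := tD ℂ EP g 0 ζ) (v' := tD ℂ EP g 0 ξ) (by rw [hproj, hζ])
    (by rw [hproj, hξ]), A.cvr_pull hg, hg0, _root_.zero_apply, _root_.zero_apply, brk_zero_left,
    add_zero, curl_complex, h, ← hζ, ← hξ, hgf.self_of_nhds, hN.vol2_complex hM hf ζ ξ, smul_neg,
    smul_smul]

/-- The curvature is determined by its integrals over small disks. -/
theorem IsPrincipalBundle.cvr_eq_of_diskIntegral (hM : IsReferenceBundle c πM ωM QM)
    (hN : IsReferenceCover c πM ωM QM q ωN QN)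
    (hP : IsPrincipalBundle (EuclideanSpace ℝ (Fin 2)) EP EG G π)
    (A : Connection EP P EG G) {X : EG} {β : ∀ x : B, TangentSpace (𝓡 2) x [⋀^Fin 2]→L[ℝ] EG}
    (hβ : ∀ p u v, A.cvr p u v = form2 β (π p) (tD EP (EuclideanSpace ℝ (Fin 2)) π p u)
      (tD EP (EuclideanSpace ℝ (Fin 2)) π p v))
    (h : ∀ Δ : EmbeddedDisk (EuclideanSpace ℝ (Fin 2)) B,
      diskIntegral Δ.toFun β = -(diskIntegral Δ.toFun vol • X)) (p : P) (u v : EP) :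
    A.cvr p u v = -(form2 vol (π p) (tD EP (EuclideanSpace ℝ (Fin 2)) π p u)
      (tD EP (EuclideanSpace ℝ (Fin 2)) π p v) • X) := by
  obtain ⟨f, hf0, hfs, δ, hδ, hf, hinj, himm⟩ :=
    exists_complex_parametrization (EB := EuclideanSpace ℝ (Fin 2)) (by simp) (π p)
  have hf' : ∀ᶠ z in 𝓝 (0 : ℂ), ContMDiffAt 𝓘(ℝ, ℂ) (𝓡 2) ∞ f z := by
    filter_upwards [Metric.ball_mem_nhds (0 : ℂ) hδ] with z hz
      using hf.contMDiffAt (Metric.isOpen_ball.mem_nhds hz)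
  obtain ⟨g, hg, hgf, rfl, hg0⟩ := hP.exists_section_horizontal A hf' hf0.symm
  have hfd : ∀ᶠ z in 𝓝 (0 : ℂ), MDifferentiableAt 𝓘(ℝ, ℂ) (𝓡 2) f z :=
    hf'.mono fun z hz => hz.mdifferentiableAt (by simp)
  have hval : ∀ᶠ z in 𝓝 (0 : ℂ), form2 β (f z) (tD ℂ (EuclideanSpace ℝ (Fin 2)) f z 1)
      (tD ℂ (EuclideanSpace ℝ (Fin 2)) f z Complex.I) = curl (pull ℂ A.co g) z 1 Complex.I +
        brk G (pull ℂ A.co g z 1) (pull ℂ A.co g z Complex.I) := by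
    filter_upwards [hg, hgf.eventually_nhds] with z hz hz'
    have hproj : ∀ ζ, tD EP (EuclideanSpace ℝ (Fin 2)) π (g z) (tD ℂ EP g z ζ) =
        tD ℂ (EuclideanSpace ℝ (Fin 2)) f z ζ := by
      intro ζ
      rw [← tD_comp_apply (F := EP) (f := π) (g := g)
        ((hP.smooth_proj _).mdifferentiableAt (by simp)) (hz.mdifferentiableAt (by simp)),
        tD_congr hz']
    rw [← A.cvr_pull hz, hβ, hproj, hproj, hz'.self_of_nhds]
  have hc : ∀ᶠ z in 𝓝 (0 : ℂ), ContinuousAt (fun z => form2 β (f z)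
      (tD ℂ (EuclideanSpace ℝ (Fin 2)) f z 1)
      (tD ℂ (EuclideanSpace ℝ (Fin 2)) f z Complex.I)) z := by
    filter_upwards [hg, hval.eventually_nhds] with z hz hz'
    have h1 := A.smoothForm_co.contDiffAt_pull hz
    refine ContinuousAt.congr ?_ (Filter.EventuallyEq.symm hz')
    exact (contDiffAt_curl h1 1 Complex.I).continuousAt.add (continuousAt_brk
      (h1.continuousAt.clm_apply continuousAt_const) (h1.continuousAt.clm_apply continuousAt_const))
  have hv : ∀ᶠ z in 𝓝 (0 : ℂ), ContinuousAt (fun z => form2 vol (f z)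
      (tD ℂ (EuclideanSpace ℝ (Fin 2)) f z 1)
      (tD ℂ (EuclideanSpace ℝ (Fin 2)) f z Complex.I)) z := by
    filter_upwards [hf'.eventually_nhds] with z hz
      using (hN.contDiff_vol2 hM hz 1 Complex.I).continuousAt
  have hlim1 := tendsto_diskIntegral_small hfd hc
  have hlim2 := ((tendsto_diskIntegral_small hfd hv).smul_const X).neg
  have hsmall : ∀ᶠ ε in 𝓝 (0 : ℝ), 2 * ε < δ :=
    (continuous_const.mul continuous_id).continuousAt.eventually (gt_mem_nhds (by simpa using hδ))
  have heq : ∀ᶠ ε in 𝓝[>] (0 : ℝ),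
      (ε ^ 2)⁻¹ • diskIntegral (fun z => f (ε • (z - 1))) β =
      -(((ε ^ 2)⁻¹ • diskIntegral (fun z => f (ε • (z - 1))) vol) • X) := by
    filter_upwards [self_mem_nhdsWithin, nhdsWithin_le_nhds hsmall] with ε hε hεδ
    obtain ⟨Δ, hΔ⟩ := exists_small_embeddedDisk hf hinj himm hε hεδ
    rw [← hΔ, h Δ, smul_neg, smul_assoc]
  have hlim := tendsto_nhds_unique (hlim1.congr' heq) hlim2
  rw [smul_assoc, ← smul_neg] at hlim
  have h1 := smul_right_injective EG Real.pi_ne_zero hlim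
  refine hP.cvr_eq_of_curl hM hN A hf' hfs hg.self_of_nhds hgf hg0 ?_ u v
  have h2 := hval.self_of_nhds
  rw [hg0, _root_.zero_apply, _root_.zero_apply, brk_zero_left, add_zero] at h2
  rw [← h2]
  exact h1

/-- The curvature is determined by the holonomies around small circles. -/
theorem IsPrincipalBundle.cvr_eq_of_holonomy (hM : IsReferenceBundle c πM ωM QM)
    (hN : IsReferenceCover c πM ωM QM q ωN QN)
    (hP : IsPrincipalBundle (EuclideanSpace ℝ (Fin 2)) EP EG G π)
    (A : Connection EP P EG G) {X : EG}
    (h : ∀ (Δ : EmbeddedDisk (EuclideanSpace ℝ (Fin 2)) B) (w : ℝ → B), IsBoundaryLoop Δ w →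
        ∀ q' : P, π q' = w 0 →
          holonomy π A w q' = lieExp (E₁ := EG) (G := G) (diskIntegral Δ.toFun vol • X))
    (p : P) (u v : EP) :
    A.cvr p u v = -(form2 vol (π p) (tD EP (EuclideanSpace ℝ (Fin 2)) π p u)
      (tD EP (EuclideanSpace ℝ (Fin 2)) π p v) • X) := by
  obtain ⟨f, hf0, hfs, δ, hδ, hf, hinj, himm⟩ :=
    exists_complex_parametrization (EB := EuclideanSpace ℝ (Fin 2)) (by simp) (π p)
  have hf' : ∀ᶠ z in 𝓝 (0 : ℂ), ContMDiffAt 𝓘(ℝ, ℂ) (𝓡 2) ∞ f z := by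
    filter_upwards [Metric.ball_mem_nhds (0 : ℂ) hδ] with z hz
      using hf.contMDiffAt (Metric.isOpen_ball.mem_nhds hz)
  obtain ⟨g, hg, hgf, rfl, hg0⟩ := hP.exists_section_horizontal A hf' hf0.symm
  obtain ⟨Φ, hΦ, hsol, hΦ0, hcurl⟩ := hP.exists_horizontal_equation A hg hg0
  obtain ⟨x, hx, hxU, hxlim⟩ := exists_solution_small_circle hΦ hΦ0
  refine hP.cvr_eq_of_curl hM hN A hf' hfs hg.self_of_nhds hgf hg0 ?_ u v
  set a : ℝ := form2 vol (f 0) (tD ℂ (EuclideanSpace ℝ (Fin 2)) f 0 1)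
    (tD ℂ (EuclideanSpace ℝ (Fin 2)) f 0 Complex.I) with ha
  -- the areas of the small disks
  let area : ℝ → ℝ := fun ε => diskIntegral (fun z => f (ε • (z - 1))) vol
  have hv : ∀ᶠ z in 𝓝 (0 : ℂ), ContinuousAt (fun z => form2 vol (f z)
      (tD ℂ (EuclideanSpace ℝ (Fin 2)) f z 1)
      (tD ℂ (EuclideanSpace ℝ (Fin 2)) f z Complex.I)) z := by
    filter_upwards [hf'.eventually_nhds] with z hz
      using (hN.contDiff_vol2 hM hz 1 Complex.I).continuousAt
  have hfd : ∀ᶠ z in 𝓝 (0 : ℂ), MDifferentiableAt 𝓘(ℝ, ℂ) (𝓡 2) f z :=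
    hf'.mono fun z hz => hz.mdifferentiableAt (by simp)
  have harea : Filter.Tendsto (fun ε => (ε ^ 2)⁻¹ * area ε) (𝓝[>] 0) (𝓝 (Real.pi * a)) :=
    tendsto_diskIntegral_small hfd hv
  have harea0 : Filter.Tendsto area (𝓝[>] 0) (𝓝 0) := by
    have h1 : Filter.Tendsto (fun ε : ℝ => ε ^ 2) (𝓝[>] 0) (𝓝 0) :=
      ((continuous_id.pow 2).tendsto' _ _ (by simp)).mono_left nhdsWithin_le_nhds
    have h2 := h1.mul harea
    rw [zero_mul] at h2
    refine h2.congr' ?_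
    filter_upwards [self_mem_nhdsWithin] with ε hε
    have hε : 0 < ε := hε
    field_simp
  -- the horizontal lifts of the small circles end at `g(0) exp(area X)`
  let e : ℝ → EG := fun t => extChartAt 𝓘(ℝ, EG) (1 : G) (expCurve G X t)
  have hΨ := eventually_contMDiffAt_actChart (G := G) hP.smooth_act hg
  have hfst : Filter.Tendsto Prod.fst (𝓝 ((0 : ℂ), (oneC G : EG))) (𝓝 0) :=
    continuous_fst.tendsto' _ _ rfl
  have hsnd : Filter.Tendsto Prod.snd (𝓝 ((0 : ℂ), (oneC G : EG))) (𝓝 (oneC G : EG)) :=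
    continuous_snd.tendsto' _ _ rfl
  have hsmall : ∀ᶠ ε in 𝓝 (0 : ℝ), 2 * ε < δ :=
    (continuous_const.mul continuous_id).continuousAt.eventually (gt_mem_nhds (by simpa using hδ))
  have hend : ∀ᶠ ε in 𝓝[>] (0 : ℝ), x ε 1 = e (area ε) := by
    filter_upwards [self_mem_nhdsWithin, nhdsWithin_le_nhds hsmall, hx, hxU _ (((hsol.and hΨ).and
      (hfst.eventually hgf)).and ((hsnd.eventually (eventually_symC (G := G))).and
      (hfst.eventually hf')))] with ε hε hεδ ⟨hx0, hxs, hxd⟩ hxε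
    obtain ⟨Δ, hΔ⟩ := exists_small_embeddedDisk hf hinj himm hε hεδ
    have hcirc : ContDiff ℝ ∞ fun t => ε • (circ t - 1) :=
      (contDiff_circ.sub contDiff_const).const_smul ε
    have hk : ContDiffOn ℝ ∞ (fun t => (ε • (circ t - 1), x ε t)) (Icc 0 1) :=
      hcirc.contDiffOn.prodMk hxs
    have hw : IsBoundaryLoop Δ fun t => f (ε • (circ t - 1)) := by
      refine ⟨fun t ht => ?_, fun t => t, continuousOn_id, by simp, fun t _ => ?_⟩
      · exact (ContMDiffAt.comp (g := f) t (hxε t ht).2.2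
          hcirc.contMDiff.contMDiffAt).contMDiffWithinAt
      · rw [hΔ]
        rfl
    have hlift : IsHorizontalLift π A (fun t => f (ε • (circ t - 1)))
        fun t => actChart G g (ε • (circ t - 1), x ε t) := by
      refine .of_interior A (fun t ht => ?_) (fun t ht => ?_) fun t ht => ?_
      · exact ContMDiffAt.comp_contMDiffWithinAt (g := actChart G g) t (hxε t ht).1.1.2
          (hk t ht).contMDiffWithinAt
      · exact (hP.proj_act _ _).trans (hxε t ht).1.2
      · have ht' := Ioo_subset_Icc_self ht
        have h1 : HasDerivAt (fun t => (ε • (circ t - 1), x ε t))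
            (ε • (2 * Real.pi * Complex.I * circ t), Φ (ε • (circ t - 1), x ε t)
              (ε • (2 * Real.pi * Complex.I * circ t))) t :=
          (((hasDerivAt_circ t).sub_const 1).const_smul ε).prodMk
            ((hxd t ht').hasDerivAt (Icc_mem_nhds ht.1 ht.2))
        rw [tD_comp_apply (F := ℂ × EG) (f := actChart (EG := EG) G g)
          (g := fun t => (ε • (circ t - 1), x ε t)) ((hxε t ht').1.1.2.mdifferentiableAt (by simp))
          h1.differentiableAt.mdifferentiableAt, tD_eq_fderiv, fderiv_apply_one_eq_deriv, h1.deriv]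
        exact (hxε t ht').1.1.1 _
    have h1 : holonomy π A (fun t => f (ε • (circ t - 1))) (g 0) = symC G (x ε 1) := by
      refine hP.holonomy_eq hlift ?_ ?_
      · rw [hx0, circ_zero, sub_self, smul_zero]
        simp only [actChart, symC_oneC]
        simp
      · rw [circ_one, sub_self, smul_zero]
        rfl
    have h2 := h Δ _ hw (g 0) (by rw [circ_zero, sub_self, smul_zero, hf0])
    have h3 : symC G (x ε 1) = expCurve G X (area ε) := by
      rw [← h1, h2, hΔ]
      exact lieExp_smul X _
    change x ε 1 = extChartAt 𝓘(ℝ, EG) (1 : G) (expCurve G X (area ε))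
    rw [← h3]
    exact ((extChartAt 𝓘(ℝ, EG) (1 : G)).right_inv (hxε 1 (by simp)).2.1).symm
  -- comparison of the two expansions of the end points
  have he0 : e 0 = oneC G := by
    change extChartAt 𝓘(ℝ, EG) (1 : G) (expCurve G X 0) = oneC G
    rw [expCurve_zero]
    rfl
  have hed : HasDerivAt e X 0 := by
    have h1 := isOneParam_expCurve (G := G) X
    have hs : expCurve G X 0 ∈ (extChartAt 𝓘(ℝ, EG) (1 : G)).source := by
      rw [expCurve_zero]; exact mem_extChartAt_source _
    have h2 : DifferentiableAt ℝ e 0 :=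
      ((h1.smooth 0).contDiffAt_chart hs).differentiableAt (by simp)
    have h3 : deriv e 0 = X := by
      rw [← fderiv_apply_one_eq_deriv, ← tD_eq_fderiv,
        tD_comp_apply (F := EG) (f := extChartAt 𝓘(ℝ, EG) (1 : G)) (g := expCurve G X)
        (mdifferentiableAt_extChartAt_of_mem hs) ((h1.smooth 0).mdifferentiableAt (by simp)),
        h1.deriv, expCurve_zero, tD_chart_self]
      rfl
    rw [← h3]
    exact h2.hasDerivAt
  have hslope : Filter.Tendsto (fun ε => dslope e 0 (area ε)) (𝓝[>] 0) (𝓝 X) := by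
    have h1 : ContinuousAt (dslope e 0) 0 := continuousAt_dslope_same.2 hed.differentiableAt
    have h2 := h1.tendsto.comp harea0
    rwa [dslope_same, hed.deriv] at h2
  have hlim := harea.smul hslope
  have heq : ∀ᶠ ε in 𝓝[>] (0 : ℝ), ((ε ^ 2)⁻¹ * area ε) • dslope e 0 (area ε) =
      (ε ^ 2)⁻¹ • (x ε 1 - oneC G) := by
    filter_upwards [hend] with ε hε
    have h1 := sub_smul_dslope e 0 (area ε)
    rw [sub_zero] at h1
    rw [mul_smul, h1, hε, he0]
  have h1 := tendsto_nhds_unique (hlim.congr' heq) hxlim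
  rw [mul_smul] at h1
  have h2 := smul_right_injective EG Real.pi_ne_zero h1
  rw [hcurl] at h2
  exact (neg_eq_iff_eq_neg.2 h2).symm

end Converses

end

end CentralYM

/-- Characterization of the connections with curvature `-X_ξ vol` on a principal bundle over a closed
surface. -/
theorem mainTheorem4
    -- the surface, its genus, area form, base point and canonical curves
    {B : Type*} [TopologicalSpace B] [T2Space B] [SecondCountableTopology B]
    [CompactSpace B] [ConnectedSpace B]
    [ChartedSpace (EuclideanSpace ℝ (Fin 2)) B] [IsManifold (𝓡 2) ∞ B]
    (ℓ : ℕ) [NeZero ℓ]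
    (vol : ∀ x : B, TangentSpace (𝓡 2) x [⋀^Fin 2]→L[ℝ] ℝ) (Q : B)
    (c : CanonicalSystem ℓ vol Q)
    -- the reference `U(1)`-bundle
    {EM : Type*} [NormedAddCommGroup EM] [NormedSpace ℝ EM] [FiniteDimensional ℝ EM]
    {M : Type*} [TopologicalSpace M] [T2Space M] [SecondCountableTopology M]
    [ChartedSpace EM M] [IsManifold 𝓘(ℝ, EM) ∞ M] [MulAction Circleᵐᵒᵖ M]
    (πM : M → B) (ωM : Connection EM M (EuclideanSpace ℝ (Fin 1)) Circle) (QM : M)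
    (hM : IsReferenceBundle c πM ωM QM)
    -- the reference `Γ_ℝ`-bundle
    {EN : Type*} [NormedAddCommGroup EN] [NormedSpace ℝ EN] [FiniteDimensional ℝ EN]
    {N : Type*} [TopologicalSpace N] [T2Space N] [SecondCountableTopology N]
    [ChartedSpace EN N] [IsManifold 𝓘(ℝ, EN) ∞ N] [MulAction (GammaR ℓ)ᵐᵒᵖ N]
    (q : N → M) (ωN : Connection EN N ℝ (GammaR ℓ)) (QN : N)
    (hN : IsReferenceCover c πM ωM QM q ωN QN)
    -- the structure group
    {EG : Type*} [NormedAddCommGroup EG] [NormedSpace ℝ EG] [FiniteDimensional ℝ EG]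
    {G : Type*} [Group G] [TopologicalSpace G] [T2Space G] [CompactSpace G] [ConnectedSpace G]
    [ChartedSpace EG G] [LieGroup 𝓘(ℝ, EG) ∞ G]
    -- the bundle `ξ`, its base point and its characteristic class
    {EP : Type*} [NormedAddCommGroup EP] [NormedSpace ℝ EP] [FiniteDimensional ℝ EP]
    {P : Type*} [TopologicalSpace P] [T2Space P] [SecondCountableTopology P]
    [ChartedSpace EP P] [IsManifold 𝓘(ℝ, EP) ∞ P] [MulAction Gᵐᵒᵖ P]
    (π : P → B) (hP : IsPrincipalBundle (EuclideanSpace ℝ (Fin 2)) EP EG G π)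
    (QP : P) (hQP : π QP = Q)
    (X : GroupLieAlgebra 𝓘(ℝ, EG) G) (hX : IsCharacteristicClass πM π X)
    -- the connection
    (A : Connection EP P EG G) :
    [ -- (i)
      ∀ (p : P) (u v : TangentSpace 𝓘(ℝ, EP) p),
        IsCentral (A.curv p u v) ∧
        A.curv p u v = -(vol (π p) ![mfderiv 𝓘(ℝ, EP) (𝓡 2) π p u,
          mfderiv 𝓘(ℝ, EP) (𝓡 2) π p v] • X),
      -- (ii)
      (∀ (p : P) (u v : TangentSpace 𝓘(ℝ, EP) p), IsCentral (A.curv p u v)) ∧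
        ∃ β : ∀ x : B, TangentSpace (𝓡 2) x [⋀^Fin 2]→L[ℝ] EG,
          (∀ (p : P) (u v : TangentSpace 𝓘(ℝ, EP) p),
            lieCoord (A.curv p u v) = β (π p) ![mfderiv 𝓘(ℝ, EP) (𝓡 2) π p u,
              mfderiv 𝓘(ℝ, EP) (𝓡 2) π p v]) ∧
          ∀ Δ : EmbeddedDisk (EuclideanSpace ℝ (Fin 2)) B,
            diskIntegral Δ.toFun β = -(diskIntegral Δ.toFun vol • lieCoord X),
      -- (iii)
      ∀ (Δ : EmbeddedDisk (EuclideanSpace ℝ (Fin 2)) B) (w : ℝ → B), IsBoundaryLoop Δ w →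
        ∀ q' : P, π q' = w 0 → holonomy π A w q' = lieExp (diskIntegral Δ.toFun vol • X),
      -- (iv)
      ∃ (lam : N → P) (χ : GammaR ℓ →* G),
        IsPreReductionMap (fun n => πM (q n)) ωN π A QN QP lam ∧
        IsConnectionMorphism (fun n => πM (q n)) ωN π A χ lam ∧
        FreeGroup.lift (fun a => holonomy π A (c.curve a) QP) = χ.comp (freeToGammaR ℓ) ∧
        ∀ t : ℝ, χ (GammaR.ofReal (2 * Real.pi * t)) = lieExp (t • X) ].TFAE := by
  have _ : CompleteSpace EG := FiniteDimensional.complete ℝ EG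
  have hXc : IsCentral X := hX.1
  have hAd : ∀ g : G, AdC (E := EG) g X = X := fun g =>
    AdC_eq_self (fun Y => (brk_swap (G := G) Y X).trans (neg_eq_zero.2 (hXc Y))) g
  have hneg : ∀ Z : EG, (∀ Y, brk G Z Y = 0) → ∀ (a : ℝ) (Y : EG), brk G (-(a • Z)) Y = 0 := by
    intro Z hZ a Y
    rw [brk_neg_left, brk_smul_left, hZ, smul_zero, neg_zero]
  have hmul : ∀ a : ℝ, IsCentral (-(a • X)) := hneg X hXc
  -- the first statement, for the curvature form as a form with values in the model space; the
  -- other statements are shown to imply it in this guise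
  have key : (∀ (p : P) (u v : EP), A.cvr p u v =
      -(form2 vol (π p) (tD EP (EuclideanSpace ℝ (Fin 2)) π p u)
        (tD EP (EuclideanSpace ℝ (Fin 2)) π p v) • lieCoord X)) →
      ∀ (p : P) (u v : TangentSpace 𝓘(ℝ, EP) p), IsCentral (A.curv p u v) ∧
        A.curv p u v = -(vol (π p) ![mfderiv 𝓘(ℝ, EP) (𝓡 2) π p u,
          mfderiv 𝓘(ℝ, EP) (𝓡 2) π p v] • X) := by
    intro h p u v
    have h1 : A.curv p u v = -(vol (π p) ![mfderiv 𝓘(ℝ, EP) (𝓡 2) π p u,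
      mfderiv 𝓘(ℝ, EP) (𝓡 2) π p v] • X) := h p u v
    exact ⟨h1 ▸ hmul _, h1⟩
  tfae_have 1 → 2 := by
    intro h
    refine ⟨fun p u v => (h p u v).1, fun x =>
      (ContinuousLinearMap.toSpanSingleton ℝ (-lieCoord X)).compContinuousAlternatingMap (vol x),
      fun p u v => ?_, fun Δ => ?_⟩
    · rw [(h p u v).2, map_neg, map_smul, ← smul_neg]
      rfl
    · rw [← smul_neg]
      exact integral_smul_const _ _
  tfae_have 2 → 1 := by
    rintro ⟨-, β, hβ, hΔ⟩
    exact key (hP.cvr_eq_of_diskIntegral hM hN A hβ hΔ)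
  tfae_have 1 → 3 := fun h Δ w hw q' hq' =>
    hP.holonomy_boundaryLoop hM hN A hAd (fun p u v => (h p u v).2) Δ hw hq'
  tfae_have 3 → 1 := fun h => key (hP.cvr_eq_of_holonomy hM hN A h)
  tfae_have 1 → 4 := fun h =>
    exists_preReduction hM hN hP hQP A hAd (fun p u v => (h p u v).2)
      (hN.horizontallyJoined hM QN)
  tfae_have 4 → 1 := by
    rintro ⟨lam, χ, -, hmor, -, hχ⟩
    exact key (hmor.cvr_eq hM hN hP hAd hχ)
  tfae_finish
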